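/- **Setting.** Let $(M,\omega)$ be a compact simply connected symplectic manifold of dimension $2n$, and let $(j_u)_{u\in U}$ be a smooth family, parametrized by a manifold $U$, of (integrable, positive) complex structures of $M$ compatible with $\omega$; write $M_u$ for the Kähler manifold $(M,\omega,j_u)$. Let $E\to U\times M$ be the bundle with fibres $E_{u,x}=T^{1,0}_xM_u$, and for $X\in T_uU$ let $\mu(X):\bar E\to E$ be the restriction to $\bar E$ of the derivative $X.j$. Let $L\to M$ be a prequantum bundle, that is, a Hermitian line bundle with a metric connection of curvature $\frac1i\omega$; pull it back, with its connection, to $U\times M$. Let $\delta\to U\times M$ be a complex line bundle with an isomorphism $\varphi:\delta^2\to\wedge^{n}E^*$. Let $\nabla^E=\pi\circ\nabla^{E\oplus\bar E}$, where $\pi=\frac12(\mathrm{id}-ij)$ and $\nabla^{E\oplus\bar E}$ is the Levi-Civita connection of $M_u$ along each slice $\{u\}\times M$ and the derivative of functions with values in the fixed space $T_xM\otimes\mathbb C$ in the directions of $U$. Give $\delta$ the connection $\nabla^\delta$ which corresponds through $\varphi$ to the connection induced by $\nabla^E$ on $\wedge^nE^*$. Then $L^k\otimes\delta$ has a connection $\nabla^{L^k\otimes\delta}$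 over $U\times M$, whose restriction to $M_u$ is the Chern connection of the holomorphic Hermitian bundle $L_u^k\otimes\delta_u$. For $X\in T_uU$ let $G(X)=\sum G_{ij}\,\partial_i\otimes\partial_j$ be the section of $S^2(T^{1,0}M_u)$ with $\sum G_{ij}\,\omega(\partial_i,\cdot)\,\partial_j=\mu(X)$, where $(\partial_i)$ is a local frame of $T^{1,0}M_u$ and $(\ell_i)$ is the dual frame. Assume that all the sections $G(X)$ are holomorphic. Let $$\Delta^{G(X)}s=\sum_k\ell_k\Bigl(\nabla_k\bigl(\sum_{i,j}G_{ij}\,\partial_i\otimes\nabla_js\bigr)\Bigr)$$ for sections $s$ of $L_u^k\otimes\delta_u$. Let $\theta^{\delta_u}$ be the $(0,1)$-form such that $\theta^{\delta_u}(\bar Z)=\sum_{k,i,j}\ell_k\bigl(\nabla_k(R^{\delta_u}(\bar Z,\partial_i)G_{ij}\partial_j)\bigr)$ for any local holomorphic section $Z$ of $T^{1,0}M_u$, $R^{\delta_u}$ being the curvature of $\delta_u$. Let $H(X)$ be the functions, depending smoothly on $(u,x)\in U\times M$ and linearly on $X\in T_uU$, with $\bar\partial H(X)=\theta^{\delta_u}$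 and $\int_MH(X)\,\omega^n=0$. **Operators.** Every differential operator on sections of $L_u^k\otimes\delta_u$ is uniquely the sum of a holomorphic differential operator (locally $\sum_\alpha a_\alpha\nabla_{z^1}^{\alpha(1)}\cdots\nabla_{z^n}^{\alpha(n)}$, with $a_\alpha$ smooth and $(z^i)$ complex coordinates of $M_u$) and an element of the left ideal generated by the anti-holomorphic derivations; the first summand is its holomorphic part, denoted by a superscript $\mathrm{hol}$. For an integer $k_0\ge1$ let $\mathrm{Op}_{sc}$ be the space of families $(Q_{u,k})_{u\in U,\,k\ge k_0}$ of differential operators on sections of $L_u^k\otimes\delta_u$ such that $Q_{u,k}$ depends smoothly on $u$ for each $k$ and, for each $u$, there is $\ell$ such that for every complex coordinate system $(V,z^1,\dots,z^n)$ of $M_u$ there are functions $a_\alpha\in C^\infty(V)$, $|\alpha|\le\ell$, independent of $k$, with $Q_{u,k}=\sum_{|\alpha|\le\ell}a_\alpha\nabla_{z^1}^{\alpha(1)}\cdots\nabla_{z^n}^{\alpha(n)}$ over $V$ for all $k\ge k_0$. **Theorem.** For vector fields $X,Y$ of $U$ and $k\ge k_0$, let $P_k(X)=\frac14(\Delta^{G(X)}-H(X))$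 and $$R_k(X,Y)=\bigl[\nabla_X^{L^k\otimes\delta}+k^{-1}P_k(X),\ \nabla_Y^{L^k\otimes\delta}+k^{-1}P_k(Y)\bigr]-\nabla^{L^k\otimes\delta}_{[X,Y]}-k^{-1}P_k([X,Y]).$$ Then $R_k(X,Y)$ is a family of differential operators on the slices $M_u$, and there are families $(P_{1,k}(X,Y))$, $(P_{2,k}(X,Y))$ in $\mathrm{Op}_{sc}$ such that $$R_k(X,Y)^{\mathrm{hol}}=k^{-1}P_{1,k}(X,Y)+k^{-2}P_{2,k}(X,Y)\qquad\text{for all }k\ge k_0.$$ -/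

import Mathlib

open scoped Manifold ContDiff TensorProduct Topology ComplexConjugate
open Bundle

noncomputable section

namespace HalfFormQuant

/-! ### Linear algebra: complexification, coordinates in a line -/

section Complexification

variable {V : Type*} [AddCommGroup V] [Module ℝ V]

/-- Real part of a complexified vector. -/
def cRe : (ℂ ⊗[ℝ] V) →ₗ[ℝ] V :=
  (TensorProduct.lid ℝ V).toLinearMap ∘ₗ LinearMap.rTensor V Complex.reLm

/-- Imaginary part of a complexified vector. -/
def cIm : (ℂ ⊗[ℝ] V) →ₗ[ℝ] V :=
  (TensorProduct.lid ℝ V).toLinearMap ∘ₗ LinearMap.rTensor V Complex.imLm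

/-- The complexified vector `a + i b`. -/
def cMk (a b : V) : ℂ ⊗[ℝ] V := (1 : ℂ) ⊗ₜ[ℝ] a + Complex.I ⊗ₜ[ℝ] b

theorem cMk_re_im (w : ℂ ⊗[ℝ] V) : cMk (cRe w) (cIm w) = w := by
  induction w using TensorProduct.induction_on with
  | zero => simp [cMk]
  | tmul z v =>
    have h : z = z.re • (1 : ℂ) + z.im • Complex.I := by
      simp [Complex.re_add_im]
    simp only [cMk, cRe, cIm, LinearMap.comp_apply, LinearMap.rTensor_tmul,
      LinearEquiv.coe_coe, TensorProduct.lid_tmul, Complex.reLm_coe, Complex.imLm_coe]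
    conv_rhs => rw [h, TensorProduct.add_tmul, TensorProduct.smul_tmul, TensorProduct.smul_tmul]
  | add x y hx hy =>
    conv_rhs => rw [← hx, ← hy]
    simp only [cMk, map_add, TensorProduct.tmul_add]
    abel

/-- Complex conjugation on a complexified vector space. -/
def cConj (w : ℂ ⊗[ℝ] V) : ℂ ⊗[ℝ] V := cMk (cRe w) (-(cIm w))

/-- The `ℂ`-linear extension `a + i b ↦ T a + i T b` of a real-linear map `T`. -/
def cExt {W : Type*} [AddCommGroup W] [Module ℂ W] (T : V → W) (w : ℂ ⊗[ℝ] V) : W :=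
  T (cRe w) + Complex.I • T (cIm w)

end Complexification

/-- For a nonzero vector `b` of a complex line, the complex number `c` such that `v = c • b`. -/
def ratio {W : Type*} [AddCommGroup W] [Module ℂ W] (v b : W) : ℂ :=
  Classical.epsilon fun c : ℂ => v = c • b

/-- Multi-indices `α ∈ ℕⁿ` with `|α| ≤ ℓ`. -/
def multiIdx (n ℓ : ℕ) : Finset (Fin n → ℕ) :=
  (Fintype.piFinset fun _ => Finset.range (ℓ + 1)).filter fun α => ∑ i, α i ≤ ℓ

/-- The operator `D₁^{α(1)} ⋯ Dₙ^{α(n)}`. -/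
def multiOp {S : Type*} {n : ℕ} (D : Fin n → S → S) (α : Fin n → ℕ) : S → S :=
  ((List.finRange n).map fun i => (D i)^[α i]).foldr (· ∘ ·) id

/-! ### Manifolds -/

section Basic

variable {d : ℕ} {N : Type*} [TopologicalSpace N] [ChartedSpace (EuclideanSpace ℝ (Fin d)) N]

/-- Smooth vector fields. -/
def IsSmoothVF [IsManifold (𝓡 d) ∞ N] (V : ∀ x : N, TangentSpace (𝓡 d) x) : Prop :=
  ContMDiff (𝓡 d) (𝓡 d).tangent ∞ fun x => (⟨x, V x⟩ : TangentBundle (𝓡 d) N)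

/-- A tangent vector at `x`, read in the model space (to which the tangent space at the fixed
point `x` is identified in Mathlib). -/
def toModel {x : N} (v : TangentSpace (𝓡 d) x) : EuclideanSpace ℝ (Fin d) := v

/-- Inverse of `toModel`. -/
def ofModel {x : N} (v : EuclideanSpace ℝ (Fin d)) : TangentSpace (𝓡 d) x := v

end Basic

variable {m n : ℕ}
  {U : Type*} [TopologicalSpace U] [ChartedSpace (EuclideanSpace ℝ (Fin m)) U]
  {M : Type*} [TopologicalSpace M] [ChartedSpace (EuclideanSpace ℝ (Fin (2 * n))) M]

/-- The tangent vector `X + v` of `U × M`. -/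
def tPair {p : U × M} (X : TangentSpace (𝓡 m) p.1) (v : TangentSpace (𝓡 (2 * n)) p.2) :
    TangentSpace ((𝓡 m).prod (𝓡 (2 * n))) p :=
  (toModel X, toModel v)

/-- A holomorphic chart (complex coordinate system) of `M` for the almost complex structure `j`:
a diffeomorphism `z` from an open set of `M` onto an open set of `ℂⁿ` with `dz ∘ j = i dz`. -/
structure HolChart (j : ∀ x : M, TangentSpace (𝓡 (2 * n)) x →L[ℝ] TangentSpace (𝓡 (2 * n)) x) where
  /-- the chart -/
  z : OpenPartialHomeomorph M (Fin n → ℂ)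
  smooth : ContMDiffOn (𝓡 (2 * n)) 𝓘(ℝ, Fin n → ℂ) ∞ z z.source
  smooth_symm : ContMDiffOn 𝓘(ℝ, Fin n → ℂ) (𝓡 (2 * n)) ∞ z.symm z.target
  hol : ∀ x ∈ z.source, ∀ v : TangentSpace (𝓡 (2 * n)) x,
    mvfderiv (𝓡 (2 * n)) z x (j x v) = Complex.I • mvfderiv (𝓡 (2 * n)) z x v

section Kahler

variable [IsManifold (𝓡 m) ∞ U] [IsManifold (𝓡 (2 * n)) ∞ M]

variable (m n U M) in
/-- A symplectic manifold `(M, ω)` of dimension `2n` with a smooth family `(j_u)_{u ∈ U}` of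
(integrable, positive) compatible complex structures. -/
structure KahlerFamily where
  /-- the symplectic form -/
  symp : ∀ x : M, LinearMap.BilinForm ℝ (TangentSpace (𝓡 (2 * n)) x)
  symp_alt : ∀ x v, symp x v v = 0
  symp_nondeg : ∀ x v, (∀ w, symp x v w = 0) → v = 0
  symp_smooth : ∀ V W : (∀ x : M, TangentSpace (𝓡 (2 * n)) x), IsSmoothVF V → IsSmoothVF W →
    ContMDiff (𝓡 (2 * n)) 𝓘(ℝ, ℝ) ∞ fun x => symp x (V x) (W x)
  symp_closed : ∀ A B C : (∀ x : M, TangentSpace (𝓡 (2 * n)) x),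
    IsSmoothVF A → IsSmoothVF B → IsSmoothVF C → ∀ x,
    mvfderiv (𝓡 (2 * n)) (fun y => symp y (B y) (C y)) x (A x)
      + mvfderiv (𝓡 (2 * n)) (fun y => symp y (C y) (A y)) x (B x)
      + mvfderiv (𝓡 (2 * n)) (fun y => symp y (A y) (B y)) x (C x)
      - symp x (VectorField.mlieBracket (𝓡 (2 * n)) A B x) (C x)
      - symp x (VectorField.mlieBracket (𝓡 (2 * n)) B C x) (A x)
      - symp x (VectorField.mlieBracket (𝓡 (2 * n)) C A x) (B x) = 0
  /-- the family of complex structures -/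
  j : U → ∀ x : M, TangentSpace (𝓡 (2 * n)) x →L[ℝ] TangentSpace (𝓡 (2 * n)) x
  j_smooth : ∀ V : (∀ x : M, TangentSpace (𝓡 (2 * n)) x), IsSmoothVF V →
    ContMDiff ((𝓡 m).prod (𝓡 (2 * n))) (𝓡 (2 * n)).tangent ∞
      fun p : U × M => (⟨p.2, j p.1 p.2 (V p.2)⟩ : TangentBundle (𝓡 (2 * n)) M)
  j_sq : ∀ u x v, j u x (j u x v) = -v
  j_integrable : ∀ u x, ∃ c : HolChart (j u), x ∈ c.z.source
  j_compatible : ∀ u x v w, symp x (j u x v) (j u x w) = symp x v w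
  j_positive : ∀ u x v, v ≠ 0 → 0 < symp x v (j u x v)

namespace KahlerFamily

variable (K : KahlerFamily m n U M)

/-- `j_u` extended to `T_x M ⊗ ℂ`. -/
def jC (p : U × M) :
    (ℂ ⊗[ℝ] TangentSpace (𝓡 (2 * n)) p.2) →ₗ[ℂ] (ℂ ⊗[ℝ] TangentSpace (𝓡 (2 * n)) p.2) :=
  (K.j p.1 p.2).toLinearMap.baseChange ℂ

theorem jC_sq (p : U × M) (w : ℂ ⊗[ℝ] TangentSpace (𝓡 (2 * n)) p.2) :
    K.jC p (K.jC p w) = -w := by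
  induction w using TensorProduct.induction_on with
  | zero => simp
  | tmul z v => simp [jC, K.j_sq, TensorProduct.tmul_neg]
  | add x y hx hy => rw [map_add, map_add, hx, hy, neg_add]

/-- The relative holomorphic tangent bundle, `E_{u,x} = T^{1,0}_x M_u`. -/
def E (p : U × M) : Submodule ℂ (ℂ ⊗[ℝ] TangentSpace (𝓡 (2 * n)) p.2) :=
  LinearMap.ker (K.jC p - Complex.I • LinearMap.id)

/-- The conjugate bundle `T^{0,1} M_u`. -/
def Ebar (p : U × M) : Submodule ℂ (ℂ ⊗[ℝ] TangentSpace (𝓡 (2 * n)) p.2) :=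
  LinearMap.ker (K.jC p + Complex.I • LinearMap.id)

/-- The projection `π = ½ (id - i j)` of `TM ⊗ ℂ` onto `E` with kernel `Ē`. -/
def projE (p : U × M) : (ℂ ⊗[ℝ] TangentSpace (𝓡 (2 * n)) p.2) →ₗ[ℂ] K.E p :=
  LinearMap.codRestrict (K.E p) ((1 / 2 : ℂ) • (LinearMap.id - Complex.I • K.jC p)) (by
    intro w
    simp only [E, LinearMap.mem_ker, LinearMap.sub_apply, LinearMap.smul_apply,
      LinearMap.id_apply, map_smul, map_sub, K.jC_sq, smul_sub, smul_neg, smul_smul]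
    have h : (1 / 2 : ℂ) * Complex.I * Complex.I = -(1 / 2 : ℂ) := by
      linear_combination (1 / 2 : ℂ) * Complex.I_mul_I
    rw [h]
    module)

/-- Smooth sections of `E → U × M`. -/
def SmoothE (W : ∀ p : U × M, K.E p) : Prop :=
  (ContMDiff ((𝓡 m).prod (𝓡 (2 * n))) (𝓡 (2 * n)).tangent ∞
      fun p : U × M => (⟨p.2, cRe (W p).1⟩ : TangentBundle (𝓡 (2 * n)) M)) ∧
  (ContMDiff ((𝓡 m).prod (𝓡 (2 * n))) (𝓡 (2 * n)).tangent ∞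
      fun p : U × M => (⟨p.2, cIm (W p).1⟩ : TangentBundle (𝓡 (2 * n)) M))

/-- The Kähler metric of `M_u`. -/
def g (u : U) (x : M) (v w : TangentSpace (𝓡 (2 * n)) x) : ℝ := K.symp x v (K.j u x w)

/-- The Levi-Civita covariant derivative `∇_v Y` at `x` of the Kähler metric of `M_u`, given by the
Koszul formula. -/
def leviCivita (u : U) (Y : ∀ x : M, TangentSpace (𝓡 (2 * n)) x) (x : M)
    (v : TangentSpace (𝓡 (2 * n)) x) : TangentSpace (𝓡 (2 * n)) x :=
  Classical.epsilon fun w => ∀ A Z : (∀ x : M, TangentSpace (𝓡 (2 * n)) x),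
    IsSmoothVF A → IsSmoothVF Z → A x = v →
    2 * K.g u x w (Z x) =
      mvfderiv (𝓡 (2 * n)) (fun y => K.g u y (Y y) (Z y)) x (A x)
      + mvfderiv (𝓡 (2 * n)) (fun y => K.g u y (Z y) (A y)) x (Y x)
      - mvfderiv (𝓡 (2 * n)) (fun y => K.g u y (A y) (Y y)) x (Z x)
      + K.g u x (VectorField.mlieBracket (𝓡 (2 * n)) A Y x) (Z x)
      - K.g u x (VectorField.mlieBracket (𝓡 (2 * n)) Y Z x) (A x)
      + K.g u x (VectorField.mlieBracket (𝓡 (2 * n)) Z A x) (Y x)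

/-- The connection on the pull-back of `TM` to `U × M` (the real form of `E ⊕ Ē`), in the direction
`X + v`: the Levi-Civita connection along the slice `M_u`, and, in the directions of `U`, the
derivative of functions with values in the fixed vector space `T_x M`. -/
def covTM (w : ∀ p : U × M, TangentSpace (𝓡 (2 * n)) p.2) (p : U × M)
    (X : TangentSpace (𝓡 m) p.1) (v : TangentSpace (𝓡 (2 * n)) p.2) :
    TangentSpace (𝓡 (2 * n)) p.2 :=
  ofModel (mvfderiv (𝓡 m) (fun u : U => toModel (w (u, p.2))) p.1 X)
    + K.leviCivita p.1 (fun x => w (p.1, x)) p.2 v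

/-- The connection `∇^E = π ∘ ∇^{E ⊕ Ē}` on `E`, in the direction `X + v`. -/
def covE (W : ∀ p : U × M, K.E p) (p : U × M)
    (X : TangentSpace (𝓡 m) p.1) (v : TangentSpace (𝓡 (2 * n)) p.2) : K.E p :=
  K.projE p (cMk (K.covTM (fun q => cRe (W q).1) p X v) (K.covTM (fun q => cIm (W q).1) p X v))

/-- The canonical (Chern, equivalently Levi-Civita) connection of `T^{1,0} M_u`, that is, the
restriction of `∇^E` to the slice `M_u`. -/
def covESlice (u : U) (W : ∀ x : M, K.E (u, x)) (x : M) (v : TangentSpace (𝓡 (2 * n)) x) :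
    K.E (u, x) :=
  K.projE (u, x) (cMk (K.leviCivita u (fun y => cRe (W y).1) x v)
    (K.leviCivita u (fun y => cIm (W y).1) x v))

/-! #### Coordinates on the slices -/

variable {K} in
/-- The vector `∂_{z^i} = ½ (∂_{x^i} - i ∂_{y^i})` at a point of the domain of a holomorphic chart
of `M_u`. -/
def dz {u : U} (c : HolChart (K.j u)) (i : Fin n) (x : M) : K.E (u, x) :=
  K.projE (u, x) (cMk
    ((show TangentSpace (𝓡 (2 * n)) x →L[ℝ] (Fin n → ℂ) from
      mvfderiv (𝓡 (2 * n)) c.z x).inverse (Pi.single i 1)) 0)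

variable {K} in
/-- The dual frame `ℓ_i = dz^i` of `E^*`. -/
def dzDual {u : U} (c : HolChart (K.j u)) (i : Fin n) (x : M) : K.E (u, x) →ₗ[ℂ] ℂ :=
  (LinearMap.liftBaseChange ℂ
    ((LinearMap.proj i : (Fin n → ℂ) →ₗ[ℝ] ℂ) ∘ₗ
      (mvfderiv (𝓡 (2 * n)) c.z x).toLinearMap)) ∘ₗ (K.E (u, x)).subtype

/-- A holomorphic chart of `M_u` around `x`. -/
def holChartAt (u : U) (x : M) : HolChart (K.j u) := (K.j_integrable u x).choose

/-! #### The variation of the complex structure and `G(X)` -/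

/-- The derivative `X.j` of the complex structure, applied to a complex tangent vector `w`; for `w`
in `Ē` this is `μ(X) w`, an element of `E`. -/
def djC (p : U × M) (X : TangentSpace (𝓡 m) p.1) (w : ℂ ⊗[ℝ] TangentSpace (𝓡 (2 * n)) p.2) :
    ℂ ⊗[ℝ] TangentSpace (𝓡 (2 * n)) p.2 :=
  cMk (ofModel (mvfderiv (𝓡 m) (fun u : U => toModel (K.j u p.2 (cRe w))) p.1 X))
    (ofModel (mvfderiv (𝓡 m) (fun u : U => toModel (K.j u p.2 (cIm w))) p.1 X))

/-- The contraction `a ⊗ b ↦ ω(a, w) b` on `E ⊗ E`. -/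
def contract (p : U × M) (w : ℂ ⊗[ℝ] TangentSpace (𝓡 (2 * n)) p.2) :
    (K.E p ⊗[ℂ] K.E p) →ₗ[ℂ] (ℂ ⊗[ℝ] TangentSpace (𝓡 (2 * n)) p.2) :=
  (TensorProduct.lid ℂ _).toLinearMap ∘ₗ
    TensorProduct.map
      ((LinearMap.flip (LinearMap.BilinForm.baseChange ℂ (K.symp p.2)) w) ∘ₗ (K.E p).subtype)
      (K.E p).subtype

/-- The tensor `G(X) = ∑ G_{ij} ∂_i ⊗ ∂_j` of `E ⊗ E` with `∑ G_{ij} ω(∂_i, ·) ∂_j = μ(X)`. -/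
def G (p : U × M) (X : TangentSpace (𝓡 m) p.1) : K.E p ⊗[ℂ] K.E p :=
  Classical.epsilon fun t => ∀ w ∈ K.Ebar p, K.contract p w t = K.djC p X w

variable {K} in
/-- The components `G_{ij}` of `G(X)` in a holomorphic chart. -/
def Gcomp {u : U} (c : HolChart (K.j u)) (X : TangentSpace (𝓡 m) u) (i j : Fin n) (x : M) : ℂ :=
  (TensorProduct.lid ℂ ℂ) (TensorProduct.map (dzDual c i x) (dzDual c j x) (K.G (u, x) X))

/-- The sections `G(X)`, `X ∈ TU`, are holomorphic. -/
def GHolomorphic : Prop :=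
  ∀ (u : U) (X : TangentSpace (𝓡 m) u) (c : HolChart (K.j u)) (i j : Fin n),
    DifferentiableOn ℂ (fun y => Gcomp c X i j (c.z.symm y)) c.z.target

/-! #### The Liouville integral -/

section Liouville

variable [CompactSpace M] [T2Space M]

/-- A partition of unity subordinate to the charts of `M`. -/
def partition : SmoothPartitionOfUnity M (𝓡 (2 * n)) M Set.univ :=
  (SmoothPartitionOfUnity.exists_isSubordinate_chartAt_source (𝓡 (2 * n)) M).choose

/-- The integral `∫_M f ωⁿ` (for the orientation defined by `ωⁿ`): in local coordinates, `ωⁿ` is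
`n! |det (ω(∂_a, ∂_b))|^{1/2}` times the Lebesgue measure. -/
def liouvilleIntegral (f : M → ℂ) : ℂ :=
  (n.factorial : ℂ) * ∑ᶠ i : M, ∫ y in (chartAt (EuclideanSpace ℝ (Fin (2 * n))) i).target,
    let x : M := (chartAt (EuclideanSpace ℝ (Fin (2 * n))) i).symm y
    let e : Fin (2 * n) → TangentSpace (𝓡 (2 * n)) x := fun a =>
      mfderiv (𝓡 (2 * n)) (𝓡 (2 * n)) (chartAt (EuclideanSpace ℝ (Fin (2 * n))) i).symm y
        (ofModel (EuclideanSpace.single a (1 : ℝ)))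
    ((partition (n := n) (M := M) i x *
      Real.sqrt |(Matrix.of fun a b => K.symp x (e a) (e b)).det| : ℝ) : ℂ) * f x

end Liouville

end KahlerFamily

/-! ### The prequantum bundle and the half-form bundle -/

section Bundles

variable (K : KahlerFamily m n U M)

/-- Prequantum structure on a complex line bundle `L → M`: a Hermitian metric and a metric
connection of curvature `(1/i) ω`. -/
structure Prequantum (L : M → Type*) [TopologicalSpace (TotalSpace ℂ L)]
    [∀ x, AddCommGroup (L x)] [∀ x, Module ℂ (L x)] [∀ x, TopologicalSpace (L x)]
    [∀ x, IsTopologicalAddGroup (L x)] [∀ x, ContinuousSMul ℝ (L x)]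
    [FiberBundle ℂ L] [VectorBundle ℝ ℂ L] where
  /-- the Hermitian metric, conjugate-linear in the first variable -/
  herm : ∀ x, L x →ₗ⋆[ℂ] L x →ₗ[ℂ] ℂ
  herm_symm : ∀ x s t, conj (herm x s t) = herm x t s
  herm_pos : ∀ x s, s ≠ 0 → 0 < (herm x s s).re
  herm_smooth : ∀ s t : (∀ x, L x),
    ContMDiff (𝓡 (2 * n)) ((𝓡 (2 * n)).prod 𝓘(ℝ, ℂ)) ∞ (fun x => TotalSpace.mk' ℂ x (s x)) →
    ContMDiff (𝓡 (2 * n)) ((𝓡 (2 * n)).prod 𝓘(ℝ, ℂ)) ∞ (fun x => TotalSpace.mk' ℂ x (t x)) →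
    ContMDiff (𝓡 (2 * n)) 𝓘(ℝ, ℂ) ∞ fun x => herm x (s x) (t x)
  /-- the connection -/
  nabla : CovariantDerivative (𝓡 (2 * n)) ℂ L
  nabla_smooth : CovariantDerivative.ContMDiffCovariantDerivative nabla ∞
  nabla_complex : ∀ s : (∀ x, L x),
    ContMDiff (𝓡 (2 * n)) ((𝓡 (2 * n)).prod 𝓘(ℝ, ℂ)) ∞ (fun x => TotalSpace.mk' ℂ x (s x)) →
    ∀ x v, nabla (fun y => Complex.I • s y) x v = Complex.I • nabla s x v
  nabla_herm : ∀ s t : (∀ x, L x),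
    ContMDiff (𝓡 (2 * n)) ((𝓡 (2 * n)).prod 𝓘(ℝ, ℂ)) ∞ (fun x => TotalSpace.mk' ℂ x (s x)) →
    ContMDiff (𝓡 (2 * n)) ((𝓡 (2 * n)).prod 𝓘(ℝ, ℂ)) ∞ (fun x => TotalSpace.mk' ℂ x (t x)) →
    ∀ x v, mvfderiv (𝓡 (2 * n)) (fun y => herm y (s y) (t y)) x v
      = herm x (nabla s x v) (t x) + herm x (s x) (nabla t x v)
  nabla_curv : ∀ (A B : ∀ x : M, TangentSpace (𝓡 (2 * n)) x) (s : ∀ x, L x),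
    IsSmoothVF A → IsSmoothVF B →
    ContMDiff (𝓡 (2 * n)) ((𝓡 (2 * n)).prod 𝓘(ℝ, ℂ)) ∞ (fun x => TotalSpace.mk' ℂ x (s x)) →
    ∀ x, nabla (fun y => nabla s y (B y)) x (A x) - nabla (fun y => nabla s y (A y)) x (B x)
        - nabla s x (VectorField.mlieBracket (𝓡 (2 * n)) A B x)
      = ((1 / Complex.I) * (K.symp x (A x) (B x) : ℂ)) • s x

/-- A family of half-form bundles: a smooth isomorphism `φ : δ² → ⋀^top E^*` of complex line
bundles over `U × M`. -/
structure HalfForm (δ : U × M → Type*) [TopologicalSpace (TotalSpace ℂ δ)]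
    [∀ p, AddCommGroup (δ p)] [∀ p, Module ℂ (δ p)] [∀ p, TopologicalSpace (δ p)]
    [FiberBundle ℂ δ] where
  /-- the isomorphism -/
  φ : ∀ p, (δ p ⊗[ℂ] δ p) ≃ₗ[ℂ] (K.E p) [⋀^Fin n]→ₗ[ℂ] ℂ
  φ_smooth : ∀ (d d' : ∀ p, δ p) (W : Fin n → ∀ p, K.E p),
    ContMDiff ((𝓡 m).prod (𝓡 (2 * n))) (((𝓡 m).prod (𝓡 (2 * n))).prod 𝓘(ℝ, ℂ)) ∞
      (fun p => TotalSpace.mk' ℂ p (d p)) →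
    ContMDiff ((𝓡 m).prod (𝓡 (2 * n))) (((𝓡 m).prod (𝓡 (2 * n))).prod 𝓘(ℝ, ℂ)) ∞
      (fun p => TotalSpace.mk' ℂ p (d' p)) →
    (∀ i, K.SmoothE (W i)) →
    ContMDiff ((𝓡 m).prod (𝓡 (2 * n))) 𝓘(ℝ, ℂ) ∞
      fun p => φ p (d p ⊗ₜ[ℂ] d' p) fun i => W i p

end Bundles

/-! ### Sections of `L^k ⊗ δ`, connection, differential operators -/

section Operators

variable {K : KahlerFamily m n U M}
  {L : M → Type*} [TopologicalSpace (TotalSpace ℂ L)]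
  [∀ x, AddCommGroup (L x)] [∀ x, Module ℂ (L x)] [∀ x, TopologicalSpace (L x)]
  [∀ x, IsTopologicalAddGroup (L x)] [∀ x, ContinuousSMul ℝ (L x)]
  [FiberBundle ℂ L] [VectorBundle ℝ ℂ L]
  {δ : U × M → Type*} [TopologicalSpace (TotalSpace ℂ δ)]
  [∀ p, AddCommGroup (δ p)] [∀ p, Module ℂ (δ p)] [∀ p, TopologicalSpace (δ p)]
  [FiberBundle ℂ δ]

variable (L δ) in
/-- The fibre of `L^k ⊗ δ` at `(u, x)`. -/
abbrev Fib (k : ℕ) (p : U × M) : Type _ := (⨂[ℂ]^k (L p.2)) ⊗[ℂ] δ p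

/-- The frame of `L` around `x₀` given by the preferred trivialization at `x₀`. -/
def frameL (L : M → Type*) [TopologicalSpace (TotalSpace ℂ L)]
    [∀ x, AddCommGroup (L x)] [∀ x, TopologicalSpace (L x)] [FiberBundle ℂ L] (x₀ x : M) : L x :=
  (trivializationAt ℂ L x₀).symm x 1

/-- The frame of `δ` around `p₀` given by the preferred trivialization at `p₀`. -/
def frameδ (δ : U × M → Type*) [TopologicalSpace (TotalSpace ℂ δ)]
    [∀ p, AddCommGroup (δ p)] [∀ p, TopologicalSpace (δ p)] [FiberBundle ℂ δ] (p₀ p : U × M) :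
    δ p :=
  (trivializationAt ℂ δ p₀).symm p 1

variable (L δ) in
/-- The corresponding frame of `L^k ⊗ δ` around `p₀`. -/
def frame (k : ℕ) (p₀ p : U × M) : Fib L δ k p :=
  (PiTensorProduct.tprod ℂ fun _ : Fin k => frameL L p₀.2 p.2) ⊗ₜ[ℂ] frameδ δ p₀ p

/-- Smooth sections of `L^k ⊗ δ → U × M`. -/
def SmoothSection {k : ℕ} (s : ∀ p, Fib L δ k p) : Prop :=
  ∀ p₀, ContMDiffAt ((𝓡 m).prod (𝓡 (2 * n))) 𝓘(ℝ, ℂ) ∞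
    (fun p => ratio (s p) (frame L δ k p₀ p)) p₀

/-- Smooth sections of `L_u^k ⊗ δ_u → M_u`. -/
def SmoothSlice {k : ℕ} {u : U} (t : ∀ x, Fib L δ k (u, x)) : Prop :=
  ∀ x₀, ContMDiffAt (𝓡 (2 * n)) 𝓘(ℝ, ℂ) ∞
    (fun x => ratio (t x) (frame L δ k (u, x₀) (u, x))) x₀

/-- The connection form of `L` in the frame at `x`: `∇_v e = A(v) e`. -/
def formL (Q : Prequantum K L) (x : M) (v : TangentSpace (𝓡 (2 * n)) x) : ℂ :=
  ratio (Q.nabla (frameL L x) x v) (frameL L x x)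

/-- The connection form of `δ` in the frame `d` at `p`: `∇_{X+v} d = A(X, v) d`, where the
connection of `δ` is the one which corresponds through `φ` to the connection of `⋀^top E^*` induced
by `∇^E`, so that `(∇ φ(d²))(W₁, …, Wₙ) = 2 A φ(d²)(W₁, …, Wₙ)` for all sections `W_i` of `E`. -/
def formδ (D : HalfForm K δ) (p : U × M) (X : TangentSpace (𝓡 m) p.1)
    (v : TangentSpace (𝓡 (2 * n)) p.2) : ℂ :=
  Classical.epsilon fun A : ℂ =>
    ∀ W : Fin n → ∀ q, K.E q, (∀ i, K.SmoothE (W i)) →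
      mvfderiv ((𝓡 m).prod (𝓡 (2 * n)))
          (fun q => D.φ q (frameδ δ p q ⊗ₜ[ℂ] frameδ δ p q) fun i => W i q) p (tPair X v)
        - ∑ i, D.φ p (frameδ δ p p ⊗ₜ[ℂ] frameδ δ p p)
            (Function.update (fun l => W l p) i (K.covE (W i) p X v))
      = 2 * A * D.φ p (frameδ δ p p ⊗ₜ[ℂ] frameδ δ p p) fun i => W i p

/-- `∇_X^{L^k ⊗ δ} s` for `X` tangent to `U`; here `L` is pulled back from `M` with its connection,
so that the frames pulled back from `M` are constant in the directions of `U`. -/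
def nablaU (D : HalfForm K δ) {k : ℕ} (X : ∀ u : U, TangentSpace (𝓡 m) u)
    (s : ∀ p, Fib L δ k p) (p : U × M) : Fib L δ k p :=
  (mvfderiv ((𝓡 m).prod (𝓡 (2 * n))) (fun q => ratio (s q) (frame L δ k p q)) p
        (tPair (X p.1) 0)
      + formδ D p (X p.1) 0 * ratio (s p) (frame L δ k p p)) • frame L δ k p p

/-- The connection of `L_u^k ⊗ δ_u → M_u` (its Chern connection, the restriction of
`∇^{L^k ⊗ δ}`), in the direction of a real tangent vector `v`. -/
def nablaM (Q : Prequantum K L) (D : HalfForm K δ) {k : ℕ} {u : U}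
    (t : ∀ x, Fib L δ k (u, x)) (x : M) (v : TangentSpace (𝓡 (2 * n)) x) : Fib L δ k (u, x) :=
  (mvfderiv (𝓡 (2 * n)) (fun y => ratio (t y) (frame L δ k (u, x) (u, y))) x v
      + (k * formL Q x v + formδ D (u, x) 0 v) * ratio (t x) (frame L δ k (u, x) (u, x)))
    • frame L δ k (u, x) (u, x)

/-- `∇_{∂/∂z^i}` in a holomorphic chart. -/
def nablaHol (Q : Prequantum K L) (D : HalfForm K δ) {k : ℕ} {u : U} (c : HolChart (K.j u))
    (i : Fin n) (t : ∀ x, Fib L δ k (u, x)) (x : M) : Fib L δ k (u, x) :=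
  cExt (nablaM Q D t x) (KahlerFamily.dz c i x).1

/-- `∇_{∂/∂z̄^i}` in a holomorphic chart. -/
def nablaAnti (Q : Prequantum K L) (D : HalfForm K δ) {k : ℕ} {u : U} (c : HolChart (K.j u))
    (i : Fin n) (t : ∀ x, Fib L δ k (u, x)) (x : M) : Fib L δ k (u, x) :=
  cExt (nablaM Q D t x) (cConj (KahlerFamily.dz c i x).1)

/-- `Q` is a holomorphic differential operator (with smooth coefficients) on sections of
`L_u^k ⊗ δ_u`. -/
def IsHolDiffOp (Q : Prequantum K L) (D : HalfForm K δ) {k : ℕ} {u : U}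
    (P : (∀ x, Fib L δ k (u, x)) → ∀ x, Fib L δ k (u, x)) : Prop :=
  ∃ ℓ : ℕ, ∀ c : HolChart (K.j u), ∃ a : (Fin n → ℕ) → M → ℂ,
    (∀ α, ContMDiffOn (𝓡 (2 * n)) 𝓘(ℝ, ℂ) ∞ (a α) c.z.source) ∧
    ∀ t, SmoothSlice (n := n) t → ∀ x ∈ c.z.source,
      P t x = ∑ α ∈ multiIdx n ℓ, a α x • multiOp (nablaHol Q D c) α t x

/-- `N` belongs to the left ideal of differential operators generated by the anti-holomorphic
derivations. -/
def InAntiIdeal (Q : Prequantum K L) (D : HalfForm K δ) {k : ℕ} {u : U}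
    (N : (∀ x, Fib L δ k (u, x)) → ∀ x, Fib L δ k (u, x)) : Prop :=
  ∃ ℓ : ℕ, ∀ c : HolChart (K.j u), ∃ a : (Fin n → ℕ) → (Fin n → ℕ) → M → ℂ,
    (∀ α β, ContMDiffOn (𝓡 (2 * n)) 𝓘(ℝ, ℂ) ∞ (a α β) c.z.source) ∧
    ∀ t, SmoothSlice (n := n) t → ∀ x ∈ c.z.source,
      N t x = ∑ α ∈ multiIdx n ℓ, ∑ β ∈ (multiIdx n ℓ).filter (· ≠ 0),
        a α β x • multiOp (nablaHol Q D c) α (multiOp (nablaAnti Q D c) β t) x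

/-- `R`, acting on sections over `U × M`, is a family of differential operators `(R_u)` on the
slices, and the holomorphic part of `R_u` is `P u`. -/
def IsHolPart (Q : Prequantum K L) (D : HalfForm K δ) {k : ℕ}
    (R : (∀ p, Fib L δ k p) → ∀ p, Fib L δ k p)
    (P : ∀ u, (∀ x, Fib L δ k (u, x)) → ∀ x, Fib L δ k (u, x)) : Prop :=
  ∀ u, IsHolDiffOp Q D (P u) ∧
    ∃ N : (∀ x, Fib L δ k (u, x)) → ∀ x, Fib L δ k (u, x), InAntiIdeal Q D N ∧
      ∀ s, SmoothSection (m := m) (n := n) s → ∀ x,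
        R s (u, x) = P u (fun y => s (u, y)) x + N (fun y => s (u, y)) x

/-- The space `Op_sc` of families `(P_{u,k})`, `u ∈ U`, `k ≥ k₀`: smooth in `u` for each `k`, and,
for each `u`, of the form `∑ a_α (∇_{z¹})^{α(1)} ⋯ (∇_{zⁿ})^{α(n)}` in each complex coordinate
system of `M_u`, with coefficients `a_α` that do not depend on `k`. -/
def OpSc (Q : Prequantum K L) (D : HalfForm K δ) (k₀ : ℕ)
    (P : ∀ (k : ℕ) (u : U), (∀ x, Fib L δ k (u, x)) → ∀ x, Fib L δ k (u, x)) : Prop :=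
  (∀ k, k₀ ≤ k → ∀ s : (∀ p, Fib L δ k p), SmoothSection (m := m) (n := n) s →
    SmoothSection (m := m) (n := n) (fun p : U × M => (P k p.1 (fun x => s (p.1, x)) p.2 : Fib L δ k p))) ∧
  ∀ u, ∃ ℓ : ℕ, ∀ c : HolChart (K.j u), ∃ a : (Fin n → ℕ) → M → ℂ,
    (∀ α, ContMDiffOn (𝓡 (2 * n)) 𝓘(ℝ, ℂ) ∞ (a α) c.z.source) ∧
    ∀ k, k₀ ≤ k → ∀ t : (∀ x, Fib L δ k (u, x)), SmoothSlice (n := n) t → ∀ x ∈ c.z.source,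
      P k u t x = ∑ α ∈ multiIdx n ℓ, a α x • multiOp (nablaHol Q D c) α t x

/-! ### `Δ^G`, `θ`, `H` and the connection -/

/-- `Δ^{G(X)} t = ∑_l ℓ_l (∇_l^{T^{1,0} ⊗ F} (∑_{i,j} G_{ij} ∂_i ⊗ ∇_j t))` at a point of the domain
of a holomorphic chart, where the Leibniz rule is used for the connection of `T^{1,0} M_u ⊗ F`. -/
def deltaChart (Q : Prequantum K L) (D : HalfForm K δ) {k : ℕ} {u : U} (c : HolChart (K.j u))
    (X : TangentSpace (𝓡 m) u) (t : ∀ x, Fib L δ k (u, x)) (x : M) : Fib L δ k (u, x) :=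
  let τ : Fin n → ∀ y, Fib L δ k (u, y) := fun i y =>
    ∑ j, KahlerFamily.Gcomp c X i j y • nablaHol Q D c j t y
  ∑ l, ∑ i,
    (KahlerFamily.dzDual c l x (KahlerFamily.dz c i x) • nablaHol Q D c l (τ i) x
      + KahlerFamily.dzDual c l x
          (cExt (K.covESlice u (KahlerFamily.dz c i) x) (KahlerFamily.dz c l x).1) • τ i x)

/-- The operator `Δ^{G(X)}`, which does not depend on the frame used to compute it. -/
def delta (Q : Prequantum K L) (D : HalfForm K δ) {k : ℕ} {u : U}
    (X : TangentSpace (𝓡 m) u) (t : ∀ x, Fib L δ k (u, x)) (x : M) : Fib L δ k (u, x) :=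
  deltaChart Q D (K.holChartAt u x) X t x

/-- The number `R^F(∂/∂z̄^r, ∂/∂z^i)`, where `F = L_u^k ⊗ δ_u` (the two fields commute). -/
def curvF (Q : Prequantum K L) (D : HalfForm K δ) (k : ℕ) {u : U} (c : HolChart (K.j u))
    (r i : Fin n) (x : M) : ℂ :=
  let t : ∀ y, Fib L δ k (u, y) := fun y => frame L δ k (u, x) (u, y)
  ratio (nablaAnti Q D c r (nablaHol Q D c i t) x - nablaHol Q D c i (nablaAnti Q D c r t) x) (t x)

/-- `θ^F(∂/∂z̄^r) = ∑_l ℓ_l (∇_l (∑_{i,j} R^F(∂/∂z̄^r, ∂_i) G_{ij} ∂_j))` for `F = L_u^k ⊗ δ_u`; for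
`k = 0` one has `F = δ_u`. -/
def theta (Q : Prequantum K L) (D : HalfForm K δ) (k : ℕ) {u : U} (c : HolChart (K.j u))
    (X : TangentSpace (𝓡 m) u) (r : Fin n) (x : M) : ℂ :=
  ∑ l, KahlerFamily.dzDual c l x
    (cExt (K.covESlice u (fun y => ∑ i, ∑ j,
        (curvF Q D k c r i y * KahlerFamily.Gcomp c X i j y) • KahlerFamily.dz c j y) x)
      (KahlerFamily.dz c l x).1)

/-- `H` is the smooth section of `p^*(T^*U) ⊗ ℂ` over `U × M` such that `∂̄ H(X) = θ^{δ_u}` and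
`∫_M H(X) ωⁿ = 0` for all `X ∈ T_u U`. -/
structure IsPotential [CompactSpace M] [T2Space M] (Q : Prequantum K L) (D : HalfForm K δ)
    (H : ∀ p : U × M, TangentSpace (𝓡 m) p.1 →L[ℝ] ℂ) : Prop where
  smooth : ∀ X : (∀ u : U, TangentSpace (𝓡 m) u), IsSmoothVF X →
    ContMDiff ((𝓡 m).prod (𝓡 (2 * n))) 𝓘(ℝ, ℂ) ∞ fun p : U × M => H p (X p.1)
  dbar : ∀ (u : U) (X : TangentSpace (𝓡 m) u) (c : HolChart (K.j u)) (r : Fin n),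
    ∀ x ∈ c.z.source,
      cExt (mvfderiv (𝓡 (2 * n)) (fun y => H (u, y) X) x) (cConj (KahlerFamily.dz c r x).1)
        = theta Q D 0 c X r x
  normalized : ∀ (u : U) (X : TangentSpace (𝓡 m) u),
    K.liouvilleIntegral (fun x => H (u, x) X) = 0

/-- The operator `∇_X^{L^k ⊗ δ} + (1/4k) (Δ^{G(X)} - H(X))` on sections of `L^k ⊗ δ`. -/
def hitchin (Q : Prequantum K L) (D : HalfForm K δ)
    (H : ∀ p : U × M, TangentSpace (𝓡 m) p.1 →L[ℝ] ℂ) {k : ℕ}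
    (X : ∀ u : U, TangentSpace (𝓡 m) u) (s : ∀ p, Fib L δ k p) (p : U × M) : Fib L δ k p :=
  nablaU D X s p
    + (1 / (4 * k : ℂ)) • (delta Q D (X p.1) (fun x => s (p.1, x)) p.2 - H p (X p.1) • s p)

/-- The curvature `R_k(X, Y)` of the connection `hitchin`, acting on sections of `L^k ⊗ δ`. -/
def hitchinCurv (Q : Prequantum K L) (D : HalfForm K δ)
    (H : ∀ p : U × M, TangentSpace (𝓡 m) p.1 →L[ℝ] ℂ) {k : ℕ}
    (X Y : ∀ u : U, TangentSpace (𝓡 m) u) (s : ∀ p, Fib L δ k p) (p : U × M) : Fib L δ k p :=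
  hitchin Q D H X (hitchin Q D H Y s) p - hitchin Q D H Y (hitchin Q D H X s) p
    - hitchin Q D H (VectorField.mlieBracket (𝓡 m) X Y) s p

end Operators

end Kahler

end HalfFormQuant

end

/-! Write ∇_X for the covariant derivative in the directions of U, and expand R_k(X,Y) in powers of
k (`hitchinCurv_eq`). Three terms appear: the curvature of ∇ along U; (4k)⁻¹ times [∇_X, Δ^{G(Y)} -
H(Y)] - [∇_Y, Δ^{G(X)} - H(X)] - (Δ^{G([X,Y])} - H([X,Y])); and (4k)⁻² times the commutator of
Δ^{G(X)} - H(X) and Δ^{G(Y)} - H(Y). The last one is holomorphic and supplies P₂. The point is that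
the first term, of order k⁰, is cancelled by a part of the second one that grows like k.

The curvature along U: L is pulled back from M and contributes nothing, so only δ does, with half of
the curvature of ∧ⁿE^*. Let V_a be vector fields of M and W_a = ½(V_a - i j V_a) their projections
to E. In this frame the matrix of ∇^E along U is -(i/2) times the derivative of the matrix of j;
hence the curvature of E is -¼ π[X.j, Y.j], with trace (i/4)τ, where τ = tr((X.j)(Y.j)j). The
curvature of δ is therefore -(i/8)τ (`nablaU_commutator`).

The commutator with the Laplacian: the derivative of W_a along X is -(i/2)(X.j)V_a, which has a part
of type (0,1), so [∇_X, ∇_{W_a}] contains derivatives along the conjugate fields (`nablaU_covC_W`).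
In Δ^{G(Y)} = ∑ ∇_{W_a} G_{ab} ∇_{W_b} + (lower order), such a derivative belongs to the left ideal
when it stands on the right. When it stands on the left it has to be moved past ∇_{W_b}, at the cost
of the curvature (k/i) ω(W̄_c, W_b). Thus the commutator is a holomorphic operator, plus an element
of the ideal, plus k times a function (`hasNormalForm_commutator_deltaOp`). That function is ¼
tr((X.j)(Y.j)) + (i/4)τ (`commSymbol_eq`). Antisymmetrization leaves (i/2)τ, and k/(4k) times this
is (i/8)τ: the terms of order k⁰ cancel exactly.

Coefficients independent of k: k enters only through the curvature of L^k, a multiple of ω along M.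
Since ω vanishes on pairs of vectors of type (1,0), and L has no mixed curvature, the coordinate
derivatives commute up to the curvature of δ alone (`nablaHol_commutator`). So every operator
generated by functions and the ∇_{W_a} (`HolOp`) has, in each holomorphic chart, coefficients that
do not depend on k (`HolOp.exists_chartOp`).

Holomorphic charts of M_u come with no smooth dependence on u. The computations over U × M therefore
use a finite overcomplete frame of TM, independent of u (`TFrame`); traces and divergences computed
in it agree with those of a coordinate frame (`sum_coord_eq_sum_coord`). The objects specified by
choice, namely the Levi-Civita connection, G(X) and the connection form of δ, are first identified
with explicit expressions in this frame (`leviCivita_eq`, `G_eq_sum`, `exists_isForm`,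
`IsForm.eq_div`). -/

noncomputable section

namespace HalfFormQuant

section

/-! ### Calculus of vector-valued functions on manifolds -/

section Calculus

variable {E : Type*} [NormedAddCommGroup E] [NormedSpace ℝ E] {H : Type*} [TopologicalSpace H]
  {I : ModelWithCorners ℝ E H} {N : Type*} [TopologicalSpace N] [ChartedSpace H N]
  {F : Type*} [NormedAddCommGroup F] [NormedSpace ℝ F]

variable (I) in
/-- The function `f` is smooth in a neighbourhood of `p`. -/
def SmoothNear (f : N → F) (p : N) : Prop :=
  ∀ᶠ q in 𝓝 p, ContMDiffAt I 𝓘(ℝ, F) ∞ f q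

theorem SmoothNear.contMDiffAt {f : N → F} {p : N} (h : SmoothNear I f p) :
    ContMDiffAt I 𝓘(ℝ, F) ∞ f p := h.self_of_nhds

theorem SmoothNear.mdiff {f : N → F} {p : N} (h : SmoothNear I f p) :
    MDifferentiableAt I 𝓘(ℝ, F) f p :=
  h.contMDiffAt.mdifferentiableAt (by simp)

theorem SmoothNear.eventually {f : N → F} {p : N} (h : SmoothNear I f p) :
    ∀ᶠ q in 𝓝 p, SmoothNear I f q := eventually_eventually_nhds.2 h

theorem smoothNear_of_contMDiff {f : N → F} (h : ContMDiff I 𝓘(ℝ, F) ∞ f) (p : N) :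
    SmoothNear I f p := Filter.Eventually.of_forall fun q => h q

theorem smoothNear_of_contMDiffOn {f : N → F} {s : Set N} (h : ContMDiffOn I 𝓘(ℝ, F) ∞ f s)
    (hs : IsOpen s) {p : N} (hp : p ∈ s) : SmoothNear I f p := by
  filter_upwards [hs.mem_nhds hp] with q hq using h.contMDiffAt (hs.mem_nhds hq)

theorem contMDiff_of_smoothNear {f : N → F} (h : ∀ p, SmoothNear I f p) :
    ContMDiff I 𝓘(ℝ, F) ∞ f := fun p => (h p).contMDiffAt

theorem contMDiffOn_of_smoothNear {f : N → F} {s : Set N} (h : ∀ p ∈ s, SmoothNear I f p) :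
    ContMDiffOn I 𝓘(ℝ, F) ∞ f s := fun p hp => (h p hp).contMDiffAt.contMDiffWithinAt

theorem SmoothNear.congr {f g : N → F} {p : N} (h : SmoothNear I f p) (hfg : g =ᶠ[𝓝 p] f) :
    SmoothNear I g p := by
  filter_upwards [h, hfg.eventuallyEq_nhds] with q hq hq'
  exact hq.congr_of_eventuallyEq hq'

theorem smoothNear_const (c : F) (p : N) : SmoothNear I (fun _ => c) p :=
  smoothNear_of_contMDiff contMDiff_const p

theorem SmoothNear.add {f g : N → F} {p : N} (hf : SmoothNear I f p) (hg : SmoothNear I g p) :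
    SmoothNear I (fun q => f q + g q) p := by
  filter_upwards [hf, hg] with q h1 h2 using h1.add h2

theorem SmoothNear.sub {f g : N → F} {p : N} (hf : SmoothNear I f p) (hg : SmoothNear I g p) :
    SmoothNear I (fun q => f q - g q) p := by
  filter_upwards [hf, hg] with q h1 h2 using h1.sub h2

theorem SmoothNear.sum {ι : Type*} {s : Finset ι} {f : ι → N → F} {p : N}
    (hf : ∀ i ∈ s, SmoothNear I (f i) p) : SmoothNear I (fun q => ∑ i ∈ s, f i q) p := by
  have h : ∀ᶠ q in 𝓝 p, ∀ i ∈ s, ContMDiffAt I 𝓘(ℝ, F) ∞ (f i) q :=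
    (Filter.eventually_all_finset s).2 hf
  filter_upwards [h] with q hq using contMDiffAt_finsetSum hq

theorem SmoothNear.clm {F' : Type*} [NormedAddCommGroup F'] [NormedSpace ℝ F'] {f : N → F} {p : N}
    (hf : SmoothNear I f p) (L : F →L[ℝ] F') : SmoothNear I (fun q => L (f q)) p := by
  filter_upwards [hf] with q h1
  exact L.contMDiff.contMDiffAt.comp q h1

theorem SmoothNear.ofReal {f : N → ℝ} {p : N} (hf : SmoothNear I f p) :
    SmoothNear I (fun q => (f q : ℂ)) p := hf.clm Complex.ofRealCLM

theorem SmoothNear.mul {A : Type*} [NormedRing A] [NormedAlgebra ℝ A] {f g : N → A} {p : N}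
    (hf : SmoothNear I f p) (hg : SmoothNear I g p) : SmoothNear I (fun q => f q * g q) p := by
  filter_upwards [hf, hg] with q h1 h2
  exact (contDiff_mul (𝕜 := ℝ) (𝔸 := A)).contMDiff.contMDiffAt.comp q (h1.prodMk_space h2)

theorem SmoothNear.const_mul {A : Type*} [NormedRing A] [NormedAlgebra ℝ A] {g : N → A} {p : N}
    (hg : SmoothNear I g p) (c : A) : SmoothNear I (fun q => c * g q) p :=
  (smoothNear_const c p).mul hg

theorem SmoothNear.inv {A : Type*} [NormedField A] [NormedAlgebra ℝ A] {f : N → A} {p : N}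
    (hf : SmoothNear I f p) (h0 : f p ≠ 0) : SmoothNear I (fun q => (f q)⁻¹) p := by
  have h1 : ∀ᶠ q in 𝓝 p, f q ≠ 0 := hf.contMDiffAt.continuousAt.eventually_ne h0
  filter_upwards [hf, h1] with q h1 h2
  exact ((contDiffAt_inv ℝ h2).contMDiffAt).comp q h1

theorem SmoothNear.pow {f : N → ℂ} {p : N}
    (hf : SmoothNear I f p) (k : ℕ) : SmoothNear I (fun q => (f q) ^ k) p := by
  induction k with
  | zero => simpa using smoothNear_const (1 : ℂ) p
  | succ k ih => simpa only [pow_succ] using ih.mul hf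

theorem SmoothNear.prod {ι : Type*} {s : Finset ι} {f : ι → N → ℝ} {p : N}
    (hf : ∀ i ∈ s, SmoothNear I (f i) p) : SmoothNear I (fun q => ∏ i ∈ s, f i q) p := by
  classical
  induction s using Finset.induction_on with
  | empty => simpa using smoothNear_const (1 : ℝ) p
  | insert a s ha ih =>
    simp only [Finset.prod_insert ha]
    exact (hf a (by simp)).mul (ih fun i hi => hf i (by simp [hi]))

theorem SmoothNear.comp {E' : Type*} [NormedAddCommGroup E'] [NormedSpace ℝ E'] {H' : Type*}
    [TopologicalSpace H'] {I' : ModelWithCorners ℝ E' H'} {N' : Type*} [TopologicalSpace N']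
    [ChartedSpace H' N'] {f : N → F} {g : N' → N} {p : N'} (hf : SmoothNear I f (g p))
    (hg : ContMDiff I' I ∞ g) : SmoothNear I' (fun q => f (g q)) p := by
  filter_upwards [hg.continuous.continuousAt.eventually hf] with q hq
  exact ContMDiffAt.comp q hq (hg q)

theorem mvfderiv_apply_of_hasMFDerivAt {f : N → F} {p : N} {f' : TangentSpace I p →L[ℝ] F}
    (h : HasMFDerivAt I 𝓘(ℝ, F) f p f') (v : TangentSpace I p) : mvfderiv I f p v = f' v := by
  have := h.mfderiv
  simp only [mvfderiv, this]
  rfl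

theorem hasMFDerivAt_mvfderiv {f : N → F} {p : N} (h : MDifferentiableAt I 𝓘(ℝ, F) f p) :
    HasMFDerivAt I 𝓘(ℝ, F) f p (mvfderiv I f p) := h.hasMFDerivAt

theorem mvfderiv_congr {f g : N → F} {p : N} (h : f =ᶠ[𝓝 p] g) :
    mvfderiv I f p = mvfderiv I g p := by
  have := h.mfderiv_eq (I := I) (I' := 𝓘(ℝ, F))
  exact this

theorem mvfderiv_add_apply {f g : N → F} {p : N} (hf : MDifferentiableAt I 𝓘(ℝ, F) f p)
    (hg : MDifferentiableAt I 𝓘(ℝ, F) g p) (v : TangentSpace I p) :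
    mvfderiv I (fun q => f q + g q) p v = mvfderiv I f p v + mvfderiv I g p v :=
  mvfderiv_apply_of_hasMFDerivAt ((hasMFDerivAt_mvfderiv hf).add (hasMFDerivAt_mvfderiv hg)) v

theorem mvfderiv_sub_apply {f g : N → F} {p : N} (hf : MDifferentiableAt I 𝓘(ℝ, F) f p)
    (hg : MDifferentiableAt I 𝓘(ℝ, F) g p) (v : TangentSpace I p) :
    mvfderiv I (fun q => f q - g q) p v = mvfderiv I f p v - mvfderiv I g p v :=
  mvfderiv_apply_of_hasMFDerivAt ((hasMFDerivAt_mvfderiv hf).sub (hasMFDerivAt_mvfderiv hg)) v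

theorem mvfderiv_const_apply (c : F) (p : N) (v : TangentSpace I p) :
    mvfderiv I (fun _ : N => c) p v = 0 :=
  mvfderiv_apply_of_hasMFDerivAt (hasMFDerivAt_const c p) v

theorem mvfderiv_clm_apply {F' : Type*} [NormedAddCommGroup F'] [NormedSpace ℝ F'] {f : N → F}
    {p : N} (hf : MDifferentiableAt I 𝓘(ℝ, F) f p) (L : F →L[ℝ] F') (v : TangentSpace I p) :
    mvfderiv I (fun q => L (f q)) p v = L (mvfderiv I f p v) :=
  mvfderiv_apply_of_hasMFDerivAt
    (HasMFDerivAt.comp p L.hasMFDerivAt (hasMFDerivAt_mvfderiv hf)) v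

theorem mvfderiv_sum_apply {ι : Type*} {s : Finset ι} {f : ι → N → F} {p : N}
    (hf : ∀ i ∈ s, MDifferentiableAt I 𝓘(ℝ, F) (f i) p) (v : TangentSpace I p) :
    mvfderiv I (fun q => ∑ i ∈ s, f i q) p v = ∑ i ∈ s, mvfderiv I (f i) p v := by
  classical
  have hd : ∀ t ⊆ s, MDifferentiableAt I 𝓘(ℝ, F) (fun q => ∑ i ∈ t, f i q) p := by
    intro t
    induction t using Finset.induction_on with
    | empty => intro _; simpa using mdifferentiableAt_const (I := I) (I' := 𝓘(ℝ, F)) (c := (0 : F))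
    | insert a t ha ih =>
      intro hts
      simp only [Finset.sum_insert ha]
      exact (hf a (hts (by simp))).add (ih fun i hi => hts (by simp [hi]))
  have key : ∀ t ⊆ s, mvfderiv I (fun q => ∑ i ∈ t, f i q) p v = ∑ i ∈ t, mvfderiv I (f i) p v := by
    intro t
    induction t using Finset.induction_on with
    | empty => intro _; simpa using mvfderiv_const_apply (0 : F) p v
    | insert a t ha ih =>
      intro hts
      simp only [Finset.sum_insert ha]
      have h1 : t ⊆ s := fun i hi => hts (by simp [hi])
      rw [mvfderiv_add_apply (hf a (hts (by simp))) (hd t h1), ih h1]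
  exact key s subset_rfl

theorem mvfderiv_bilin_apply {F₁ F₂ : Type*} [NormedAddCommGroup F₁] [NormedSpace ℝ F₁]
    [NormedAddCommGroup F₂] [NormedSpace ℝ F₂] (B : F₁ →L[ℝ] F₂ →L[ℝ] F) {f : N → F₁} {g : N → F₂}
    {p : N} (hf : MDifferentiableAt I 𝓘(ℝ, F₁) f p) (hg : MDifferentiableAt I 𝓘(ℝ, F₂) g p)
    (v : TangentSpace I p) :
    mvfderiv I (fun q => B (f q) (g q)) p v
      = B (f p) (mvfderiv I g p v) + B (mvfderiv I f p v) (g p) := by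
  have h1 := hasMFDerivAt_mvfderiv hf
  have h2 := hasMFDerivAt_mvfderiv hg
  have h3 : HasMFDerivAt I 𝓘(ℝ, F) (fun q => B (f q) (g q)) p
      (B.precompR E (f p) (mvfderiv I g p) + B.precompL E (mvfderiv I f p) (g p)) := by
    refine ⟨(B.isBoundedBilinearMap.continuous.continuousAt (x := (f p, g p))).comp
      (f := fun q => (f q, g q)) (h1.1.prodMk h2.1), ?_⟩
    have := B.hasFDerivWithinAt_of_bilinear h1.2 h2.2
    simpa only [mfld_simps] using! this
  exact mvfderiv_apply_of_hasMFDerivAt h3 v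

theorem mvfderiv_mul_apply {A : Type*} [NormedRing A] [NormedAlgebra ℝ A] {f g : N → A} {p : N}
    (hf : MDifferentiableAt I 𝓘(ℝ, A) f p) (hg : MDifferentiableAt I 𝓘(ℝ, A) g p)
    (v : TangentSpace I p) :
    mvfderiv I (fun q => f q * g q) p v = f p * mvfderiv I g p v + mvfderiv I f p v * g p :=
  mvfderiv_bilin_apply (ContinuousLinearMap.mul ℝ A) hf hg v

theorem mvfderiv_smul_apply' {a : N → ℝ} {f : N → F} {p : N}
    (ha : MDifferentiableAt I 𝓘(ℝ, ℝ) a p) (hf : MDifferentiableAt I 𝓘(ℝ, F) f p)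
    (v : TangentSpace I p) :
    mvfderiv I (fun q => a q • f q) p v = a p • mvfderiv I f p v + mvfderiv I a p v • f p :=
  mvfderiv_bilin_apply (ContinuousLinearMap.lsmul ℝ ℝ) ha hf v

theorem mvfderiv_const_mul_apply {A : Type*} [NormedRing A] [NormedAlgebra ℝ A] {f : N → A} {p : N}
    (hf : MDifferentiableAt I 𝓘(ℝ, A) f p) (c : A) (v : TangentSpace I p) :
    mvfderiv I (fun q => c * f q) p v = c * mvfderiv I f p v :=
  mvfderiv_clm_apply hf (ContinuousLinearMap.mul ℝ A c) v

theorem mvfderiv_comp_apply' {E' : Type*} [NormedAddCommGroup E'] [NormedSpace ℝ E'] {H' : Type*}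
    [TopologicalSpace H'] {I' : ModelWithCorners ℝ E' H'} {N' : Type*} [TopologicalSpace N']
    [ChartedSpace H' N'] {f : N → F} {g : N' → N} {p : N'}
    (hf : MDifferentiableAt I 𝓘(ℝ, F) f (g p)) (hg : MDifferentiableAt I' I g p)
    (v : TangentSpace I' p) :
    mvfderiv I' (fun q => f (g q)) p v = mvfderiv I f (g p) (mfderiv I' I g p v) :=
  mvfderiv_apply_of_hasMFDerivAt
    (HasMFDerivAt.comp p (hasMFDerivAt_mvfderiv hf) hg.hasMFDerivAt) v

/-- A function that is smooth near `p` agrees near `p` with a globally smooth function. -/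
theorem SmoothNear.exists_bump [FiniteDimensional ℝ E] [T2Space N] [IsManifold I ∞ N]
    {s : Set N} {p : N} (hs : s ∈ 𝓝 p) :
    ∃ ψ : N → ℝ, ContMDiff I 𝓘(ℝ, ℝ) ∞ ψ ∧ (∀ᶠ q in 𝓝 p, ψ q = 1) ∧ tsupport ψ ⊆ s := by
  obtain ⟨f, -, hf⟩ := (SmoothBumpFunction.nhds_basis_tsupport (I := I) p).mem_iff.1 hs
  exact ⟨f, f.contMDiff, f.eventuallyEq_one, hf⟩

theorem contMDiff_smul_of_tsupport {ψ : N → ℝ} {f : N → F} {s : Set N}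
    (hψ : ContMDiff I 𝓘(ℝ, ℝ) ∞ ψ) (hs : tsupport ψ ⊆ s)
    (hf : ∀ q ∈ s, ContMDiffAt I 𝓘(ℝ, F) ∞ f q) :
    ContMDiff I 𝓘(ℝ, F) ∞ fun q => ψ q • f q := by
  intro q
  by_cases hq : q ∈ tsupport ψ
  · exact (hψ q).smul (hf q (hs hq))
  · have : (fun q => ψ q • f q) =ᶠ[𝓝 q] fun _ => 0 := by
      filter_upwards [(isClosed_tsupport ψ).isOpen_compl.mem_nhds hq] with r hr
      rw [image_eq_zero_of_notMem_tsupport hr, zero_smul]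
    exact contMDiffAt_const.congr_of_eventuallyEq this

theorem SmoothNear.exists_extension [FiniteDimensional ℝ E] [T2Space N] [IsManifold I ∞ N]
    {f : N → F} {p : N} (h : SmoothNear I f p) :
    ∃ g : N → F, ContMDiff I 𝓘(ℝ, F) ∞ g ∧ g =ᶠ[𝓝 p] f := by
  obtain ⟨ψ, hψ, h1, hs⟩ := SmoothNear.exists_bump (I := I) h
  refine ⟨fun q => ψ q • f q, contMDiff_smul_of_tsupport hψ hs fun q hq => hq, ?_⟩
  filter_upwards [h1] with q hq
  simp [hq]

/-- The derivative along a field is the tangent map of f composed with the field, followed by the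
projection of the trivial bundle TF to its fibre. -/
theorem contMDiff_mvfderiv_apply [IsManifold I ∞ N] {f : N → F}
    (hf : ContMDiff I 𝓘(ℝ, F) ∞ f) {Z : ∀ p : N, TangentSpace I p}
    (hZ : ContMDiff I I.tangent ∞ fun p => (⟨p, Z p⟩ : TangentBundle I N)) :
    ContMDiff I 𝓘(ℝ, F) ∞ fun p => mvfderiv I f p (Z p) := by
  have : IsManifold I 1 N := IsManifold.of_le (n := ∞) (by simp)
  have h1 : ContMDiff I.tangent 𝓘(ℝ, F).tangent ∞ (tangentMap I 𝓘(ℝ, F) f) :=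
    hf.contMDiff_tangentMap (by simp)
  exact (contMDiff_snd_tangentBundle_modelSpace F 𝓘(ℝ, F)).comp (h1.comp hZ)

/-- A derivative at q depends only on the germ of f at q, so f may be replaced by a globally smooth
function. -/
theorem SmoothNear.mvfderiv [FiniteDimensional ℝ E] [T2Space N] [IsManifold I ∞ N] {f : N → F}
    {p : N} (hf : SmoothNear I f p) {Z : ∀ p : N, TangentSpace I p}
    (hZ : ContMDiff I I.tangent ∞ fun p => (⟨p, Z p⟩ : TangentBundle I N)) :
    SmoothNear I (fun q => mvfderiv I f q (Z q)) p := by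
  obtain ⟨g, hg, hgf⟩ := hf.exists_extension
  refine (smoothNear_of_contMDiff (contMDiff_mvfderiv_apply hg hZ) p).congr ?_
  filter_upwards [hgf.eventuallyEq_nhds] with q hq
  rw [mvfderiv_congr hq]

/-! ### Lie brackets as commutators of derivations -/

section Bracket

variable [I.Boundaryless] [FiniteDimensional ℝ E] [IsManifold I ∞ N]

variable (I) in
/-- A vector field, read in the chart at `p`. -/
def chartField (p : N) (Z : ∀ p : N, TangentSpace I p) (z : E) : E :=
  VectorField.mpullbackWithin 𝓘(ℝ, E) I (extChartAt I p).symm Z (Set.range I) z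

/-- The Lie bracket of vector fields is the commutator of derivations. -/
theorem mvfderiv_commutator [T2Space N] {f : N → F} {p : N} (hf : SmoothNear I f p)
    {X Y : ∀ p : N, TangentSpace I p}
    (hX : ContMDiff I I.tangent ∞ fun p => (⟨p, X p⟩ : TangentBundle I N))
    (hY : ContMDiff I I.tangent ∞ fun p => (⟨p, Y p⟩ : TangentBundle I N)) :
    mvfderiv I (fun q => mvfderiv I f q (Y q)) p (X p)
      - mvfderiv I (fun q => mvfderiv I f q (X q)) p (Y p)
      = mvfderiv I f p (VectorField.mlieBracket I X Y p) := by
  have : IsManifold I 1 N := IsManifold.of_le (n := ∞) (by simp)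
  have : CompleteSpace E := FiniteDimensional.complete ℝ E
  set φ := extChartAt I p with hφ
  have hrange : Set.range I = Set.univ := I.range_eq_univ
  have htgt : φ.target ∈ 𝓝 (φ p) := extChartAt_target_mem_nhds p
  have hsrc : φ.source ∈ 𝓝 p := extChartAt_source_mem_nhds p
  set Fh : E → F := fun z => f (φ.symm z) with hFh
  set Xh : E → E := chartField I p X
  set Yh : E → E := chartField I p Y
  have hsymm : ∀ z ∈ φ.target, MDifferentiableAt 𝓘(ℝ, E) I φ.symm z := by
    intro z hz
    have := (contMDiffOn_extChartAt_symm (I := I) (n := 1) p).contMDiffAt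
      ((isOpen_extChartAt_target p).mem_nhds hz)
    exact this.mdifferentiableAt (by simp)
  have hinv : ∀ (Z : ∀ p : N, TangentSpace I p), ∀ z ∈ φ.target,
      mfderiv 𝓘(ℝ, E) I φ.symm z (id (α := E) (chartField I p Z z)) = Z (φ.symm z) := by
    intro Z z hz
    have hi := isInvertible_mfderivWithin_extChartAt_symm (I := I) hz
    rw [hrange, mfderivWithin_univ] at hi
    have h1 : chartField I p Z z = (mfderiv 𝓘(ℝ, E) I φ.symm z).inverse (Z (φ.symm z)) := by
      rw [chartField, VectorField.mpullbackWithin_apply, hrange, mfderivWithin_univ]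
    rw [id, h1]
    exact hi.self_apply_inverse _
  have hp : φ.symm (φ p) = p := extChartAt_to_inv p
  have hpt : φ p ∈ φ.target := mem_extChartAt_target p
  have hchart : ∀ {g : N → F} {z : E}, z ∈ φ.target → MDifferentiableAt I 𝓘(ℝ, F) g (φ.symm z) →
      ∀ w : E, fderiv ℝ (fun z => g (φ.symm z)) z w
        = mvfderiv I g (φ.symm z) (mfderiv 𝓘(ℝ, E) I φ.symm z w) := by
    intro g z hz hg w
    rw [← mvfderiv_comp_apply' hg (hsymm z hz) w, mvfderiv, mfderiv_eq_fderiv]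
    rfl
  have htend : Filter.Tendsto φ.symm (𝓝 (φ p)) (𝓝 p) := by
    have := continuousAt_extChartAt_symm (I := I) p
    rwa [ContinuousAt, extChartAt_to_inv] at this
  have hnear : ∀ᶠ z in 𝓝 (φ p), z ∈ φ.target ∧ SmoothNear I f (φ.symm z) :=
    (Filter.eventually_mem_set.2 htgt).and (htend.eventually hf.eventually)
  have hFY : ∀ (Z : ∀ p : N, TangentSpace I p), ∀ᶠ z in 𝓝 (φ p),
      mvfderiv I f (φ.symm z) (Z (φ.symm z)) = fderiv ℝ Fh z
        (chartField I p Z z) := by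
    intro Z
    filter_upwards [hnear] with z hz
    have h1 := hchart hz.1 hz.2.mdiff (chartField I p Z z)
    have h2 := hinv Z z hz.1
    rw [id] at h2
    rw [h2] at h1
    exact h1.symm
  have hF2 : ContDiffAt ℝ 2 Fh (φ p) := by
    have h1 : ContMDiffAt 𝓘(ℝ, E) I 2 φ.symm (φ p) :=
      (contMDiffOn_extChartAt_symm (I := I) (n := 2) p).contMDiffAt
        ((isOpen_extChartAt_target p).mem_nhds hpt)
    have h2 : ContMDiffAt I 𝓘(ℝ, F) 2 f (φ.symm (φ p)) := by
      rw [hp]; exact hf.contMDiffAt.of_le (by norm_cast)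
    exact (h2.comp (φ p) h1).contDiffAt
  have hdiffF : DifferentiableAt ℝ (fderiv ℝ Fh) (φ p) :=
    (hF2.fderiv_right (m := 1) (by norm_num)).differentiableAt (by simp)
  have hdiffV : ∀ {Z : ∀ p : N, TangentSpace I p},
      ContMDiff I I.tangent ∞ (fun p => (⟨p, Z p⟩ : TangentBundle I N)) →
      DifferentiableAt ℝ
        (fun z => (chartField I p Z z)) (φ p) := by
    intro Z hZ
    have h1 : MDifferentiableWithinAt I I.tangent (fun x => (⟨x, Z x⟩ : TangentBundle I N))
        Set.univ p := ((hZ p).mdifferentiableAt (by simp)).mdifferentiableWithinAt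
    have h2 := h1.differentiableWithinAt_mpullbackWithin_vectorField
    have h3 : DifferentiableWithinAt ℝ (chartField I p Z) Set.univ (φ p) := by
      have h4 : (φ.symm ⁻¹' Set.univ ∩ Set.range I) = Set.univ := by simp [hrange]
      rw [← h4]
      exact h2
    exact differentiableWithinAt_univ.1 h3
  -- In the chart, a second derivative is the Hessian of `Fh` on the two fields plus the derivative
  -- of `Fh` along the derivative of the inner field. The Hessian is symmetric and drops out of the
  -- commutator; the other parts make up the bracket.
  have hsecond : ∀ {Z W : ∀ p : N, TangentSpace I p},
      ContMDiff I I.tangent ∞ (fun p => (⟨p, Z p⟩ : TangentBundle I N)) →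
      ContMDiff I I.tangent ∞ (fun p => (⟨p, W p⟩ : TangentBundle I N)) →
      mvfderiv I (fun q => mvfderiv I f q (W q)) p (Z p)
        = fderiv ℝ (fderiv ℝ Fh) (φ p)
            (chartField I p Z (φ p))
            (chartField I p W (φ p))
          + fderiv ℝ Fh (φ p) (fderiv ℝ
            (fun z => (chartField I p W z)) (φ p)
            (chartField I p Z (φ p))) := by
    intro Z W hZ hW
    have hg : MDifferentiableAt I 𝓘(ℝ, F) (fun q => mvfderiv I f q (W q)) (φ.symm (φ p)) := by
      rw [hp]; exact (hf.mvfderiv hW).mdiff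
    have h1 := hchart hpt hg
      (chartField I p Z (φ p))
    have h0 := hinv Z _ hpt
    rw [id] at h0
    rw [h0] at h1
    have h2 : mvfderiv I (fun q => mvfderiv I f q (W q)) (φ.symm (φ p)) (Z (φ.symm (φ p)))
        = mvfderiv I (fun q => mvfderiv I f q (W q)) p (Z p) := by rw [hp]
    rw [← h2, ← h1, Filter.EventuallyEq.fderiv_eq (hFY W),
      fderiv_clm_apply hdiffF (hdiffV hW)]
    exact add_comm _ _
  have hbr : mvfderiv I f p (VectorField.mlieBracket I X Y p)
      = fderiv ℝ Fh (φ p) (fderiv ℝ Yh (φ p) (Xh (φ p)) - fderiv ℝ Xh (φ p) (Yh (φ p))) := by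
    set b : E := fderiv ℝ Yh (φ p) (Xh (φ p)) - fderiv ℝ Xh (φ p) (Yh (φ p)) with hb
    have h0 : VectorField.mlieBracket I X Y p = (mfderiv I 𝓘(ℝ, E) φ p).inverse b := by
      rw [← VectorField.mlieBracketWithin_univ, VectorField.mlieBracketWithin_apply]
      have h4 : (φ.symm ⁻¹' Set.univ ∩ Set.range I) = Set.univ := by simp [hrange]
      have h5 : VectorField.lieBracketWithin ℝ Xh Yh Set.univ (φ p) = b := by
        rw [VectorField.lieBracketWithin_univ]; rfl
      rw [h4]
      exact congrArg (mfderiv I 𝓘(ℝ, E) φ p).inverse h5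
    have h1 := isInvertible_mfderiv_extChartAt (I := I) (mem_extChartAt_source (I := I) p)
    have hpf : MDifferentiableAt I 𝓘(ℝ, F) f (φ.symm (φ p)) := by rw [hp]; exact hf.mdiff
    have h2 := hchart hpt hpf b
    -- The bracket is transported by the inverse of the differential of the chart, whereas `hchart`
    -- uses the differential of the inverse chart; the two agree at p.
    have h3 : mfderiv 𝓘(ℝ, E) I φ.symm (φ p) b = (mfderiv I 𝓘(ℝ, E) φ p).inverse b := by
      have h5 := mfderivWithin_extChartAt_symm_comp_mfderiv_extChartAt'
        (I := I) (mem_extChartAt_source (I := I) p)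
      rw [hrange, mfderivWithin_univ] at h5
      have h6 := DFunLike.congr_fun h5 ((mfderiv I 𝓘(ℝ, E) φ p).inverse b)
      have h7 : mfderiv I 𝓘(ℝ, E) φ p ((mfderiv I 𝓘(ℝ, E) φ p).inverse b) = b :=
        h1.self_apply_inverse b
      rw [ContinuousLinearMap.comp_apply, h7] at h6
      exact h6
    rw [h3] at h2
    rw [h0, h2, hp]
  rw [hsecond hX hY, hsecond hY hX, hbr, map_sub]
  have hs := hF2.isSymmSndFDerivAt (by simp)
  rw [hs.eq (Xh (φ p)) (Yh (φ p))]
  abel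

end Bracket

end Calculus

end

/-! ### Products of manifolds -/

section

section Product

variable {m n : ℕ}
  {U : Type*} [TopologicalSpace U] [ChartedSpace (EuclideanSpace ℝ (Fin m)) U]
  {M : Type*} [TopologicalSpace M] [ChartedSpace (EuclideanSpace ℝ (Fin (2 * n))) M]
  {F : Type*} [NormedAddCommGroup F] [NormedSpace ℝ F]

theorem tPair_add {p : U × M} (X : TangentSpace (𝓡 m) p.1) (v : TangentSpace (𝓡 (2 * n)) p.2) :
    tPair X v = tPair X 0 + tPair 0 v :=
  Prod.ext (add_zero X).symm (zero_add v).symm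

theorem mvfderiv_tPair (f : U × M → F) (p : U × M) (X : TangentSpace (𝓡 m) p.1)
    (v : TangentSpace (𝓡 (2 * n)) p.2) :
    mvfderiv ((𝓡 m).prod (𝓡 (2 * n))) f p (tPair X v)
      = mvfderiv ((𝓡 m).prod (𝓡 (2 * n))) f p (tPair X 0)
        + mvfderiv ((𝓡 m).prod (𝓡 (2 * n))) f p (tPair 0 v) := by
  rw [tPair_add, map_add]

theorem mvfderiv_tPair_left {f : U × M → F} {p : U × M}
    (hf : MDifferentiableAt ((𝓡 m).prod (𝓡 (2 * n))) 𝓘(ℝ, F) f p) (X : TangentSpace (𝓡 m) p.1) :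
    mvfderiv ((𝓡 m).prod (𝓡 (2 * n))) f p (tPair X 0)
      = mvfderiv (𝓡 m) (fun u => f (u, p.2)) p.1 X := by
  have hg : MDifferentiableAt (𝓡 m) ((𝓡 m).prod (𝓡 (2 * n))) (fun u : U => (u, p.2)) p.1 :=
    mdifferentiableAt_id.prodMk mdifferentiableAt_const
  rw [mvfderiv_comp_apply' (g := fun u : U => (u, p.2)) hf hg, mfderiv_prod_left]
  rfl

theorem mvfderiv_tPair_right {f : U × M → F} {p : U × M}
    (hf : MDifferentiableAt ((𝓡 m).prod (𝓡 (2 * n))) 𝓘(ℝ, F) f p)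
    (v : TangentSpace (𝓡 (2 * n)) p.2) :
    mvfderiv ((𝓡 m).prod (𝓡 (2 * n))) f p (tPair 0 v)
      = mvfderiv (𝓡 (2 * n)) (fun x => f (p.1, x)) p.2 v := by
  have hg : MDifferentiableAt (𝓡 (2 * n)) ((𝓡 m).prod (𝓡 (2 * n))) (fun x : M => (p.1, x)) p.2 :=
    mdifferentiableAt_const.prodMk mdifferentiableAt_id
  rw [mvfderiv_comp_apply' (g := fun x : M => (p.1, x)) hf hg, mfderiv_prod_right]
  rfl

theorem mvfderiv_comp_fst {g : U → F} {p : U × M}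
    (hg : MDifferentiableAt (𝓡 m) 𝓘(ℝ, F) g p.1) (X : TangentSpace (𝓡 m) p.1)
    (v : TangentSpace (𝓡 (2 * n)) p.2) :
    mvfderiv ((𝓡 m).prod (𝓡 (2 * n))) (fun q : U × M => g q.1) p (tPair X v)
      = mvfderiv (𝓡 m) g p.1 X := by
  rw [mvfderiv_comp_apply' (g := fun q : U × M => q.1) hg mdifferentiableAt_fst, mfderiv_fst]
  rfl

theorem mvfderiv_comp_snd {g : M → F} {p : U × M}
    (hg : MDifferentiableAt (𝓡 (2 * n)) 𝓘(ℝ, F) g p.2) (X : TangentSpace (𝓡 m) p.1)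
    (v : TangentSpace (𝓡 (2 * n)) p.2) :
    mvfderiv ((𝓡 m).prod (𝓡 (2 * n))) (fun q : U × M => g q.2) p (tPair X v)
      = mvfderiv (𝓡 (2 * n)) g p.2 v := by
  rw [mvfderiv_comp_apply' (g := fun q : U × M => q.2) hg mdifferentiableAt_snd, mfderiv_snd]
  rfl

theorem SmoothNear.slice_left {f : U × M → F} {p : U × M}
    (hf : SmoothNear ((𝓡 m).prod (𝓡 (2 * n))) f p) :
    SmoothNear (𝓡 m) (fun u => f (u, p.2)) p.1 :=
  SmoothNear.comp (g := fun u : U => (u, p.2)) hf (contMDiff_id.prodMk contMDiff_const)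

theorem SmoothNear.slice_right {f : U × M → F} {p : U × M}
    (hf : SmoothNear ((𝓡 m).prod (𝓡 (2 * n))) f p) :
    SmoothNear (𝓡 (2 * n)) (fun x => f (p.1, x)) p.2 :=
  SmoothNear.comp (g := fun x : M => (p.1, x)) hf (contMDiff_const.prodMk contMDiff_id)

variable [IsManifold (𝓡 m) ∞ U] [IsManifold (𝓡 (2 * n)) ∞ M]

theorem contMDiff_tPair_left {X : ∀ u : U, TangentSpace (𝓡 m) u} (hX : IsSmoothVF X) :
    ContMDiff ((𝓡 m).prod (𝓡 (2 * n))) ((𝓡 m).prod (𝓡 (2 * n))).tangent ∞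
      fun p : U × M => (⟨p, tPair (X p.1) 0⟩ : TangentBundle ((𝓡 m).prod (𝓡 (2 * n))) (U × M)) := by
  have h1 : ContMDiff ((𝓡 m).prod (𝓡 (2 * n))) (𝓡 (2 * n)).tangent ∞
      fun p : U × M => (⟨p.2, 0⟩ : TangentBundle (𝓡 (2 * n)) M) :=
    (contMDiff_zeroSection ℝ (TangentSpace (𝓡 (2 * n)) (M := M))).comp contMDiff_snd
  exact (contMDiff_equivTangentBundleProd_symm (I := 𝓡 m) (I' := 𝓡 (2 * n)) (n := ∞)).comp
    ((hX.comp contMDiff_fst).prodMk h1)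

theorem contMDiff_tPair_right {V : ∀ x : M, TangentSpace (𝓡 (2 * n)) x} (hV : IsSmoothVF V) :
    ContMDiff ((𝓡 m).prod (𝓡 (2 * n))) ((𝓡 m).prod (𝓡 (2 * n))).tangent ∞
      fun p : U × M => (⟨p, tPair 0 (V p.2)⟩ : TangentBundle ((𝓡 m).prod (𝓡 (2 * n))) (U × M)) := by
  have h1 : ContMDiff ((𝓡 m).prod (𝓡 (2 * n))) (𝓡 m).tangent ∞
      fun p : U × M => (⟨p.1, 0⟩ : TangentBundle (𝓡 m) U) :=
    (contMDiff_zeroSection ℝ (TangentSpace (𝓡 m) (M := U))).comp contMDiff_fst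
  exact (contMDiff_equivTangentBundleProd_symm (I := 𝓡 m) (I' := 𝓡 (2 * n)) (n := ∞)).comp
    (h1.prodMk (hV.comp contMDiff_snd))

variable [T2Space U] [T2Space M]

/-- Commutation of the derivatives in the directions of the two factors. -/
theorem mvfderiv_tPair_comm {f : U × M → F} {p : U × M}
    (hf : SmoothNear ((𝓡 m).prod (𝓡 (2 * n))) f p)
    {X : ∀ u : U, TangentSpace (𝓡 m) u} (hX : IsSmoothVF X)
    {V : ∀ x : M, TangentSpace (𝓡 (2 * n)) x} (hV : IsSmoothVF V) :
    mvfderiv ((𝓡 m).prod (𝓡 (2 * n)))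
        (fun q => mvfderiv ((𝓡 m).prod (𝓡 (2 * n))) f q (tPair 0 (V q.2))) p (tPair (X p.1) 0)
      = mvfderiv ((𝓡 m).prod (𝓡 (2 * n)))
        (fun q => mvfderiv ((𝓡 m).prod (𝓡 (2 * n))) f q (tPair (X q.1) 0)) p
          (tPair 0 (V p.2)) := by
  have hXl := contMDiff_tPair_left (M := M) (n := n) hX
  have hVl := contMDiff_tPair_right (U := U) (m := m) hV
  set B := VectorField.mlieBracket ((𝓡 m).prod (𝓡 (2 * n)))
    (fun p : U × M => tPair (X p.1) 0) (fun p : U × M => tPair 0 (V p.2)) p with hB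
  have hB1 : B = tPair (B.1 : EuclideanSpace ℝ (Fin m)) (B.2 : EuclideanSpace ℝ (Fin (2 * n))) := rfl
  -- The bracket acts as a derivation on the chart of U, seen as a function of the first variable.
  -- Its derivative along V vanishes, and its derivative along X depends on u only, so V kills it
  -- too. The differential of a chart being injective, the bracket has no component along U. The
  -- component along M is treated in the same way.
  have hfst : (B.1 : EuclideanSpace ℝ (Fin m)) = 0 := by
    have hs : SmoothNear (𝓡 m) (extChartAt (𝓡 m) p.1) p.1 :=
      smoothNear_of_contMDiffOn (s := (chartAt (EuclideanSpace ℝ (Fin m)) p.1).source)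
        contMDiffOn_extChartAt (chartAt _ p.1).open_source (mem_chart_source _ p.1)
    have hf1 : SmoothNear ((𝓡 m).prod (𝓡 (2 * n)))
      (fun q : U × M => extChartAt (𝓡 m) p.1 q.1) p := SmoothNear.comp hs contMDiff_fst
    have h1 := mvfderiv_commutator hf1 hXl hVl
    have e1 := (continuous_fst.continuousAt (x := p)).eventually hs.eventually
    rw [mvfderiv_congr (g := fun _ => (0 : EuclideanSpace ℝ (Fin m))) (by
        filter_upwards [e1] with q hq
        rw [mvfderiv_comp_fst hq.mdiff, map_zero]), mvfderiv_const_apply,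
      mvfderiv_congr (g := fun q : U × M => mvfderiv (𝓡 m) (extChartAt (𝓡 m) p.1) q.1 (X q.1)) (by
        filter_upwards [e1] with q hq
        rw [mvfderiv_comp_fst hq.mdiff]),
      mvfderiv_comp_fst (g := fun u => mvfderiv (𝓡 m) (extChartAt (𝓡 m) p.1) u (X u))
        (hs.mvfderiv hX).mdiff, map_zero, ← hB, sub_zero] at h1
    replace h1 := h1.trans (mvfderiv_comp_fst (g := extChartAt (𝓡 m) p.1) hs.mdiff B.1 B.2)
    exact (isInvertible_mfderiv_extChartAt (I := 𝓡 m) (mem_extChartAt_source p.1)).injective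
      (h1.symm.trans (map_zero _).symm)
  have hsnd : (B.2 : EuclideanSpace ℝ (Fin (2 * n))) = 0 := by
    have hs : SmoothNear (𝓡 (2 * n)) (extChartAt (𝓡 (2 * n)) p.2) p.2 :=
      smoothNear_of_contMDiffOn (s := (chartAt (EuclideanSpace ℝ (Fin (2 * n))) p.2).source)
        contMDiffOn_extChartAt (chartAt _ p.2).open_source (mem_chart_source _ p.2)
    have hf1 : SmoothNear ((𝓡 m).prod (𝓡 (2 * n)))
      (fun q : U × M => extChartAt (𝓡 (2 * n)) p.2 q.2) p := SmoothNear.comp hs contMDiff_snd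
    have h1 := mvfderiv_commutator hf1 hXl hVl
    have e1 := (continuous_snd.continuousAt (x := p)).eventually hs.eventually
    rw [mvfderiv_congr (p := p) (f := fun q : U × M => mvfderiv ((𝓡 m).prod (𝓡 (2 * n)))
          (fun q : U × M => extChartAt (𝓡 (2 * n)) p.2 q.2) q (tPair (X q.1) 0))
        (g := fun _ => (0 : EuclideanSpace ℝ (Fin (2 * n)))) (by
        filter_upwards [e1] with q hq
        rw [mvfderiv_comp_snd hq.mdiff, map_zero]), mvfderiv_const_apply,
      mvfderiv_congr (p := p) (f := fun q : U × M => mvfderiv ((𝓡 m).prod (𝓡 (2 * n)))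
          (fun q : U × M => extChartAt (𝓡 (2 * n)) p.2 q.2) q (tPair 0 (V q.2)))
        (g := fun q : U × M =>
          mvfderiv (𝓡 (2 * n)) (extChartAt (𝓡 (2 * n)) p.2) q.2 (V q.2)) (by
        filter_upwards [e1] with q hq
        rw [mvfderiv_comp_snd hq.mdiff]),
      mvfderiv_comp_snd (g := fun x => mvfderiv (𝓡 (2 * n)) (extChartAt (𝓡 (2 * n)) p.2) x (V x))
        (hs.mvfderiv hV).mdiff, map_zero, ← hB, sub_zero] at h1
    replace h1 := h1.trans (mvfderiv_comp_snd (g := extChartAt (𝓡 (2 * n)) p.2) hs.mdiff B.1 B.2)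
    exact (isInvertible_mfderiv_extChartAt (I := 𝓡 (2 * n)) (mem_extChartAt_source p.2)).injective
      (h1.symm.trans (map_zero _).symm)
  have hB0 : B = 0 := by rw [hB1, hfst, hsnd]; rfl
  have := mvfderiv_commutator hf hXl hVl
  rw [← hB, hB0, map_zero] at this
  exact sub_eq_zero.1 this

end Product

end

/-! ### Finite overcomplete frames of the tangent bundle -/

section

section Frame

variable (d : ℕ) (N : Type*) [TopologicalSpace N] [ChartedSpace (EuclideanSpace ℝ (Fin d)) N]
  [IsManifold (𝓡 d) ∞ N]

/-- A finite family of smooth vector fields `V_a` and of smooth one-forms `lam_a` such that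
`v = ∑ lam_a(v) V_a` for all tangent vectors `v`. -/
structure TFrame where
  /-- the number of vector fields -/
  card : ℕ
  /-- the vector fields -/
  V : Fin card → ∀ x : N, TangentSpace (𝓡 d) x
  /-- the one-forms -/
  lam : Fin card → ∀ x : N, TangentSpace (𝓡 d) x →ₗ[ℝ] ℝ
  V_smooth : ∀ a, IsSmoothVF (V a)
  lam_smooth : ∀ a, ContMDiff (𝓡 d).tangent 𝓘(ℝ, ℝ) ∞
    fun v : TangentBundle (𝓡 d) N => lam a v.1 v.2
  sum_eq : ∀ x v, ∑ a, lam a x v • V a x = v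

variable {d N}

/-- The one-forms of the frame near one point, before normalization. -/
def bumpForm {x₀ : N} (ρ : SmoothBumpFunction (𝓡 d) x₀) (b : Fin d) (x : N) :
    TangentSpace (𝓡 d) x →ₗ[ℝ] ℝ :=
  ρ x • ((EuclideanSpace.proj b : EuclideanSpace ℝ (Fin d) →L[ℝ] ℝ).toLinearMap ∘ₗ
    (trivializationAt (EuclideanSpace ℝ (Fin d)) (TangentSpace (𝓡 d)) x₀).linearMapAt ℝ x)

/-- The vector fields of the frame near one point. -/
def bumpField {x₀ : N} (ρ : SmoothBumpFunction (𝓡 d) x₀) (b : Fin d) (x : N) :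
    TangentSpace (𝓡 d) x :=
  ρ x • (trivializationAt (EuclideanSpace ℝ (Fin d)) (TangentSpace (𝓡 d)) x₀).symmₗ ℝ x
    (EuclideanSpace.single b (1 : ℝ))

theorem bumpField_smooth [T2Space N] {x₀ : N} (ρ : SmoothBumpFunction (𝓡 d) x₀) (b : Fin d) :
    IsSmoothVF (bumpField ρ b) := by
  set e := trivializationAt (EuclideanSpace ℝ (Fin d)) (TangentSpace (𝓡 d)) x₀ with he
  intro x
  by_cases hx : x ∈ e.baseSet
  · have h1 := (e.contMDiffOn_localFrame_baseSet (I := 𝓡 d) ∞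
      (EuclideanSpace.basisFun (Fin d) ℝ).toBasis b).contMDiffAt (e.open_baseSet.mem_nhds hx)
    have h2 : ContMDiffAt (𝓡 d) (𝓡 d).tangent ∞
        (fun x => (⟨x, ρ x • e.localFrame (EuclideanSpace.basisFun (Fin d) ℝ).toBasis b x⟩ :
          TangentBundle (𝓡 d) N)) x := (ρ.contMDiff x).smul_section h1
    refine h2.congr_of_eventuallyEq ?_
    filter_upwards [e.open_baseSet.mem_nhds hx] with y hy
    rw [e.localFrame_apply_of_mem_baseSet _ hy]
    have h3 := e.symmₗ_apply (R := ℝ) hy (EuclideanSpace.single b (1 : ℝ))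
    simp only [bumpField, Trivialization.basisAt, Module.Basis.map_apply,
      OrthonormalBasis.coe_toBasis, EuclideanSpace.basisFun_apply]
    exact congrArg (fun w => (⟨y, ρ y • w⟩ : TangentBundle (𝓡 d) N)) h3
  · have h3 : x ∉ tsupport ρ := fun h => hx (by
      have := ρ.tsupport_subset_chartAt_source h
      simpa [he] using this)
    have h4 : ContMDiffAt (𝓡 d) (𝓡 d).tangent ∞
      (fun x => (⟨x, 0⟩ : TangentBundle (𝓡 d) N)) x :=
      (contMDiff_zeroSection ℝ (TangentSpace (𝓡 d) (M := N))) x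
    refine h4.congr_of_eventuallyEq ?_
    filter_upwards [(isClosed_tsupport ρ).isOpen_compl.mem_nhds h3] with y hy
    rw [bumpField, image_eq_zero_of_notMem_tsupport hy, zero_smul]

theorem bumpForm_smooth [T2Space N] {x₀ : N} (ρ : SmoothBumpFunction (𝓡 d) x₀) (b : Fin d) :
    ContMDiff (𝓡 d).tangent 𝓘(ℝ, ℝ) ∞ fun v : TangentBundle (𝓡 d) N => bumpForm ρ b v.1 v.2 := by
  set e := trivializationAt (EuclideanSpace ℝ (Fin d)) (TangentSpace (𝓡 d)) x₀ with he
  have hproj : Continuous (fun v : TangentBundle (𝓡 d) N => v.1) :=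
    FiberBundle.continuous_proj (EuclideanSpace ℝ (Fin d)) (TangentSpace (𝓡 d))
  intro v
  by_cases hx : v.1 ∈ e.baseSet
  · have h1 : ContMDiffAt (𝓡 d).tangent ((𝓡 d).prod 𝓘(ℝ, EuclideanSpace ℝ (Fin d))) ∞ e v :=
      (e.contMDiffOn (IB := 𝓡 d) (n := ∞)).contMDiffAt (e.open_source.mem_nhds (by
        rwa [e.mem_source]))
    have h2 : ContMDiffAt (𝓡 d).tangent 𝓘(ℝ, ℝ) ∞
        (fun v : TangentBundle (𝓡 d) N => ρ v.1 * (EuclideanSpace.proj b :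
          EuclideanSpace ℝ (Fin d) →L[ℝ] ℝ) (e v).2) v := by
      refine ContMDiffAt.mul (ρ.contMDiff.contMDiffAt.comp v (contMDiff_proj _ v)) ?_
      exact (ContinuousLinearMap.contMDiff _).contMDiffAt.comp v
        (contMDiffAt_snd.comp v h1)
    refine h2.congr_of_eventuallyEq ?_
    filter_upwards [hproj.continuousAt.eventually (e.open_baseSet.mem_nhds hx)] with w hw
    simp only [bumpForm, ← he, LinearMap.smul_apply, LinearMap.comp_apply, smul_eq_mul]
    rw [e.coe_linearMapAt_of_mem hw]
    rfl
  · have h3 : v.1 ∉ tsupport ρ := fun h => hx (by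
      have := ρ.tsupport_subset_chartAt_source h
      simpa [he] using this)
    refine (contMDiffAt_const (c := (0 : ℝ))).congr_of_eventuallyEq ?_
    filter_upwards [hproj.continuousAt.eventually
      ((isClosed_tsupport ρ).isOpen_compl.mem_nhds h3)] with w hw
    rw [bumpForm, image_eq_zero_of_notMem_tsupport hw, zero_smul]
    rfl

theorem sum_bumpForm_smul_bumpField [T2Space N] {x₀ : N} (ρ : SmoothBumpFunction (𝓡 d) x₀)
    (x : N) (v : TangentSpace (𝓡 d) x) :
    ∑ b, bumpForm ρ b x v • bumpField ρ b x = (ρ x * ρ x) • v := by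
  set e := trivializationAt (EuclideanSpace ℝ (Fin d)) (TangentSpace (𝓡 d)) x₀ with he
  by_cases hx : x ∈ e.baseSet
  · have h1 : ∀ b, bumpForm ρ b x v • bumpField ρ b x = (ρ x * ρ x) • e.symmₗ ℝ x
        ((e.linearMapAt ℝ x v) b • EuclideanSpace.single b (1 : ℝ)) := by
      intro b
      rw [map_smul, smul_smul]
      change (ρ x * (e.linearMapAt ℝ x v) b) • ρ x • e.symmₗ ℝ x
        (EuclideanSpace.single b (1 : ℝ)) = _
      rw [smul_smul]
      congr 1
      ring
    rw [Finset.sum_congr rfl fun b _ => h1 b, ← Finset.smul_sum, ← map_sum]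
    congr 1
    have h2 : ∑ b, (e.linearMapAt ℝ x v) b • EuclideanSpace.single b (1 : ℝ)
        = e.linearMapAt ℝ x v := by
      have := (EuclideanSpace.basisFun (Fin d) ℝ).sum_repr (e.linearMapAt ℝ x v)
      simpa using this
    rw [h2]
    exact e.symmₗ_linearMapAt hx v
  · have h3 : x ∉ tsupport ρ := fun h => hx (by
      have := ρ.tsupport_subset_chartAt_source h
      simpa [he] using this)
    simp [bumpForm, image_eq_zero_of_notMem_tsupport h3]

-- By compactness, finitely many bump functions have supports covering the manifold. Each local
-- frame is cut off by its bump ρ, once in the fields and once in the forms, so that it reproduces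
-- ρ² times the identity; the forms are then divided by the sum of the ρ², which vanishes nowhere.
variable (d N) in
theorem TFrame.exists [T2Space N] [CompactSpace N] : Nonempty (TFrame d N) := by
  classical
  have hne : ∀ x : N, ∃ _ : SmoothBumpFunction (𝓡 d) x, True := fun x =>
    ((SmoothBumpFunction.nhds_basis_tsupport (I := 𝓡 d) x).ex_mem).imp fun _ _ => trivial
  choose ρ _ using hne
  obtain ⟨t, ht⟩ := CompactSpace.elim_nhds_subcover (fun x => Function.support (ρ x))
    fun x => (ρ x).support_mem_nhds
  let σ : N → ℝ := fun x => ∑ y ∈ t, ρ y x * ρ y x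
  have hσ : ∀ x, σ x ≠ 0 := by
    intro x
    have hx : x ∈ ⋃ y ∈ t, Function.support (ρ y) := by rw [ht]; trivial
    simp only [Set.mem_iUnion, Function.mem_support] at hx
    obtain ⟨y, hy, hyx⟩ := hx
    exact (Finset.sum_pos' (fun i _ => mul_self_nonneg (ρ i x)) ⟨y, hy, mul_self_pos.2 hyx⟩).ne'
  have hσs : ContMDiff (𝓡 d) 𝓘(ℝ, ℝ) ∞ σ :=
    contMDiff_of_smoothNear fun p => SmoothNear.sum fun i _ =>
      ((smoothNear_of_contMDiff (ρ i).contMDiff p).mul (smoothNear_of_contMDiff (ρ i).contMDiff p))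
  let e := Fintype.equivFin (t × Fin d)
  refine ⟨⟨Fintype.card (t × Fin d), fun a => bumpField (ρ (e.symm a).1) (e.symm a).2,
    fun a x => (σ x)⁻¹ • bumpForm (ρ (e.symm a).1) (e.symm a).2 x,
    fun a => bumpField_smooth _ _, fun a => ?_, fun x v => ?_⟩⟩
  · have h1 : ContMDiff (𝓡 d) 𝓘(ℝ, ℝ) ∞ fun x => (σ x)⁻¹ :=
      contMDiff_of_smoothNear fun p => (smoothNear_of_contMDiff hσs p).inv (hσ p)
    exact (h1.comp (contMDiff_proj _)).smul (bumpForm_smooth (ρ (e.symm a).1) (e.symm a).2)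
  · simp only [LinearMap.smul_apply, smul_assoc]
    rw [← Finset.smul_sum, e.symm.sum_comp (fun c : t × Fin d =>
      bumpForm (ρ c.1) c.2 x v • bumpField (ρ c.1) c.2 x), Fintype.sum_prod_type]
    simp only [sum_bumpForm_smul_bumpField]
    rw [← Finset.sum_smul, Finset.sum_coe_sort t (fun y => ρ y x * ρ y x), smul_smul,
      inv_mul_cancel₀ (hσ x), one_smul]

namespace TFrame

variable (T : TFrame d N)
  {E' : Type*} [NormedAddCommGroup E'] [NormedSpace ℝ E'] {H' : Type*} [TopologicalSpace H']
  {I' : ModelWithCorners ℝ E' H'} {N' : Type*} [TopologicalSpace N'] [ChartedSpace H' N']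

theorem contMDiff_coeff {g : N' → N} {w : ∀ p, TangentSpace (𝓡 d) (g p)}
    (hw : ContMDiff I' (𝓡 d).tangent ∞ fun p => (⟨g p, w p⟩ : TangentBundle (𝓡 d) N))
    (a : Fin T.card) : ContMDiff I' 𝓘(ℝ, ℝ) ∞ fun p => T.lam a (g p) (w p) :=
  (T.lam_smooth a).comp hw

theorem contMDiff_sum {g : N' → N} (hg : ContMDiff I' (𝓡 d) ∞ g) {c : Fin T.card → N' → ℝ}
    (hc : ∀ a, ContMDiff I' 𝓘(ℝ, ℝ) ∞ (c a)) :
    ContMDiff I' (𝓡 d).tangent ∞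
      fun p => (⟨g p, ∑ a, c a p • T.V a (g p)⟩ : TangentBundle (𝓡 d) N) := by
  intro p
  rw [contMDiffAt_totalSpace]
  refine ⟨hg p, ?_⟩
  have h1 : ∀ a, ContMDiffAt I' 𝓘(ℝ, EuclideanSpace ℝ (Fin d)) ∞
      (fun q => (trivializationAt (EuclideanSpace ℝ (Fin d)) (TangentSpace (𝓡 d)) (g p)
        ⟨g q, T.V a (g q)⟩).2) p := fun a =>
    (contMDiffAt_totalSpace.1 (ContMDiffAt.comp p (T.V_smooth a (g p)) (hg p))).2
  have h2 : ContMDiffAt I' 𝓘(ℝ, EuclideanSpace ℝ (Fin d)) ∞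
      (fun q => ∑ a, c a q • (trivializationAt (EuclideanSpace ℝ (Fin d)) (TangentSpace (𝓡 d)) (g p)
        ⟨g q, T.V a (g q)⟩).2) p := contMDiffAt_finsetSum fun a _ => (hc a p).smul (h1 a)
  refine h2.congr_of_eventuallyEq ?_
  filter_upwards [hg.continuous.continuousAt.eventually
    ((trivializationAt (EuclideanSpace ℝ (Fin d)) (TangentSpace (𝓡 d)) (g p)).open_baseSet.mem_nhds
      (mem_baseSet_trivializationAt _ _ _))] with q hq
  have h3 := fun v => (trivializationAt (EuclideanSpace ℝ (Fin d))
    (TangentSpace (𝓡 d)) (g p)).linearEquivAt_apply (R := ℝ) (g q) hq v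
  simp only [← h3, map_sum, map_smul]

/-- Smoothness of a vector field along a map becomes smoothness of finitely many real functions
defined everywhere, which is the form in which it is verified for fields depending on (u, x). -/
theorem contMDiff_iff {g : N' → N} (hg : ContMDiff I' (𝓡 d) ∞ g)
    {w : ∀ p, TangentSpace (𝓡 d) (g p)} :
    (ContMDiff I' (𝓡 d).tangent ∞ fun p => (⟨g p, w p⟩ : TangentBundle (𝓡 d) N)) ↔
      ∀ a, ContMDiff I' 𝓘(ℝ, ℝ) ∞ fun p => T.lam a (g p) (w p) := by
  refine ⟨fun h a => T.contMDiff_coeff h a, fun h => ?_⟩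
  have := T.contMDiff_sum hg h
  simpa only [T.sum_eq] using this

theorem isSmoothVF_iff {w : ∀ x : N, TangentSpace (𝓡 d) x} :
    IsSmoothVF w ↔ ∀ a, ContMDiff (𝓡 d) 𝓘(ℝ, ℝ) ∞ fun p => T.lam a p (w p) :=
  T.contMDiff_iff contMDiff_id

/-- Extension of a tangent vector to a smooth vector field. -/
def ext (x : N) (v : TangentSpace (𝓡 d) x) (y : N) : TangentSpace (𝓡 d) y :=
  ∑ a, T.lam a x v • T.V a y

theorem ext_smooth (x : N) (v : TangentSpace (𝓡 d) x) : IsSmoothVF (T.ext x v) :=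
  T.contMDiff_sum contMDiff_id fun _ => contMDiff_const

theorem ext_self (x : N) (v : TangentSpace (𝓡 d) x) : T.ext x v x = v := T.sum_eq x v

end TFrame

end Frame

end

/-! ### Matrices depending smoothly on a point -/

section

section MatrixSmooth

variable {E : Type*} [NormedAddCommGroup E] [NormedSpace ℝ E] {H : Type*} [TopologicalSpace H]
  {I : ModelWithCorners ℝ E H} {N : Type*} [TopologicalSpace N] [ChartedSpace H N]
  {ι : Type*} [Fintype ι] [DecidableEq ι]

theorem SmoothNear.det {A : N → Matrix ι ι ℝ} {p : N}
    (hA : ∀ i j, SmoothNear I (fun q => A q i j) p) : SmoothNear I (fun q => (A q).det) p := by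
  simp only [Matrix.det_apply']
  exact SmoothNear.sum fun σ _ => (SmoothNear.prod fun i _ => hA (σ i) i).const_mul _

theorem SmoothNear.matrix_inv {A : N → Matrix ι ι ℝ} {p : N}
    (hA : ∀ i j, SmoothNear I (fun q => A q i j) p) (h0 : (A p).det ≠ 0) (i j : ι) :
    SmoothNear I (fun q => (A q)⁻¹ i j) p := by
  simp only [Matrix.inv_def, Matrix.smul_apply, smul_eq_mul, Ring.inverse_eq_inv',
    Matrix.adjugate_apply]
  refine ((SmoothNear.det hA).inv h0).mul (SmoothNear.det fun a b => ?_)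
  by_cases h : a = j
  · subst h
    simpa using smoothNear_const _ p
  · simpa [Matrix.updateRow_ne h] using hA a b

end MatrixSmooth

/-! ### Gram matrices of a nondegenerate bilinear form -/

section Gram

variable {V : Type*} [AddCommGroup V] [Module ℝ V] {ι : Type*} [Fintype ι] [DecidableEq ι]

/-- The transposed Gram matrix of a bilinear form. -/
def gramFlip (B : LinearMap.BilinForm ℝ V) (e : ι → V) : Matrix ι ι ℝ :=
  Matrix.of fun i j => B (e j) (e i)

theorem gramFlip_mulVec (B : LinearMap.BilinForm ℝ V) (e : ι → V) (v : ι → ℝ) (i : ι) :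
    (gramFlip B e).mulVec v i = B (∑ j, v j • e j) (e i) := by
  simp only [map_sum, LinearMap.sum_apply, map_smul, LinearMap.smul_apply, smul_eq_mul,
    Matrix.mulVec, dotProduct, gramFlip, Matrix.of_apply]
  exact Finset.sum_congr rfl fun j _ => mul_comm _ _

theorem det_gramFlip_basis_ne_zero (B : LinearMap.BilinForm ℝ V) (hB : Function.Injective B)
    (b : Module.Basis ι ℝ V) : (gramFlip B b).det ≠ 0 := by
  intro h
  obtain ⟨v, hv, hv0⟩ := Matrix.exists_mulVec_eq_zero_iff.2 h
  apply hv
  have h1 : B (∑ j, v j • b j) = 0 := b.ext fun i => by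
    rw [← gramFlip_mulVec, hv0]; rfl
  exact funext (Fintype.linearIndependent_iff.1 b.linearIndependent v
    (hB (h1.trans (map_zero B).symm)))

/-- The nonzero determinant makes e a basis, and the inverse Gram matrix applied to the values of l'
gives the coordinates of ξ. When the data vary smoothly, so does this expression of l ξ. -/
theorem eval_eq_of_gramFlip [FiniteDimensional ℝ V] (B : LinearMap.BilinForm ℝ V)
    (hB : Function.Injective B) (e : ι → V) (hcard : Fintype.card ι = Module.finrank ℝ V)
    (hdet : (gramFlip B e).det ≠ 0) (l l' : V →ₗ[ℝ] ℝ) (ξ : V) (hξ : ∀ v, B ξ v = l' v) :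
    l ξ = ∑ j, (∑ i, (gramFlip B e)⁻¹ j i * l' (e i)) * l (e j) := by
  have hli : LinearIndependent ℝ e := by
    rw [Fintype.linearIndependent_iff]
    intro g hg
    have h1 : (gramFlip B e).mulVec g = 0 := by
      ext i
      rw [gramFlip_mulVec, hg, map_zero]; rfl
    exact congrFun (Matrix.eq_zero_of_mulVec_eq_zero hdet h1)
  have hspan := hli.span_eq_top_of_card_eq_finrank' hcard
  have : ξ = ∑ j, (∑ i, (gramFlip B e)⁻¹ j i * l' (e i)) • e j := by
    apply hB
    apply LinearMap.ext_on_range hspan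
    intro i
    have h2 := gramFlip_mulVec B e ((gramFlip B e)⁻¹.mulVec fun i => l' (e i)) i
    rw [Matrix.mulVec_mulVec, Matrix.mul_nonsing_inv _ (Ne.isUnit hdet), Matrix.one_mulVec] at h2
    rw [hξ]
    exact h2
  conv_lhs => rw [this]
  simp only [map_sum, map_smul, smul_eq_mul]

end Gram

instance {d : ℕ} {N : Type*} [TopologicalSpace N] [ChartedSpace (EuclideanSpace ℝ (Fin d)) N]
    (x : N) : FiniteDimensional ℝ (TangentSpace (𝓡 d) x) :=
  inferInstanceAs (FiniteDimensional ℝ (EuclideanSpace ℝ (Fin d)))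

theorem finrank_tangentSpace {d : ℕ} {N : Type*} [TopologicalSpace N]
    [ChartedSpace (EuclideanSpace ℝ (Fin d)) N] (x : N) :
    Module.finrank ℝ (TangentSpace (𝓡 d) x) = d :=
  finrank_euclideanSpace_fin (𝕜 := ℝ) (n := d)

variable {m n : ℕ}
  {U : Type*} [TopologicalSpace U] [ChartedSpace (EuclideanSpace ℝ (Fin m)) U]
  {M : Type*} [TopologicalSpace M] [ChartedSpace (EuclideanSpace ℝ (Fin (2 * n))) M]
  [IsManifold (𝓡 m) ∞ U] [IsManifold (𝓡 (2 * n)) ∞ M]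

/-! ### The duality defined by the symplectic form -/

namespace KahlerFamily

variable (K : KahlerFamily m n U M)

theorem symp_neg_swap (x : M) (v w : TangentSpace (𝓡 (2 * n)) x) :
    K.symp x v w = -K.symp x w v := by
  have h := K.symp_alt x (v + w)
  simp only [map_add, LinearMap.add_apply, K.symp_alt, zero_add, add_zero] at h
  linarith

theorem g_symm (u : U) (x : M) (v w : TangentSpace (𝓡 (2 * n)) x) : K.g u x v w = K.g u x w v := by
  have h := K.j_compatible u x v (K.j u x w)
  rw [K.j_sq, map_neg, K.symp_neg_swap x _ w, neg_neg] at h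
  exact h.symm

theorem symp_flat_bijective (x : M) : Function.Bijective (K.symp x) := by
  have hinj : Function.Injective (K.symp x) := by
    rw [← LinearMap.ker_eq_bot, LinearMap.ker_eq_bot']
    intro v hv
    exact K.symp_nondeg x v fun w => by rw [hv]; rfl
  exact ⟨hinj, (LinearMap.injective_iff_surjective_of_finrank_eq_finrank
    (Subspace.dual_finrank_eq (K := ℝ)).symm).1 hinj⟩

/-- The vector `ξ` such that `ω(ξ, ·)` is a given linear form. -/
def sharp (x : M) (l : TangentSpace (𝓡 (2 * n)) x →ₗ[ℝ] ℝ) : TangentSpace (𝓡 (2 * n)) x :=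
  (LinearEquiv.ofBijective (K.symp x) (K.symp_flat_bijective x)).symm l

theorem symp_sharp (x : M) (l : TangentSpace (𝓡 (2 * n)) x →ₗ[ℝ] ℝ)
    (v : TangentSpace (𝓡 (2 * n)) x) : K.symp x (K.sharp x l) v = l v := by
  have := (LinearEquiv.ofBijective (K.symp x) (K.symp_flat_bijective x)).apply_symm_apply l
  exact DFunLike.congr_fun this v

/-- Fields extending a basis of the tangent space at x₀ keep an invertible Gram matrix near x₀, so
there the dual vector has coordinates given by Cramer's rule. -/
theorem sharp_smooth [T2Space M] (T : TFrame (2 * n) M) (c : Fin T.card) :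
    IsSmoothVF fun x => K.sharp x (T.lam c x) := by
  classical
  rw [T.isSmoothVF_iff]
  intro a x₀
  let b := Module.finBasis ℝ (TangentSpace (𝓡 (2 * n)) x₀)
  let ι := Fin (Module.finrank ℝ (TangentSpace (𝓡 (2 * n)) x₀))
  let e : ι → ∀ x : M, TangentSpace (𝓡 (2 * n)) x := fun i => T.ext x₀ (b i)
  have he : ∀ i, IsSmoothVF (e i) := fun i => T.ext_smooth x₀ (b i)
  let A : M → Matrix ι ι ℝ := fun x => gramFlip (K.symp x) fun i => e i x
  have hA : ∀ i j, SmoothNear (𝓡 (2 * n)) (fun x => A x i j) x₀ := fun i j =>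
    smoothNear_of_contMDiff (K.symp_smooth _ _ (he j) (he i)) x₀
  have h0 : (A x₀).det ≠ 0 := by
    have h1 : (fun i => e i x₀) = b := funext fun i => T.ext_self x₀ (b i)
    have h2 := det_gramFlip_basis_ne_zero (K.symp x₀) (K.symp_flat_bijective x₀).1 b
    rwa [← h1] at h2
  have hdet : ∀ᶠ x in 𝓝 x₀, (A x).det ≠ 0 :=
    (SmoothNear.det hA).contMDiffAt.continuousAt.eventually_ne h0
  have hform : ∀ᶠ x in 𝓝 x₀, T.lam a x (K.sharp x (T.lam c x))
      = ∑ j, (∑ i, (A x)⁻¹ j i * T.lam c x (e i x)) * T.lam a x (e j x) := by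
    filter_upwards [hdet] with x hx
    exact eval_eq_of_gramFlip (K.symp x) (K.symp_flat_bijective x).1 (fun i => e i x)
      ((Fintype.card_fin _).trans ((finrank_tangentSpace x₀).trans (finrank_tangentSpace x).symm))
      hx (T.lam a x) (T.lam c x) _ (K.symp_sharp x _)
  have hs : SmoothNear (𝓡 (2 * n)) (fun x => T.lam a x (K.sharp x (T.lam c x))) x₀ := by
    refine SmoothNear.congr ?_ hform
    exact SmoothNear.sum fun j _ => (SmoothNear.sum fun i _ =>
      (SmoothNear.matrix_inv hA h0 j i).mul
        (smoothNear_of_contMDiff (T.isSmoothVF_iff.1 (he i) c) x₀)).mul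
        (smoothNear_of_contMDiff (T.isSmoothVF_iff.1 (he j) a) x₀)
  exact hs.contMDiffAt

end KahlerFamily

end

/-! ### The Levi-Civita connection of the slices -/

section

section BracketSum

variable {d : ℕ} {N : Type*} [TopologicalSpace N] [ChartedSpace (EuclideanSpace ℝ (Fin d)) N]
  [IsManifold (𝓡 d) ∞ N]

theorem IsSmoothVF.mdiff {V : ∀ x : N, TangentSpace (𝓡 d) x} (hV : IsSmoothVF V) (x : N) :
    MDifferentiableAt (𝓡 d) (𝓡 d).tangent (fun y => (⟨y, V y⟩ : TangentBundle (𝓡 d) N)) x :=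
  (hV x).mdifferentiableAt (by simp)

theorem mlieBracket_sum_right {ι : Type*} (s : Finset ι) {f : ι → N → ℝ}
    {Y : ι → ∀ x : N, TangentSpace (𝓡 d) x} (A : ∀ x : N, TangentSpace (𝓡 d) x) {x : N}
    (hf : ∀ i, MDifferentiableAt (𝓡 d) 𝓘(ℝ, ℝ) (f i) x) (hY : ∀ i, IsSmoothVF (Y i)) :
    VectorField.mlieBracket (𝓡 d) A (fun y => ∑ i ∈ s, f i y • Y i y) x
      = ∑ i ∈ s, (mvfderiv (𝓡 d) (f i) x (A x) • Y i x
        + f i x • VectorField.mlieBracket (𝓡 d) A (Y i) x) := by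
  have : IsManifold (𝓡 d) 2 N := IsManifold.of_le (n := ∞) (by norm_cast)
  have hs : ∀ i, MDifferentiableAt (𝓡 d) (𝓡 d).tangent
      (fun y => (⟨y, f i y • Y i y⟩ : TangentBundle (𝓡 d) N)) x := fun i =>
    (hf i).smul_section ((hY i).mdiff x)
  classical
  induction s using Finset.induction_on with
  | empty =>
    have := congrFun (VectorField.mlieBracket_zero_right (I := 𝓡 d) (W := A)) x
    simp only [Finset.sum_empty]
    exact this
  | insert i s hi ih =>
    have h1 : (fun y => ∑ l ∈ insert i s, f l y • Y l y)
        = (f i • Y i) + fun y => ∑ l ∈ s, f l y • Y l y := by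
      funext y; exact Finset.sum_insert hi
    have h2 : MDifferentiableAt (𝓡 d) (𝓡 d).tangent
        (fun y => (⟨y, ∑ l ∈ s, f l y • Y l y⟩ : TangentBundle (𝓡 d) N)) x :=
      MDifferentiableAt.sum_section fun l _ => hs l
    rw [h1, Finset.sum_insert hi, ← ih]
    have h3 := VectorField.mlieBracket_add_right (I := 𝓡 d) (V := A) (hs i) h2
    have h4 := VectorField.mlieBracket_smul_right (I := 𝓡 d) (V := A) (hf i) ((hY i).mdiff x)
    exact h3.trans (congrArg (· + _) h4)

end BracketSum

variable {m n : ℕ}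
  {U : Type*} [TopologicalSpace U] [ChartedSpace (EuclideanSpace ℝ (Fin m)) U]
  {M : Type*} [TopologicalSpace M] [ChartedSpace (EuclideanSpace ℝ (Fin (2 * n))) M]
  [IsManifold (𝓡 m) ∞ U] [IsManifold (𝓡 (2 * n)) ∞ M]

namespace KahlerFamily

variable (K : KahlerFamily m n U M)

theorem g_sum_left {ι : Type*} (s : Finset ι) (u : U) (x : M) (f : ι → ℝ)
    (v : ι → TangentSpace (𝓡 (2 * n)) x) (w : TangentSpace (𝓡 (2 * n)) x) :
    K.g u x (∑ i ∈ s, f i • v i) w = ∑ i ∈ s, f i * K.g u x (v i) w := by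
  simp only [g, map_sum, LinearMap.sum_apply, map_smul, LinearMap.smul_apply, smul_eq_mul]

theorem g_add_left (u : U) (x : M) (v v' w : TangentSpace (𝓡 (2 * n)) x) :
    K.g u x (v + v') w = K.g u x v w + K.g u x v' w := by
  simp only [g, map_add, LinearMap.add_apply]

theorem g_neg_left (u : U) (x : M) (v w : TangentSpace (𝓡 (2 * n)) x) :
    K.g u x (-v) w = -K.g u x v w := by
  simp only [g, map_neg, LinearMap.neg_apply]

theorem g_nondeg (u : U) (x : M) {v v' : TangentSpace (𝓡 (2 * n)) x}
    (h : ∀ w, K.g u x v w = K.g u x v' w) : v = v' := by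
  have h1 : ∀ w, K.symp x (v - v') w = 0 := fun w => by
    have := h (-(K.j u x w))
    simp only [g, map_neg, K.j_sq, neg_neg] at this
    rw [map_sub, LinearMap.sub_apply, this, sub_self]
  exact sub_eq_zero.1 (K.symp_nondeg x _ h1)

theorem g_j (u : U) (x : M) (v w : TangentSpace (𝓡 (2 * n)) x) :
    K.g u x (K.j u x v) w = K.symp x v w := K.j_compatible u x v w

theorem j_slice_smooth (u : U) {V : ∀ x : M, TangentSpace (𝓡 (2 * n)) x} (hV : IsSmoothVF V) :
    IsSmoothVF fun x => K.j u x (V x) :=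
  (K.j_smooth V hV).comp ((contMDiff_const (c := u)).prodMk contMDiff_id)

theorem g_smooth (u : U) {V W : ∀ x : M, TangentSpace (𝓡 (2 * n)) x} (hV : IsSmoothVF V)
    (hW : IsSmoothVF W) : ContMDiff (𝓡 (2 * n)) 𝓘(ℝ, ℝ) ∞ fun x => K.g u x (V x) (W x) :=
  K.symp_smooth _ _ hV (K.j_slice_smooth u hW)

/-- The right-hand side of the Koszul formula. -/
def koszul (u : U) (A Y Z : ∀ x : M, TangentSpace (𝓡 (2 * n)) x) (x : M) : ℝ :=
  mvfderiv (𝓡 (2 * n)) (fun y => K.g u y (Y y) (Z y)) x (A x)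
    + mvfderiv (𝓡 (2 * n)) (fun y => K.g u y (Z y) (A y)) x (Y x)
    - mvfderiv (𝓡 (2 * n)) (fun y => K.g u y (A y) (Y y)) x (Z x)
    + K.g u x (VectorField.mlieBracket (𝓡 (2 * n)) A Y x) (Z x)
    - K.g u x (VectorField.mlieBracket (𝓡 (2 * n)) Y Z x) (A x)
    + K.g u x (VectorField.mlieBracket (𝓡 (2 * n)) Z A x) (Y x)

/-- Metric compatibility: by symmetry of g and antisymmetry of the bracket all the terms but one
cancel in pairs. It transfers the Leibniz rule in Y into linearity over functions in Z. -/
theorem koszul_add_swap (u : U) (A Y Z : ∀ x : M, TangentSpace (𝓡 (2 * n)) x) (x : M) :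
    K.koszul u A Y Z x + K.koszul u A Z Y x
      = 2 * mvfderiv (𝓡 (2 * n)) (fun y => K.g u y (Y y) (Z y)) x (A x) := by
  have e : ∀ B C : ∀ x : M, TangentSpace (𝓡 (2 * n)) x,
      (fun y => K.g u y (B y) (C y)) = fun y => K.g u y (C y) (B y) := fun B C =>
    funext fun y => K.g_symm u y _ _
  have b : ∀ B C D : ∀ x : M, TangentSpace (𝓡 (2 * n)) x,
      K.g u x (VectorField.mlieBracket (𝓡 (2 * n)) B C x) (D x)
        = -K.g u x (VectorField.mlieBracket (𝓡 (2 * n)) C B x) (D x) := fun B C D => by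
    rw [VectorField.mlieBracket_swap_apply, g_neg_left]
  unfold koszul
  rw [e Z Y, e Y A, e Z A, b A Z, b Z Y, b Y A]
  ring

section Sums

variable {ι : Type*} {s : Finset ι} {u : U} {x : M} {f : ι → M → ℝ}
  {V : ι → ∀ x : M, TangentSpace (𝓡 (2 * n)) x} {A Y Z : ∀ x : M, TangentSpace (𝓡 (2 * n)) x}

theorem mvfderiv_g_sum (hf : ∀ i, MDifferentiableAt (𝓡 (2 * n)) 𝓘(ℝ, ℝ) (f i) x)
    (hV : ∀ i, IsSmoothVF (V i)) (hZ : IsSmoothVF Z) (v : TangentSpace (𝓡 (2 * n)) x) :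
    mvfderiv (𝓡 (2 * n)) (fun y => K.g u y (∑ i ∈ s, f i y • V i y) (Z y)) x v
      = ∑ i ∈ s, (f i x * mvfderiv (𝓡 (2 * n)) (fun y => K.g u y (V i y) (Z y)) x v
        + mvfderiv (𝓡 (2 * n)) (f i) x v * K.g u x (V i x) (Z x)) := by
  simp only [g_sum_left]
  have hg : ∀ i, MDifferentiableAt (𝓡 (2 * n)) 𝓘(ℝ, ℝ) (fun y => K.g u y (V i y) (Z y)) x :=
    fun i => (K.g_smooth u (hV i) hZ x).mdifferentiableAt (by simp)
  refine (mvfderiv_sum_apply (fun i _ => (hf i).mul (hg i)) v).trans ?_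
  exact Finset.sum_congr rfl fun i _ => mvfderiv_mul_apply (hf i) (hg i) v

/-- The derivatives of the coefficients along Z cancel between the third and the fifth terms of the
Koszul formula; those along A, from the first and the fourth terms, add up, whence the factor 2. -/
theorem koszul_sum_mid (hf : ∀ i, MDifferentiableAt (𝓡 (2 * n)) 𝓘(ℝ, ℝ) (f i) x)
    (hV : ∀ i, IsSmoothVF (V i)) (hA : IsSmoothVF A) (hZ : IsSmoothVF Z) :
    K.koszul u A (fun y => ∑ i ∈ s, f i y • V i y) Z x
      = ∑ i ∈ s, (f i x * K.koszul u A (V i) Z x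
        + 2 * mvfderiv (𝓡 (2 * n)) (f i) x (A x) * K.g u x (V i x) (Z x)) := by
  have h1 := K.mvfderiv_g_sum (s := s) (u := u) hf hV hZ (A x)
  have h2 : mvfderiv (𝓡 (2 * n)) (fun y => K.g u y (Z y) (A y)) x (∑ i ∈ s, f i x • V i x)
      = ∑ i ∈ s, f i x * mvfderiv (𝓡 (2 * n)) (fun y => K.g u y (Z y) (A y)) x (V i x) := by
    rw [map_sum]
    exact Finset.sum_congr rfl fun i _ => map_smul _ _ _
  have h3 := K.mvfderiv_g_sum (s := s) (u := u) hf hV hA (Z x)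
  have h3' : (fun y => K.g u y (A y) (∑ i ∈ s, f i y • V i y))
      = fun y => K.g u y (∑ i ∈ s, f i y • V i y) (A y) := funext fun y => K.g_symm u y _ _
  have h4 := congrArg (fun w => K.g u x w (Z x)) (mlieBracket_sum_right s A hf hV)
  have h6 := congrArg (fun w => K.g u x w (A x)) (mlieBracket_sum_right s Z hf hV)
  have h5 : VectorField.mlieBracket (𝓡 (2 * n)) (fun y => ∑ i ∈ s, f i y • V i y) Z x
      = - VectorField.mlieBracket (𝓡 (2 * n)) Z (fun y => ∑ i ∈ s, f i y • V i y) x :=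
    VectorField.mlieBracket_swap_apply
  have h7 : K.g u x (VectorField.mlieBracket (𝓡 (2 * n)) Z A x) (∑ i ∈ s, f i x • V i x)
      = ∑ i ∈ s, f i x * K.g u x (VectorField.mlieBracket (𝓡 (2 * n)) Z A x) (V i x) := by
    rw [g_symm, g_sum_left]
    exact Finset.sum_congr rfl fun i _ => by rw [g_symm]
  have hsum : ∀ (a b : ι → ℝ) (v w : ι → TangentSpace (𝓡 (2 * n)) x)
      (z : TangentSpace (𝓡 (2 * n)) x), K.g u x (∑ i ∈ s, (a i • v i + b i • w i)) z
        = ∑ i ∈ s, (a i * K.g u x (v i) z + b i * K.g u x (w i) z) := fun a b v w z => by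
    rw [Finset.sum_add_distrib, g_add_left, g_sum_left, g_sum_left, Finset.sum_add_distrib]
  simp only [hsum] at h4 h6
  unfold koszul
  simp only [h1, h2, h3', h3, h5, g_neg_left, h4, h6, h7]
  simp only [← Finset.sum_add_distrib, ← Finset.sum_sub_distrib, ← Finset.sum_neg_distrib]
  refine Finset.sum_congr rfl fun i _ => ?_
  have e1 : (fun y => K.g u y (A y) (V i y)) = fun y => K.g u y (V i y) (A y) :=
    funext fun y => K.g_symm u y _ _
  have e2 : K.g u x (VectorField.mlieBracket (𝓡 (2 * n)) (V i) Z x) (A x)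
      = -K.g u x (VectorField.mlieBracket (𝓡 (2 * n)) Z (V i) x) (A x) := by
    rw [VectorField.mlieBracket_swap_apply, g_neg_left]
  rw [e1, e2]
  ring

theorem koszul_sum_right (hf : ∀ i, MDifferentiableAt (𝓡 (2 * n)) 𝓘(ℝ, ℝ) (f i) x)
    (hV : ∀ i, IsSmoothVF (V i)) (hA : IsSmoothVF A) (hY : IsSmoothVF Y) :
    K.koszul u A Y (fun y => ∑ i ∈ s, f i y • V i y) x
      = ∑ i ∈ s, f i x * K.koszul u A Y (V i) x := by
  have h1 := K.koszul_add_swap u A (fun y => ∑ i ∈ s, f i y • V i y) Y x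
  rw [K.koszul_sum_mid hf hV hA hY, K.mvfderiv_g_sum hf hV hY] at h1
  have h2 : ∀ i, K.koszul u A Y (V i) x
      = 2 * mvfderiv (𝓡 (2 * n)) (fun y => K.g u y (V i y) (Y y)) x (A x)
        - K.koszul u A (V i) Y x := fun i => by
    rw [← K.koszul_add_swap u A (V i) Y x]; ring
  simp only [h2]
  rw [← eq_sub_iff_add_eq'] at h1
  rw [h1, Finset.mul_sum, ← Finset.sum_sub_distrib]
  exact Finset.sum_congr rfl fun i _ => by ring

theorem koszul_sum_left (hf : ∀ i, MDifferentiableAt (𝓡 (2 * n)) 𝓘(ℝ, ℝ) (f i) x)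
    (hV : ∀ i, IsSmoothVF (V i)) (hY : IsSmoothVF Y) (hZ : IsSmoothVF Z) :
    K.koszul u (fun y => ∑ i ∈ s, f i y • V i y) Y Z x
      = ∑ i ∈ s, f i x * K.koszul u (V i) Y Z x := by
  have h1 := K.mvfderiv_g_sum (s := s) (u := u) hf hV hZ (Y x)
  have h1' : (fun y => K.g u y (Z y) (∑ i ∈ s, f i y • V i y))
      = fun y => K.g u y (∑ i ∈ s, f i y • V i y) (Z y) := funext fun y => K.g_symm u y _ _
  have h2 : mvfderiv (𝓡 (2 * n)) (fun y => K.g u y (Y y) (Z y)) x (∑ i ∈ s, f i x • V i x)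
      = ∑ i ∈ s, f i x * mvfderiv (𝓡 (2 * n)) (fun y => K.g u y (Y y) (Z y)) x (V i x) := by
    rw [map_sum]
    exact Finset.sum_congr rfl fun i _ => map_smul _ _ _
  have h3 := K.mvfderiv_g_sum (s := s) (u := u) hf hV hY (Z x)
  have h4 := congrArg (fun w => K.g u x w (Y x)) (mlieBracket_sum_right s Z hf hV)
  have h6 := congrArg (fun w => K.g u x w (Z x)) (mlieBracket_sum_right s Y hf hV)
  have h5 : VectorField.mlieBracket (𝓡 (2 * n)) (fun y => ∑ i ∈ s, f i y • V i y) Y x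
      = - VectorField.mlieBracket (𝓡 (2 * n)) Y (fun y => ∑ i ∈ s, f i y • V i y) x :=
    VectorField.mlieBracket_swap_apply
  have h7 : K.g u x (VectorField.mlieBracket (𝓡 (2 * n)) Y Z x) (∑ i ∈ s, f i x • V i x)
      = ∑ i ∈ s, f i x * K.g u x (VectorField.mlieBracket (𝓡 (2 * n)) Y Z x) (V i x) := by
    rw [g_symm, g_sum_left]
    exact Finset.sum_congr rfl fun i _ => by rw [g_symm]
  have hsum : ∀ (a b : ι → ℝ) (v w : ι → TangentSpace (𝓡 (2 * n)) x)
      (z : TangentSpace (𝓡 (2 * n)) x), K.g u x (∑ i ∈ s, (a i • v i + b i • w i)) z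
        = ∑ i ∈ s, (a i * K.g u x (v i) z + b i * K.g u x (w i) z) := fun a b v w z => by
    rw [Finset.sum_add_distrib, g_add_left, g_sum_left, g_sum_left, Finset.sum_add_distrib]
  simp only [hsum] at h4 h6
  unfold koszul
  simp only [h1, h2, h1', h3, h5, g_neg_left, h4, h6, h7]
  simp only [← Finset.sum_add_distrib, ← Finset.sum_sub_distrib, ← Finset.sum_neg_distrib]
  refine Finset.sum_congr rfl fun i _ => ?_
  have e1 : (fun y => K.g u y (Z y) (V i y)) = fun y => K.g u y (V i y) (Z y) :=
    funext fun y => K.g_symm u y _ _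
  have e2 : K.g u x (VectorField.mlieBracket (𝓡 (2 * n)) (V i) Y x) (Z x)
      = -K.g u x (VectorField.mlieBracket (𝓡 (2 * n)) Y (V i) x) (Z x) := by
    rw [VectorField.mlieBracket_swap_apply, g_neg_left]
  rw [e1, e2]
  ring

end Sums

variable [T2Space M] (T : TFrame (2 * n) M)

/-- The field `∇_{V_a} V_d` at a point. -/
def christoffel (a d : Fin T.card) (u : U) (x : M) : TangentSpace (𝓡 (2 * n)) x :=
  K.j u x (∑ c, (1 / 2 * K.koszul u (T.V a) (T.V d) (T.V c) x) • K.sharp x (T.lam c x))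

/-- Since g(jξ, ·) = ω(ξ, ·), applying j to the ω-dual of a linear form gives its g-dual. This is
the reason for j and `sharp` in `christoffel`: the dual is taken of half the Koszul expression. -/
theorem g_christoffel (a d : Fin T.card) (u : U) (x : M) (z : TangentSpace (𝓡 (2 * n)) x) :
    2 * K.g u x (K.christoffel T a d u x) z
      = ∑ c, T.lam c x z * K.koszul u (T.V a) (T.V d) (T.V c) x := by
  unfold christoffel
  rw [g_j]
  simp only [map_sum, LinearMap.sum_apply, map_smul, LinearMap.smul_apply, smul_eq_mul, symp_sharp,
    Finset.mul_sum]
  exact Finset.sum_congr rfl fun c _ => by ring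

/-- The vector specified by the Koszul formula exists because the explicit candidate satisfies it,
as seen by expanding A, Y and Z in the frame; it is unique because g is nondegenerate. Only
differentiability of the coefficients of Y at x is required, so the formula also applies to fields
that are smooth on the domain of a chart only. -/
theorem leviCivita_eq (u : U) {Y : ∀ x : M, TangentSpace (𝓡 (2 * n)) x} {x : M}
    (hY : ∀ d, MDifferentiableAt (𝓡 (2 * n)) 𝓘(ℝ, ℝ) (fun y => T.lam d y (Y y)) x)
    (v : TangentSpace (𝓡 (2 * n)) x) :
    K.leviCivita u Y x v
      = ∑ d, (mvfderiv (𝓡 (2 * n)) (fun y => T.lam d y (Y y)) x v • T.V d x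
        + T.lam d x (Y x) • ∑ a, T.lam a x v • K.christoffel T a d u x) := by
  set w := ∑ d, (mvfderiv (𝓡 (2 * n)) (fun y => T.lam d y (Y y)) x v • T.V d x
        + T.lam d x (Y x) • ∑ a, T.lam a x v • K.christoffel T a d u x) with hw
  have hexp : ∀ A : ∀ x : M, TangentSpace (𝓡 (2 * n)) x,
      A = fun y => ∑ a, T.lam a y (A y) • T.V a y := fun A =>
    funext fun y => (T.sum_eq y (A y)).symm
  have hmd : ∀ A : ∀ x : M, TangentSpace (𝓡 (2 * n)) x, IsSmoothVF A → ∀ a,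
      MDifferentiableAt (𝓡 (2 * n)) 𝓘(ℝ, ℝ) (fun y => T.lam a y (A y)) x := fun A hA a =>
    (T.isSmoothVF_iff.1 hA a x).mdifferentiableAt (by simp)
  have hgw : ∀ A Z : (∀ x : M, TangentSpace (𝓡 (2 * n)) x), IsSmoothVF A → IsSmoothVF Z →
      A x = v → 2 * K.g u x w (Z x) = K.koszul u A Y Z x := by
    intro A Z hA hZ hv
    subst hv
    have e1 : K.koszul u A Y Z x
        = ∑ d, (T.lam d x (Y x) * K.koszul u A (T.V d) Z x
          + 2 * mvfderiv (𝓡 (2 * n)) (fun y => T.lam d y (Y y)) x (A x)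
            * K.g u x (T.V d x) (Z x)) := by
      conv_lhs => rw [hexp Y]
      exact K.koszul_sum_mid hY T.V_smooth hA hZ
    have e2 : ∀ d, K.koszul u A (T.V d) Z x = ∑ a, T.lam a x (A x) *
        ∑ c, T.lam c x (Z x) * K.koszul u (T.V a) (T.V d) (T.V c) x := by
      intro d
      conv_lhs => rw [hexp A]
      rw [K.koszul_sum_left (hmd A hA) T.V_smooth (T.V_smooth d) hZ]
      refine Finset.sum_congr rfl fun a _ => ?_
      congr 1
      conv_lhs => rw [hexp Z]
      exact K.koszul_sum_right (hmd Z hZ) T.V_smooth (T.V_smooth a) (T.V_smooth d)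
    rw [e1, hw, Finset.sum_add_distrib, g_add_left, g_sum_left, g_sum_left, mul_add,
      Finset.sum_add_distrib, add_comm, Finset.mul_sum, Finset.mul_sum]
    congr 1
    · refine Finset.sum_congr rfl fun d _ => ?_
      rw [e2, g_sum_left, mul_left_comm, Finset.mul_sum]
      congr 1
      refine Finset.sum_congr rfl fun a _ => ?_
      rw [← g_christoffel]
      ring
    · exact Finset.sum_congr rfl fun d _ => by ring
  have hspec := Classical.epsilon_spec (p := fun w : TangentSpace (𝓡 (2 * n)) x =>
    ∀ A Z : (∀ x : M, TangentSpace (𝓡 (2 * n)) x), IsSmoothVF A → IsSmoothVF Z → A x = v →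
    2 * K.g u x w (Z x) = K.koszul u A Y Z x) ⟨w, hgw⟩
  apply K.g_nondeg u x
  intro z
  -- Uniqueness needs only one extension of v and one of each z; those with constant coefficients in
  -- the frame are smooth.
  have h1 := hspec (T.ext x v) (T.ext x z) (T.ext_smooth x v) (T.ext_smooth x z) (T.ext_self x v)
  have h2 := hgw (T.ext x v) (T.ext x z) (T.ext_smooth x v) (T.ext_smooth x z) (T.ext_self x v)
  rw [T.ext_self] at h1 h2
  have h3 := h1.trans h2.symm
  exact mul_left_cancel₀ two_ne_zero h3

end KahlerFamily

end

/-! ### The bundle of vectors of type (1,0) -/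

section

/-! ### Complexified vectors and linear forms -/

section Complexification

variable {V : Type*} [AddCommGroup V] [Module ℝ V]

@[simp] theorem cRe_tmul (z : ℂ) (v : V) : cRe (z ⊗ₜ[ℝ] v) = z.re • v := by
  simp [cRe]

@[simp] theorem cIm_tmul (z : ℂ) (v : V) : cIm (z ⊗ₜ[ℝ] v) = z.im • v := by
  simp [cIm]

theorem one_tmul_re_add (w : ℂ ⊗[ℝ] V) :
    (1 : ℂ) ⊗ₜ[ℝ] cRe w + Complex.I • ((1 : ℂ) ⊗ₜ[ℝ] cIm w) = w := by
  conv_rhs => rw [← cMk_re_im w]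
  rw [cMk, TensorProduct.smul_tmul', smul_eq_mul, mul_one]

theorem cMk_eq (a b : V) :
    cMk a b = (1 : ℂ) ⊗ₜ[ℝ] a + Complex.I • ((1 : ℂ) ⊗ₜ[ℝ] b) := by
  rw [cMk, TensorProduct.smul_tmul', smul_eq_mul, mul_one]

@[simp] theorem cRe_I_smul (w : ℂ ⊗[ℝ] V) : cRe (Complex.I • w) = -cIm w := by
  induction w using TensorProduct.induction_on with
  | zero => simp
  | tmul z v => simp [TensorProduct.smul_tmul']
  | add x y hx hy => rw [smul_add, map_add, hx, hy, map_add, neg_add]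

@[simp] theorem cRe_cMk (a b : V) : cRe (cMk a b) = a := by simp [cMk]

@[simp] theorem cIm_cMk (a b : V) : cIm (cMk a b) = b := by simp [cMk]

theorem cConj_tmul (z : ℂ) (v : V) : cConj (z ⊗ₜ[ℝ] v) = (conj z) ⊗ₜ[ℝ] v := by
  rw [← cMk_re_im ((conj z) ⊗ₜ[ℝ] v)]
  simp [cConj, cMk]

theorem cConj_add (w w' : ℂ ⊗[ℝ] V) : cConj (w + w') = cConj w + cConj w' := by
  simp only [cConj, cMk, map_add, neg_add, TensorProduct.tmul_add]
  abel

theorem cConj_smul (c : ℂ) (w : ℂ ⊗[ℝ] V) : cConj (c • w) = conj c • cConj w := by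
  induction w using TensorProduct.induction_on with
  | zero => simp [cConj, cMk]
  | tmul z v => simp [TensorProduct.smul_tmul', cConj_tmul]
  | add x y hx hy => rw [smul_add, cConj_add, hx, hy, cConj_add, smul_add]

theorem cConj_sum {ι : Type*} (s : Finset ι) (f : ι → ℂ ⊗[ℝ] V) :
    cConj (∑ i ∈ s, f i) = ∑ i ∈ s, cConj (f i) := by
  classical
  induction s using Finset.induction_on with
  | empty => simp [cConj, cMk]
  | insert i s hi ih => rw [Finset.sum_insert hi, Finset.sum_insert hi, cConj_add, ih]

variable {W : Type*} [AddCommGroup W] [Module ℂ W]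

/-- For a real-linear map the extension is the base change, which makes it linear over ℂ. -/
theorem cExt_eq [Module ℝ W] [IsScalarTower ℝ ℂ W] (T : V →ₗ[ℝ] W) (w : ℂ ⊗[ℝ] V) :
    cExt T w = LinearMap.liftBaseChange ℂ T w := by
  conv_rhs => rw [← one_tmul_re_add w]
  simp [cExt]

/-- The complexification of a real linear form. -/
def formC (l : V →ₗ[ℝ] ℝ) : (ℂ ⊗[ℝ] V) →ₗ[ℂ] ℂ :=
  LinearMap.liftBaseChange ℂ ((Algebra.linearMap ℝ ℂ) ∘ₗ l)

theorem formC_tmul (l : V →ₗ[ℝ] ℝ) (z : ℂ) (v : V) : formC l (z ⊗ₜ[ℝ] v) = z * l v := by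
  simp [formC]

theorem formC_apply (l : V →ₗ[ℝ] ℝ) (w : ℂ ⊗[ℝ] V) :
    formC l w = (l (cRe w) : ℂ) + Complex.I * (l (cIm w) : ℂ) := by
  conv_lhs => rw [← one_tmul_re_add w]
  rw [map_add, map_smul, formC_tmul, formC_tmul]
  simp

theorem formC_cConj (l : V →ₗ[ℝ] ℝ) (w : ℂ ⊗[ℝ] V) : formC l (cConj w) = conj (formC l w) := by
  simp [formC_apply, cConj]

theorem smul_one_tmul (r : ℝ) (v : V) : (1 : ℂ) ⊗ₜ[ℝ] (r • v) = (r : ℂ) • ((1 : ℂ) ⊗ₜ[ℝ] v) := by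
  rw [TensorProduct.tmul_smul, TensorProduct.smul_tmul', TensorProduct.smul_tmul']
  simp

theorem formC_expand {ι : Type*} [Fintype ι] {l : ι → V →ₗ[ℝ] ℝ} {v : ι → V}
    (h : ∀ w, ∑ a, l a w • v a = w) (w : ℂ ⊗[ℝ] V) :
    ∑ a, formC (l a) w • ((1 : ℂ) ⊗ₜ[ℝ] v a) = w := by
  conv_rhs => rw [← one_tmul_re_add w, ← h (cRe w), ← h (cIm w)]
  rw [TensorProduct.tmul_sum, TensorProduct.tmul_sum, Finset.smul_sum, ← Finset.sum_add_distrib]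
  refine Finset.sum_congr rfl fun a _ => ?_
  rw [formC_apply, smul_one_tmul, smul_one_tmul, add_smul, mul_smul]

end Complexification

variable {m n : ℕ}
  {U : Type*} [TopologicalSpace U] [ChartedSpace (EuclideanSpace ℝ (Fin m)) U]
  {M : Type*} [TopologicalSpace M] [ChartedSpace (EuclideanSpace ℝ (Fin (2 * n))) M]
  [IsManifold (𝓡 m) ∞ U] [IsManifold (𝓡 (2 * n)) ∞ M]

namespace KahlerFamily

variable (K : KahlerFamily m n U M)

theorem jC_tmul (p : U × M) (z : ℂ) (v : TangentSpace (𝓡 (2 * n)) p.2) :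
    K.jC p (z ⊗ₜ[ℝ] v) = z ⊗ₜ[ℝ] K.j p.1 p.2 v := by
  simp [jC]

theorem jC_E {p : U × M} (e : K.E p) : K.jC p e.1 = Complex.I • e.1 := by
  have := e.2
  simp only [E, LinearMap.mem_ker, LinearMap.sub_apply, LinearMap.smul_apply, LinearMap.id_apply,
    sub_eq_zero] at this
  exact this

theorem projE_val (p : U × M) (w : ℂ ⊗[ℝ] TangentSpace (𝓡 (2 * n)) p.2) :
    (K.projE p w).1 = (1 / 2 : ℂ) • (w - Complex.I • K.jC p w) := rfl

theorem projE_E {p : U × M} (e : K.E p) : K.projE p e.1 = e := by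
  apply Subtype.ext
  rw [projE_val, jC_E, smul_smul, Complex.I_mul_I]
  module

theorem cConj_E {p : U × M} (e : K.E p) : cConj e.1 ∈ K.Ebar p := by
  have hj : ∀ w, K.jC p (cConj w) = cConj (K.jC p w) := by
    intro w
    induction w using TensorProduct.induction_on with
    | zero => simp [cConj, cMk]
    | tmul z v => rw [cConj_tmul, jC_tmul, jC_tmul, cConj_tmul]
    | add x y hx hy => rw [cConj_add, map_add, hx, hy, map_add, cConj_add]
  simp only [Ebar, LinearMap.mem_ker, LinearMap.add_apply, LinearMap.smul_apply,
    LinearMap.id_apply]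
  rw [hj, jC_E, cConj_smul]
  simp

variable (T : TFrame (2 * n) M)

/-- The frame of `E` obtained by projection of the frame of `TM`. -/
def W (a : Fin T.card) (p : U × M) : K.E p := K.projE p ((1 : ℂ) ⊗ₜ[ℝ] T.V a p.2)

theorem W_val (a : Fin T.card) (p : U × M) :
    (K.W T a p).1 = (1 / 2 : ℂ) • ((1 : ℂ) ⊗ₜ[ℝ] T.V a p.2)
      + (-(Complex.I / 2)) • ((1 : ℂ) ⊗ₜ[ℝ] K.j p.1 p.2 (T.V a p.2)) := by
  rw [W, projE_val, jC_tmul]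
  module

theorem W_add_conj (a : Fin T.card) (p : U × M) :
    (K.W T a p).1 + cConj (K.W T a p).1 = (1 : ℂ) ⊗ₜ[ℝ] T.V a p.2 := by
  rw [W_val, cConj_add, cConj_smul, cConj_smul, cConj_tmul, cConj_tmul]
  simp only [map_div₀, map_one, map_neg, Complex.conj_I, Complex.conj_ofNat, neg_div, neg_neg]
  module

/-- The coordinates of a complex tangent vector in the frame. -/
def lamC (a : Fin T.card) (x : M) : (ℂ ⊗[ℝ] TangentSpace (𝓡 (2 * n)) x) →ₗ[ℂ] ℂ :=
  formC (T.lam a x)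

theorem lamC_expand (x : M) (w : ℂ ⊗[ℝ] TangentSpace (𝓡 (2 * n)) x) :
    ∑ a, lamC T a x w • ((1 : ℂ) ⊗ₜ[ℝ] T.V a x) = w := formC_expand (T.sum_eq x) w

theorem projE_expand (p : U × M) (w : ℂ ⊗[ℝ] TangentSpace (𝓡 (2 * n)) p.2) :
    K.projE p w = ∑ a, lamC T a p.2 w • K.W T a p := by
  conv_lhs => rw [← lamC_expand T p.2 w]
  rw [map_sum]
  exact Finset.sum_congr rfl fun a _ => map_smul _ _ _

theorem E_expand {p : U × M} (e : K.E p) : ∑ a, lamC T a p.2 e.1 • K.W T a p = e := by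
  rw [← projE_expand, projE_E]

/-- The matrix of `j`. -/
def Jc (a b : Fin T.card) (p : U × M) : ℝ := T.lam b p.2 (K.j p.1 p.2 (T.V a p.2))

theorem j_V (a : Fin T.card) (p : U × M) :
    K.j p.1 p.2 (T.V a p.2) = ∑ b, K.Jc T a b p • T.V b p.2 := (T.sum_eq _ _).symm

theorem j_expand (p : U × M) (v : TangentSpace (𝓡 (2 * n)) p.2) :
    K.j p.1 p.2 v = ∑ b, (∑ a, T.lam a p.2 v * K.Jc T a b p) • T.V b p.2 := by
  conv_lhs => rw [← T.sum_eq p.2 v]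
  rw [map_sum]
  simp only [Finset.sum_smul]
  rw [Finset.sum_comm]
  refine Finset.sum_congr rfl fun a _ => ?_
  rw [map_smul, j_V, Finset.smul_sum]
  exact Finset.sum_congr rfl fun b _ => smul_smul _ _ _

theorem Jc_smooth (a b : Fin T.card) :
    ContMDiff ((𝓡 m).prod (𝓡 (2 * n))) 𝓘(ℝ, ℝ) ∞ (K.Jc T a b) :=
  T.contMDiff_coeff (g := Prod.snd) (K.j_smooth _ (T.V_smooth a)) b

theorem lam_j (b : Fin T.card) (p : U × M) (v : TangentSpace (𝓡 (2 * n)) p.2) :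
    T.lam b p.2 (K.j p.1 p.2 v) = ∑ a, T.lam a p.2 v * K.Jc T a b p := by
  conv_lhs => rw [← T.sum_eq p.2 v]
  simp only [map_sum, map_smul, smul_eq_mul]
  rfl

theorem lamC_W (a b : Fin T.card) (p : U × M) :
    lamC T b p.2 (K.W T a p).1
      = 1 / 2 * (T.lam b p.2 (T.V a p.2) : ℂ) - Complex.I / 2 * (K.Jc T a b p : ℂ) := by
  rw [W_val, map_add, map_smul, map_smul, lamC, formC_tmul, formC_tmul, smul_eq_mul, smul_eq_mul]
  simp only [Jc]
  ring

theorem smoothE_iff {W : ∀ p : U × M, K.E p} :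
    K.SmoothE W ↔ ∀ a, ContMDiff ((𝓡 m).prod (𝓡 (2 * n))) 𝓘(ℝ, ℂ) ∞
      fun p => lamC T a p.2 (W p).1 := by
  unfold SmoothE
  rw [T.contMDiff_iff contMDiff_snd, T.contMDiff_iff contMDiff_snd, ← forall_and]
  refine forall_congr' fun a => ?_
  simp only [lamC, formC_apply]
  constructor
  · rintro ⟨h1, h2⟩ p
    exact ((smoothNear_of_contMDiff h1 p).ofReal.add
      ((smoothNear_of_contMDiff h2 p).ofReal.const_mul _)).contMDiffAt
  · intro h
    refine ⟨fun p => ?_, fun p => ?_⟩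
    · have := ((smoothNear_of_contMDiff h p).clm Complex.reCLM).contMDiffAt
      simpa using! this
    · have := ((smoothNear_of_contMDiff h p).clm Complex.imCLM).contMDiffAt
      simpa using! this

theorem W_smooth (a : Fin T.card) : K.SmoothE (K.W T a) := by
  rw [K.smoothE_iff T]
  intro b p
  simp only [lamC_W]
  have h1 : ContMDiff ((𝓡 m).prod (𝓡 (2 * n))) 𝓘(ℝ, ℝ) ∞
      fun p : U × M => T.lam b p.2 (T.V a p.2) :=
    (T.isSmoothVF_iff.1 (T.V_smooth a) b).comp contMDiff_snd
  exact (((smoothNear_of_contMDiff h1 p).ofReal.const_mul _).sub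
    ((smoothNear_of_contMDiff (K.Jc_smooth T a b) p).ofReal.const_mul _)).contMDiffAt

end KahlerFamily

end

/-! ### Covariant derivatives of vectors of type (1,0) -/

section

theorem IsSmoothVF.mlieBracket {d : ℕ} {N : Type*} [TopologicalSpace N]
    [ChartedSpace (EuclideanSpace ℝ (Fin d)) N] [IsManifold (𝓡 d) ∞ N]
    {A B : ∀ x : N, TangentSpace (𝓡 d) x} (hA : IsSmoothVF A) (hB : IsSmoothVF B) :
    IsSmoothVF (VectorField.mlieBracket (𝓡 d) A B) := by
  have : IsManifold (𝓡 d) (((⊤ : ℕ∞) : WithTop ℕ∞) + 1) N :=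
    IsManifold.of_le (n := ∞) (by norm_cast)
  have : IsManifold (𝓡 d) (minSmoothness ℝ 2) N :=
    IsManifold.of_le (n := ∞) (by simp only [minSmoothness_of_isRCLikeNormedField]; norm_cast)
  exact ContDiff.mlieBracket_vectorField (m := ⊤) (n := ⊤) hA hB (by simp)

theorem cMk_sum {V : Type*} [AddCommGroup V] [Module ℝ V] {ι : Type*} (s : Finset ι)
    (a a' b b' : ι → ℝ) (v c : ι → V) :
    cMk (∑ i ∈ s, (a i • v i + b i • c i)) (∑ i ∈ s, (a' i • v i + b' i • c i))
      = ∑ i ∈ s, (((a i : ℂ) + Complex.I * a' i) • ((1 : ℂ) ⊗ₜ[ℝ] v i)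
        + ((b i : ℂ) + Complex.I * b' i) • ((1 : ℂ) ⊗ₜ[ℝ] c i)) := by
  rw [cMk_eq, TensorProduct.tmul_sum, TensorProduct.tmul_sum, Finset.smul_sum,
    ← Finset.sum_add_distrib]
  refine Finset.sum_congr rfl fun i _ => ?_
  simp only [TensorProduct.tmul_add, smul_one_tmul]
  module

variable {m n : ℕ}
  {U : Type*} [TopologicalSpace U] [ChartedSpace (EuclideanSpace ℝ (Fin m)) U]
  {M : Type*} [TopologicalSpace M] [ChartedSpace (EuclideanSpace ℝ (Fin (2 * n))) M]
  [IsManifold (𝓡 m) ∞ U] [IsManifold (𝓡 (2 * n)) ∞ M]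

namespace KahlerFamily

variable (K : KahlerFamily m n U M)

/-- The field j_u B depends on u, so the smoothness of ω on fields of M does not apply to it
directly. Expanding it in the frame confines the dependence on u to scalar coefficients. -/
theorem g_smooth_joint (T : TFrame (2 * n) M) {A B : ∀ x : M, TangentSpace (𝓡 (2 * n)) x} (hA : IsSmoothVF A)
    (hB : IsSmoothVF B) :
    ContMDiff ((𝓡 m).prod (𝓡 (2 * n))) 𝓘(ℝ, ℝ) ∞
      fun p : U × M => K.g p.1 p.2 (A p.2) (B p.2) := by
  have h : (fun p : U × M => K.g p.1 p.2 (A p.2) (B p.2))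
      = fun p => ∑ b, T.lam b p.2 (K.j p.1 p.2 (B p.2)) * K.symp p.2 (A p.2) (T.V b p.2) := by
    funext p
    conv_lhs => rw [g, ← T.sum_eq p.2 (K.j p.1 p.2 (B p.2))]
    simp only [map_sum, map_smul, smul_eq_mul]
  rw [h]
  apply contMDiff_of_smoothNear
  intro p
  refine SmoothNear.sum fun b _ => SmoothNear.mul
    (smoothNear_of_contMDiff (T.contMDiff_coeff (g := Prod.snd) (K.j_smooth _ hB) b) p) ?_
  exact smoothNear_of_contMDiff ((K.symp_smooth _ _ hA (T.V_smooth b)).comp contMDiff_snd) p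

theorem koszul_smooth (T : TFrame (2 * n) M) {A Y Z : ∀ x : M, TangentSpace (𝓡 (2 * n)) x} (hA : IsSmoothVF A)
    (hY : IsSmoothVF Y) (hZ : IsSmoothVF Z) :
    ContMDiff ((𝓡 m).prod (𝓡 (2 * n))) 𝓘(ℝ, ℝ) ∞
      fun p : U × M => K.koszul p.1 A Y Z p.2 := by
  have h1 : ∀ {B C D : ∀ x : M, TangentSpace (𝓡 (2 * n)) x}, IsSmoothVF B → IsSmoothVF C →
      IsSmoothVF D → ∀ p, SmoothNear ((𝓡 m).prod (𝓡 (2 * n))) (fun p : U × M =>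
        mvfderiv (𝓡 (2 * n)) (fun y => K.g p.1 y (B y) (C y)) p.2 (D p.2)) p := by
    intro B C D hB hC hD p
    have hg := K.g_smooth_joint T hB hC
    have h2 := contMDiff_mvfderiv_apply hg (contMDiff_tPair_right (U := U) (m := m) hD)
    refine (smoothNear_of_contMDiff h2 p).congr (Filter.Eventually.of_forall fun q => ?_)
    exact (mvfderiv_tPair_right ((hg q).mdifferentiableAt (by simp)) (D q.2)).symm
  have h3 : ∀ {B C D : ∀ x : M, TangentSpace (𝓡 (2 * n)) x}, IsSmoothVF B → IsSmoothVF C →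
      IsSmoothVF D → ∀ p, SmoothNear ((𝓡 m).prod (𝓡 (2 * n))) (fun p : U × M =>
        K.g p.1 p.2 (VectorField.mlieBracket (𝓡 (2 * n)) B C p.2) (D p.2)) p :=
    fun hB hC hD p => smoothNear_of_contMDiff (K.g_smooth_joint T (hB.mlieBracket hC) hD) p
  apply contMDiff_of_smoothNear
  intro p
  exact (((((h1 hY hZ hA p).add (h1 hZ hA hY p)).sub (h1 hA hY hZ p)).add (h3 hA hY hZ p)).sub
    (h3 hY hZ hA p)).add (h3 hZ hA hY p)

variable [T2Space M] (T : TFrame (2 * n) M)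

/-- The Christoffel symbols in the frame. -/
def Gam (a d b : Fin T.card) (p : U × M) : ℝ := T.lam b p.2 (K.christoffel T a d p.1 p.2)

theorem Gam_smooth (a d b : Fin T.card) :
    ContMDiff ((𝓡 m).prod (𝓡 (2 * n))) 𝓘(ℝ, ℝ) ∞ (K.Gam T a d b) := by
  have h : K.Gam T a d b = fun p => ∑ e, (∑ c, (1 / 2 * K.koszul p.1 (T.V a) (T.V d) (T.V c) p.2)
      * T.lam e p.2 (K.sharp p.2 (T.lam c p.2))) * K.Jc T e b p := by
    funext p
    simp only [Gam, christoffel, lam_j]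
    refine Finset.sum_congr rfl fun e _ => ?_
    simp only [map_sum, map_smul, smul_eq_mul]
  rw [h]
  apply contMDiff_of_smoothNear
  intro p
  refine SmoothNear.sum fun e _ => (SmoothNear.sum fun c _ => SmoothNear.mul ?_ ?_).mul
    (smoothNear_of_contMDiff (K.Jc_smooth T e b) p)
  · exact (smoothNear_of_contMDiff
      (K.koszul_smooth T (T.V_smooth a) (T.V_smooth d) (T.V_smooth c)) p).const_mul _
  · exact smoothNear_of_contMDiff
      ((T.isSmoothVF_iff.1 (K.sharp_smooth T c) e).comp contMDiff_snd) p

/-- The fields V_d do not depend on u. So the plain derivative along U and the Levi-Civita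
derivative along M together differentiate the coefficients in the direction X + v, and only the
latter adds Christoffel terms. -/
theorem covTM_eq {w : ∀ p : U × M, TangentSpace (𝓡 (2 * n)) p.2} {p : U × M}
    (hw : ∀ d, MDifferentiableAt ((𝓡 m).prod (𝓡 (2 * n))) 𝓘(ℝ, ℝ)
      (fun q => T.lam d q.2 (w q)) p)
    (X : TangentSpace (𝓡 m) p.1) (v : TangentSpace (𝓡 (2 * n)) p.2) :
    K.covTM w p X v
      = ∑ d, (mvfderiv ((𝓡 m).prod (𝓡 (2 * n))) (fun q => T.lam d q.2 (w q)) p (tPair X v)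
          • T.V d p.2
        + T.lam d p.2 (w p) • ∑ a, T.lam a p.2 v • K.christoffel T a d p.1 p.2) := by
  have hl : ∀ d, MDifferentiableAt (𝓡 m) 𝓘(ℝ, ℝ) (fun u => T.lam d p.2 (w (u, p.2))) p.1 :=
    fun d => MDifferentiableAt.comp (I' := (𝓡 m).prod (𝓡 (2 * n))) p.1 (f := fun u => (u, p.2))
      (hw d) (mdifferentiableAt_id.prodMk mdifferentiableAt_const)
  have hr : ∀ d, MDifferentiableAt (𝓡 (2 * n)) 𝓘(ℝ, ℝ) (fun x => T.lam d x (w (p.1, x))) p.2 :=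
    fun d => MDifferentiableAt.comp (I' := (𝓡 m).prod (𝓡 (2 * n))) p.2 (f := fun x => (p.1, x))
      (hw d) (mdifferentiableAt_const.prodMk mdifferentiableAt_id)
  have h1 : (fun u : U => toModel (w (u, p.2)))
      = fun u => ∑ d, T.lam d p.2 (w (u, p.2)) • toModel (T.V d p.2) :=
    funext fun u => (T.sum_eq p.2 (w (u, p.2))).symm
  have h2 : mvfderiv (𝓡 m) (fun u : U => toModel (w (u, p.2))) p.1 X
      = ∑ d, mvfderiv (𝓡 m) (fun u => T.lam d p.2 (w (u, p.2))) p.1 X • toModel (T.V d p.2) := by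
    rw [h1]
    refine (mvfderiv_sum_apply (fun d _ => (hl d).smul mdifferentiableAt_const) X).trans ?_
    refine Finset.sum_congr rfl fun d _ => ?_
    refine (mvfderiv_smul_apply' (hl d) mdifferentiableAt_const X).trans ?_
    rw [mvfderiv_const_apply, smul_zero, zero_add]
  have h3 := K.leviCivita_eq T p.1 hr v
  unfold covTM
  rw [h3]
  have h4 : ∀ d, mvfderiv ((𝓡 m).prod (𝓡 (2 * n))) (fun q => T.lam d q.2 (w q)) p (tPair X v)
      = mvfderiv (𝓡 m) (fun u => T.lam d p.2 (w (u, p.2))) p.1 X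
        + mvfderiv (𝓡 (2 * n)) (fun x => T.lam d x (w (p.1, x))) p.2 v := fun d => by
    rw [mvfderiv_tPair, mvfderiv_tPair_left (hw d), mvfderiv_tPair_right (hw d)]
  simp only [h4, add_smul, Finset.sum_add_distrib]
  rw [add_assoc]
  exact congrArg (· + _) h2

theorem projE_christoffel (a d : Fin T.card) (p : U × M) :
    K.projE p ((1 : ℂ) ⊗ₜ[ℝ] K.christoffel T a d p.1 p.2)
      = ∑ b, (K.Gam T a d b p : ℂ) • K.W T b p := by
  rw [K.projE_expand T]
  refine Finset.sum_congr rfl fun b _ => ?_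
  rw [lamC, formC_tmul, one_mul]
  rfl

theorem projE_connection (p : U × M) (v : TangentSpace (𝓡 (2 * n)) p.2)
    (a a' b b' : Fin T.card → ℝ) :
    K.projE p (cMk
      (∑ d, (a d • T.V d p.2 + b d • ∑ e, T.lam e p.2 v • K.christoffel T e d p.1 p.2))
      (∑ d, (a' d • T.V d p.2 + b' d • ∑ e, T.lam e p.2 v • K.christoffel T e d p.1 p.2)))
      = ∑ d, (((a d : ℂ) + Complex.I * a' d) • K.W T d p
        + ((b d : ℂ) + Complex.I * b' d) • ∑ e, (T.lam e p.2 v : ℂ) •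
            ∑ c, (K.Gam T e d c p : ℂ) • K.W T c p) := by
  rw [cMk_sum, map_sum]
  refine Finset.sum_congr rfl fun d _ => ?_
  rw [map_add, map_smul, map_smul, TensorProduct.tmul_sum, map_sum]
  congr 2
  refine Finset.sum_congr rfl fun e _ => ?_
  rw [smul_one_tmul, map_smul, projE_christoffel]

theorem covE_eq {W : ∀ p : U × M, K.E p} {p : U × M}
    (hW : ∀ d, MDifferentiableAt ((𝓡 m).prod (𝓡 (2 * n))) 𝓘(ℝ, ℂ)
      (fun q => lamC T d q.2 (W q).1) p)
    (X : TangentSpace (𝓡 m) p.1) (v : TangentSpace (𝓡 (2 * n)) p.2) :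
    K.covE W p X v
      = ∑ d, (mvfderiv ((𝓡 m).prod (𝓡 (2 * n))) (fun q => lamC T d q.2 (W q).1) p (tPair X v)
          • K.W T d p
        + lamC T d p.2 (W p).1 • ∑ e, (T.lam e p.2 v : ℂ) •
            ∑ c, (K.Gam T e d c p : ℂ) • K.W T c p) := by
  have hre : ∀ d, (fun q : U × M => T.lam d q.2 (cRe (W q).1))
      = fun q => Complex.reCLM (lamC T d q.2 (W q).1) := fun d => by
    funext q; simp [lamC, formC_apply]
  have him : ∀ d, (fun q : U × M => T.lam d q.2 (cIm (W q).1))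
      = fun q => Complex.imCLM (lamC T d q.2 (W q).1) := fun d => by
    funext q; simp [lamC, formC_apply]
  have h1 : ∀ d, MDifferentiableAt ((𝓡 m).prod (𝓡 (2 * n))) 𝓘(ℝ, ℝ)
      (fun q => T.lam d q.2 (cRe (W q).1)) p := fun d => by
    rw [hre]
    exact Complex.reCLM.differentiableAt.mdifferentiableAt.comp p (hW d)
  have h2 : ∀ d, MDifferentiableAt ((𝓡 m).prod (𝓡 (2 * n))) 𝓘(ℝ, ℝ)
      (fun q => T.lam d q.2 (cIm (W q).1)) p := fun d => by
    rw [him]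
    exact Complex.imCLM.differentiableAt.mdifferentiableAt.comp p (hW d)
  unfold covE
  rw [K.covTM_eq T h1, K.covTM_eq T h2, projE_connection]
  refine Finset.sum_congr rfl fun d _ => ?_
  congr 2
  · rw [hre, him, mvfderiv_clm_apply (hW d), mvfderiv_clm_apply (hW d)]
    simp [mul_comm Complex.I, Complex.re_add_im]
  · rw [lamC, formC_apply]

theorem covESlice_eq {u : U} {W : ∀ x : M, K.E (u, x)} {x : M}
    (hW : ∀ d, MDifferentiableAt (𝓡 (2 * n)) 𝓘(ℝ, ℂ) (fun y => lamC T d y (W y).1) x)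
    (v : TangentSpace (𝓡 (2 * n)) x) :
    K.covESlice u W x v
      = ∑ d, (mvfderiv (𝓡 (2 * n)) (fun y => lamC T d y (W y).1) x v • K.W T d (u, x)
        + lamC T d x (W x).1 • ∑ e, (T.lam e x v : ℂ) •
            ∑ c, (K.Gam T e d c (u, x) : ℂ) • K.W T c (u, x)) := by
  have hre : ∀ d, (fun y : M => T.lam d y (cRe (W y).1))
      = fun y => Complex.reCLM (lamC T d y (W y).1) := fun d => by
    funext q; simp [lamC, formC_apply]
  have him : ∀ d, (fun y : M => T.lam d y (cIm (W y).1))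
      = fun y => Complex.imCLM (lamC T d y (W y).1) := fun d => by
    funext q; simp [lamC, formC_apply]
  have h1 : ∀ d, MDifferentiableAt (𝓡 (2 * n)) 𝓘(ℝ, ℝ)
      (fun q => T.lam d q (cRe (W q).1)) x := fun d => by
    rw [hre]
    exact Complex.reCLM.differentiableAt.mdifferentiableAt.comp x (hW d)
  have h2 : ∀ d, MDifferentiableAt (𝓡 (2 * n)) 𝓘(ℝ, ℝ)
      (fun q => T.lam d q (cIm (W q).1)) x := fun d => by
    rw [him]
    exact Complex.imCLM.differentiableAt.mdifferentiableAt.comp x (hW d)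
  unfold covESlice
  rw [K.leviCivita_eq T u h1, K.leviCivita_eq T u h2]
  refine (K.projE_connection T (u, x) v _ _ _ _).trans ?_
  refine Finset.sum_congr rfl fun d _ => ?_
  congr 2
  · rw [hre, him, mvfderiv_clm_apply (hW d), mvfderiv_clm_apply (hW d)]
    simp [mul_comm Complex.I, Complex.re_add_im]
  · rw [lamC, formC_apply]

end KahlerFamily

end

/-! ### The variation of the complex structure, the tensor G(X) and the rank of E -/

section

theorem sum_smul_tmul_sum_smul {A B : Type*} [AddCommGroup A] [Module ℂ A] [AddCommGroup B]
    [Module ℂ B] {ι ι' : Type*} (s : Finset ι) (t : Finset ι') (α : ι → ℂ) (β : ι' → ℂ) (v : ι → A)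
    (w : ι' → B) : (∑ a ∈ s, α a • v a) ⊗ₜ[ℂ] (∑ b ∈ t, β b • w b)
      = ∑ a ∈ s, ∑ b ∈ t, (α a * β b) • (v a ⊗ₜ[ℂ] w b) := by
  rw [TensorProduct.sum_tmul]
  refine Finset.sum_congr rfl fun a _ => ?_
  rw [TensorProduct.tmul_sum]
  exact Finset.sum_congr rfl fun b _ => by
    rw [TensorProduct.tmul_smul, ← TensorProduct.smul_tmul', smul_smul, mul_comm]

variable {m n : ℕ}
  {U : Type*} [TopologicalSpace U] [ChartedSpace (EuclideanSpace ℝ (Fin m)) U]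
  {M : Type*} [TopologicalSpace M] [ChartedSpace (EuclideanSpace ℝ (Fin (2 * n))) M]
  [IsManifold (𝓡 m) ∞ U] [IsManifold (𝓡 (2 * n)) ∞ M]

namespace KahlerFamily

variable (K : KahlerFamily m n U M) (T : TFrame (2 * n) M)

/-- The derivative of the matrix of `j` in the direction of `U`. -/
def dJ (a b : Fin T.card) (p : U × M) (X : TangentSpace (𝓡 m) p.1) : ℝ :=
  mvfderiv ((𝓡 m).prod (𝓡 (2 * n))) (K.Jc T a b) p (tPair X 0)

/-- The derivative `X.j`. -/
def dj (p : U × M) (X : TangentSpace (𝓡 m) p.1) :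
    TangentSpace (𝓡 (2 * n)) p.2 →ₗ[ℝ] TangentSpace (𝓡 (2 * n)) p.2 :=
  ∑ a, ∑ b, K.dJ T a b p X • (T.lam a p.2).smulRight (T.V b p.2)

theorem dj_apply (p : U × M) (X : TangentSpace (𝓡 m) p.1) (v : TangentSpace (𝓡 (2 * n)) p.2) :
    K.dj T p X v = ∑ b, (∑ a, T.lam a p.2 v * K.dJ T a b p X) • T.V b p.2 := by
  simp only [dj, LinearMap.sum_apply, LinearMap.smul_apply, LinearMap.smulRight_apply,
    Finset.sum_smul]
  rw [Finset.sum_comm]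
  refine Finset.sum_congr rfl fun a _ => Finset.sum_congr rfl fun b _ => ?_
  exact (smul_smul _ _ _).trans (congrArg (· • _) (mul_comm _ _))

theorem dJ_eq (a b : Fin T.card) (p : U × M) (X : TangentSpace (𝓡 m) p.1) :
    K.dJ T a b p X = mvfderiv (𝓡 m) (fun u => K.Jc T a b (u, p.2)) p.1 X :=
  mvfderiv_tPair_left ((K.Jc_smooth T a b p).mdifferentiableAt (by simp)) X

theorem mdiff_Jc (a b : Fin T.card) (p : U × M) :
    MDifferentiableAt (𝓡 m) 𝓘(ℝ, ℝ) (fun u => K.Jc T a b (u, p.2)) p.1 :=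
  (smoothNear_of_contMDiff (K.Jc_smooth T a b) p).slice_left.mdiff

/-- Tested against arbitrary linear forms, the operator assembled from the derivatives of the matrix
entries is the derivative of j. The overcomplete frame makes the entries redundant, so this is not
automatic. -/
theorem mdiff_j (p : U × M) (l : TangentSpace (𝓡 (2 * n)) p.2 →ₗ[ℝ] ℝ)
    (v : TangentSpace (𝓡 (2 * n)) p.2) :
    MDifferentiableAt (𝓡 m) 𝓘(ℝ, ℝ) (fun u => l (K.j u p.2 v)) p.1
      ∧ ∀ X, mvfderiv (𝓡 m) (fun u => l (K.j u p.2 v)) p.1 X = l (K.dj T p X v) := by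
  have h : (fun u => l (K.j u p.2 v))
      = fun u => ∑ b, (∑ a, T.lam a p.2 v * K.Jc T a b (u, p.2)) * l (T.V b p.2) := by
    funext u
    conv_lhs => rw [K.j_expand T (u, p.2) v]
    simp only [map_sum, map_smul, smul_eq_mul]
  have h1 : ∀ b, SmoothNear (𝓡 m)
      (fun u => (∑ a, T.lam a p.2 v * K.Jc T a b (u, p.2))) p.1 := fun b =>
    SmoothNear.sum fun a _ =>
      (smoothNear_of_contMDiff (K.Jc_smooth T a b) p).slice_left.const_mul _
  rw [h]
  refine ⟨(SmoothNear.sum fun b _ => (h1 b).mul (smoothNear_const _ _)).mdiff, fun X => ?_⟩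
  refine (mvfderiv_sum_apply (fun b _ => ((h1 b).mul (smoothNear_const _ _)).mdiff) X).trans ?_
  rw [dj_apply, map_sum]
  refine Finset.sum_congr rfl fun b _ => ?_
  refine (mvfderiv_mul_apply (h1 b).mdiff mdifferentiableAt_const X).trans ?_
  rw [mvfderiv_const_apply, mul_zero, zero_add, map_smul, smul_eq_mul]
  congr 1
  refine (mvfderiv_sum_apply (fun a _ => ((K.mdiff_Jc T a b p).const_smul
    (T.lam a p.2 v : ℝ))) X).trans ?_
  refine Finset.sum_congr rfl fun a _ => ?_
  refine (mvfderiv_const_mul_apply (K.mdiff_Jc T a b p) _ X).trans ?_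
  rw [dJ_eq]

theorem lam_dj_V (a b : Fin T.card) (p : U × M) (X : TangentSpace (𝓡 m) p.1) :
    T.lam b p.2 (K.dj T p X (T.V a p.2)) = K.dJ T a b p X := by
  rw [dJ_eq, ← (K.mdiff_j T p (T.lam b p.2) (T.V a p.2)).2 X]
  rfl

theorem dj_V (a : Fin T.card) (p : U × M) (X : TangentSpace (𝓡 m) p.1) :
    K.dj T p X (T.V a p.2) = ∑ b, K.dJ T a b p X • T.V b p.2 := by
  conv_lhs => rw [← T.sum_eq p.2 (K.dj T p X (T.V a p.2))]
  exact Finset.sum_congr rfl fun b _ => by rw [lam_dj_V]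

theorem ext_lam (x : M) {v w : TangentSpace (𝓡 (2 * n)) x}
    (h : ∀ a, T.lam a x v = T.lam a x w) : v = w := by
  rw [← T.sum_eq x v, ← T.sum_eq x w]
  exact Finset.sum_congr rfl fun a _ => by rw [h]

theorem mvfderiv_pair (p : U × M) (B : Fin T.card → U → ℝ)
    (hB : ∀ b, MDifferentiableAt (𝓡 m) 𝓘(ℝ, ℝ) (B b) p.1)
    (w : TangentSpace (𝓡 (2 * n)) p.2) (X : TangentSpace (𝓡 m) p.1) :
    mvfderiv (𝓡 m) (fun u => ∑ b, T.lam b p.2 (K.j u p.2 w) * B b u) p.1 X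
      = ∑ b, (T.lam b p.2 (K.j p.1 p.2 w) * mvfderiv (𝓡 m) (B b) p.1 X
        + T.lam b p.2 (K.dj T p X w) * B b p.1) := by
  refine (mvfderiv_sum_apply (fun b _ => (K.mdiff_j T p (T.lam b p.2) w).1.mul (hB b)) X).trans ?_
  refine Finset.sum_congr rfl fun b _ => ?_
  refine (mvfderiv_mul_apply (K.mdiff_j T p (T.lam b p.2) w).1 (hB b) X).trans ?_
  rw [(K.mdiff_j T p (T.lam b p.2) w).2]

/-- This is the derivative of j² = -1 along X. -/
theorem dj_j (p : U × M) (X : TangentSpace (𝓡 m) p.1) (v : TangentSpace (𝓡 (2 * n)) p.2) :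
    K.dj T p X (K.j p.1 p.2 v) = -K.j p.1 p.2 (K.dj T p X v) := by
  apply ext_lam T
  intro a
  have h1 := K.mvfderiv_pair T p (fun b u => T.lam a p.2 (K.j u p.2 (T.V b p.2)))
    (fun b => (K.mdiff_j T p (T.lam a p.2) (T.V b p.2)).1) v X
  have h2 : (fun u => ∑ b, T.lam b p.2 (K.j u p.2 v) * T.lam a p.2 (K.j u p.2 (T.V b p.2)))
      = fun _ => T.lam a p.2 (-v) := by
    funext u
    rw [← K.j_sq u p.2 v]
    conv_rhs => rw [← T.sum_eq p.2 (K.j u p.2 v)]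
    simp only [map_sum, map_smul, smul_eq_mul]
  rw [h2, mvfderiv_const_apply] at h1
  simp only [(K.mdiff_j T p (T.lam a p.2) _).2 X] at h1
  rw [Finset.sum_add_distrib] at h1
  have h3 : ∀ w : TangentSpace (𝓡 (2 * n)) p.2, ∀ L : TangentSpace (𝓡 (2 * n)) p.2 →ₗ[ℝ] ℝ,
      ∑ b, T.lam b p.2 w * L (T.V b p.2) = L w := fun w L => by
    conv_rhs => rw [← T.sum_eq p.2 w]
    simp only [map_sum, map_smul, smul_eq_mul]
  have h4 := h3 (K.j p.1 p.2 v) (T.lam a p.2 ∘ₗ K.dj T p X)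
  have h5 := h3 (K.dj T p X v) (T.lam a p.2 ∘ₗ (K.j p.1 p.2).toLinearMap)
  simp only [LinearMap.comp_apply, ContinuousLinearMap.coe_coe] at h4 h5
  rw [h4, h5] at h1
  rw [map_neg]
  linarith

/-- The derivative of ω(jv, jw) = ω(v, w) along X, with -jw in place of w, gives the identity once
X.j is moved past j. -/
theorem symp_dj (p : U × M) (X : TangentSpace (𝓡 m) p.1) (v w : TangentSpace (𝓡 (2 * n)) p.2) :
    K.symp p.2 (K.dj T p X v) w = -K.symp p.2 v (K.dj T p X w) := by
  have key : ∀ v w, K.symp p.2 (K.j p.1 p.2 v) (K.dj T p X w)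
      + K.symp p.2 (K.dj T p X v) (K.j p.1 p.2 w) = 0 := by
    intro v w
    have h1 := K.mvfderiv_pair T p (fun b u => K.symp p.2 (T.V b p.2) (K.j u p.2 w))
      (fun b => (K.mdiff_j T p (K.symp p.2 (T.V b p.2)) w).1) v X
    have h3 : ∀ v : TangentSpace (𝓡 (2 * n)) p.2, ∀ w,
        ∑ b, T.lam b p.2 v * K.symp p.2 (T.V b p.2) w = K.symp p.2 v w := fun v w => by
      conv_rhs => rw [← T.sum_eq p.2 v]
      simp only [map_sum, map_smul, smul_eq_mul, LinearMap.sum_apply, LinearMap.smul_apply]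
    have h2 : (fun u => ∑ b, T.lam b p.2 (K.j u p.2 v) * K.symp p.2 (T.V b p.2) (K.j u p.2 w))
        = fun _ => K.symp p.2 v w := by
      funext u
      rw [h3, K.j_compatible]
    rw [h2, mvfderiv_const_apply] at h1
    simp only [(K.mdiff_j T p _ _).2 X] at h1
    rw [Finset.sum_add_distrib, h3, h3] at h1
    exact h1.symm
  have h := key v (-(K.j p.1 p.2 w))
  have h6 := K.j_compatible p.1 p.2 v (K.dj T p X w)
  simp only [map_neg, K.dj_j, K.j_sq, neg_neg] at h
  linarith

theorem djC_eq (p : U × M) (X : TangentSpace (𝓡 m) p.1)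
    (w : ℂ ⊗[ℝ] TangentSpace (𝓡 (2 * n)) p.2) :
    K.djC p X w = (K.dj T p X).baseChange ℂ w := by
  have h1 : ∀ v : TangentSpace (𝓡 (2 * n)) p.2,
      (ofModel (mvfderiv (𝓡 m) (fun u : U => toModel (K.j u p.2 v)) p.1 X) :
        TangentSpace (𝓡 (2 * n)) p.2) = K.dj T p X v := by
    intro v
    have h : (fun u : U => toModel (K.j u p.2 v))
        = fun u => ∑ b, T.lam b p.2 (K.j u p.2 v) • toModel (T.V b p.2) :=
      funext fun u => (T.sum_eq p.2 (K.j u p.2 v)).symm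
    rw [h]
    have h2 : mvfderiv (𝓡 m) (fun u => ∑ b, T.lam b p.2 (K.j u p.2 v) • toModel (T.V b p.2)) p.1 X
        = ∑ b, T.lam b p.2 (K.dj T p X v) • toModel (T.V b p.2) := by
      refine (mvfderiv_sum_apply (fun b _ => (K.mdiff_j T p (T.lam b p.2) v).1.smul
        mdifferentiableAt_const) X).trans ?_
      refine Finset.sum_congr rfl fun b _ => ?_
      refine (mvfderiv_smul_apply' (K.mdiff_j T p (T.lam b p.2) v).1
        mdifferentiableAt_const X).trans ?_
      rw [mvfderiv_const_apply, smul_zero, zero_add, (K.mdiff_j T p (T.lam b p.2) v).2]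
    rw [h2]
    exact T.sum_eq p.2 (K.dj T p X v)
  conv_rhs => rw [← one_tmul_re_add w, map_add, map_smul, LinearMap.baseChange_tmul,
    LinearMap.baseChange_tmul]
  rw [djC, h1, h1, cMk_eq]

/-- The complexified symplectic form. -/
def sympC (x : M) : LinearMap.BilinForm ℂ (ℂ ⊗[ℝ] TangentSpace (𝓡 (2 * n)) x) :=
  LinearMap.BilinForm.baseChange ℂ (K.symp x)

theorem sympC_tmul (x : M) (z w : ℂ) (a b : TangentSpace (𝓡 (2 * n)) x) :
    K.sympC x (z ⊗ₜ[ℝ] a) (w ⊗ₜ[ℝ] b) = z * w * K.symp x a b := by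
  simp [sympC, LinearMap.BilinForm.baseChange_tmul, mul_comm]

theorem sympC_jC (p : U × M) (a b : ℂ ⊗[ℝ] TangentSpace (𝓡 (2 * n)) p.2) :
    K.sympC p.2 (K.jC p a) (K.jC p b) = K.sympC p.2 a b := by
  induction a using TensorProduct.induction_on with
  | zero => simp
  | add x y hx hy => simp only [map_add, LinearMap.add_apply, hx, hy]
  | tmul z v =>
    induction b using TensorProduct.induction_on with
    | zero => simp
    | add x y hx hy => simp only [map_add, hx, hy]
    | tmul w v' => rw [jC_tmul, jC_tmul, sympC_tmul, sympC_tmul, K.j_compatible]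

/-- Invariance under j multiplies the pairing by i² = -1. This vanishing is what keeps k out of the
commutators of holomorphic derivatives. -/
theorem sympC_E {p : U × M} (e f : K.E p) : K.sympC p.2 e.1 f.1 = 0 := by
  have h := K.sympC_jC p e.1 f.1
  rw [jC_E, jC_E, map_smul, map_smul, LinearMap.smul_apply, smul_smul, Complex.I_mul_I,
    neg_one_smul] at h
  exact self_eq_neg.1 h.symm

theorem jC_Ebar {p : U × M} {w : ℂ ⊗[ℝ] TangentSpace (𝓡 (2 * n)) p.2} (hw : w ∈ K.Ebar p) :
    K.jC p w = -(Complex.I • w) := by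
  simp only [Ebar, LinearMap.mem_ker, LinearMap.add_apply, LinearMap.smul_apply,
    LinearMap.id_apply] at hw
  exact eq_neg_of_add_eq_zero_left hw

theorem sympC_Ebar {p : U × M} {w w' : ℂ ⊗[ℝ] TangentSpace (𝓡 (2 * n)) p.2}
    (hw : w ∈ K.Ebar p) (hw' : w' ∈ K.Ebar p) : K.sympC p.2 w w' = 0 := by
  have h := K.sympC_jC p w w'
  rw [K.jC_Ebar hw, K.jC_Ebar hw', map_neg, map_neg, LinearMap.neg_apply, neg_neg, map_smul,
    map_smul, LinearMap.smul_apply, smul_smul, Complex.I_mul_I, neg_one_smul] at h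
  exact self_eq_neg.1 h.symm

theorem projE_one_tmul (p : U × M) (v : TangentSpace (𝓡 (2 * n)) p.2) :
    (K.projE p ((1 : ℂ) ⊗ₜ[ℝ] v)).1 = (1 / 2 : ℂ) • ((1 : ℂ) ⊗ₜ[ℝ] v)
      + (-(Complex.I / 2)) • ((1 : ℂ) ⊗ₜ[ℝ] K.j p.1 p.2 v) := by
  rw [projE_val, jC_tmul]
  module

theorem projE_add_conj (p : U × M) (v : TangentSpace (𝓡 (2 * n)) p.2) :
    (K.projE p ((1 : ℂ) ⊗ₜ[ℝ] v)).1 + cConj (K.projE p ((1 : ℂ) ⊗ₜ[ℝ] v)).1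
      = (1 : ℂ) ⊗ₜ[ℝ] v := by
  rw [projE_one_tmul, cConj_add, cConj_smul, cConj_smul, cConj_tmul, cConj_tmul]
  simp only [map_div₀, map_one, map_neg, Complex.conj_I, Complex.conj_ofNat, neg_div, neg_neg]
  module

variable [T2Space M]

/-- Vectors of `E` dual to the frame. -/
def xiE (c : Fin T.card) (p : U × M) : K.E p :=
  K.projE p ((1 : ℂ) ⊗ₜ[ℝ] K.sharp p.2 (T.lam c p.2))

theorem sympC_sharp (c : Fin T.card) (x : M) (w : ℂ ⊗[ℝ] TangentSpace (𝓡 (2 * n)) x) :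
    K.sympC x ((1 : ℂ) ⊗ₜ[ℝ] K.sharp x (T.lam c x)) w = lamC T c x w := by
  induction w using TensorProduct.induction_on with
  | zero => simp
  | add a b ha hb => rw [map_add, map_add, ha, hb]
  | tmul z v => rw [sympC_tmul, lamC, formC_tmul, symp_sharp, one_mul]

theorem contract_tmul (p : U × M) (w : ℂ ⊗[ℝ] TangentSpace (𝓡 (2 * n)) p.2) (e f : K.E p) :
    K.contract p w (e ⊗ₜ[ℂ] f) = K.sympC p.2 e.1 w • f.1 := by
  simp [contract, sympC]

/-- Because E is isotropic, the coordinate form λ_c only sees the (0,1) part of its ω-dual when it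
is applied to E. So the coordinates of an element of E are its pairings with elements of Ē. -/
theorem E_expand_sharp {p : U × M} (e : K.E p) :
    e = ∑ c, K.sympC p.2 e.1 (-cConj (K.xiE T c p).1) • K.W T c p := by
  have h1 : ∀ c, lamC T c p.2 e.1 = K.sympC p.2 e.1 (-cConj (K.xiE T c p).1) := by
    intro c
    rw [map_neg]
    have hsw : ∀ a b : ℂ ⊗[ℝ] TangentSpace (𝓡 (2 * n)) p.2,
        K.sympC p.2 a b = -K.sympC p.2 b a := by
      intro a b
      induction a using TensorProduct.induction_on with
      | zero => simp
      | add x y hx hy => simp only [map_add, LinearMap.add_apply, hx, hy, neg_add]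
      | tmul z v =>
        induction b using TensorProduct.induction_on with
        | zero => simp
        | add x y hx hy => simp only [map_add, LinearMap.add_apply, hx, hy, neg_add]
        | tmul w v' =>
          rw [sympC_tmul, sympC_tmul, K.symp_neg_swap]
          push_cast
          ring
    rw [← K.sympC_sharp T c p.2 e.1, ← K.projE_add_conj p (K.sharp p.2 (T.lam c p.2)), map_add,
      LinearMap.add_apply, sympC_E, zero_add, hsw]
    rfl
  conv_lhs => rw [← K.E_expand T e]
  exact Finset.sum_congr rfl fun c _ => by rw [h1]

/-- A tensor is recovered from the contractions of its first factor with Ē, so the condition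
defining G(X) has at most one solution. -/
theorem tensor_expand {p : U × M} (t : K.E p ⊗[ℂ] K.E p) :
    t = ∑ c, K.W T c p ⊗ₜ[ℂ] K.projE p (K.contract p (-cConj (K.xiE T c p).1) t) := by
  induction t using TensorProduct.induction_on with
  | zero => simp
  | add x y hx hy =>
    conv_lhs => rw [hx, hy]
    simp only [map_add, TensorProduct.tmul_add, Finset.sum_add_distrib]
  | tmul e f =>
    have h : ∀ c, K.W T c p ⊗ₜ[ℂ] K.projE p (K.contract p (-cConj (K.xiE T c p).1) (e ⊗ₜ[ℂ] f))
        = (K.sympC p.2 e.1 (-cConj (K.xiE T c p).1) • K.W T c p) ⊗ₜ[ℂ] f := fun c => by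
      rw [contract_tmul, map_smul, projE_E, TensorProduct.smul_tmul]
    simp only [h]
    rw [← TensorProduct.sum_tmul]
    exact congrArg (· ⊗ₜ[ℂ] f) (K.E_expand_sharp T e)

theorem djC_Ebar {p : U × M} (X : TangentSpace (𝓡 m) p.1)
    {w : ℂ ⊗[ℝ] TangentSpace (𝓡 (2 * n)) p.2} (hw : w ∈ K.Ebar p) :
    (K.dj T p X).baseChange ℂ w ∈ K.E p := by
  have h : ∀ w, K.jC p ((K.dj T p X).baseChange ℂ w) = -(K.dj T p X).baseChange ℂ (K.jC p w) := by
    intro w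
    induction w using TensorProduct.induction_on with
    | zero => simp
    | add x y hx hy => simp only [map_add, hx, hy, neg_add]
    | tmul z v =>
      rw [jC_tmul, LinearMap.baseChange_tmul, LinearMap.baseChange_tmul, jC_tmul, dj_j,
        TensorProduct.tmul_neg, neg_neg]
  simp only [E, LinearMap.mem_ker, LinearMap.sub_apply, LinearMap.smul_apply, LinearMap.id_apply]
  rw [h, K.jC_Ebar hw, map_neg, neg_neg, map_smul, sub_self]

/-- For w in Ē one has λ_c(w) = ω(ξ_c, w), and (X.j)w lies in E because X.j anticommutes with j.
Applying π ∘ (X.j) to w = ∑ λ_c(w) V_c shows that the right-hand side solves the defining equation;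
`tensor_expand` gives uniqueness. -/
theorem G_eq (p : U × M) (X : TangentSpace (𝓡 m) p.1) :
    K.G p X = ∑ c, K.xiE T c p ⊗ₜ[ℂ] K.projE p ((1 : ℂ) ⊗ₜ[ℝ] K.dj T p X (T.V c p.2)) := by
  set G₀ := ∑ c, K.xiE T c p ⊗ₜ[ℂ] K.projE p ((1 : ℂ) ⊗ₜ[ℝ] K.dj T p X (T.V c p.2)) with hG₀
  have hex : ∀ w ∈ K.Ebar p, K.contract p w G₀ = K.djC p X w := by
    intro w hw
    rw [K.djC_eq T]
    have h0 := K.projE_E ⟨_, K.djC_Ebar T X hw⟩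
    have h1 : ∀ c, K.sympC p.2 (K.xiE T c p).1 w = lamC T c p.2 w := by
      intro c
      rw [← K.sympC_sharp T c p.2 w, ← K.projE_add_conj p (K.sharp p.2 (T.lam c p.2)), map_add,
        LinearMap.add_apply, K.sympC_Ebar (K.cConj_E _) hw, add_zero]
      rfl
    have h2 : K.contract p w G₀ = (K.projE p ((K.dj T p X).baseChange ℂ w)).1 := by
      rw [hG₀, map_sum]
      conv_rhs => rw [← lamC_expand T p.2 w, map_sum, map_sum]
      rw [AddSubmonoidClass.coe_finsetSum]
      refine Finset.sum_congr rfl fun c _ => ?_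
      rw [contract_tmul, h1, map_smul, LinearMap.baseChange_tmul, map_smul]
      rfl
    rw [h2, h0]
  have hspec := Classical.epsilon_spec
    (p := fun t => ∀ w ∈ K.Ebar p, K.contract p w t = K.djC p X w) ⟨G₀, hex⟩
  rw [K.tensor_expand T (K.G p X), K.tensor_expand T G₀]
  refine Finset.sum_congr rfl fun c _ => ?_
  have hm : -cConj (K.xiE T c p).1 ∈ K.Ebar p := (K.Ebar p).neg_mem (K.cConj_E _)
  have h : K.contract p _ (K.G p X) = _ := hspec _ hm
  rw [h, hex _ hm]

/-- The components of `G(X)` in the frame. -/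
def Gc (a b : Fin T.card) (p : U × M) (X : TangentSpace (𝓡 m) p.1) : ℝ :=
  ∑ c, T.lam a p.2 (K.sharp p.2 (T.lam c p.2)) * K.dJ T c b p X

theorem G_eq_sum (p : U × M) (X : TangentSpace (𝓡 m) p.1) :
    K.G p X = ∑ a, ∑ b, (K.Gc T a b p X : ℂ) • (K.W T a p ⊗ₜ[ℂ] K.W T b p) := by
  rw [G_eq K T]
  have h1 : ∀ c, K.xiE T c p
      = ∑ a, (T.lam a p.2 (K.sharp p.2 (T.lam c p.2)) : ℂ) • K.W T a p := fun c => by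
    rw [xiE, K.projE_expand T]
    exact Finset.sum_congr rfl fun a _ => by rw [lamC, formC_tmul, one_mul]
  have h2 : ∀ c, K.projE p ((1 : ℂ) ⊗ₜ[ℝ] K.dj T p X (T.V c p.2))
      = ∑ b, (K.dJ T c b p X : ℂ) • K.W T b p := fun c => by
    rw [K.projE_expand T]
    exact Finset.sum_congr rfl fun a _ => by rw [lamC, formC_tmul, one_mul, lam_dj_V]
  simp only [h1, h2, sum_smul_tmul_sum_smul]
  rw [Finset.sum_comm]
  refine Finset.sum_congr rfl fun a _ => ?_
  rw [Finset.sum_comm]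
  refine Finset.sum_congr rfl fun b _ => ?_
  rw [← Finset.sum_smul, Gc]
  push_cast
  rfl

theorem dJ_smooth (a b : Fin T.card) {X : ∀ u : U, TangentSpace (𝓡 m) u} (hX : IsSmoothVF X) :
    ContMDiff ((𝓡 m).prod (𝓡 (2 * n))) 𝓘(ℝ, ℝ) ∞ fun p : U × M => K.dJ T a b p (X p.1) :=
  contMDiff_mvfderiv_apply (K.Jc_smooth T a b) (contMDiff_tPair_left hX)

theorem Gc_smooth (a b : Fin T.card) {X : ∀ u : U, TangentSpace (𝓡 m) u} (hX : IsSmoothVF X) :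
    ContMDiff ((𝓡 m).prod (𝓡 (2 * n))) 𝓘(ℝ, ℝ) ∞ fun p : U × M => K.Gc T a b p (X p.1) := by
  apply contMDiff_of_smoothNear
  intro p
  exact SmoothNear.sum fun c _ => (smoothNear_of_contMDiff
    ((T.isSmoothVF_iff.1 (K.sharp_smooth T c) a).comp contMDiff_snd) p).mul
    (smoothNear_of_contMDiff (K.dJ_smooth T c b hX) p)

/-! #### Dimension of `E` and traces -/

/-- The projection v ↦ π(v) is a real isomorphism of the tangent space onto E, with twice the real
part as inverse, so that E has real dimension 2n. -/
theorem finrank_E (p : U × M) : Module.finrank ℂ (K.E p) = n := by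
  let F : TangentSpace (𝓡 (2 * n)) p.2 →ₗ[ℝ] K.E p :=
    { toFun := fun v => K.projE p ((1 : ℂ) ⊗ₜ[ℝ] v)
      map_add' := fun v w => by rw [TensorProduct.tmul_add, map_add]
      map_smul' := fun r v => by
        rw [smul_one_tmul, map_smul]
        rfl }
  have hF : ∀ v, (F v).1 = (K.projE p ((1 : ℂ) ⊗ₜ[ℝ] v)).1 := fun v => rfl
  have hre : ∀ v, cRe (F v).1 = (1 / 2 : ℝ) • v := fun v => by
    rw [hF, projE_one_tmul]
    simp [TensorProduct.smul_tmul']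
  have hinj : Function.Injective F := by
    rw [← LinearMap.ker_eq_bot, LinearMap.ker_eq_bot']
    intro v hv
    have := hre v
    rw [hv] at this
    simpa using this.symm
  have hsurj : Function.Surjective F := by
    intro e
    refine ⟨(2 : ℝ) • cRe e.1, Subtype.ext ?_⟩
    have h1 : K.j p.1 p.2 (cRe e.1) = -cIm e.1 := by
      have h2 := congrArg cRe (K.jC_E e)
      rw [cRe_I_smul, ← one_tmul_re_add e.1, map_add, map_smul, jC_tmul, jC_tmul] at h2
      simpa [TensorProduct.smul_tmul'] using h2
    rw [hF, projE_one_tmul, map_smul, h1]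
    conv_rhs => rw [← one_tmul_re_add e.1]
    rw [smul_one_tmul, smul_one_tmul, TensorProduct.tmul_neg]
    push_cast
    module
  have h1 := (LinearEquiv.ofBijective F ⟨hinj, hsurj⟩).finrank_eq
  have h2 := Module.finrank_mul_finrank ℝ ℂ (K.E p)
  rw [← h1, finrank_tangentSpace, Complex.finrank_real_complex] at h2
  omega

end KahlerFamily

end

/-! ### Alternating forms of top degree -/

section

section TopForms

variable {E : Type*} [AddCommGroup E] [Module ℂ E] {n : ℕ}

/-- The trace of an endomorphism does not depend on the frame used to compute it. -/
theorem sum_coord_eq_sum_coord {ι κ : Type*} [Fintype ι] [Fintype κ] {l : ι → E →ₗ[ℂ] ℂ} {w : ι → E}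
    {l' : κ → E →ₗ[ℂ] ℂ} {w' : κ → E} (h : ∀ e, ∑ a, l a e • w a = e)
    (h' : ∀ e, ∑ a, l' a e • w' a = e) (S : E →ₗ[ℂ] E) :
    ∑ a, l a (S (w a)) = ∑ b, l' b (S (w' b)) := by
  have h1 : ∀ a, l a (S (w a)) = ∑ b, l' b (w a) * l a (S (w' b)) := fun a => by
    conv_lhs => rw [← h' (w a)]
    simp only [map_sum, map_smul, smul_eq_mul]
  have h2 : ∀ b, l' b (S (w' b)) = ∑ a, l' b (w a) * l a (S (w' b)) := fun b => by
    conv_lhs => rw [← h (S (w' b))]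
    simp only [map_sum, map_smul, smul_eq_mul]
    exact Finset.sum_congr rfl fun a _ => mul_comm _ _
  simp only [h1, h2]
  exact Finset.sum_comm

theorem topForm_ext (b : Module.Basis (Fin n) ℂ E) {Φ Ψ : E [⋀^Fin n]→ₗ[ℂ] ℂ} (h : Φ b = Ψ b) :
    Φ = Ψ := by
  refine Module.Basis.ext_alternating b fun v hv => ?_
  let σ : Equiv.Perm (Fin n) := Equiv.ofBijective v (Finite.injective_iff_bijective.1 hv)
  have h1 := Φ.map_perm b σ
  have h2 := Ψ.map_perm b σ
  rw [h] at h1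
  exact h1.trans h2.symm

/-- The action of an endomorphism as a derivation on alternating forms. -/
def derivAlt (Φ : E [⋀^Fin n]→ₗ[ℂ] ℂ) (S : E →ₗ[ℂ] E) : E [⋀^Fin n]→ₗ[ℂ] ℂ :=
  { ∑ l, Φ.toMultilinearMap.compLinearMap fun i => if i = l then S else LinearMap.id with
    map_eq_zero_of_eq' := by
      intro v i j hv hij
      have h1 : ∀ l, (Φ.toMultilinearMap.compLinearMap
          fun i => if i = l then S else LinearMap.id) v = Φ (Function.update v l (S (v l))) := by
        intro l
        rw [MultilinearMap.compLinearMap_apply]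
        refine congrArg Φ (funext fun i => ?_)
        by_cases h : i = l
        · subst h; simp
        · simp [h]
      have h2 : (∑ l, Φ.toMultilinearMap.compLinearMap
          fun i => if i = l then S else LinearMap.id) v
          = ∑ l, Φ (Function.update v l (S (v l))) := by
        rw [_root_.sum_apply]
        exact Finset.sum_congr rfl fun l _ => h1 l
      refine h2.trans ?_
      -- When v_i = v_j, the terms in which S acts on slot i and on slot j differ by a transposition
      -- and cancel; in the other terms the repeated argument survives.
      rw [Finset.sum_eq_add i j hij]
      · have h3 : Function.update v j (S (v j))
            = Function.update v i (S (v i)) ∘ Equiv.swap i j := by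
          funext k
          by_cases hki : k = i
          · subst hki
            simp [hij, hv, Function.update_of_ne hij.symm]
          · by_cases hkj : k = j
            · subst hkj
              simp [hv]
            · simp [Equiv.swap_apply_of_ne_of_ne hki hkj, hki, hkj]
        rw [h3, Φ.map_swap _ hij, add_neg_cancel]
      · intro l _ hl
        exact Φ.map_eq_zero_of_eq _ (by simp [hl.1.symm, hl.2.symm, hv]) hij
      · simp
      · simp }

theorem derivAlt_apply (Φ : E [⋀^Fin n]→ₗ[ℂ] ℂ) (S : E →ₗ[ℂ] E) (v : Fin n → E) :
    derivAlt Φ S v = ∑ l, Φ (Function.update v l (S (v l))) := by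
  have h1 : ∀ l, (Φ.toMultilinearMap.compLinearMap
      fun i => if i = l then S else LinearMap.id) v = Φ (Function.update v l (S (v l))) := by
    intro l
    rw [MultilinearMap.compLinearMap_apply]
    refine congrArg Φ (funext fun i => ?_)
    by_cases h : i = l
    · subst h; simp
    · simp [h]
  have h2 : derivAlt Φ S v = (∑ l, Φ.toMultilinearMap.compLinearMap
      fun i => if i = l then S else LinearMap.id) v := rfl
  rw [h2, _root_.sum_apply]
  exact Finset.sum_congr rfl fun l _ => h1 l

/-- Both sides are alternating of top degree in v, hence may be compared on a single basis, where
only the diagonal coefficients of S survive. Independence of the trace from the frame then allows an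
overcomplete frame. -/
theorem sum_topForm_update [FiniteDimensional ℂ E] (hn : Module.finrank ℂ E = n) {ι : Type*}
    [Fintype ι] {l : ι → E →ₗ[ℂ] ℂ} {w : ι → E} (h : ∀ e, ∑ a, l a e • w a = e)
    (Φ : E [⋀^Fin n]→ₗ[ℂ] ℂ) (S : E →ₗ[ℂ] E) (v : Fin n → E) :
    ∑ i, Φ (Function.update v i (S (v i))) = (∑ a, l a (S (w a))) * Φ v := by
  let b := Module.finBasisOfFinrankEq ℂ E hn
  have h1 : derivAlt Φ S = (∑ a, l a (S (w a))) • Φ := by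
    apply topForm_ext b
    rw [derivAlt_apply, AlternatingMap.smul_apply,
      sum_coord_eq_sum_coord (l' := fun i => b.coord i) (w' := b) h (fun e => b.sum_repr e) S,
      smul_eq_mul, Finset.sum_mul]
    refine Finset.sum_congr rfl fun i _ => ?_
    conv_lhs => rw [← b.sum_repr (S (b i))]
    rw [AlternatingMap.map_update_sum]
    rw [Finset.sum_eq_single i]
    · rw [AlternatingMap.map_update_smul, Function.update_eq_self]
      rfl
    · intro k _ hk
      rw [AlternatingMap.map_update_smul, Φ.map_update_self _ hk.symm, smul_zero]
    · simp
  rw [← derivAlt_apply, h1]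
  rfl

theorem topForm_line [FiniteDimensional ℂ E] (hn : Module.finrank ℂ E = n)
    {Φ : E [⋀^Fin n]→ₗ[ℂ] ℂ} {v₀ : Fin n → E} (h0 : Φ v₀ ≠ 0) (Ψ : E [⋀^Fin n]→ₗ[ℂ] ℂ)
    (v : Fin n → E) : Ψ v = Ψ v₀ / Φ v₀ * Φ v := by
  have hli : LinearIndependent ℂ v₀ := by
    by_contra hd
    exact h0 (Φ.map_linearDependent v₀ hd)
  let b := Module.Basis.mk hli (hli.span_eq_top_of_card_eq_finrank' (by simp [hn])).ge
  have hb : (b : Fin n → E) = v₀ := Module.Basis.coe_mk _ _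
  have : Ψ = (Ψ v₀ / Φ v₀) • Φ := by
    apply topForm_ext b
    rw [hb, AlternatingMap.smul_apply, smul_eq_mul, div_mul_cancel₀ _ h0]
  conv_lhs => rw [this]
  rfl

theorem multilinear_expand {ι : Type*} [Fintype ι] (Φ : E [⋀^Fin n]→ₗ[ℂ] ℂ)
    (c : Fin n → ι → ℂ) (w : ι → E) :
    Φ (fun i => ∑ b, c i b • w b) = ∑ f : Fin n → ι, (∏ i, c i (f i)) * Φ fun i => w (f i) := by
  classical
  refine (Φ.toMultilinearMap.map_sum _).trans ?_
  refine Finset.sum_congr rfl fun f _ => ?_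
  exact Φ.toMultilinearMap.map_smul_univ (fun i => c i (f i)) fun i => w (f i)

end TopForms

/-! ### Derivatives of multilinear expansions -/

section ProductRule

variable {E : Type*} [NormedAddCommGroup E] [NormedSpace ℝ E] {H : Type*} [TopologicalSpace H]
  {I : ModelWithCorners ℝ E H} {N : Type*} [TopologicalSpace N] [ChartedSpace H N]

theorem mvfderiv_prod_apply {ι : Type*} [DecidableEq ι] (s : Finset ι) {a : ι → N → ℂ} {p : N}
    (ha : ∀ i, MDifferentiableAt I 𝓘(ℝ, ℂ) (a i) p) (v : TangentSpace I p) :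
    MDifferentiableAt I 𝓘(ℝ, ℂ) (fun q => ∏ i ∈ s, a i q) p ∧
    mvfderiv I (fun q => ∏ i ∈ s, a i q) p v
      = ∑ l ∈ s, ∏ i ∈ s, Function.update (fun i => a i p) l (mvfderiv I (a l) p v) i := by
  induction s using Finset.induction_on with
  | empty =>
    simp only [Finset.prod_empty, Finset.sum_empty]
    exact ⟨mdifferentiableAt_const, mvfderiv_const_apply _ _ _⟩
  | insert j s hj ih =>
    simp only [Finset.prod_insert hj, Finset.sum_insert hj]
    refine ⟨(ha j).mul ih.1, ?_⟩
    refine (mvfderiv_mul_apply (ha j) ih.1 v).trans ?_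
    rw [ih.2, add_comm, Finset.mul_sum]
    congr 1
    · rw [Function.update_self]
      congr 1
      exact Finset.prod_congr rfl fun i hi => by
        rw [Function.update_of_ne (ne_of_mem_of_not_mem hi hj)]
    · refine Finset.sum_congr rfl fun l hl => ?_
      rw [Function.update_of_ne (ne_of_mem_of_not_mem hl hj).symm]

theorem mvfderiv_expand {n : ℕ} {ι : Type*} [Fintype ι] {c : Fin n → ι → N → ℂ}
    {μ : (Fin n → ι) → N → ℂ} {p : N} (hc : ∀ i b, MDifferentiableAt I 𝓘(ℝ, ℂ) (c i b) p)
    (hμ : ∀ f, MDifferentiableAt I 𝓘(ℝ, ℂ) (μ f) p) (v : TangentSpace I p) :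
    mvfderiv I (fun q => ∑ f : Fin n → ι, (∏ i, c i (f i) q) * μ f q) p v
      = ∑ f : Fin n → ι, (∏ i, c i (f i) p) * mvfderiv I (μ f) p v
        + ∑ l, ∑ f : Fin n → ι, (∏ i, Function.update (fun i b => c i b p) l
            (fun b => mvfderiv I (c l b) p v) i (f i)) * μ f p := by
  classical
  have h1 : ∀ f : Fin n → ι, _ := fun f =>
    mvfderiv_prod_apply (Finset.univ : Finset (Fin n)) (fun i => hc i (f i)) v
  refine (mvfderiv_sum_apply (fun f _ => (h1 f).1.mul (hμ f)) v).trans ?_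
  rw [Finset.sum_comm (s := (Finset.univ : Finset (Fin n))), ← Finset.sum_add_distrib]
  refine Finset.sum_congr rfl fun f _ => ?_
  refine (mvfderiv_mul_apply (h1 f).1 (hμ f) v).trans ?_
  rw [(h1 f).2, Finset.sum_mul]
  congr 1
  refine Finset.sum_congr rfl fun l _ => ?_
  congr 1
  refine Finset.prod_congr rfl fun i _ => ?_
  by_cases h : i = l
  · subst h; simp
  · simp [h]

end ProductRule

/-! ### The derivation action of matrices on families indexed by multi-indices -/

section IndexAlgebra

variable {n : ℕ} {ι : Type*} [Fintype ι]

/-- The action of a matrix as a derivation on families indexed by multi-indices. -/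
def indexDeriv (B : ι → ι → ℂ) (μ : (Fin n → ι) → ℂ) (f : Fin n → ι) : ℂ :=
  ∑ l, ∑ b, B (f l) b * μ (Function.update f l b)

/-- Actions on two distinct slots commute; their total, the sum of `off`, is symmetric in B and C
and cancels. Two successive actions on the same slot multiply the matrices and leave their
commutator. -/
theorem indexDeriv_commutator (B C : ι → ι → ℂ) (μ : (Fin n → ι) → ℂ) (f : Fin n → ι) :
    indexDeriv B (indexDeriv C μ) f - indexDeriv C (indexDeriv B μ) f
      = indexDeriv (fun a c => ∑ b, (B a b * C b c - C a b * B b c)) μ f := by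
  let off : (ι → ι → ℂ) → (ι → ι → ℂ) → Fin n → Fin n → ℂ := fun B C l k =>
    if k = l then 0 else ∑ b, ∑ c, B (f l) b * (C (f k) c
      * μ (Function.update (Function.update f l b) k c))
  have key : ∀ B C : ι → ι → ℂ, indexDeriv B (indexDeriv C μ) f
      = ∑ l, ∑ c, (∑ b, B (f l) b * C b c) * μ (Function.update f l c)
        + ∑ l, ∑ k, off B C l k := by
    intro B C
    rw [← Finset.sum_add_distrib]
    refine Finset.sum_congr rfl fun l _ => ?_
    have h1 : ∀ b, indexDeriv C μ (Function.update f l b)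
        = ∑ c, C b c * μ (Function.update f l c)
          + ∑ k, (if k = l then 0 else ∑ c, C (f k) c
            * μ (Function.update (Function.update f l b) k c)) := by
      intro b
      rw [indexDeriv, ← Finset.add_sum_erase _ _ (Finset.mem_univ l),
        ← Finset.add_sum_erase (a := l) _ (fun k => if k = l then (0 : ℂ) else _)
          (Finset.mem_univ l)]
      simp only [if_true, zero_add, Function.update_self, Function.update_idem]
      congr 1
      refine Finset.sum_congr rfl fun k hk => ?_
      have hkl := Finset.ne_of_mem_erase hk
      rw [if_neg hkl]
      exact Finset.sum_congr rfl fun c _ => by rw [Function.update_of_ne hkl]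
    simp only [h1, mul_add, Finset.sum_add_distrib]
    congr 1
    · simp only [Finset.mul_sum, Finset.sum_mul]
      rw [Finset.sum_comm]
      exact Finset.sum_congr rfl fun c _ => Finset.sum_congr rfl fun b _ => by ring
    · simp only [Finset.mul_sum]
      rw [Finset.sum_comm]
      refine Finset.sum_congr rfl fun k _ => ?_
      by_cases hkl : k = l
      · simp [off, hkl]
      · simp [off, hkl, Finset.mul_sum]
  have hoff : ∑ l, ∑ k, off B C l k = ∑ l, ∑ k, off C B l k := by
    rw [Finset.sum_comm]
    refine Finset.sum_congr rfl fun l _ => Finset.sum_congr rfl fun k _ => ?_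
    by_cases hkl : k = l
    · simp [off, hkl]
    · simp only [off, if_neg hkl, if_neg (Ne.symm hkl)]
      rw [Finset.sum_comm]
      refine Finset.sum_congr rfl fun b _ => Finset.sum_congr rfl fun c _ => ?_
      rw [Function.update_comm hkl]
      ring
  rw [key B C, key C B, hoff, add_sub_add_right_eq_sub, indexDeriv, ← Finset.sum_sub_distrib]
  refine Finset.sum_congr rfl fun l _ => ?_
  rw [← Finset.sum_sub_distrib]
  refine Finset.sum_congr rfl fun c _ => ?_
  rw [Finset.sum_sub_distrib, sub_mul]

end IndexAlgebra

end

/-! ### The matrix of the connection of E and the existence of the connection form of δ -/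

section

theorem sum_smul_sum_smul {A ι κ : Type*} [AddCommGroup A] [Module ℂ A] [Fintype ι] [Fintype κ]
    (β : κ → ℂ) (γ : κ → ι → ℂ) (w : ι → A) :
    ∑ e, β e • ∑ c, γ e c • w c = ∑ c, (∑ e, β e * γ e c) • w c := by
  simp only [Finset.smul_sum, Finset.sum_smul, smul_smul]
  exact Finset.sum_comm

theorem mdifferentiableAt_sum_apply {E H N F : Type*} [NormedAddCommGroup E] [NormedSpace ℝ E]
    [TopologicalSpace H] {I : ModelWithCorners ℝ E H} [TopologicalSpace N] [ChartedSpace H N]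
    [NormedAddCommGroup F] [NormedSpace ℝ F] {ι : Type*} {s : Finset ι} {f : ι → N → F} {p : N}
    (hf : ∀ i ∈ s, MDifferentiableAt I 𝓘(ℝ, F) (f i) p) :
    MDifferentiableAt I 𝓘(ℝ, F) (fun q => ∑ i ∈ s, f i q) p := by
  classical
  induction s using Finset.induction_on with
  | empty => simpa using mdifferentiableAt_const
  | insert i s hi ih =>
    simp only [Finset.sum_insert hi]
    exact (hf i (Finset.mem_insert_self i s)).add
      (ih fun l hl => hf l (Finset.mem_insert_of_mem hl))

/-- The algebra common to the Leibniz rules over U × M and over a slice, for a field ∑ f_i e_i. Here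
w and L are the coordinates of this field and of the e_i in the frame W, the prefix z marks their
derivatives, and PG stands for the covariant derivative coming from Christoffel terms. -/
theorem leibniz_algebra {A ι κ : Type*} [AddCommGroup A] [Module ℂ A] [Fintype ι] [Fintype κ]
    {w zw : ι → ℂ} {f zf : κ → ℂ} {L ZL : κ → ι → ℂ} {W PG : ι → A} {e : κ → A}
    (h1 : ∀ d, w d = ∑ i, f i * L i d) (h2 : ∀ d, zw d = ∑ i, (f i * ZL i d + zf i * L i d))
    (h3 : ∀ i, ∑ d, L i d • W d = e i) :
    ∑ d, (zw d • W d + w d • PG d)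
      = ∑ i, (zf i • e i + f i • ∑ d, (ZL i d • W d + L i d • PG d)) := by
  simp only [h1, h2, ← h3, Finset.sum_smul, Finset.smul_sum, add_smul, smul_add, mul_smul,
    Finset.sum_add_distrib]
  rw [Finset.sum_comm (f := fun d i => f i • ZL i d • W d),
    Finset.sum_comm (f := fun d i => zf i • L i d • W d),
    Finset.sum_comm (f := fun d i => f i • L i d • PG d)]
  abel

variable {m n : ℕ}
  {U : Type*} [TopologicalSpace U] [ChartedSpace (EuclideanSpace ℝ (Fin m)) U]
  {M : Type*} [TopologicalSpace M] [ChartedSpace (EuclideanSpace ℝ (Fin (2 * n))) M]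
  [IsManifold (𝓡 m) ∞ U] [IsManifold (𝓡 (2 * n)) ∞ M]

section Commutators

variable {F : Type*} [NormedAddCommGroup F] [NormedSpace ℝ F] {f : U × M → F} {p : U × M}

theorem smoothNear_mvfderiv_left [T2Space U] [T2Space M]
    (hf : SmoothNear ((𝓡 m).prod (𝓡 (2 * n))) f p)
    {X : ∀ u : U, TangentSpace (𝓡 m) u} (hX : IsSmoothVF X) :
    SmoothNear ((𝓡 m).prod (𝓡 (2 * n)))
      (fun q => mvfderiv ((𝓡 m).prod (𝓡 (2 * n))) f q (tPair (X q.1) 0)) p :=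
  hf.mvfderiv (contMDiff_tPair_left hX)

theorem smoothNear_mvfderiv_right [T2Space U] [T2Space M]
    (hf : SmoothNear ((𝓡 m).prod (𝓡 (2 * n))) f p)
    {V : ∀ x : M, TangentSpace (𝓡 (2 * n)) x} (hV : IsSmoothVF V) :
    SmoothNear ((𝓡 m).prod (𝓡 (2 * n)))
      (fun q => mvfderiv ((𝓡 m).prod (𝓡 (2 * n))) f q (tPair 0 (V q.2))) p :=
  hf.mvfderiv (contMDiff_tPair_right hV)

theorem mvfderiv_left_commutator [T2Space U] [T2Space M]
    (hf : SmoothNear ((𝓡 m).prod (𝓡 (2 * n))) f p)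
    {X Y : ∀ u : U, TangentSpace (𝓡 m) u} (hX : IsSmoothVF X) (hY : IsSmoothVF Y) :
    mvfderiv ((𝓡 m).prod (𝓡 (2 * n)))
        (fun q => mvfderiv ((𝓡 m).prod (𝓡 (2 * n))) f q (tPair (Y q.1) 0)) p (tPair (X p.1) 0)
      - mvfderiv ((𝓡 m).prod (𝓡 (2 * n)))
        (fun q => mvfderiv ((𝓡 m).prod (𝓡 (2 * n))) f q (tPair (X q.1) 0)) p (tPair (Y p.1) 0)
      = mvfderiv ((𝓡 m).prod (𝓡 (2 * n))) f p
          (tPair (VectorField.mlieBracket (𝓡 m) X Y p.1) 0) := by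
  have h1 : ∀ {X Y : ∀ u : U, TangentSpace (𝓡 m) u}, IsSmoothVF X → IsSmoothVF Y →
      mvfderiv ((𝓡 m).prod (𝓡 (2 * n)))
        (fun q => mvfderiv ((𝓡 m).prod (𝓡 (2 * n))) f q (tPair (Y q.1) 0)) p (tPair (X p.1) 0)
      = mvfderiv (𝓡 m) (fun u => mvfderiv (𝓡 m) (fun u' => f (u', p.2)) u (Y u)) p.1 (X p.1) := by
    intro X Y hX hY
    rw [mvfderiv_tPair_left (smoothNear_mvfderiv_left hf hY).mdiff]
    congr 1
    refine mvfderiv_congr ?_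
    have hc : ContinuousAt (fun u : U => ((u, p.2) : U × M)) p.1 :=
      (continuous_id.prodMk continuous_const).continuousAt
    filter_upwards [hc.eventually hf.eventually] with u hu
    exact mvfderiv_tPair_left (p := (u, p.2)) hu.mdiff (Y u)
  rw [h1 hX hY, h1 hY hX, mvfderiv_tPair_left hf.mdiff]
  exact mvfderiv_commutator hf.slice_left hX hY

theorem mvfderiv_right_commutator [T2Space U] [T2Space M]
    (hf : SmoothNear ((𝓡 m).prod (𝓡 (2 * n))) f p)
    {X Y : ∀ x : M, TangentSpace (𝓡 (2 * n)) x} (hX : IsSmoothVF X) (hY : IsSmoothVF Y) :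
    mvfderiv ((𝓡 m).prod (𝓡 (2 * n)))
        (fun q => mvfderiv ((𝓡 m).prod (𝓡 (2 * n))) f q (tPair 0 (Y q.2))) p (tPair 0 (X p.2))
      - mvfderiv ((𝓡 m).prod (𝓡 (2 * n)))
        (fun q => mvfderiv ((𝓡 m).prod (𝓡 (2 * n))) f q (tPair 0 (X q.2))) p (tPair 0 (Y p.2))
      = mvfderiv ((𝓡 m).prod (𝓡 (2 * n))) f p
          (tPair 0 (VectorField.mlieBracket (𝓡 (2 * n)) X Y p.2)) := by
  have h1 : ∀ {X Y : ∀ x : M, TangentSpace (𝓡 (2 * n)) x}, IsSmoothVF X → IsSmoothVF Y →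
      mvfderiv ((𝓡 m).prod (𝓡 (2 * n)))
        (fun q => mvfderiv ((𝓡 m).prod (𝓡 (2 * n))) f q (tPair 0 (Y q.2))) p (tPair 0 (X p.2))
      = mvfderiv (𝓡 (2 * n)) (fun x => mvfderiv (𝓡 (2 * n)) (fun x' => f (p.1, x')) x (Y x))
          p.2 (X p.2) := by
    intro X Y hX hY
    rw [mvfderiv_tPair_right (smoothNear_mvfderiv_right hf hY).mdiff]
    congr 1
    refine mvfderiv_congr ?_
    have hc : ContinuousAt (fun x : M => ((p.1, x) : U × M)) p.2 :=
      (continuous_const.prodMk continuous_id).continuousAt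
    filter_upwards [hc.eventually hf.eventually] with x hx
    exact mvfderiv_tPair_right (p := (p.1, x)) hx.mdiff (Y x)
  rw [h1 hX hY, h1 hY hX, mvfderiv_tPair_right hf.mdiff]
  exact mvfderiv_commutator hf.slice_right hX hY

end Commutators

namespace KahlerFamily

variable (K : KahlerFamily m n U M) [T2Space M] (T : TFrame (2 * n) M)

instance (p : U × M) : FiniteDimensional ℂ (K.E p) :=
  FiniteDimensional.finiteDimensional_submodule _

/-- The matrix of `∇^E` in the frame. -/
def connMat (a b : Fin T.card) (p : U × M) (X : TangentSpace (𝓡 m) p.1)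
    (v : TangentSpace (𝓡 (2 * n)) p.2) : ℂ :=
  mvfderiv ((𝓡 m).prod (𝓡 (2 * n))) (fun q => lamC T b q.2 (K.W T a q).1) p (tPair X v)
    + ∑ d, lamC T d p.2 (K.W T a p).1 * ∑ e, (T.lam e p.2 v : ℂ) * (K.Gam T e d b p : ℂ)

theorem lamC_W_smooth (a b : Fin T.card) :
    ContMDiff ((𝓡 m).prod (𝓡 (2 * n))) 𝓘(ℝ, ℂ) ∞ fun q => lamC T b q.2 (K.W T a q).1 :=
  (K.smoothE_iff T).1 (K.W_smooth T a) b

theorem lamC_mdiff {W : ∀ p : U × M, K.E p} (hW : K.SmoothE W) (b : Fin T.card) (p : U × M) :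
    MDifferentiableAt ((𝓡 m).prod (𝓡 (2 * n))) 𝓘(ℝ, ℂ) (fun q => lamC T b q.2 (W q).1) p :=
  ((K.smoothE_iff T).1 hW b p).mdifferentiableAt (by simp)

theorem covE_W (a : Fin T.card) (p : U × M) (X : TangentSpace (𝓡 m) p.1)
    (v : TangentSpace (𝓡 (2 * n)) p.2) :
    K.covE (K.W T a) p X v = ∑ b, K.connMat T a b p X v • K.W T b p := by
  rw [K.covE_eq T fun d => K.lamC_mdiff T (K.W_smooth T a) d p]
  simp only [connMat, add_smul, Finset.sum_add_distrib]
  refine congrArg₂ (· + ·) rfl ?_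
  exact (Finset.sum_congr rfl fun x _ => congrArg (_ • ·) (sum_smul_sum_smul _ _ _)).trans
    (sum_smul_sum_smul _ _ _)

theorem covE_sum {κ : Type*} [Fintype κ] {f : κ → U × M → ℂ} {e : κ → ∀ p : U × M, K.E p}
    {p : U × M} (hf : ∀ i, MDifferentiableAt ((𝓡 m).prod (𝓡 (2 * n))) 𝓘(ℝ, ℂ) (f i) p)
    (he : ∀ i d, MDifferentiableAt ((𝓡 m).prod (𝓡 (2 * n))) 𝓘(ℝ, ℂ)
      (fun q => lamC T d q.2 (e i q).1) p)
    {W : ∀ p : U × M, K.E p} (hW : ∀ q, W q = ∑ i, f i q • e i q)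
    (X : TangentSpace (𝓡 m) p.1) (v : TangentSpace (𝓡 (2 * n)) p.2) :
    K.covE W p X v = ∑ i, (mvfderiv ((𝓡 m).prod (𝓡 (2 * n))) (f i) p (tPair X v) • e i p
      + f i p • K.covE (e i) p X v) := by
  have h1 : ∀ d q, lamC T d q.2 (W q).1 = ∑ i, f i q * lamC T d q.2 (e i q).1 := fun d q => by
    rw [hW, AddSubmonoidClass.coe_finsetSum, map_sum]
    exact Finset.sum_congr rfl fun i _ => by
      rw [Submodule.coe_smul, map_smul, smul_eq_mul]
  have h1' : ∀ d, (fun q => lamC T d q.2 (W q).1)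
      = fun q => ∑ i, f i q * lamC T d q.2 (e i q).1 := fun d => funext (h1 d)
  have h2 : ∀ d, MDifferentiableAt ((𝓡 m).prod (𝓡 (2 * n))) 𝓘(ℝ, ℂ)
      (fun q => lamC T d q.2 (W q).1) p := fun d => by
    rw [h1']
    exact mdifferentiableAt_sum_apply fun i _ => (hf i).mul (he i d)
  rw [K.covE_eq T h2]
  simp only [fun i => K.covE_eq T (he i) X v]
  refine leibniz_algebra (fun d => h1 d p) (fun d => ?_) fun i => K.E_expand T (e i p)
  rw [h1']
  refine (mvfderiv_sum_apply (fun i _ => (hf i).mul (he i d)) _).trans ?_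
  exact Finset.sum_congr rfl fun i _ => mvfderiv_mul_apply (hf i) (he i d) _

theorem covESlice_sum {κ : Type*} [Fintype κ] {u : U} {f : κ → M → ℂ} {e : κ → ∀ x, K.E (u, x)}
    {x : M} (hf : ∀ i, MDifferentiableAt (𝓡 (2 * n)) 𝓘(ℝ, ℂ) (f i) x)
    (he : ∀ i d, MDifferentiableAt (𝓡 (2 * n)) 𝓘(ℝ, ℂ) (fun y => lamC T d y (e i y).1) x)
    {W : ∀ x, K.E (u, x)} (hW : ∀ᶠ y in 𝓝 x, W y = ∑ i, f i y • e i y)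
    (v : TangentSpace (𝓡 (2 * n)) x) :
    K.covESlice u W x v = ∑ i, (mvfderiv (𝓡 (2 * n)) (f i) x v • e i x
      + f i x • K.covESlice u (e i) x v) := by
  have h1' : ∀ d, (fun y => lamC T d y (W y).1)
      =ᶠ[𝓝 x] fun y => ∑ i, f i y * lamC T d y (e i y).1 := fun d => by
    filter_upwards [hW] with y hy
    rw [hy, AddSubmonoidClass.coe_finsetSum, map_sum]
    exact Finset.sum_congr rfl fun i _ => by
      rw [Submodule.coe_smul, map_smul, smul_eq_mul]
  have h2 : ∀ d, MDifferentiableAt (𝓡 (2 * n)) 𝓘(ℝ, ℂ) (fun y => lamC T d y (W y).1) x :=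
    fun d => MDifferentiableAt.congr_of_eventuallyEq
      (mdifferentiableAt_sum_apply fun i _ => (hf i).mul (he i d)) (h1' d)
  rw [K.covESlice_eq T h2]
  simp only [fun i => K.covESlice_eq T (he i) v]
  refine leibniz_algebra (fun d => (h1' d).self_of_nhds) (fun d => ?_)
    fun i => K.E_expand T (e i x)
  rw [mvfderiv_congr (h1' d)]
  refine (mvfderiv_sum_apply (fun i _ => (hf i).mul (he i d)) _).trans ?_
  exact Finset.sum_congr rfl fun i _ => mvfderiv_mul_apply (hf i) (he i d) _

theorem connMat_smooth (a b : Fin T.card) [T2Space U] {X : ∀ u : U, TangentSpace (𝓡 m) u}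
    (hX : IsSmoothVF X) {V : ∀ x : M, TangentSpace (𝓡 (2 * n)) x} (hV : IsSmoothVF V) (p : U × M) :
    SmoothNear ((𝓡 m).prod (𝓡 (2 * n))) (fun q => K.connMat T a b q (X q.1) (V q.2)) p := by
  have hl : ∀ a b, SmoothNear ((𝓡 m).prod (𝓡 (2 * n)))
      (fun q => lamC T b q.2 (K.W T a q).1) p := fun a b =>
    smoothNear_of_contMDiff (K.lamC_W_smooth T a b) p
  unfold connMat
  refine SmoothNear.add ?_ (SmoothNear.sum fun d _ => (hl a d).mul (SmoothNear.sum fun e _ => ?_))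
  · refine ((smoothNear_mvfderiv_left (hl a b) hX).add
      (smoothNear_mvfderiv_right (hl a b) hV)).congr (Filter.Eventually.of_forall fun q => ?_)
    exact mvfderiv_tPair _ _ _ _
  · exact (smoothNear_of_contMDiff
      ((T.isSmoothVF_iff.1 hV e).comp contMDiff_snd) p).ofReal.mul
      (smoothNear_of_contMDiff (K.Gam_smooth T e d b) p).ofReal

/-- Among the coefficients of W_a = ½(V_a - i j V_a) only those of jV_a depend on u, and the
Christoffel terms vanish in a direction tangent to U. -/
theorem connMat_left (a b : Fin T.card) (p : U × M) (X : TangentSpace (𝓡 m) p.1) :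
    K.connMat T a b p X 0 = -(Complex.I / 2) * (K.dJ T a b p X : ℂ) := by
  have h1 : (fun q : U × M => lamC T b q.2 (K.W T a q).1)
      = fun q => 1 / 2 * (T.lam b q.2 (T.V a q.2) : ℂ) - Complex.I / 2 * (K.Jc T a b q : ℂ) :=
    funext fun q => K.lamC_W T a b q
  have h2 : ContMDiff (𝓡 (2 * n)) 𝓘(ℝ, ℝ) ∞ fun x : M => T.lam b x (T.V a x) :=
    T.isSmoothVF_iff.1 (T.V_smooth a) b
  have h3 : SmoothNear ((𝓡 m).prod (𝓡 (2 * n)))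
      (fun q : U × M => ((T.lam b q.2 (T.V a q.2) : ℝ) : ℂ)) p :=
    (smoothNear_of_contMDiff (h2.comp contMDiff_snd) p).ofReal
  have h4 : SmoothNear ((𝓡 m).prod (𝓡 (2 * n))) (fun q : U × M => ((K.Jc T a b q : ℝ) : ℂ)) p :=
    (smoothNear_of_contMDiff (K.Jc_smooth T a b) p).ofReal
  have h5 : mvfderiv ((𝓡 m).prod (𝓡 (2 * n)))
      (fun q : U × M => ((T.lam b q.2 (T.V a q.2) : ℝ) : ℂ)) p (tPair X 0) = 0 := by
    rw [mvfderiv_tPair_left h3.mdiff]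
    exact mvfderiv_const_apply _ _ _
  have h6 : mvfderiv ((𝓡 m).prod (𝓡 (2 * n))) (fun q : U × M => ((K.Jc T a b q : ℝ) : ℂ)) p
      (tPair X 0) = (K.dJ T a b p X : ℂ) :=
    mvfderiv_clm_apply (smoothNear_of_contMDiff (K.Jc_smooth T a b) p).mdiff Complex.ofRealCLM _
  unfold connMat
  rw [h1, mvfderiv_sub_apply (h3.const_mul _).mdiff (h4.const_mul _).mdiff,
    mvfderiv_const_mul_apply h3.mdiff, mvfderiv_const_mul_apply h4.mdiff, h5, h6]
  simp only [map_zero, Complex.ofReal_zero, zero_mul, Finset.sum_const_zero, mul_zero, add_zero]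
  ring

/-! #### Connection forms of powers of a section of the half-form bundle -/

variable (Φ : ∀ q : U × M, K.E q [⋀^Fin n]→ₗ[ℂ] ℂ)

/-- The values of a family of top forms on the frame. -/
def formCoef (f : Fin n → Fin T.card) (q : U × M) : ℂ := Φ q fun i => K.W T (f i) q

/-- The number `A` is half of the connection form of `Φ` in the direction `X + v`. -/
def IsForm (p : U × M) (X : TangentSpace (𝓡 m) p.1) (v : TangentSpace (𝓡 (2 * n)) p.2)
    (A : ℂ) : Prop :=
  ∀ W : Fin n → ∀ q, K.E q, (∀ i, K.SmoothE (W i)) →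
    mvfderiv ((𝓡 m).prod (𝓡 (2 * n))) (fun q => Φ q fun i => W i q) p (tPair X v)
      - ∑ i, Φ p (Function.update (fun l => W l p) i (K.covE (W i) p X v))
    = 2 * A * Φ p fun i => W i p

variable {Φ}

theorem form_expand (q : U × M) (w : Fin n → K.E q) :
    Φ q w = ∑ f : Fin n → Fin T.card, (∏ i, lamC T (f i) q.2 (w i).1) * K.formCoef T Φ f q := by
  have h := multilinear_expand (Φ q) (fun i b => lamC T b q.2 (w i).1) (fun b => K.W T b q)
  simp only [E_expand] at h
  exact h

theorem exists_formCoef_ne_zero {q : U × M} (h : Φ q ≠ 0) : ∃ f, K.formCoef T Φ f q ≠ 0 := by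
  by_contra! hc
  apply h
  ext w
  rw [K.form_expand T]
  simp [hc]

/-- On the frame W_a the defining condition becomes a first order linear system for the coefficients
of Φ, in which the connection matrix acts as a derivation. Smoothness, linearity and curvature are
all read from this system. -/
theorem IsForm.coef {p : U × M} {X : TangentSpace (𝓡 m) p.1} {v : TangentSpace (𝓡 (2 * n)) p.2}
    {A : ℂ} (h : K.IsForm Φ p X v A) (f : Fin n → Fin T.card) :
    mvfderiv ((𝓡 m).prod (𝓡 (2 * n))) (K.formCoef T Φ f) p (tPair X v)
      = 2 * A * K.formCoef T Φ f p
        + indexDeriv (fun a b => K.connMat T a b p X v) (fun g => K.formCoef T Φ g p) f := by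
  have h1 := h (fun i => K.W T (f i)) fun i => K.W_smooth T (f i)
  rw [sub_eq_iff_eq_add] at h1
  refine h1.trans (congrArg₂ (· + ·) rfl ?_)
  refine Finset.sum_congr rfl fun l _ => ?_
  rw [covE_W, AlternatingMap.map_update_sum]
  refine Finset.sum_congr rfl fun b _ => ?_
  rw [AlternatingMap.map_update_smul, smul_eq_mul]
  refine congrArg (_ * ·) (congrArg (Φ p) (funext fun i => ?_))
  by_cases hi : i = l
  · subst hi; simp
  · simp [hi]

/-- Top forms on E_p form a line. Transporting Φ to E_p with frozen frame coordinates therefore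
gives h(q) Φ_p for a scalar function h. In the derivative of Φ(W_1, …, W_n), the derivatives of the
coordinates of the W_i cancel against those in ∇W_i; what is left is the derivative of h and the
derivation action of an endomorphism C, which is multiplication by its trace. -/
theorem exists_isForm {p : U × M}
    (hs : ∀ f, SmoothNear ((𝓡 m).prod (𝓡 (2 * n))) (K.formCoef T Φ f) p) (h0 : Φ p ≠ 0)
    (X : TangentSpace (𝓡 m) p.1) (v : TangentSpace (𝓡 (2 * n)) p.2) :
    ∃ A, K.IsForm Φ p X v A := by
  obtain ⟨f₀, hf₀⟩ := K.exists_formCoef_ne_zero T h0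
  let v₀ : Fin n → K.E p := fun i => K.W T (f₀ i) p
  have hv₀ : Φ p v₀ ≠ 0 := hf₀
  -- extension with constant coordinates
  let Iq : ∀ q : U × M, K.E p →ₗ[ℂ] K.E q := fun q =>
    ∑ b, (lamC T b p.2 ∘ₗ (K.E p).subtype).smulRight (K.W T b q)
  have hIq : ∀ q e, Iq q e = ∑ b, lamC T b p.2 e.1 • K.W T b q := fun q e => by
    simp [Iq, LinearMap.sum_apply]
  let h : U × M → ℂ := fun q => (Φ q).compLinearMap (Iq q) v₀ / Φ p v₀
  have hexp : ∀ q (w : Fin n → K.E p), (Φ q).compLinearMap (Iq q) w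
      = ∑ f : Fin n → Fin T.card, (∏ i, lamC T (f i) p.2 (w i).1) * K.formCoef T Φ f q := by
    intro q w
    have := multilinear_expand (Φ q) (fun i b => lamC T b p.2 (w i).1) (fun b => K.W T b q)
    simp only [← hIq] at this
    exact this
  have hline : ∀ q w, (Φ q).compLinearMap (Iq q) w = h q * Φ p w := fun q w =>
    topForm_line (K.finrank_E p) hv₀ _ w
  have hh : SmoothNear ((𝓡 m).prod (𝓡 (2 * n))) h p := by
    have : SmoothNear ((𝓡 m).prod (𝓡 (2 * n))) (fun q => (Φ p v₀)⁻¹ *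
        ∑ f : Fin n → Fin T.card, (∏ i, lamC T (f i) p.2 (v₀ i).1) * K.formCoef T Φ f q) p :=
      (SmoothNear.sum fun f _ => (hs f).const_mul _).const_mul _
    refine this.congr (Filter.Eventually.of_forall fun q => ?_)
    change (Φ q).compLinearMap (Iq q) v₀ / Φ p v₀ = _
    rw [hexp, div_eq_inv_mul]
  have hB : ∀ w : Fin n → K.E p, ∑ f : Fin n → Fin T.card, (∏ i, lamC T (f i) p.2 (w i).1)
      * mvfderiv ((𝓡 m).prod (𝓡 (2 * n))) (K.formCoef T Φ f) p (tPair X v)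
      = mvfderiv ((𝓡 m).prod (𝓡 (2 * n))) h p (tPair X v) * Φ p w := by
    intro w
    have e1 : (fun q => h q * Φ p w) = fun q => ∑ f : Fin n → Fin T.card,
        (∏ i, lamC T (f i) p.2 (w i).1) * K.formCoef T Φ f q :=
      funext fun q => (hline q w).symm.trans (hexp q w)
    have e2 := mvfderiv_mul_apply hh.mdiff (mdifferentiableAt_const (c := Φ p w)) (tPair X v)
    rw [mvfderiv_const_apply, mul_zero, zero_add, e1] at e2
    rw [← e2]
    refine ((mvfderiv_sum_apply (fun f _ => ((hs f).const_mul _).mdiff) (tPair X v)).trans ?_).symm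
    exact Finset.sum_congr rfl fun f _ => mvfderiv_const_mul_apply (hs f).mdiff _ _
  -- the endomorphism part
  let C : K.E p →ₗ[ℂ] K.E p :=
    ∑ b, (lamC T b p.2 ∘ₗ (K.E p).subtype).smulRight (K.covE (K.W T b) p X v)
  have hC : ∀ e, C e = ∑ b, lamC T b p.2 e.1 • K.covE (K.W T b) p X v := fun e => by
    simp [C, LinearMap.sum_apply]
  -- The numerator is the connection form of Φ itself: the derivative of Φ with frozen coordinates,
  -- minus the trace of the derivative of the frame. It is halved because Φ is the image of a
  -- square.
  refine ⟨(mvfderiv ((𝓡 m).prod (𝓡 (2 * n))) h p (tPair X v)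
    - ∑ a, lamC T a p.2 (C (K.W T a p)).1) / 2, fun W hW => ?_⟩
  have hw : ∀ i b, MDifferentiableAt ((𝓡 m).prod (𝓡 (2 * n))) 𝓘(ℝ, ℂ)
      (fun q => lamC T b q.2 (W i q).1) p := fun i b => K.lamC_mdiff T (hW i) b p
  have hcov : ∀ i, K.covE (W i) p X v
      = ∑ b, mvfderiv ((𝓡 m).prod (𝓡 (2 * n))) (fun q => lamC T b q.2 (W i q).1) p (tPair X v) • K.W T b p
        + C (W i p) := by
    intro i
    rw [K.covE_sum T (hw i) (fun b d => K.lamC_mdiff T (K.W_smooth T b) d p)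
      (fun q => (K.E_expand T (W i q)).symm), Finset.sum_add_distrib, hC]
  have e1 : (fun q => Φ q fun i => W i q) = fun q => ∑ f : Fin n → Fin T.card,
      (∏ i, lamC T (f i) q.2 (W i q).1) * K.formCoef T Φ f q :=
    funext fun q => K.form_expand T q _
  rw [e1, mvfderiv_expand hw fun f => (hs f).mdiff]
  have e2 := hB fun i => W i p
  have e3 : ∀ l, ∑ f : Fin n → Fin T.card, (∏ i, Function.update
      (fun i b => lamC T b p.2 (W i p).1) l (fun b => mvfderiv ((𝓡 m).prod (𝓡 (2 * n)))
        (fun q => lamC T b q.2 (W l q).1) p (tPair X v)) i (f i)) * K.formCoef T Φ f p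
      = Φ p (Function.update (fun l => W l p) l
        (∑ b, mvfderiv ((𝓡 m).prod (𝓡 (2 * n))) (fun q => lamC T b q.2 (W l q).1) p (tPair X v)
          • K.W T b p)) := by
    intro l
    refine (multilinear_expand (Φ p) _ (fun b => K.W T b p)).symm.trans ?_
    refine congrArg (Φ p) (funext fun i => ?_)
    by_cases hi : i = l
    · subst hi; simp
    · simp [hi, E_expand]
  have e4 := sum_topForm_update (K.finrank_E p) (l := fun a => lamC T a p.2 ∘ₗ (K.E p).subtype)
    (w := fun a => K.W T a p) (fun e => K.E_expand T e) (Φ p) C (fun i => W i p)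
  have e5 : ∀ i, Φ p (Function.update (fun l => W l p) i (K.covE (W i) p X v))
      = Φ p (Function.update (fun l => W l p) i
        (∑ b, mvfderiv ((𝓡 m).prod (𝓡 (2 * n))) (fun q => lamC T b q.2 (W i q).1) p (tPair X v)
          • K.W T b p)) + Φ p (Function.update (fun l => W l p) i (C (W i p))) := fun i => by
    rw [hcov, AlternatingMap.map_update_add]
  simp only [e5, Finset.sum_add_distrib]
  rw [e4, e2]
  simp only [e3]
  change _ = 2 * ((_ - ∑ a, lamC T a p.2 (C (K.W T a p)).1) / 2) * _
  change _ - (_ + (∑ a, lamC T a p.2 (C (K.W T a p)).1) * _) = _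
  ring

end KahlerFamily

end

/-! ### Uniqueness, smoothness and curvature of the connection form of δ -/

section

variable {m n : ℕ}
  {U : Type*} [TopologicalSpace U] [ChartedSpace (EuclideanSpace ℝ (Fin m)) U]
  {M : Type*} [TopologicalSpace M] [ChartedSpace (EuclideanSpace ℝ (Fin (2 * n))) M]
  [IsManifold (𝓡 m) ∞ U] [IsManifold (𝓡 (2 * n)) ∞ M]

namespace KahlerFamily

variable (K : KahlerFamily m n U M) [T2Space M] (T : TFrame (2 * n) M)
  {Φ : ∀ q : U × M, K.E q [⋀^Fin n]→ₗ[ℂ] ℂ}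

theorem indexDeriv_smooth {N H E : Type*} [NormedAddCommGroup E] [NormedSpace ℝ E]
    [TopologicalSpace H] {I : ModelWithCorners ℝ E H} [TopologicalSpace N] [ChartedSpace H N]
    {ι : Type*} [Fintype ι] {B : N → ι → ι → ℂ} {μ : N → (Fin n → ι) → ℂ} {p : N}
    (hB : ∀ a b, SmoothNear I (fun q => B q a b) p) (hμ : ∀ f, SmoothNear I (fun q => μ q f) p)
    (f : Fin n → ι) : SmoothNear I (fun q => indexDeriv (B q) (μ q) f) p :=
  SmoothNear.sum fun _ _ => SmoothNear.sum fun _ _ => (hB _ _).mul (hμ _)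

/-- A coefficient of Φ that does not vanish determines A uniquely, by a quotient of functions known
to be smooth. -/
theorem IsForm.eq_div {p : U × M} {X : TangentSpace (𝓡 m) p.1} {v : TangentSpace (𝓡 (2 * n)) p.2}
    {A : ℂ} (h : K.IsForm Φ p X v A) {f : Fin n → Fin T.card} (hf : K.formCoef T Φ f p ≠ 0) :
    A = (mvfderiv ((𝓡 m).prod (𝓡 (2 * n))) (K.formCoef T Φ f) p (tPair X v)
        - indexDeriv (fun a b => K.connMat T a b p X v) (fun g => K.formCoef T Φ g p) f)
      * (2 * K.formCoef T Φ f p)⁻¹ := by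
  rw [IsForm.coef K T h f]
  field_simp
  ring

theorem isForm_smooth [T2Space U] {p : U × M}
    (hs : ∀ f, SmoothNear ((𝓡 m).prod (𝓡 (2 * n))) (K.formCoef T Φ f) p) (h0 : Φ p ≠ 0)
    {X : ∀ u : U, TangentSpace (𝓡 m) u} (hX : IsSmoothVF X)
    {V : ∀ x : M, TangentSpace (𝓡 (2 * n)) x} (hV : IsSmoothVF V) {A : U × M → ℂ}
    (hA : ∀ᶠ q in 𝓝 p, K.IsForm Φ q (X q.1) (V q.2) (A q)) :
    SmoothNear ((𝓡 m).prod (𝓡 (2 * n))) A p := by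
  obtain ⟨f, hf⟩ := K.exists_formCoef_ne_zero T h0
  have h2 : SmoothNear ((𝓡 m).prod (𝓡 (2 * n))) (fun q =>
      (mvfderiv ((𝓡 m).prod (𝓡 (2 * n))) (K.formCoef T Φ f) q (tPair (X q.1) 0)
        + mvfderiv ((𝓡 m).prod (𝓡 (2 * n))) (K.formCoef T Φ f) q (tPair 0 (V q.2))
        - indexDeriv (fun a b => K.connMat T a b q (X q.1) (V q.2))
          (fun g => K.formCoef T Φ g q) f) * (2 * K.formCoef T Φ f q)⁻¹) p := by
    refine SmoothNear.mul (SmoothNear.sub ((smoothNear_mvfderiv_left (hs f) hX).add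
      (smoothNear_mvfderiv_right (hs f) hV)) ?_) (((hs f).const_mul 2).inv (by simpa using hf))
    exact indexDeriv_smooth (fun a b => K.connMat_smooth T a b hX hV p) hs f
  refine h2.congr ?_
  filter_upwards [hA, (hs f).contMDiffAt.continuousAt.eventually_ne hf] with q hq hfq
  rw [← mvfderiv_tPair]
  exact IsForm.eq_div K T hq hfq

theorem connMat_add (a b : Fin T.card) (p : U × M) (X X' : TangentSpace (𝓡 m) p.1)
    (v v' : TangentSpace (𝓡 (2 * n)) p.2) :
    K.connMat T a b p (X + X') (v + v') = K.connMat T a b p X v + K.connMat T a b p X' v' := by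
  have h : (tPair (p := p) (X + X') (v + v')) = tPair X v + tPair X' v' := rfl
  have h1 := (mvfderiv ((𝓡 m).prod (𝓡 (2 * n)))
    (fun q => lamC T b q.2 (K.W T a q).1) p).map_add (tPair X v) (tPair X' v')
  unfold connMat
  rw [h, h1]
  simp only [map_add, Complex.ofReal_add, add_mul, Finset.sum_add_distrib, mul_add]
  ring

theorem connMat_smul (a b : Fin T.card) (p : U × M) (X : TangentSpace (𝓡 m) p.1)
    (v : TangentSpace (𝓡 (2 * n)) p.2) (c : ℝ) :
    K.connMat T a b p (c • X) (c • v) = (c : ℂ) * K.connMat T a b p X v := by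
  have h : (tPair (p := p) (c • X) (c • v)) = c • tPair X v := rfl
  have h1 := (mvfderiv ((𝓡 m).prod (𝓡 (2 * n)))
    (fun q => lamC T b q.2 (K.W T a q).1) p).map_smul c (tPair X v)
  unfold connMat
  rw [h, h1, mul_add, Finset.mul_sum]
  simp only [map_smul, smul_eq_mul, Complex.ofReal_mul, Complex.real_smul, Finset.mul_sum]
  congr 1
  exact Finset.sum_congr rfl fun d _ => Finset.sum_congr rfl fun e _ => by ring

theorem indexDeriv_add {ι : Type*} [Fintype ι] (B C : ι → ι → ℂ) (μ : (Fin n → ι) → ℂ)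
    (f : Fin n → ι) :
    indexDeriv (fun a b => B a b + C a b) μ f = indexDeriv B μ f + indexDeriv C μ f := by
  simp only [indexDeriv, add_mul, Finset.sum_add_distrib]

theorem indexDeriv_smul {ι : Type*} [Fintype ι] (c : ℂ) (B : ι → ι → ℂ) (μ : (Fin n → ι) → ℂ)
    (f : Fin n → ι) : indexDeriv (fun a b => c * B a b) μ f = c * indexDeriv B μ f := by
  simp only [indexDeriv, Finset.mul_sum, mul_assoc]

/-- The numbers A are specified separately for each direction, so additivity comes from uniqueness:
the quotient of `IsForm.eq_div` is additive in the direction. -/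
theorem isForm_add (T : TFrame (2 * n) M) {p : U × M} (h0 : Φ p ≠ 0) {X X' : TangentSpace (𝓡 m) p.1}
    {v v' : TangentSpace (𝓡 (2 * n)) p.2} {A A' A'' : ℂ} (h : K.IsForm Φ p X v A)
    (h' : K.IsForm Φ p X' v' A') (h'' : K.IsForm Φ p (X + X') (v + v') A'') : A'' = A + A' := by
  obtain ⟨f, hf⟩ := K.exists_formCoef_ne_zero T h0
  have ht : (tPair (p := p) (X + X') (v + v')) = tPair X v + tPair X' v' := rfl
  have h1 := (mvfderiv ((𝓡 m).prod (𝓡 (2 * n))) (K.formCoef T Φ f) p).map_add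
    (tPair X v) (tPair X' v')
  rw [IsForm.eq_div K T h hf, IsForm.eq_div K T h' hf, IsForm.eq_div K T h'' hf, ht, h1]
  simp only [connMat_add, indexDeriv_add]
  ring

theorem isForm_smul (T : TFrame (2 * n) M) {p : U × M} (h0 : Φ p ≠ 0) {X : TangentSpace (𝓡 m) p.1}
    {v : TangentSpace (𝓡 (2 * n)) p.2} {A A' : ℂ} {c : ℝ} (h : K.IsForm Φ p X v A)
    (h' : K.IsForm Φ p (c • X) (c • v) A') : A' = c * A := by
  obtain ⟨f, hf⟩ := K.exists_formCoef_ne_zero T h0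
  have ht : (tPair (p := p) (c • X) (c • v)) = c • tPair X v := rfl
  have h1 := (mvfderiv ((𝓡 m).prod (𝓡 (2 * n))) (K.formCoef T Φ f) p).map_smul c (tPair X v)
  rw [IsForm.eq_div K T h hf, IsForm.eq_div K T h' hf, ht, h1]
  simp only [connMat_smul, indexDeriv_smul, Complex.real_smul]
  ring

/-! #### Traces in the frame -/

/-- The trace of an endomorphism of a tangent space, computed in the frame. -/
def frameTrace (x : M) (S : TangentSpace (𝓡 (2 * n)) x →ₗ[ℝ] TangentSpace (𝓡 (2 * n)) x) : ℝ :=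
  ∑ c, T.lam c x (S (T.V c x))

theorem frameTrace_comp_comm (x : M)
    (S S' : TangentSpace (𝓡 (2 * n)) x →ₗ[ℝ] TangentSpace (𝓡 (2 * n)) x) :
    frameTrace T x (S ∘ₗ S') = frameTrace T x (S' ∘ₗ S) := by
  have h : ∀ S S' : TangentSpace (𝓡 (2 * n)) x →ₗ[ℝ] TangentSpace (𝓡 (2 * n)) x,
      frameTrace T x (S ∘ₗ S') = ∑ c, ∑ d, T.lam d x (S' (T.V c x)) * T.lam c x (S (T.V d x)) := by
    intro S S'
    refine Finset.sum_congr rfl fun c _ => ?_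
    have := congrArg (fun w => T.lam c x (S w)) (T.sum_eq x (S' (T.V c x)))
    refine this.symm.trans ?_
    simp only [map_sum, map_smul, smul_eq_mul]
  rw [h, h, Finset.sum_comm]
  exact Finset.sum_congr rfl fun c _ => Finset.sum_congr rfl fun d _ => mul_comm _ _

theorem frameTrace_neg (x : M) (S : TangentSpace (𝓡 (2 * n)) x →ₗ[ℝ] TangentSpace (𝓡 (2 * n)) x) :
    frameTrace T x (-S) = -frameTrace T x S := by
  simp only [frameTrace, LinearMap.neg_apply, map_neg, Finset.sum_neg_distrib]

theorem frameTrace_sub (x : M)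
    (S S' : TangentSpace (𝓡 (2 * n)) x →ₗ[ℝ] TangentSpace (𝓡 (2 * n)) x) :
    frameTrace T x (S - S') = frameTrace T x S - frameTrace T x S' := by
  simp only [frameTrace, LinearMap.sub_apply, map_sub, Finset.sum_sub_distrib]

/-- The trace of `(X.j) (Y.j) j`. -/
def tau (p : U × M) (X Y : TangentSpace (𝓡 m) p.1) : ℝ :=
  frameTrace T p.2 (K.dj T p X ∘ₗ K.dj T p Y ∘ₗ (K.j p.1 p.2).toLinearMap)

/-- Moving j past X.j changes the sign, and the trace is cyclic. -/
theorem tau_swap (p : U × M) (X Y : TangentSpace (𝓡 m) p.1) :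
    K.tau T p Y X = -K.tau T p X Y := by
  have h : K.dj T p Y ∘ₗ K.dj T p X ∘ₗ (K.j p.1 p.2).toLinearMap
      = -((K.dj T p Y ∘ₗ (K.j p.1 p.2).toLinearMap) ∘ₗ K.dj T p X) := by
    ext v
    simp [K.dj_j]
  rw [tau, h, frameTrace_neg, frameTrace_comp_comm]
  rfl

/-- The curvature of the connection of `E` in the directions of `U`. -/
def curvE (p : U × M) (X Y : TangentSpace (𝓡 m) p.1) : K.E p →ₗ[ℂ] K.E p :=
  (-(1 / 4) : ℂ) • (K.projE p ∘ₗ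
    (K.dj T p X ∘ₗ K.dj T p Y - K.dj T p Y ∘ₗ K.dj T p X).baseChange ℂ) ∘ₗ (K.E p).subtype

theorem curvE_W (p : U × M) (X Y : TangentSpace (𝓡 m) p.1) (a : Fin T.card) :
    K.curvE T p X Y (K.W T a p) = (-(1 / 4) : ℂ) • K.projE p ((1 : ℂ) ⊗ₜ[ℝ]
      (K.dj T p X (K.dj T p Y (T.V a p.2)) - K.dj T p Y (K.dj T p X (T.V a p.2)))) := by
  set S := K.dj T p X ∘ₗ K.dj T p Y - K.dj T p Y ∘ₗ K.dj T p X with hS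
  have hj : ∀ v, S (K.j p.1 p.2 v) = K.j p.1 p.2 (S v) := fun v => by
    simp [hS, K.dj_j]
  have h1 : K.curvE T p X Y (K.W T a p)
      = (-(1 / 4) : ℂ) • K.projE p (S.baseChange ℂ (K.W T a p).1) := rfl
  have h2 : S.baseChange ℂ (K.W T a p).1 = (K.projE p ((1 : ℂ) ⊗ₜ[ℝ] S (T.V a p.2))).1 := by
    rw [W_val, projE_one_tmul, map_add, map_smul, map_smul, LinearMap.baseChange_tmul,
      LinearMap.baseChange_tmul, hj]
  rw [h1, h2, projE_E]
  rfl

/-- Let S be the commutator of X.j and Y.j. The factor ½(id - i j) of the projection splits the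
trace into those of S and of jS: the former is zero and the latter is 2τ. -/
theorem trace_curvE (p : U × M) (X Y : TangentSpace (𝓡 m) p.1) :
    ∑ a, lamC T a p.2 (K.curvE T p X Y (K.W T a p)).1
      = Complex.I / 4 * (K.tau T p X Y : ℂ) := by
  set S := K.dj T p X ∘ₗ K.dj T p Y - K.dj T p Y ∘ₗ K.dj T p X with hS
  have h1 : ∀ a, lamC T a p.2 (K.curvE T p X Y (K.W T a p)).1
      = -(1 / 8) * (T.lam a p.2 (S (T.V a p.2)) : ℂ)
        + Complex.I / 8 * (T.lam a p.2 (((K.j p.1 p.2).toLinearMap ∘ₗ S) (T.V a p.2)) : ℂ) := by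
    intro a
    rw [curvE_W, Submodule.coe_smul, projE_one_tmul, map_smul, map_add, map_smul, map_smul, lamC,
      formC_tmul, formC_tmul]
    simp only [smul_eq_mul, one_mul, hS]
    rw [LinearMap.comp_apply]
    simp only [LinearMap.sub_apply, LinearMap.comp_apply, ContinuousLinearMap.coe_coe]
    ring
  have h2 : frameTrace T p.2 S = 0 := by
    rw [hS, frameTrace_sub, frameTrace_comp_comm, sub_self]
  have h3 : frameTrace T p.2 ((K.j p.1 p.2).toLinearMap ∘ₗ S) = 2 * K.tau T p X Y := by
    have h4 : (K.j p.1 p.2).toLinearMap ∘ₗ S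
        = (K.dj T p X ∘ₗ K.dj T p Y ∘ₗ (K.j p.1 p.2).toLinearMap)
          - (K.dj T p Y ∘ₗ K.dj T p X ∘ₗ (K.j p.1 p.2).toLinearMap) := by
      ext v
      simp [hS, K.dj_j]
    rw [h4, frameTrace_sub]
    have := K.tau_swap T p X Y
    unfold tau at this ⊢
    rw [this]
    ring
  simp only [h1, Finset.sum_add_distrib, ← Finset.mul_sum, ← Complex.ofReal_sum]
  change -(1 / 8) * ((frameTrace T p.2 S : ℝ) : ℂ)
    + Complex.I / 8 * ((frameTrace T p.2 ((K.j p.1 p.2).toLinearMap ∘ₗ S) : ℝ) : ℂ) = _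
  rw [h2, h3]
  push_cast
  ring

theorem mvfderiv_indexDeriv {N H E : Type*} [NormedAddCommGroup E] [NormedSpace ℝ E]
    [TopologicalSpace H] {I : ModelWithCorners ℝ E H} [TopologicalSpace N] [ChartedSpace H N]
    {ι : Type*} [Fintype ι] {B : N → ι → ι → ℂ} {μ : N → (Fin n → ι) → ℂ} {p : N}
    (hB : ∀ a b, SmoothNear I (fun q => B q a b) p) (hμ : ∀ f, SmoothNear I (fun q => μ q f) p)
    (f : Fin n → ι) (v : TangentSpace I p) :
    mvfderiv I (fun q => indexDeriv (B q) (μ q) f) p v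
      = indexDeriv (B p) (fun g => mvfderiv I (fun q => μ q g) p v) f
        + indexDeriv (fun a b => mvfderiv I (fun q => B q a b) p v) (μ p) f := by
  unfold indexDeriv
  refine (mvfderiv_sum_apply (fun l _ => (SmoothNear.sum fun b _ =>
    (hB (f l) b).mul (hμ (Function.update f l b))).mdiff) v).trans ?_
  rw [← Finset.sum_add_distrib]
  refine Finset.sum_congr rfl fun l _ => ?_
  refine (mvfderiv_sum_apply (fun b _ =>
    ((hB (f l) b).mul (hμ (Function.update f l b))).mdiff) v).trans ?_
  rw [← Finset.sum_add_distrib]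
  exact Finset.sum_congr rfl fun b _ =>
    mvfderiv_mul_apply (hB (f l) b).mdiff (hμ (Function.update f l b)).mdiff v

theorem indexDeriv_right {ι : Type*} [Fintype ι] (c : ℂ) (B : ι → ι → ℂ)
    (μ ν : (Fin n → ι) → ℂ) (f : Fin n → ι) :
    indexDeriv B (fun g => c * μ g + ν g) f = c * indexDeriv B μ f + indexDeriv B ν f := by
  simp only [indexDeriv, mul_add, Finset.sum_add_distrib, Finset.mul_sum]
  congr 1
  exact Finset.sum_congr rfl fun l _ => Finset.sum_congr rfl fun b _ => by ring

theorem indexDeriv_formCoef (p : U × M) (B : Fin T.card → Fin T.card → ℂ)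
    (f : Fin n → Fin T.card) :
    indexDeriv B (fun g => K.formCoef T Φ g p) f
      = ∑ l, Φ p (Function.update (fun i => K.W T (f i) p) l (∑ c, B (f l) c • K.W T c p)) := by
  refine Finset.sum_congr rfl fun l _ => ?_
  rw [AlternatingMap.map_update_sum]
  refine Finset.sum_congr rfl fun b _ => ?_
  rw [AlternatingMap.map_update_smul, smul_eq_mul]
  refine congrArg (_ * ·) (congrArg (Φ p) (funext fun i => ?_))
  by_cases hi : i = l
  · subst hi; simp
  · simp [hi]

/-- The frame matrix along U is -(i/2) times that of X.j, and the product of two such factors is the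
-¼ in `curvE`. -/
theorem curvE_W_expand (p : U × M) (X Y : TangentSpace (𝓡 m) p.1) (a : Fin T.card) :
    K.curvE T p X Y (K.W T a p) = ∑ c, (∑ b, (K.connMat T a b p Y 0 * K.connMat T b c p X 0
      - K.connMat T a b p X 0 * K.connMat T b c p Y 0)) • K.W T c p := by
  have h1 : ∀ (X Y : TangentSpace (𝓡 m) p.1) c,
      T.lam c p.2 (K.dj T p X (K.dj T p Y (T.V a p.2)))
        = ∑ b, K.dJ T a b p Y * K.dJ T b c p X := fun X Y c => by
    rw [K.dj_V T a p Y]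
    simp only [map_sum, map_smul, smul_eq_mul, lam_dj_V]
  rw [curvE_W, K.projE_expand T, Finset.smul_sum]
  refine Finset.sum_congr rfl fun c _ => ?_
  rw [smul_smul, lamC, formC_tmul, map_sub, h1, h1]
  congr 1
  simp only [connMat_left, one_mul]
  push_cast
  rw [← Finset.sum_sub_distrib, Finset.mul_sum]
  refine Finset.sum_congr rfl fun b _ => ?_
  linear_combination (-(1 / 4 : ℂ) * ((K.dJ T a b p Y : ℂ) * (K.dJ T b c p X : ℂ)
    - (K.dJ T a b p X : ℂ) * (K.dJ T b c p Y : ℂ))) * Complex.I_mul_I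

/-- The curvature of the half-form bundle in the directions of `U`. -/
theorem isForm_curvature [T2Space U] {p : U × M}
    (hs : ∀ f, SmoothNear ((𝓡 m).prod (𝓡 (2 * n))) (K.formCoef T Φ f) p) (h0 : Φ p ≠ 0)
    {X Y : ∀ u : U, TangentSpace (𝓡 m) u} (hX : IsSmoothVF X) (hY : IsSmoothVF Y)
    {AX AY AZ : U × M → ℂ}
    (hAX : ∀ᶠ q in 𝓝 p, K.IsForm Φ q (X q.1) 0 (AX q))
    (hAY : ∀ᶠ q in 𝓝 p, K.IsForm Φ q (Y q.1) 0 (AY q))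
    (hAZ : K.IsForm Φ p (VectorField.mlieBracket (𝓡 m) X Y p.1) 0 (AZ p)) :
    mvfderiv ((𝓡 m).prod (𝓡 (2 * n))) AY p (tPair (X p.1) 0)
      - mvfderiv ((𝓡 m).prod (𝓡 (2 * n))) AX p (tPair (Y p.1) 0) - AZ p
      = -(Complex.I / 8) * (K.tau T p (X p.1) (Y p.1) : ℂ) := by
  -- The system of `IsForm.coef` is differentiated once more and substituted into itself. The terms
  -- symmetric in X and Y then disappear from the commutator.
  have hder : ∀ {X Y : ∀ u : U, TangentSpace (𝓡 m) u}, IsSmoothVF X → IsSmoothVF Y →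
      ∀ {AX AY : U × M → ℂ}, (∀ᶠ q in 𝓝 p, K.IsForm Φ q (X q.1) 0 (AX q)) →
      (∀ᶠ q in 𝓝 p, K.IsForm Φ q (Y q.1) 0 (AY q)) → ∀ f,
      mvfderiv ((𝓡 m).prod (𝓡 (2 * n))) (fun q => mvfderiv ((𝓡 m).prod (𝓡 (2 * n)))
          (K.formCoef T Φ f) q (tPair (Y q.1) 0)) p (tPair (X p.1) 0)
        = 2 * mvfderiv ((𝓡 m).prod (𝓡 (2 * n))) AY p (tPair (X p.1) 0) * K.formCoef T Φ f p
          + 4 * AX p * AY p * K.formCoef T Φ f p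
          + 2 * AY p * indexDeriv (fun a b => K.connMat T a b p (X p.1) 0)
              (fun g => K.formCoef T Φ g p) f
          + 2 * AX p * indexDeriv (fun a b => K.connMat T a b p (Y p.1) 0)
              (fun g => K.formCoef T Φ g p) f
          + indexDeriv (fun a b => K.connMat T a b p (Y p.1) 0)
              (indexDeriv (fun a b => K.connMat T a b p (X p.1) 0)
                (fun g => K.formCoef T Φ g p)) f
          + indexDeriv (fun a b => mvfderiv ((𝓡 m).prod (𝓡 (2 * n)))
              (fun q => K.connMat T a b q (Y q.1) 0) p (tPair (X p.1) 0))
              (fun g => K.formCoef T Φ g p) f := by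
    intro X Y hX hY AX AY hAX hAY f
    have h0v : IsSmoothVF (fun x : M => (0 : TangentSpace (𝓡 (2 * n)) x)) := by
      rw [T.isSmoothVF_iff]
      intro a
      simp only [map_zero]
      exact contMDiff_const
    have hAYs := K.isForm_smooth T hs h0 hY h0v hAY
    have hB : ∀ a b, SmoothNear ((𝓡 m).prod (𝓡 (2 * n)))
        (fun q => K.connMat T a b q (Y q.1) 0) p := fun a b => K.connMat_smooth T a b hY h0v p
    have e1 : (fun q => mvfderiv ((𝓡 m).prod (𝓡 (2 * n))) (K.formCoef T Φ f) q (tPair (Y q.1) 0))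
        =ᶠ[𝓝 p] fun q => 2 * AY q * K.formCoef T Φ f q
          + indexDeriv (fun a b => K.connMat T a b q (Y q.1) 0)
            (fun g => K.formCoef T Φ g q) f := by
      filter_upwards [hAY] with q hq
      exact IsForm.coef K T hq f
    rw [mvfderiv_congr e1, mvfderiv_add_apply ((hAYs.const_mul 2).mul (hs f)).mdiff
      (indexDeriv_smooth hB hs f).mdiff, mvfderiv_mul_apply (hAYs.const_mul 2).mdiff (hs f).mdiff,
      mvfderiv_const_mul_apply hAYs.mdiff, mvfderiv_indexDeriv hB hs]
    have e2 : ∀ g, mvfderiv ((𝓡 m).prod (𝓡 (2 * n))) (K.formCoef T Φ g) p (tPair (X p.1) 0)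
        = 2 * AX p * K.formCoef T Φ g p + indexDeriv (fun a b => K.connMat T a b p (X p.1) 0)
          (fun g => K.formCoef T Φ g p) g := fun g => IsForm.coef K T hAX.self_of_nhds g
    have e3 : (fun g => mvfderiv ((𝓡 m).prod (𝓡 (2 * n))) (fun q => K.formCoef T Φ g q) p
        (tPair (X p.1) 0)) = fun g => 2 * AX p * K.formCoef T Φ g p
          + indexDeriv (fun a b => K.connMat T a b p (X p.1) 0) (fun g => K.formCoef T Φ g p) g :=
      funext e2
    rw [e3, e2, indexDeriv_right]
    ring
  obtain ⟨f, hf⟩ := K.exists_formCoef_ne_zero T h0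
  have h1 := mvfderiv_left_commutator (hs f) hX hY
  rw [hder hX hY hAX hAY, hder hY hX hAY hAX, IsForm.coef K T hAZ f] at h1
  have h2 : ∀ {X Y : ∀ u : U, TangentSpace (𝓡 m) u}, IsSmoothVF X → IsSmoothVF Y → ∀ a b,
      mvfderiv ((𝓡 m).prod (𝓡 (2 * n))) (fun q => K.connMat T a b q (Y q.1) 0) p (tPair (X p.1) 0)
      = -(Complex.I / 2) * (mvfderiv ((𝓡 m).prod (𝓡 (2 * n)))
          (fun q => mvfderiv ((𝓡 m).prod (𝓡 (2 * n))) (K.Jc T a b) q (tPair (Y q.1) 0))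
            p (tPair (X p.1) 0) : ℝ) := by
    intro X Y hX hY a b
    have hd := smoothNear_of_contMDiff (K.dJ_smooth T a b hY) p
    simp only [connMat_left]
    rw [mvfderiv_const_mul_apply hd.ofReal.mdiff]
    congr 1
    exact mvfderiv_clm_apply hd.mdiff Complex.ofRealCLM _
  -- Along U the connection matrix is -(i/2) times the differential of the matrix of j, an exact
  -- form. Its antisymmetrized derivative is thus its value on the bracket, and it adds nothing to
  -- the curvature.
  have h3 : ∀ a b, mvfderiv ((𝓡 m).prod (𝓡 (2 * n)))
        (fun q => K.connMat T a b q (Y q.1) 0) p (tPair (X p.1) 0)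
      = mvfderiv ((𝓡 m).prod (𝓡 (2 * n)))
        (fun q => K.connMat T a b q (X q.1) 0) p (tPair (Y p.1) 0)
        + K.connMat T a b p (VectorField.mlieBracket (𝓡 m) X Y p.1) 0 := by
    intro a b
    rw [h2 hX hY, h2 hY hX, connMat_left, dJ, ← mvfderiv_left_commutator
      (smoothNear_of_contMDiff (K.Jc_smooth T a b) p) hX hY]
    push_cast
    ring
  -- The whole curvature comes from the commutator of the two matrices, which is `curvE` in the
  -- frame; on top forms it acts by its trace.
  have h4 := indexDeriv_commutator (fun a b => K.connMat T a b p (Y p.1) 0)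
    (fun a b => K.connMat T a b p (X p.1) 0) (fun g => K.formCoef T Φ g p) f
  rw [indexDeriv_formCoef] at h4
  simp only [← curvE_W_expand] at h4
  have h5 := sum_topForm_update (K.finrank_E p) (l := fun a => lamC T a p.2 ∘ₗ (K.E p).subtype)
    (w := fun a => K.W T a p) (fun e => K.E_expand T e) (Φ p) (K.curvE T p (X p.1) (Y p.1))
    (fun i => K.W T (f i) p)
  rw [h5] at h4
  have h6 : ∑ a, (lamC T a p.2 ∘ₗ (K.E p).subtype) (K.curvE T p (X p.1) (Y p.1) (K.W T a p))
    = Complex.I / 4 * (K.tau T p (X p.1) (Y p.1) : ℂ) := K.trace_curvE T p (X p.1) (Y p.1)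
  rw [h6] at h4
  simp only [h3, indexDeriv_add] at h1
  have h7 : (fun i => K.W T (f i) p) = fun i => K.W T (f i) p := rfl
  change _ = Complex.I / 4 * (K.tau T p (X p.1) (Y p.1) : ℂ) * K.formCoef T Φ f p at h4
  apply mul_right_cancel₀ hf
  -- The halves appear because A is half of the connection form of Φ; they turn the trace (i/4)τ
  -- into (i/8)τ.
  linear_combination (1 / 2) * h1 - (1 / 2) * h4

end KahlerFamily

end

/-! ### Frames of line bundles -/

section

section LinearAlgebra

variable {A B : Type*} [AddCommGroup A] [Module ℂ A] [AddCommGroup B] [Module ℂ B]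

/-- `b` is a basis of a complex line. -/
def IsLineFrame (b : A) : Prop := b ≠ 0 ∧ ∀ v, ∃ c : ℂ, v = c • b

theorem ratio_smul_self {b : A} (hb : IsLineFrame b) (v : A) : ratio v b • b = v :=
  (Classical.epsilon_spec (hb.2 v)).symm

theorem ratio_eq {b : A} (hb : IsLineFrame b) {v : A} {c : ℂ} (h : v = c • b) : ratio v b = c := by
  have h1 := ratio_smul_self hb v
  rw [h] at h1
  rw [h]
  exact smul_left_injective ℂ hb.1 h1

theorem ratio_self {b : A} (hb : IsLineFrame b) : ratio b b = 1 :=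
  ratio_eq hb (one_smul ℂ b).symm

theorem ratio_zero {b : A} (hb : IsLineFrame b) : ratio 0 b = 0 :=
  ratio_eq hb (zero_smul ℂ b).symm

theorem ratio_add {b : A} (hb : IsLineFrame b) (v w : A) :
    ratio (v + w) b = ratio v b + ratio w b :=
  ratio_eq hb (by rw [add_smul, ratio_smul_self hb, ratio_smul_self hb])

theorem ratio_sub {b : A} (hb : IsLineFrame b) (v w : A) :
    ratio (v - w) b = ratio v b - ratio w b :=
  ratio_eq hb (by rw [sub_smul, ratio_smul_self hb, ratio_smul_self hb])

theorem ratio_smul {b : A} (hb : IsLineFrame b) (c : ℂ) (v : A) :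
    ratio (c • v) b = c * ratio v b :=
  ratio_eq hb (by rw [mul_smul, ratio_smul_self hb])

theorem ratio_sum {b : A} (hb : IsLineFrame b) {ι : Type*} (s : Finset ι) (v : ι → A) :
    ratio (∑ i ∈ s, v i) b = ∑ i ∈ s, ratio (v i) b :=
  ratio_eq hb (by rw [Finset.sum_smul]; exact Finset.sum_congr rfl fun i _ =>
    (ratio_smul_self hb _).symm)

theorem ratio_trans {b c : A} (hb : IsLineFrame b) (hc : IsLineFrame c) (v : A) :
    ratio v b = ratio v c * ratio c b :=
  ratio_eq hb (by rw [mul_smul, ratio_smul_self hb, ratio_smul_self hc])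

theorem ratio_mul_ratio {b c : A} (hb : IsLineFrame b) (hc : IsLineFrame c) :
    ratio b c * ratio c b = 1 := by
  rw [← ratio_trans hb hc, ratio_self hb]

theorem ratio_ne_zero {b c : A} (hb : IsLineFrame b) (hc : IsLineFrame c) : ratio b c ≠ 0 :=
  left_ne_zero_of_mul_eq_one (ratio_mul_ratio hb hc)

theorem IsLineFrame.ext {b v w : A} (hb : IsLineFrame b) (h : ratio v b = ratio w b) : v = w := by
  rw [← ratio_smul_self hb v, h, ratio_smul_self hb w]

theorem IsLineFrame.tmul {b : A} {c : B} (hb : IsLineFrame b) (hc : IsLineFrame c) :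
    IsLineFrame (b ⊗ₜ[ℂ] c) := by
  constructor
  · obtain ⟨f, hf⟩ := Module.Projective.exists_dual_eq_one ℂ hb.1
    obtain ⟨g, hg⟩ := Module.Projective.exists_dual_eq_one ℂ hc.1
    intro h
    have := congrArg (fun w => TensorProduct.lid ℂ ℂ (TensorProduct.map f g w)) h
    simp [hf, hg] at this
  · intro v
    induction v using TensorProduct.induction_on with
    | zero => exact ⟨0, (zero_smul _ _).symm⟩
    | tmul x y =>
      obtain ⟨s, hs⟩ := hb.2 x
      obtain ⟨t, ht⟩ := hc.2 y
      exact ⟨s * t, by rw [hs, ht, TensorProduct.smul_tmul_smul]⟩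
    | add x y hx hy =>
      obtain ⟨s, hs⟩ := hx
      obtain ⟨t, ht⟩ := hy
      exact ⟨s + t, by rw [add_smul, ← hs, ← ht]⟩

theorem tprod_smul_const (k : ℕ) (c : ℂ) (b : A) :
    (PiTensorProduct.tprod ℂ fun _ : Fin k => c • b)
      = c ^ k • PiTensorProduct.tprod ℂ fun _ : Fin k => b := by
  have := (PiTensorProduct.tprod ℂ (s := fun _ : Fin k => A)).map_smul_univ (fun _ => c) fun _ => b
  simpa using this

theorem IsLineFrame.tprod {b : A} (hb : IsLineFrame b) (k : ℕ) :
    IsLineFrame (PiTensorProduct.tprod ℂ fun _ : Fin k => b) := by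
  constructor
  · obtain ⟨f, hf⟩ := Module.Projective.exists_dual_eq_one ℂ hb.1
    intro h
    have := congrArg (PiTensorProduct.lift
      ((MultilinearMap.mkPiAlgebra ℂ (Fin k) ℂ).compLinearMap fun _ => f)) h
    simp [hf] at this
  · intro v
    induction v using PiTensorProduct.induction_on with
    | smul_tprod r f =>
      have h : f = fun i => ratio (f i) b • b := funext fun i => (ratio_smul_self hb _).symm
      have h1 := (PiTensorProduct.tprod ℂ (s := fun _ : Fin k => A)).map_smul_univ
        (fun i => ratio (f i) b) fun _ => b
      exact ⟨r * ∏ i, ratio (f i) b, by rw [mul_smul, ← h1, ← h]⟩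
    | add x y hx hy =>
      obtain ⟨s, hs⟩ := hx
      obtain ⟨t, ht⟩ := hy
      exact ⟨s + t, by rw [add_smul, ← hs, ← ht]⟩

end LinearAlgebra

theorem ContMDiffAt.cmul {E : Type*} [NormedAddCommGroup E] [NormedSpace ℝ E]
    {H : Type*} [TopologicalSpace H] {I : ModelWithCorners ℝ E H}
    {N : Type*} [TopologicalSpace N] [ChartedSpace H N] {f g : N → ℂ} {p : N}
    (hf : ContMDiffAt I 𝓘(ℝ, ℂ) ∞ f p) (hg : ContMDiffAt I 𝓘(ℝ, ℂ) ∞ g p) :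
    ContMDiffAt I 𝓘(ℝ, ℂ) ∞ (fun q => f q * g q) p :=
  (contDiff_mul (𝕜 := ℝ) (𝔸 := ℂ)).contMDiff.contMDiffAt.comp p (hf.prodMk_space hg)

/-! ### Systems of local frames of a complex line bundle -/

section FrameSystem

variable {E : Type*} [NormedAddCommGroup E] [NormedSpace ℝ E]
  {H : Type*} [TopologicalSpace H] (I : ModelWithCorners ℝ E H)
  {N : Type*} [TopologicalSpace N] [ChartedSpace H N]
  {Z : N → Type*} [∀ x, AddCommGroup (Z x)] [∀ x, Module ℂ (Z x)]

/-- A system of local frames of a complex line bundle, one around each point, with smooth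
transition functions. -/
structure FrameSystem (F : N → ∀ x, Z x) (B : N → Set N) : Prop where
  isOpen : ∀ p, IsOpen (B p)
  mem : ∀ p, p ∈ B p
  isLineFrame : ∀ p, ∀ q ∈ B p, IsLineFrame (F p q)
  smooth : ∀ p p' q, q ∈ B p → q ∈ B p' → SmoothNear I (fun x => ratio (F p x) (F p' x)) q

/-- Smooth sections, with respect to a system of local frames. -/
def SmoothSec (F : N → ∀ x, Z x) (s : ∀ x, Z x) : Prop :=
  ∀ p, ContMDiffAt I 𝓘(ℝ, ℂ) ∞ (fun x => ratio (s x) (F p x)) p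

variable {I}

namespace FrameSystem

variable {F : N → ∀ x, Z x} {B : N → Set N} (S : FrameSystem I F B)
include S

/-- Smoothness at each point is asked in the frame attached to that point. The transition functions
carry it to any frame, and so to a whole neighbourhood in one fixed frame. -/
theorem smoothSec_iff {s : ∀ x, Z x} :
    SmoothSec I F s ↔ ∀ p, ∀ q ∈ B p, SmoothNear I (fun x => ratio (s x) (F p x)) q := by
  refine ⟨fun h p q hq => ?_, fun h p => (h p p (S.mem p)).contMDiffAt⟩
  filter_upwards [(S.isOpen p).mem_nhds hq] with q' hq'
  refine (ContMDiffAt.cmul (h q')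
    (S.smooth q' p q' (S.mem q') hq').contMDiffAt).congr_of_eventuallyEq ?_
  filter_upwards [(S.isOpen p).mem_nhds hq', (S.isOpen q').mem_nhds (S.mem q')] with y hy hy'
  exact ratio_trans (S.isLineFrame p y hy) (S.isLineFrame q' y hy') _

theorem smoothNear {s : ∀ x, Z x} (hs : SmoothSec I F s) {p q : N} (hq : q ∈ B p) :
    SmoothNear I (fun x => ratio (s x) (F p x)) q := S.smoothSec_iff.1 hs p q hq

theorem mdiff {s : ∀ x, Z x} (hs : SmoothSec I F s) {p q : N} (hq : q ∈ B p) :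
    MDifferentiableAt I 𝓘(ℝ, ℂ) (fun x => ratio (s x) (F p x)) q := (S.smoothNear hs hq).mdiff

/-- Near each point, a smooth function times the frame extends to a smooth section. -/
theorem exists_smoothSec [FiniteDimensional ℝ E] [T2Space N] [IsManifold I ∞ N] {p q : N}
    (hq : q ∈ B p) {f : N → ℂ} (hf : SmoothNear I f q) :
    ∃ s : ∀ x, Z x, SmoothSec I F s ∧ ∀ᶠ x in 𝓝 q, s x = f x • F p x := by
  have hn : {x | x ∈ B p ∧ SmoothNear I f x} ∈ 𝓝 q :=
    Filter.inter_mem ((S.isOpen p).mem_nhds hq) hf.eventually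
  obtain ⟨ψ, hψ, h1, hs⟩ := SmoothNear.exists_bump (I := I) hn
  refine ⟨fun x => ((ψ x : ℂ) * f x) • F p x, fun y => ?_, ?_⟩
  · by_cases hy : y ∈ tsupport ψ
    · obtain ⟨hy1, hy2⟩ := hs hy
      have h2 : SmoothNear I (fun x => ((ψ x : ℂ) * f x) * ratio (F p x) (F y x)) y :=
        (((smoothNear_of_contMDiff hψ y).ofReal).mul hy2).mul (S.smooth p y y hy1 (S.mem y))
      refine h2.contMDiffAt.congr_of_eventuallyEq ?_
      filter_upwards [(S.isOpen y).mem_nhds (S.mem y)] with x hx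
      exact ratio_smul (S.isLineFrame y x hx) _ _
    · refine (contMDiffAt_const (c := (0 : ℂ))).congr_of_eventuallyEq ?_
      have h0 : ψ =ᶠ[𝓝 y] 0 := notMem_tsupport_iff_eventuallyEq.1 hy
      filter_upwards [h0, (S.isOpen y).mem_nhds (S.mem y)] with x hx hx'
      rw [hx]
      simp [ratio_zero (S.isLineFrame y x hx')]
  · filter_upwards [h1] with x hx
    rw [hx]
    simp

theorem smoothSec_add {s t : ∀ x, Z x} (hs : SmoothSec I F s) (ht : SmoothSec I F t) :
    SmoothSec I F fun x => s x + t x := fun p => by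
  refine ((hs p).add (ht p)).congr_of_eventuallyEq ?_
  filter_upwards [(S.isOpen p).mem_nhds (S.mem p)] with x hx
  exact ratio_add (S.isLineFrame p x hx) _ _

theorem smoothSec_sub {s t : ∀ x, Z x} (hs : SmoothSec I F s) (ht : SmoothSec I F t) :
    SmoothSec I F fun x => s x - t x := fun p => by
  refine ((hs p).sub (ht p)).congr_of_eventuallyEq ?_
  filter_upwards [(S.isOpen p).mem_nhds (S.mem p)] with x hx
  exact ratio_sub (S.isLineFrame p x hx) _ _

theorem smoothSec_smul {f : N → ℂ} {s : ∀ x, Z x} (hf : ContMDiff I 𝓘(ℝ, ℂ) ∞ f)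
    (hs : SmoothSec I F s) : SmoothSec I F fun x => f x • s x := fun p => by
  refine (ContMDiffAt.cmul (hf p) (hs p)).congr_of_eventuallyEq ?_
  filter_upwards [(S.isOpen p).mem_nhds (S.mem p)] with x hx
  exact ratio_smul (S.isLineFrame p x hx) _ _

theorem smoothSec_sum {ι : Type*} {A : Finset ι} {s : ι → ∀ x, Z x}
    (hs : ∀ i ∈ A, SmoothSec I F (s i)) : SmoothSec I F fun x => ∑ i ∈ A, s i x := fun p => by
  refine (contMDiffAt_finsetSum fun i hi => hs i hi p).congr_of_eventuallyEq ?_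
  filter_upwards [(S.isOpen p).mem_nhds (S.mem p)] with x hx
  exact ratio_sum (S.isLineFrame p x hx) _ _

end FrameSystem

end FrameSystem

/-! ### Frames given by local trivializations -/

section Bundles

variable {E : Type*} [NormedAddCommGroup E] [NormedSpace ℝ E]
  {H : Type*} [TopologicalSpace H] {I : ModelWithCorners ℝ E H}
  {N : Type*} [TopologicalSpace N] [ChartedSpace H N]
  {Z : N → Type*} [TopologicalSpace (TotalSpace ℂ Z)]
  [∀ x, AddCommGroup (Z x)] [∀ x, Module ℂ (Z x)] [∀ x, TopologicalSpace (Z x)]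
  [FiberBundle ℂ Z] [VectorBundle ℂ ℂ Z]

theorem isLineFrame_trivialization {x₀ x : N} (hx : x ∈ (trivializationAt ℂ Z x₀).baseSet) :
    IsLineFrame ((trivializationAt ℂ Z x₀).symm x 1) := by
  set e := trivializationAt ℂ Z x₀
  have h1 : ∀ c : ℂ, e.symm x c = c • e.symm x 1 := fun c => by
    rw [← e.symmₗ_apply (R := ℂ) hx, ← e.symmₗ_apply (R := ℂ) hx, ← map_smul, smul_eq_mul, mul_one]
  refine ⟨fun h => ?_, fun v => ⟨(e ⟨x, v⟩).2, ?_⟩⟩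
  · have h2 : e ⟨x, e.symm x 1⟩ = (x, 1) := e.apply_mk_symm hx 1
    have h3 : e ⟨x, e.symm x 0⟩ = (x, 0) := e.apply_mk_symm hx 0
    rw [h1 0, zero_smul, ← h, h2] at h3
    exact one_ne_zero (congrArg Prod.snd h3)
  · rw [← h1, e.symm_apply_apply_mk hx]

theorem ratio_trivialization {x₀ x : N} (hx : x ∈ (trivializationAt ℂ Z x₀).baseSet) (v : Z x) :
    ratio v ((trivializationAt ℂ Z x₀).symm x 1) = (trivializationAt ℂ Z x₀ ⟨x, v⟩).2 := by
  set e := trivializationAt ℂ Z x₀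
  refine ratio_eq (isLineFrame_trivialization hx) ?_
  have h1 : ∀ c : ℂ, e.symm x c = c • e.symm x 1 := fun c => by
    rw [← e.symmₗ_apply (R := ℂ) hx, ← e.symmₗ_apply (R := ℂ) hx, ← map_smul, smul_eq_mul, mul_one]
  exact (e.symm_apply_apply_mk hx v).symm.trans (h1 _)

variable [VectorBundle ℝ ℂ Z]  [ContMDiffVectorBundle ∞ ℂ Z I]

theorem contMDiffAt_section_iff_ratio {s : ∀ x, Z x} {x₀ x : N}
    (hx : x ∈ (trivializationAt ℂ Z x₀).baseSet) :
    ContMDiffAt I (I.prod 𝓘(ℝ, ℂ)) ∞ (fun x => TotalSpace.mk' ℂ x (s x)) x ↔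
      ContMDiffAt I 𝓘(ℝ, ℂ) ∞ (fun x => ratio (s x) ((trivializationAt ℂ Z x₀).symm x 1)) x := by
  rw [(trivializationAt ℂ Z x₀).contMDiffAt_section_iff hx]
  refine Filter.EventuallyEq.contMDiffAt_iff ?_
  filter_upwards [(trivializationAt ℂ Z x₀).open_baseSet.mem_nhds hx] with y hy
  exact (ratio_trivialization hy _).symm

theorem frameSystem_trivialization :
    FrameSystem I (fun x₀ x => (trivializationAt ℂ Z x₀).symm x 1)
      fun x₀ => (trivializationAt ℂ Z x₀).baseSet where
  isOpen p := (trivializationAt ℂ Z p).open_baseSet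
  mem p := FiberBundle.mem_baseSet_trivializationAt ℂ Z p
  isLineFrame p q hq := isLineFrame_trivialization hq
  smooth p p' q hq hq' := by
    filter_upwards [(trivializationAt ℂ Z p).open_baseSet.mem_nhds hq,
      (trivializationAt ℂ Z p').open_baseSet.mem_nhds hq'] with x hx hx'
    rw [← contMDiffAt_section_iff_ratio hx', contMDiffAt_section_iff_ratio hx]
    refine (contMDiffAt_const (c := (1 : ℂ))).congr_of_eventuallyEq ?_
    filter_upwards [(trivializationAt ℂ Z p).open_baseSet.mem_nhds hx] with y hy
    exact ratio_self (isLineFrame_trivialization hy)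

theorem contMDiff_section_iff_smoothSec {s : ∀ x, Z x} :
    ContMDiff I (I.prod 𝓘(ℝ, ℂ)) ∞ (fun x => TotalSpace.mk' ℂ x (s x)) ↔
      SmoothSec I (fun x₀ x => (trivializationAt ℂ Z x₀).symm x 1) s :=
  forall_congr' fun p => contMDiffAt_section_iff_ratio (FiberBundle.mem_baseSet_trivializationAt ℂ Z p)

end Bundles

end

/-! ### The connection forms of the prequantum bundle -/

section

variable {m n : ℕ}
  {U : Type*} [TopologicalSpace U] [ChartedSpace (EuclideanSpace ℝ (Fin m)) U]
  {M : Type*} [TopologicalSpace M] [ChartedSpace (EuclideanSpace ℝ (Fin (2 * n))) M]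
  [IsManifold (𝓡 m) ∞ U] [IsManifold (𝓡 (2 * n)) ∞ M]

section PrequantumForms

variable {K : KahlerFamily m n U M}
  {L : M → Type*} [TopologicalSpace (TotalSpace ℂ L)]
  [∀ x, AddCommGroup (L x)] [∀ x, Module ℂ (L x)] [∀ x, TopologicalSpace (L x)]
  [∀ x, IsTopologicalAddGroup (L x)] [∀ x, ContinuousSMul ℝ (L x)]
  [FiberBundle ℂ L] [VectorBundle ℝ ℂ L] [VectorBundle ℂ ℂ L]
  [ContMDiffVectorBundle ∞ ℂ L (𝓡 (2 * n))]

variable (L) in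
theorem frameSystemL : FrameSystem (𝓡 (2 * n)) (frameL L)
    fun x₀ => (trivializationAt ℂ L x₀).baseSet := frameSystem_trivialization

variable (L) in
/-- Smooth sections of `L`. -/
abbrev SmoothL (s : ∀ x, L x) : Prop := SmoothSec (𝓡 (2 * n)) (frameL L) s

theorem smoothL_iff {s : ∀ x, L x} :
    ContMDiff (𝓡 (2 * n)) ((𝓡 (2 * n)).prod 𝓘(ℝ, ℂ)) ∞ (fun x => TotalSpace.mk' ℂ x (s x)) ↔
      SmoothL (n := n) L s :=
  contMDiff_section_iff_smoothSec

variable [T2Space M] (Q : Prequantum K L)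

theorem smoothL_mdiff {s : ∀ x, L x} (hs : SmoothL (n := n) L s) (x : M) :
    MDifferentiableAt (𝓡 (2 * n)) ((𝓡 (2 * n)).prod 𝓘(ℝ, ℂ))
      (fun x => TotalSpace.mk' ℂ x (s x)) x :=
  (smoothL_iff.2 hs x).mdifferentiableAt (by simp)

theorem nabla_congr {s t : ∀ x, L x} (hs : SmoothL (n := n) L s) {x : M}
    (h : ∀ᶠ y in 𝓝 x, t y = s y) : Q.nabla t x = Q.nabla s x := by
  have h1 := smoothL_mdiff hs x
  have h2 : MDifferentiableAt (𝓡 (2 * n)) ((𝓡 (2 * n)).prod 𝓘(ℝ, ℂ))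
      (fun x => TotalSpace.mk' ℂ x (t x)) x := by
    refine h1.congr_of_eventuallyEq ?_
    filter_upwards [h] with y hy
    rw [hy]
  exact (Q.nabla.isCovariantDerivativeOn (s := Set.univ)).congr_of_eventuallyEq h2 h1
    Filter.univ_mem h

/-- The Leibniz rule of a covariant derivative is for real functions. It is applied to the real and
imaginary parts of f separately, and compatibility with multiplication by i reassembles them. -/
theorem nabla_smul {s : ∀ x, L x} (hs : SmoothL (n := n) L s) {f : M → ℂ}
    (hf : ContMDiff (𝓡 (2 * n)) 𝓘(ℝ, ℂ) ∞ f) (x : M) (v : TangentSpace (𝓡 (2 * n)) x) :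
    Q.nabla (fun y => f y • s y) x v
      = f x • Q.nabla s x v + mvfderiv (𝓡 (2 * n)) f x v • s x := by
  have hre : ContMDiff (𝓡 (2 * n)) 𝓘(ℝ, ℝ) ∞ fun y => (f y).re :=
    Complex.reCLM.contMDiff.comp hf
  have him : ContMDiff (𝓡 (2 * n)) 𝓘(ℝ, ℝ) ∞ fun y => (f y).im :=
    Complex.imCLM.contMDiff.comp hf
  have hI : SmoothL (n := n) L fun y => Complex.I • s y :=
    (frameSystemL L).smoothSec_smul contMDiff_const hs
  have hsr : SmoothL (n := n) L fun y => ((f y).re : ℂ) • s y :=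
    (frameSystemL L).smoothSec_smul (Complex.ofRealCLM.contMDiff.comp hre) hs
  have hsi : SmoothL (n := n) L fun y => ((f y).im : ℂ) • Complex.I • s y :=
    (frameSystemL L).smoothSec_smul (Complex.ofRealCLM.contMDiff.comp him) hI
  have hmf : MDifferentiableAt (𝓡 (2 * n)) 𝓘(ℝ, ℂ) f x := (hf x).mdifferentiableAt (by simp)
  have h1 : (fun y => f y • s y)
      = (fun y => ((f y).re : ℂ) • s y) + fun y => ((f y).im : ℂ) • Complex.I • s y := by
    funext y
    rw [Pi.add_apply, smul_smul, ← add_smul, Complex.re_add_im]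
  have hc := Q.nabla.isCovariantDerivativeOn (s := Set.univ)
  have h2 := hc.add (smoothL_mdiff hsr x) (smoothL_mdiff hsi x)
  have h3 := hc.leibniz (g := fun y => (f y).re) (smoothL_mdiff hs x)
    ((hre x).mdifferentiableAt (by simp))
  have h4 := hc.leibniz (g := fun y => (f y).im) (smoothL_mdiff hI x)
    ((him x).mdifferentiableAt (by simp))
  have h5 := Q.nabla_complex s (smoothL_iff.2 hs) x v
  have h6 : mvfderiv (𝓡 (2 * n)) (fun y => (f y).re) x v = (mvfderiv (𝓡 (2 * n)) f x v).re :=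
    mvfderiv_clm_apply hmf Complex.reCLM v
  have h7 : mvfderiv (𝓡 (2 * n)) (fun y => (f y).im) x v = (mvfderiv (𝓡 (2 * n)) f x v).im :=
    mvfderiv_clm_apply hmf Complex.imCLM v
  have h3' := congrArg (fun T => T v) h3
  have h4' := congrArg (fun T => T v) h4
  have e3 : Q.nabla (fun y => ((f y).re : ℂ) • s y) x v = ((f x).re : ℂ) • Q.nabla s x v
      + ((mvfderiv (𝓡 (2 * n)) f x v).re : ℂ) • s x := by
    rw [← h6]
    exact h3'
  have e4 : Q.nabla (fun y => ((f y).im : ℂ) • Complex.I • s y) x v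
      = ((f x).im : ℂ) • Complex.I • Q.nabla s x v
        + ((mvfderiv (𝓡 (2 * n)) f x v).im : ℂ) • Complex.I • s x := by
    rw [← h7, ← h5]
    exact h4'
  rw [h1]
  refine (congrArg (fun T => T v) h2).trans ?_
  refine (congrArg₂ (· + ·) e3 e4).trans ?_
  conv_rhs => rw [← Complex.re_add_im (f x), ← Complex.re_add_im (mvfderiv (𝓡 (2 * n)) f x v)]
  module

/-- The connection form of `L` in a local frame. -/
def aL (x₀ x : M) (v : TangentSpace (𝓡 (2 * n)) x) : ℂ :=
  ratio (Q.nabla (frameL L x₀) x v) (frameL L x₀ x)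

theorem aL_add {x₀ x : M} (hx : x ∈ (trivializationAt ℂ L x₀).baseSet)
    (v w : TangentSpace (𝓡 (2 * n)) x) : aL Q x₀ x (v + w) = aL Q x₀ x v + aL Q x₀ x w := by
  rw [aL, map_add, ratio_add ((frameSystemL (n := n) L).isLineFrame x₀ x hx)]
  rfl

/-- The local frame is not a global section. It is replaced by a smooth section σ equal to it near
x, and s by the product of σ and a global extension of its coefficient, which changes nothing in the
germs at x. -/
theorem nabla_eq {s : ∀ x, L x} (hs : SmoothL (n := n) L s) {x₀ x : M}
    (hx : x ∈ (trivializationAt ℂ L x₀).baseSet) (v : TangentSpace (𝓡 (2 * n)) x) :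
    ratio (Q.nabla s x v) (frameL L x₀ x)
      = mvfderiv (𝓡 (2 * n)) (fun y => ratio (s y) (frameL L x₀ y)) x v
        + aL Q x₀ x v * ratio (s x) (frameL L x₀ x) := by
  have S := frameSystemL (n := n) L
  obtain ⟨σ, hσ, h1⟩ := S.exists_smoothSec hx (smoothNear_const (1 : ℂ) x)
  obtain ⟨g, hg, h2⟩ := (S.smoothNear hs hx).exists_extension
  have h3 : ∀ᶠ y in 𝓝 x, frameL L x₀ y = σ y := by
    filter_upwards [h1] with y hy
    rw [hy, one_smul]
  have h4 : ∀ᶠ y in 𝓝 x, s y = g y • σ y := by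
    filter_upwards [h2, h3, (S.isOpen x₀).mem_nhds hx] with y hy hy' hy2
    rw [← hy', hy, ratio_smul_self (S.isLineFrame x₀ y hy2)]
  have h5 := S.isLineFrame x₀ x hx
  rw [nabla_congr Q (S.smoothSec_smul hg hσ) h4, nabla_smul Q hσ hg, ratio_add h5, ratio_smul h5,
    ratio_smul h5, ← mvfderiv_congr h2, aL, nabla_congr Q hσ h3, ← h3.self_of_nhds, ratio_self h5,
    show ratio (s x) (frameL L x₀ x) = g x from h2.self_of_nhds.symm]
  ring

theorem aL_smooth {x₀ x : M} (hx : x ∈ (trivializationAt ℂ L x₀).baseSet)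
    {V : ∀ x : M, TangentSpace (𝓡 (2 * n)) x} (hV : IsSmoothVF V) :
    SmoothNear (𝓡 (2 * n)) (fun y => aL Q x₀ y (V y)) x := by
  have S := frameSystemL (n := n) L
  obtain ⟨σ, hσ, h1⟩ := S.exists_smoothSec hx (smoothNear_const (1 : ℂ) x)
  have hs : SmoothL (n := n) L fun y => Q.nabla σ y (V y) := by
    rw [← smoothL_iff]
    have h2 := Q.nabla_smooth.contMDiff.contMDiff (σ := σ)
      (contMDiffOn_univ.2 (by simpa using smoothL_iff.2 hσ))
    exact ContMDiff.clm_bundle_apply (contMDiffOn_univ.1 h2) hV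
  refine (S.smoothNear hs hx).congr ?_
  filter_upwards [h1.eventually_nhds] with y hy
  have h3 : ∀ᶠ z in 𝓝 y, frameL L x₀ z = σ z := by
    filter_upwards [hy] with z hz
    rw [hz, one_smul]
  rw [aL, nabla_congr Q hσ h3]

/-- Change of frame. -/
theorem aL_transition {x₀ x₁ x : M} (hx : x ∈ (trivializationAt ℂ L x₀).baseSet)
    (hx₁ : x ∈ (trivializationAt ℂ L x₁).baseSet) (v : TangentSpace (𝓡 (2 * n)) x) :
    aL Q x₁ x v * ratio (frameL L x₁ x) (frameL L x₀ x)
      = mvfderiv (𝓡 (2 * n)) (fun y => ratio (frameL L x₁ y) (frameL L x₀ y)) x v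
        + aL Q x₀ x v * ratio (frameL L x₁ x) (frameL L x₀ x) := by
  have S := frameSystemL (n := n) L
  obtain ⟨σ, hσ, h1⟩ := S.exists_smoothSec hx₁ (smoothNear_const (1 : ℂ) x)
  have h3 : ∀ᶠ y in 𝓝 x, frameL L x₁ y = σ y := by
    filter_upwards [h1] with y hy
    rw [hy, one_smul]
  have h4 := nabla_eq Q hσ hx v
  have h6 : (fun y => ratio (frameL L x₁ y) (frameL L x₀ y))
      =ᶠ[𝓝 x] fun y => ratio (σ y) (frameL L x₀ y) := by
    filter_upwards [h3] with y hy
    rw [hy]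
  rw [← h3.self_of_nhds, ← mvfderiv_congr h6, ← nabla_congr Q hσ h3,
    ratio_trans (S.isLineFrame x₀ x hx) (S.isLineFrame x₁ x hx₁)] at h4
  exact h4

/-- The curvature identity is applied to a section equal to the frame near x. The products of two
values of the connection form cancel, since complex scalars commute. -/
theorem aL_curvature {x₀ x : M} (hx : x ∈ (trivializationAt ℂ L x₀).baseSet)
    {A B : ∀ x : M, TangentSpace (𝓡 (2 * n)) x} (hA : IsSmoothVF A) (hB : IsSmoothVF B) :
    mvfderiv (𝓡 (2 * n)) (fun y => aL Q x₀ y (B y)) x (A x)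
      - mvfderiv (𝓡 (2 * n)) (fun y => aL Q x₀ y (A y)) x (B x)
      - aL Q x₀ x (VectorField.mlieBracket (𝓡 (2 * n)) A B x)
      = (1 / Complex.I) * (K.symp x (A x) (B x) : ℂ) := by
  have S := frameSystemL (n := n) L
  obtain ⟨σ, hσ, h1⟩ := S.exists_smoothSec hx (smoothNear_const (1 : ℂ) x)
  have h3 : ∀ᶠ y in 𝓝 x, frameL L x₀ y = σ y := by
    filter_upwards [h1] with y hy
    rw [hy, one_smul]
  have hs : ∀ {V : ∀ x : M, TangentSpace (𝓡 (2 * n)) x}, IsSmoothVF V →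
      SmoothL (n := n) L fun y => Q.nabla σ y (V y) := fun {V} hV => by
    rw [← smoothL_iff]
    have h2 := Q.nabla_smooth.contMDiff.contMDiff (σ := σ)
      (contMDiffOn_univ.2 (by simpa using smoothL_iff.2 hσ))
    exact ContMDiff.clm_bundle_apply (contMDiffOn_univ.1 h2) hV
  have h4 : ∀ {V : ∀ x : M, TangentSpace (𝓡 (2 * n)) x},
      (fun y => aL Q x₀ y (V y)) =ᶠ[𝓝 x] fun y => ratio (Q.nabla σ y (V y)) (frameL L x₀ y) :=
    fun {V} => by
      filter_upwards [h3.eventually_nhds] with y hy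
      rw [aL, nabla_congr Q hσ hy]
  have h5 := S.isLineFrame x₀ x hx
  have h6 := congrArg (fun v => ratio v (frameL L x₀ x))
    (Q.nabla_curv A B σ hA hB (smoothL_iff.2 hσ) x)
  have h7 : ratio (σ x) (frameL L x₀ x) = 1 := by rw [← h3.self_of_nhds, ratio_self h5]
  simp only [ratio_sub h5, ratio_smul h5, h7, mul_one, nabla_eq Q (hs hB) hx,
    nabla_eq Q (hs hA) hx] at h6
  rw [← h6, mvfderiv_congr h4, mvfderiv_congr h4]
  have h8 : ∀ v, ratio (Q.nabla σ x v) (frameL L x₀ x) = aL Q x₀ x v := fun v => by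
    rw [aL, nabla_congr Q hσ h3]
  rw [h8, h8, h8]
  ring

end PrequantumForms

end

/-! ### The connection forms of the half-form bundle -/

section

variable {m n : ℕ}
  {U : Type*} [TopologicalSpace U] [ChartedSpace (EuclideanSpace ℝ (Fin m)) U]
  {M : Type*} [TopologicalSpace M] [ChartedSpace (EuclideanSpace ℝ (Fin (2 * n))) M]
  [IsManifold (𝓡 m) ∞ U] [IsManifold (𝓡 (2 * n)) ∞ M]

section HalfForms

variable {K : KahlerFamily m n U M}
  {δ : U × M → Type*} [TopologicalSpace (TotalSpace ℂ δ)]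
  [∀ p, AddCommGroup (δ p)] [∀ p, Module ℂ (δ p)] [∀ p, TopologicalSpace (δ p)]
  [FiberBundle ℂ δ] [VectorBundle ℝ ℂ δ] [VectorBundle ℂ ℂ δ]
  [ContMDiffVectorBundle ∞ ℂ δ ((𝓡 m).prod (𝓡 (2 * n)))]

variable (δ) in
theorem frameSystemδ : FrameSystem ((𝓡 m).prod (𝓡 (2 * n))) (frameδ δ)
    fun p₀ => (trivializationAt ℂ δ p₀).baseSet := frameSystem_trivialization

variable (D : HalfForm K δ)

/-- The image by `φ` of the square of a frame of `δ`. -/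
def formΦ (p₀ q : U × M) : K.E q [⋀^Fin n]→ₗ[ℂ] ℂ := D.φ q (frameδ δ p₀ q ⊗ₜ[ℂ] frameδ δ p₀ q)

theorem formΦ_ne_zero {p₀ q : U × M} (hq : q ∈ (trivializationAt ℂ δ p₀).baseSet) :
    formΦ D p₀ q ≠ 0 := by
  have h := (frameSystemδ (m := m) (n := n) δ).isLineFrame p₀ q hq
  exact (D.φ q).map_ne_zero_iff.2 (h.tmul h).1

/-- The connection form of `δ` in a local frame. -/
def aδ (p₀ q : U × M) (X : TangentSpace (𝓡 m) q.1) (v : TangentSpace (𝓡 (2 * n)) q.2) : ℂ :=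
  Classical.epsilon (K.IsForm (formΦ D p₀) q X v)

theorem formδ_eq (p : U × M) (X : TangentSpace (𝓡 m) p.1) (v : TangentSpace (𝓡 (2 * n)) p.2) :
    formδ D p X v = aδ D p p X v := rfl

variable [T2Space U] [T2Space M] (T : TFrame (2 * n) M)

theorem formCoef_formΦ_smooth {p₀ q : U × M} (hq : q ∈ (trivializationAt ℂ δ p₀).baseSet)
    (f : Fin n → Fin T.card) :
    SmoothNear ((𝓡 m).prod (𝓡 (2 * n))) (K.formCoef T (formΦ D p₀) f) q := by
  obtain ⟨d, hd, h1⟩ := (frameSystemδ (m := m) (n := n) δ).exists_smoothSec hq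
    (smoothNear_const (1 : ℂ) q)
  have h2 := D.φ_smooth d d (fun i => K.W T (f i)) (contMDiff_section_iff_smoothSec.2 hd)
    (contMDiff_section_iff_smoothSec.2 hd) fun i => K.W_smooth T (f i)
  refine (smoothNear_of_contMDiff h2 q).congr ?_
  filter_upwards [h1] with y hy
  rw [hy, one_smul]
  rfl

include T in
theorem isForm_aδ {p₀ q : U × M} (hq : q ∈ (trivializationAt ℂ δ p₀).baseSet)
    (X : TangentSpace (𝓡 m) q.1) (v : TangentSpace (𝓡 (2 * n)) q.2) :
    K.IsForm (formΦ D p₀) q X v (aδ D p₀ q X v) :=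
  Classical.epsilon_spec (K.exists_isForm T (fun f => formCoef_formΦ_smooth D T hq f)
    (formΦ_ne_zero D hq) X v)

-- The connection form of δ is chosen direction by direction; its additivity rests on the uniqueness
-- of the chosen number.
include T in
theorem aδ_add {p₀ q : U × M} (hq : q ∈ (trivializationAt ℂ δ p₀).baseSet)
    (X X' : TangentSpace (𝓡 m) q.1) (v v' : TangentSpace (𝓡 (2 * n)) q.2) :
    aδ D p₀ q (X + X') (v + v') = aδ D p₀ q X v + aδ D p₀ q X' v' :=
  K.isForm_add T (formΦ_ne_zero D hq) (isForm_aδ D T hq X v) (isForm_aδ D T hq X' v')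
    (isForm_aδ D T hq _ _)

include T in
theorem aδ_smul {p₀ q : U × M} (hq : q ∈ (trivializationAt ℂ δ p₀).baseSet)
    (c : ℝ) (X : TangentSpace (𝓡 m) q.1) (v : TangentSpace (𝓡 (2 * n)) q.2) :
    aδ D p₀ q (c • X) (c • v) = c * aδ D p₀ q X v :=
  K.isForm_smul T (formΦ_ne_zero D hq) (isForm_aδ D T hq X v) (isForm_aδ D T hq _ _)

include T in
theorem aδ_smooth {p₀ q : U × M} (hq : q ∈ (trivializationAt ℂ δ p₀).baseSet)
    {X : ∀ u : U, TangentSpace (𝓡 m) u} (hX : IsSmoothVF X)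
    {V : ∀ x : M, TangentSpace (𝓡 (2 * n)) x} (hV : IsSmoothVF V) :
    SmoothNear ((𝓡 m).prod (𝓡 (2 * n))) (fun p => aδ D p₀ p (X p.1) (V p.2)) q := by
  refine K.isForm_smooth T (fun f => formCoef_formΦ_smooth D T hq f) (formΦ_ne_zero D hq) hX hV ?_
  filter_upwards [(trivializationAt ℂ δ p₀).open_baseSet.mem_nhds hq] with y hy
  exact isForm_aδ D T hy _ _

theorem aδ_curvature {p₀ q : U × M} (hq : q ∈ (trivializationAt ℂ δ p₀).baseSet)
    {X Y : ∀ u : U, TangentSpace (𝓡 m) u} (hX : IsSmoothVF X) (hY : IsSmoothVF Y) :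
    mvfderiv ((𝓡 m).prod (𝓡 (2 * n))) (fun p => aδ D p₀ p (Y p.1) 0) q (tPair (X q.1) 0)
      - mvfderiv ((𝓡 m).prod (𝓡 (2 * n))) (fun p => aδ D p₀ p (X p.1) 0) q (tPair (Y q.1) 0)
      - aδ D p₀ q (VectorField.mlieBracket (𝓡 m) X Y q.1) 0
      = -(Complex.I / 8) * (K.tau T q (X q.1) (Y q.1) : ℂ) := by
  have h : ∀ X : ∀ u : U, TangentSpace (𝓡 m) u,
      ∀ᶠ p in 𝓝 q, K.IsForm (formΦ D p₀) p (X p.1) 0 (aδ D p₀ p (X p.1) 0) := fun X => by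
    filter_upwards [(trivializationAt ℂ δ p₀).open_baseSet.mem_nhds hq] with y hy
    exact isForm_aδ D T hy _ _
  exact K.isForm_curvature T (fun f => formCoef_formΦ_smooth D T hq f) (formΦ_ne_zero D hq) hX hY
    (AZ := fun p => aδ D p₀ p (VectorField.mlieBracket (𝓡 m) X Y p.1) 0)
    (h X) (h Y) (isForm_aδ D T hq _ _)

include T in
/-- Change of frame. -/
theorem aδ_transition {p₀ p₁ q : U × M} (hq : q ∈ (trivializationAt ℂ δ p₀).baseSet)
    (hq₁ : q ∈ (trivializationAt ℂ δ p₁).baseSet) (X : TangentSpace (𝓡 m) q.1)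
    (v : TangentSpace (𝓡 (2 * n)) q.2) :
    aδ D p₁ q X v * ratio (frameδ δ p₁ q) (frameδ δ p₀ q)
      = mvfderiv ((𝓡 m).prod (𝓡 (2 * n))) (fun y => ratio (frameδ δ p₁ y) (frameδ δ p₀ y)) q
          (tPair X v)
        + aδ D p₀ q X v * ratio (frameδ δ p₁ q) (frameδ δ p₀ q) := by
  have S := frameSystemδ (m := m) (n := n) δ
  set t : U × M → ℂ := fun y => ratio (frameδ δ p₁ y) (frameδ δ p₀ y) with ht
  have ht1 : SmoothNear ((𝓡 m).prod (𝓡 (2 * n))) t q := S.smooth p₁ p₀ q hq₁ hq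
  have ht0 : t q ≠ 0 := ratio_ne_zero (S.isLineFrame p₁ q hq₁) (S.isLineFrame p₀ q hq)
  -- The frame of δ enters Φ through its square, so the transition function does as well. The
  -- resulting factor 2 in the derivative matches the one in `IsForm`.
  have h1 : ∀ᶠ y in 𝓝 q, formΦ D p₁ y = (t y * t y) • formΦ D p₀ y := by
    filter_upwards [(S.isOpen p₀).mem_nhds hq] with y hy
    have h := ratio_smul_self (S.isLineFrame p₀ y hy) (frameδ δ p₁ y)
    rw [formΦ, ← h, TensorProduct.smul_tmul_smul, map_smul]
    rfl
  obtain ⟨f, hf⟩ := K.exists_formCoef_ne_zero T (formΦ_ne_zero D hq)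
  have e1 := KahlerFamily.IsForm.coef K T (isForm_aδ D T hq X v) f
  have e2 := KahlerFamily.IsForm.coef K T (isForm_aδ D T hq₁ X v) f
  have h2 : ∀ g, K.formCoef T (formΦ D p₁) g
      =ᶠ[𝓝 q] fun y => (t y * t y) * K.formCoef T (formΦ D p₀) g y := fun g => by
    filter_upwards [h1] with y hy
    rw [KahlerFamily.formCoef, hy]
    rfl
  rw [mvfderiv_congr (h2 f), mvfderiv_mul_apply (ht1.mul ht1).mdiff
    (formCoef_formΦ_smooth D T hq f).mdiff, mvfderiv_mul_apply ht1.mdiff ht1.mdiff, e1] at e2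
  simp only [fun g => (h2 g).self_of_nhds] at e2
  have h3 : indexDeriv (fun a b => K.connMat T a b q X v)
      (fun g => t q * t q * K.formCoef T (formΦ D p₀) g q) f
      = t q * t q * indexDeriv (fun a b => K.connMat T a b q X v)
        (fun g => K.formCoef T (formΦ D p₀) g q) f := by
    simp only [indexDeriv, Finset.mul_sum]
    exact Finset.sum_congr rfl fun l _ => Finset.sum_congr rfl fun b _ => by ring
  rw [h3] at e2
  -- Comparison of the two systems gives the transition rule multiplied by this factor, which is
  -- nonzero.
  have h4 : (2 * t q * K.formCoef T (formΦ D p₀) f q) ≠ 0 :=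
    mul_ne_zero (mul_ne_zero two_ne_zero ht0) hf
  refine mul_left_cancel₀ h4 ?_
  linear_combination -e2

end HalfForms

end

/-! ### Derivations of the sections of a line bundle -/

section

section Derivations

variable {E : Type*} [NormedAddCommGroup E] [NormedSpace ℝ E]
  {H : Type*} [TopologicalSpace H] (I : ModelWithCorners ℝ E H)
  {N : Type*} [TopologicalSpace N] [ChartedSpace H N]
  {Z : N → Type*} [∀ x, AddCommGroup (Z x)] [∀ x, Module ℂ (Z x)]

/-- Multiplication by f p avoids the exponent k - 1, so that k = 0 is not a separate case. -/
theorem mvfderiv_pow_apply {f : N → ℂ} {p : N} (hf : MDifferentiableAt I 𝓘(ℝ, ℂ) f p)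
    (k : ℕ) (v : TangentSpace I p) :
    f p * mvfderiv I (fun q => f q ^ k) p v = k * f p ^ k * mvfderiv I f p v := by
  have hd : ∀ k : ℕ, MDifferentiableAt I 𝓘(ℝ, ℂ) (fun q => f q ^ k) p := fun k => by
    induction k with
    | zero => simpa using mdifferentiableAt_const
    | succ k ih =>
      have h := ih.mul hf
      simp only [pow_succ]
      exact h
  induction k with
  | zero => simp [mvfderiv_const_apply]
  | succ k ih =>
    simp only [pow_succ]
    rw [mvfderiv_mul_apply (hd k) hf, mul_add, ← mul_assoc (f p) (mvfderiv I _ p v), ih]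
    push_cast
    ring

/-- The operator `P` on sections is, in each local frame, a vector field plus a function. -/
structure IsDerivation (F : N → ∀ x, Z x) (B : N → Set N) (ξ : ∀ x : N, TangentSpace I x)
    (θ : N → N → ℂ) (P : (∀ x, Z x) → ∀ x, Z x) : Prop where
  apply : ∀ s, SmoothSec I F s → ∀ p, ∀ q ∈ B p,
    ratio (P s q) (F p q) = mvfderiv I (fun x => ratio (s x) (F p x)) q (ξ q)
      + θ p q * ratio (s q) (F p q)
  smooth : ∀ p, ∀ q ∈ B p, SmoothNear I (θ p) q

/-- The coefficient of the commutator of two derivations. -/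
def commCoef (ξ₁ ξ₂ : ∀ x : N, TangentSpace I x) (θ₁ θ₂ θ₃ : N → N → ℂ) (p q : N) : ℂ :=
  mvfderiv I (θ₂ p) q (ξ₁ q) - mvfderiv I (θ₁ p) q (ξ₂ q) - θ₃ p q

variable {I} [FiniteDimensional ℝ E] [T2Space N] [IsManifold I ∞ N]
  {F : N → ∀ x, Z x} {B : N → Set N} {ξ ξ₁ ξ₂ ξ₃ : ∀ x : N, TangentSpace I x}
  {θ θ₁ θ₂ θ₃ : N → N → ℂ} {P P₁ P₂ P₃ : (∀ x, Z x) → ∀ x, Z x}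

namespace IsDerivation

theorem smoothSec (S : FrameSystem I F B) (h : IsDerivation I F B ξ θ P)
    (hξ : ContMDiff I I.tangent ∞ fun p => (⟨p, ξ p⟩ : TangentBundle I N))
    {s : ∀ x, Z x} (hs : SmoothSec I F s) : SmoothSec I F (P s) := by
  intro p
  refine ((((S.smoothNear hs (S.mem p)).mvfderiv hξ).add
    ((h.smooth p p (S.mem p)).mul (S.smoothNear hs (S.mem p)))).contMDiffAt).congr_of_eventuallyEq ?_
  filter_upwards [(S.isOpen p).mem_nhds (S.mem p)] with q hq using h.apply s hs p q hq

theorem apply_smul (S : FrameSystem I F B) (h : IsDerivation I F B ξ θ P) {f : N → ℂ}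
    (hf : ContMDiff I 𝓘(ℝ, ℂ) ∞ f) {s : ∀ x, Z x} (hs : SmoothSec I F s) (q : N) :
    P (fun x => f x • s x) q = f q • P s q + mvfderiv I f q (ξ q) • s q := by
  have hq := S.mem q
  have h0 := S.isLineFrame q q hq
  refine h0.ext ?_
  rw [h.apply _ (S.smoothSec_smul hf hs) q q hq, ratio_add h0, ratio_smul h0, ratio_smul h0,
    ratio_smul h0, h.apply s hs q q hq]
  have h1 : (fun x => ratio (f x • s x) (F q x)) =ᶠ[𝓝 q] fun x => f x * ratio (s x) (F q x) := by
    filter_upwards [(S.isOpen q).mem_nhds hq] with x hx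
    exact ratio_smul (S.isLineFrame q x hx) _ _
  rw [mvfderiv_congr h1, mvfderiv_mul_apply ((hf q).mdifferentiableAt (by simp)) (S.mdiff hs hq)]
  ring

theorem apply_add (S : FrameSystem I F B) (h : IsDerivation I F B ξ θ P) {s t : ∀ x, Z x}
    (hs : SmoothSec I F s) (ht : SmoothSec I F t) (q : N) :
    P (fun x => s x + t x) q = P s q + P t q := by
  have hq := S.mem q
  have h0 := S.isLineFrame q q hq
  refine h0.ext ?_
  rw [h.apply _ (S.smoothSec_add hs ht) q q hq, ratio_add h0, ratio_add h0, h.apply s hs q q hq,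
    h.apply t ht q q hq]
  have h1 : (fun x => ratio (s x + t x) (F q x))
      =ᶠ[𝓝 q] fun x => ratio (s x) (F q x) + ratio (t x) (F q x) := by
    filter_upwards [(S.isOpen q).mem_nhds hq] with x hx
    exact ratio_add (S.isLineFrame q x hx) _ _
  rw [mvfderiv_congr h1, mvfderiv_add_apply (S.mdiff hs hq) (S.mdiff ht hq)]
  ring

/-- In a local frame the first order parts of the commutator cancel by the bracket relation, and the
products of coefficients cancel by commutativity. What remains is multiplication by the coefficient.
-/
theorem commutator (S : FrameSystem I F B) (h₁ : IsDerivation I F B ξ₁ θ₁ P₁)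
    (h₂ : IsDerivation I F B ξ₂ θ₂ P₂) (h₃ : IsDerivation I F B ξ₃ θ₃ P₃)
    (hξ₁ : ContMDiff I I.tangent ∞ fun p => (⟨p, ξ₁ p⟩ : TangentBundle I N))
    (hξ₂ : ContMDiff I I.tangent ∞ fun p => (⟨p, ξ₂ p⟩ : TangentBundle I N))
    (hξ : ∀ {f : N → ℂ} {q : N}, SmoothNear I f q →
      mvfderiv I (fun x => mvfderiv I f x (ξ₂ x)) q (ξ₁ q)
        - mvfderiv I (fun x => mvfderiv I f x (ξ₁ x)) q (ξ₂ q) = mvfderiv I f q (ξ₃ q))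
    {s : ∀ x, Z x} (hs : SmoothSec I F s) {p q : N} (hq : q ∈ B p) :
    P₁ (P₂ s) q - P₂ (P₁ s) q - P₃ s q = commCoef I ξ₁ ξ₂ θ₁ θ₂ θ₃ p q • s q := by
  have h0 := S.isLineFrame p q hq
  refine h0.ext ?_
  have hf := S.smoothNear hs hq
  have e1 : (fun x => ratio (P₁ s x) (F p x)) =ᶠ[𝓝 q]
      fun x => mvfderiv I (fun x => ratio (s x) (F p x)) x (ξ₁ x)
        + θ₁ p x * ratio (s x) (F p x) := by
    filter_upwards [(S.isOpen p).mem_nhds hq] with x hx using h₁.apply s hs p x hx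
  have e2 : (fun x => ratio (P₂ s x) (F p x)) =ᶠ[𝓝 q]
      fun x => mvfderiv I (fun x => ratio (s x) (F p x)) x (ξ₂ x)
        + θ₂ p x * ratio (s x) (F p x) := by
    filter_upwards [(S.isOpen p).mem_nhds hq] with x hx using h₂.apply s hs p x hx
  have t1 := h₁.smooth p q hq
  have t2 := h₂.smooth p q hq
  rw [ratio_sub h0, ratio_sub h0, ratio_smul h0,
    h₁.apply _ (h₂.smoothSec S hξ₂ hs) p q hq, h₂.apply _ (h₁.smoothSec S hξ₁ hs) p q hq,
    h₃.apply s hs p q hq, mvfderiv_congr e1, mvfderiv_congr e2,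
    mvfderiv_add_apply (hf.mvfderiv hξ₁).mdiff (t1.mul hf).mdiff,
    mvfderiv_add_apply (hf.mvfderiv hξ₂).mdiff (t2.mul hf).mdiff,
    mvfderiv_mul_apply t1.mdiff hf.mdiff, mvfderiv_mul_apply t2.mdiff hf.mdiff,
    h₁.apply s hs p q hq, h₂.apply s hs p q hq, commCoef, ← hξ hf]
  ring

/-- The coefficient is determined by the action of the commutator on a section that does not vanish
at q, so it is the same in all frames; near p it can be computed in the frame at p. -/
theorem commCoef_smooth (S : FrameSystem I F B) (h₁ : IsDerivation I F B ξ₁ θ₁ P₁)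
    (h₂ : IsDerivation I F B ξ₂ θ₂ P₂) (h₃ : IsDerivation I F B ξ₃ θ₃ P₃)
    (hξ₁ : ContMDiff I I.tangent ∞ fun p => (⟨p, ξ₁ p⟩ : TangentBundle I N))
    (hξ₂ : ContMDiff I I.tangent ∞ fun p => (⟨p, ξ₂ p⟩ : TangentBundle I N))
    (hξ : ∀ {f : N → ℂ} {q : N}, SmoothNear I f q →
      mvfderiv I (fun x => mvfderiv I f x (ξ₂ x)) q (ξ₁ q)
        - mvfderiv I (fun x => mvfderiv I f x (ξ₁ x)) q (ξ₂ q) = mvfderiv I f q (ξ₃ q)) :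
    ContMDiff I 𝓘(ℝ, ℂ) ∞ fun q => commCoef I ξ₁ ξ₂ θ₁ θ₂ θ₃ q q := by
  intro p
  have hp := S.mem p
  refine ((((h₂.smooth p p hp).mvfderiv hξ₁).sub ((h₁.smooth p p hp).mvfderiv hξ₂)).sub
    (h₃.smooth p p hp)).contMDiffAt.congr_of_eventuallyEq ?_
  filter_upwards [(S.isOpen p).mem_nhds hp] with q hq
  obtain ⟨s, hs, h1⟩ := S.exists_smoothSec hq (smoothNear_const (1 : ℂ) q)
  have e1 := h₁.commutator S h₂ h₃ hξ₁ hξ₂ hξ hs hq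
  have e2 := h₁.commutator S h₂ h₃ hξ₁ hξ₂ hξ hs (S.mem q)
  have h2 : s q ≠ 0 := by
    rw [h1.self_of_nhds, one_smul]
    exact (S.isLineFrame p q hq).1
  exact smul_left_injective ℂ h2 (e2.symm.trans e1)

end IsDerivation

end Derivations

end

/-! ### The connection on the tensor products -/

section

variable {m n : ℕ}
  {U : Type*} [TopologicalSpace U] [ChartedSpace (EuclideanSpace ℝ (Fin m)) U]
  {M : Type*} [TopologicalSpace M] [ChartedSpace (EuclideanSpace ℝ (Fin (2 * n))) M]
  [IsManifold (𝓡 m) ∞ U] [IsManifold (𝓡 (2 * n)) ∞ M]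

section Connection

variable {K : KahlerFamily m n U M}
  {L : M → Type*} [TopologicalSpace (TotalSpace ℂ L)]
  [∀ x, AddCommGroup (L x)] [∀ x, Module ℂ (L x)] [∀ x, TopologicalSpace (L x)]
  [∀ x, IsTopologicalAddGroup (L x)] [∀ x, ContinuousSMul ℝ (L x)]
  [FiberBundle ℂ L] [VectorBundle ℝ ℂ L] [VectorBundle ℂ ℂ L]
  [ContMDiffVectorBundle ∞ ℂ L (𝓡 (2 * n))]
  {δ : U × M → Type*} [TopologicalSpace (TotalSpace ℂ δ)]
  [∀ p, AddCommGroup (δ p)] [∀ p, Module ℂ (δ p)] [∀ p, TopologicalSpace (δ p)]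
  [FiberBundle ℂ δ] [VectorBundle ℝ ℂ δ] [VectorBundle ℂ ℂ δ]
  [ContMDiffVectorBundle ∞ ℂ δ ((𝓡 m).prod (𝓡 (2 * n)))]

variable (L δ) in
/-- The domain of the frame of `L^k ⊗ δ` around `p₀`. -/
def baseF (p₀ : U × M) : Set (U × M) :=
  {q | q.2 ∈ (trivializationAt ℂ L p₀.2).baseSet ∧ q ∈ (trivializationAt ℂ δ p₀).baseSet}

theorem isLineFrame_frame (k : ℕ) {p₀ q : U × M} (hq : q ∈ baseF L δ p₀) :
    IsLineFrame (frame L δ k p₀ q) :=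
  ((isLineFrame_trivialization hq.1).tprod k).tmul (isLineFrame_trivialization hq.2)

theorem ratio_frame (k : ℕ) {p₀ p₁ q : U × M} (hq : q ∈ baseF L δ p₀) :
    ratio (frame L δ k p₁ q) (frame L δ k p₀ q)
      = ratio (frameL L p₁.2 q.2) (frameL L p₀.2 q.2) ^ k
        * ratio (frameδ δ p₁ q) (frameδ δ p₀ q) := by
  refine ratio_eq (isLineFrame_frame k hq) ?_
  have h1 : ratio (frameL L p₁.2 q.2) (frameL L p₀.2 q.2) • frameL L p₀.2 q.2
      = frameL L p₁.2 q.2 := ratio_smul_self (isLineFrame_trivialization hq.1) _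
  have h2 : ratio (frameδ δ p₁ q) (frameδ δ p₀ q) • frameδ δ p₀ q = frameδ δ p₁ q :=
    ratio_smul_self (isLineFrame_trivialization hq.2) _
  rw [frame, frame, ← TensorProduct.smul_tmul_smul, ← tprod_smul_const, h1, h2]

theorem ratio_frame_smooth {p₀ p₁ q : U × M} (hq : q ∈ baseF L δ p₀) (hq₁ : q ∈ baseF L δ p₁) :
    SmoothNear ((𝓡 m).prod (𝓡 (2 * n)))
        (fun y : U × M => ratio (frameL L p₁.2 y.2) (frameL L p₀.2 y.2)) q
      ∧ SmoothNear ((𝓡 m).prod (𝓡 (2 * n)))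
        (fun y => ratio (frameδ δ p₁ y) (frameδ δ p₀ y)) q :=
  ⟨SmoothNear.comp (g := fun y : U × M => y.2)
    ((frameSystemL (n := n) L).smooth p₁.2 p₀.2 q.2 hq₁.1 hq.1) contMDiff_snd,
    (frameSystemδ (m := m) (n := n) δ).smooth p₁ p₀ q hq₁.2 hq.2⟩

variable (L δ) in
theorem isOpen_baseF (p₀ : U × M) : IsOpen (baseF L δ p₀) :=
  ((trivializationAt ℂ L p₀.2).open_baseSet.preimage continuous_snd).inter
    (trivializationAt ℂ δ p₀).open_baseSet

variable (L δ) in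
theorem mem_baseF (p : U × M) : p ∈ baseF L δ p :=
  ⟨FiberBundle.mem_baseSet_trivializationAt ℂ L p.2, FiberBundle.mem_baseSet_trivializationAt ℂ δ p⟩

variable (L δ) in
theorem frameSystemF (k : ℕ) :
    FrameSystem ((𝓡 m).prod (𝓡 (2 * n))) (frame L δ k) (baseF L δ) where
  isOpen := isOpen_baseF L δ
  mem := mem_baseF L δ
  isLineFrame p q hq := isLineFrame_frame k hq
  smooth p p' q hq hq' := by
    obtain ⟨h1, h2⟩ := ratio_frame_smooth (m := m) (n := n) hq' hq
    refine ((h1.pow k).mul h2).congr ?_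
    filter_upwards [(isOpen_baseF L δ p').mem_nhds hq'] with y hy
    exact ratio_frame k hy

variable (L δ) in
/-- The frames of `L_u^k ⊗ δ_u`. -/
def sliceFrame (k : ℕ) (u : U) (x₀ x : M) : Fib L δ k (u, x) := frame L δ k (u, x₀) (u, x)

variable (L δ) in
/-- The domains of the frames of `L_u^k ⊗ δ_u`. -/
def sliceBase (u : U) (x₀ : M) : Set M := {x | (u, x) ∈ baseF L δ (u, x₀)}

variable (m L δ) in
include m in
theorem frameSystemSlice (k : ℕ) (u : U) :
    FrameSystem (𝓡 (2 * n)) (sliceFrame L δ k u) (sliceBase L δ u) where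
  isOpen x₀ := (isOpen_baseF L δ (u, x₀)).preimage (Continuous.prodMk_right u)
  mem x₀ := mem_baseF L δ (u, x₀)
  isLineFrame x₀ x hx := isLineFrame_frame k hx
  smooth x₀ x₁ x hx hx' := ((frameSystemF (m := m) (n := n) L δ k).smooth (u, x₀) (u, x₁) (u, x)
    hx hx').slice_right

theorem SmoothSection.slice {k : ℕ} {s : ∀ p, Fib L δ k p}
    (hs : SmoothSection (m := m) (n := n) s) (u : U) :
    SmoothSlice (n := n) fun x => s (u, x) := fun x₀ =>
  ((frameSystemF (m := m) (n := n) L δ k).smoothNear hs (mem_baseF L δ (u, x₀))).slice_right.contMDiffAt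

variable [T2Space U] [T2Space M] (Q : Prequantum K L) (D : HalfForm K δ) (T : TFrame (2 * n) M)

/-- The connection form of `L^k ⊗ δ` in a local frame. -/
def aF (k : ℕ) (p₀ q : U × M) (X : TangentSpace (𝓡 m) q.1) (v : TangentSpace (𝓡 (2 * n)) q.2) :
    ℂ := k * aL Q p₀.2 q.2 v + aδ D p₀ q X v

-- The transition function of L^k ⊗ δ is r^k t, whose logarithmic derivative is k times that of r
-- plus that of t.
include T in
theorem aF_transition (k : ℕ) {p₀ p₁ q : U × M} (hq : q ∈ baseF L δ p₀) (hq₁ : q ∈ baseF L δ p₁)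
    (X : TangentSpace (𝓡 m) q.1) (v : TangentSpace (𝓡 (2 * n)) q.2) :
    aF Q D k p₁ q X v * ratio (frame L δ k p₁ q) (frame L δ k p₀ q)
      = mvfderiv ((𝓡 m).prod (𝓡 (2 * n)))
          (fun y => ratio (frame L δ k p₁ y) (frame L δ k p₀ y)) q (tPair X v)
        + aF Q D k p₀ q X v * ratio (frame L δ k p₁ q) (frame L δ k p₀ q) := by
  obtain ⟨h1, h2⟩ := ratio_frame_smooth (m := m) (n := n) hq hq₁
  have SL := frameSystemL (n := n) L
  have hev : (fun y => ratio (frame L δ k p₁ y) (frame L δ k p₀ y)) =ᶠ[𝓝 q]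
      fun y => ratio (frameL L p₁.2 y.2) (frameL L p₀.2 y.2) ^ k
        * ratio (frameδ δ p₁ y) (frameδ δ p₀ y) := by
    filter_upwards [(isOpen_baseF L δ p₀).mem_nhds hq] with y hy
    exact ratio_frame k hy
  have e1 := aL_transition Q hq.1 hq₁.1 v
  have e2 := aδ_transition D T hq.2 hq₁.2 X v
  have e3 := mvfderiv_pow_apply _ h1.mdiff k (tPair X v)
  have e4 : mvfderiv ((𝓡 m).prod (𝓡 (2 * n)))
      (fun y : U × M => ratio (frameL L p₁.2 y.2) (frameL L p₀.2 y.2)) q (tPair X v)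
      = mvfderiv (𝓡 (2 * n)) (fun y => ratio (frameL L p₁.2 y) (frameL L p₀.2 y)) q.2 v :=
    mvfderiv_comp_snd (g := fun y => ratio (frameL L p₁.2 y) (frameL L p₀.2 y))
      (SL.smooth p₁.2 p₀.2 q.2 hq₁.1 hq.1).mdiff X v
  rw [e4] at e3
  rw [mvfderiv_congr hev, mvfderiv_mul_apply (h1.pow k).mdiff h2.mdiff,
    ratio_frame k hq]
  have h0 : ratio (frameL L p₁.2 q.2) (frameL L p₀.2 q.2) ≠ 0 :=
    ratio_ne_zero (SL.isLineFrame p₁.2 q.2 hq₁.1) (SL.isLineFrame p₀.2 q.2 hq.1)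
  refine mul_left_cancel₀ h0 ?_
  unfold aF
  generalize mvfderiv ((𝓡 m).prod (𝓡 (2 * n))) (fun y : U × M =>
    ratio (frameL L p₁.2 y.2) (frameL L p₀.2 y.2) ^ k) q (tPair X v) = d1 at *
  generalize mvfderiv ((𝓡 m).prod (𝓡 (2 * n)))
    (fun y => ratio (frameδ δ p₁ y) (frameδ δ p₀ y)) q (tPair X v) = d2 at *
  generalize mvfderiv (𝓡 (2 * n)) (fun y => ratio (frameL L p₁.2 y) (frameL L p₀.2 y)) q.2 v
    = d3 at *
  generalize ratio (frameL L p₁.2 q.2) (frameL L p₀.2 q.2) = r at *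
  generalize ratio (frameδ δ p₁ q) (frameδ δ p₀ q) = t at *
  linear_combination (k : ℂ) * r ^ k * t * e1 + r * r ^ k * e2 - t * e3

theorem aF_left (k : ℕ) {p₀ q : U × M} (hq : q ∈ baseF L δ p₀) (X : TangentSpace (𝓡 m) q.1) :
    aF Q D k p₀ q X 0 = aδ D p₀ q X 0 := by
  have h : aL Q p₀.2 q.2 0 = 0 := by
    have := aL_add Q hq.1 0 0
    simpa using this
  rw [aF, h, mul_zero, zero_add]

-- The operator is defined at each point with the preferred frame of that very point. The transition
-- rule rewrites it in one fixed frame, where the result can be differentiated again.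
include T in
theorem nablaM_eq {k : ℕ} {u : U} {t : ∀ x, Fib L δ k (u, x)} {p₀ : U × M} {x : M}
    (hq : (u, x) ∈ baseF L δ p₀) (ht : MDifferentiableAt (𝓡 (2 * n)) 𝓘(ℝ, ℂ)
      (fun y => ratio (t y) (frame L δ k p₀ (u, y))) x) (v : TangentSpace (𝓡 (2 * n)) x) :
    ratio (nablaM Q D t x v) (frame L δ k p₀ (u, x))
      = mvfderiv (𝓡 (2 * n)) (fun y => ratio (t y) (frame L δ k p₀ (u, y))) x v
        + aF Q D k p₀ (u, x) 0 v * ratio (t x) (frame L δ k p₀ (u, x)) := by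
  have S := frameSystemF (m := m) (n := n) L δ k
  have hm := mem_baseF L δ (u, x)
  have h0 := S.isLineFrame p₀ _ hq
  have h1 := S.isLineFrame (u, x) _ hm
  have hr := S.smooth p₀ (u, x) (u, x) hq hm
  have e1 := aF_transition Q D T k hm hq 0 v
  rw [mvfderiv_tPair_right hr.mdiff] at e1
  have hev : (fun y => ratio (t y) (frame L δ k (u, x) (u, y))) =ᶠ[𝓝 x]
      fun y => ratio (t y) (frame L δ k p₀ (u, y))
        * ratio (frame L δ k p₀ (u, y)) (frame L δ k (u, x) (u, y)) := by
    have hc : Continuous fun y : M => (u, y) := Continuous.prodMk_right u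
    filter_upwards [((S.isOpen p₀).preimage hc).mem_nhds hq,
      ((S.isOpen (u, x)).preimage hc).mem_nhds hm] with y hy hy'
    exact ratio_trans (S.isLineFrame _ _ hy') (S.isLineFrame _ _ hy) _
  have e2 : ratio (frame L δ k p₀ (u, x)) (frame L δ k (u, x) (u, x))
      * ratio (frame L δ k (u, x) (u, x)) (frame L δ k p₀ (u, x)) = 1 := ratio_mul_ratio h0 h1
  have e3 : ratio (t x) (frame L δ k (u, x) (u, x)) = ratio (t x) (frame L δ k p₀ (u, x))
        * ratio (frame L δ k p₀ (u, x)) (frame L δ k (u, x) (u, x)) := hev.self_of_nhds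
  have e4 : (k : ℂ) * formL Q x v + formδ D (u, x) 0 v = aF Q D k (u, x) (u, x) 0 v := rfl
  rw [nablaM, ratio_smul h0, e4, mvfderiv_congr hev,
    mvfderiv_mul_apply ht hr.slice_right.mdiff, e3]
  linear_combination (mvfderiv (𝓡 (2 * n)) (fun y => ratio (t y) (frame L δ k p₀ (u, y))) x v
    + aF Q D k p₀ (u, x) 0 v * ratio (t x) (frame L δ k p₀ (u, x))) * e2
    - ratio (t x) (frame L δ k p₀ (u, x))
      * ratio (frame L δ k (u, x) (u, x)) (frame L δ k p₀ (u, x)) * e1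

-- As for the derivative along M, the pointwise frames are exchanged for a fixed one. The connection
-- form of L does not appear, because L is pulled back from M.
include T Q in
theorem nablaU_eq {k : ℕ} {s : ∀ p, Fib L δ k p} (hs : SmoothSection (m := m) (n := n) s)
    (X : ∀ u : U, TangentSpace (𝓡 m) u) {p₀ q : U × M} (hq : q ∈ baseF L δ p₀) :
    ratio (nablaU D X s q) (frame L δ k p₀ q)
      = mvfderiv ((𝓡 m).prod (𝓡 (2 * n))) (fun y => ratio (s y) (frame L δ k p₀ y)) q
          (tPair (X q.1) 0)
        + aδ D p₀ q (X q.1) 0 * ratio (s q) (frame L δ k p₀ q) := by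
  have S := frameSystemF (m := m) (n := n) L δ k
  have hm := mem_baseF L δ q
  have h0 := S.isLineFrame p₀ _ hq
  have h1 := S.isLineFrame q _ hm
  have hr := S.smooth p₀ q q hq hm
  have e1 := aF_transition Q D T k hm hq (X q.1) 0
  rw [aF_left Q D k hq, aF_left Q D k hm] at e1
  have hev : (fun y => ratio (s y) (frame L δ k q y)) =ᶠ[𝓝 q]
      fun y => ratio (s y) (frame L δ k p₀ y)
        * ratio (frame L δ k p₀ y) (frame L δ k q y) := by
    filter_upwards [(S.isOpen p₀).mem_nhds hq, (S.isOpen q).mem_nhds hm] with y hy hy'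
    exact ratio_trans (S.isLineFrame _ _ hy') (S.isLineFrame _ _ hy) _
  have e2 : ratio (frame L δ k p₀ q) (frame L δ k q q)
      * ratio (frame L δ k q q) (frame L δ k p₀ q) = 1 := ratio_mul_ratio h0 h1
  have e3 : ratio (s q) (frame L δ k q q) = ratio (s q) (frame L δ k p₀ q)
        * ratio (frame L δ k p₀ q) (frame L δ k q q) := hev.self_of_nhds
  rw [nablaU, ratio_smul h0, formδ_eq, mvfderiv_congr hev,
    mvfderiv_mul_apply (S.mdiff hs hq) hr.mdiff, e3]
  linear_combination (mvfderiv ((𝓡 m).prod (𝓡 (2 * n))) (fun y => ratio (s y) (frame L δ k p₀ y)) q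
          (tPair (X q.1) 0)
    + aδ D p₀ q (X q.1) 0 * ratio (s q) (frame L δ k p₀ q)) * e2
    - ratio (s q) (frame L δ k p₀ q)
      * ratio (frame L δ k q q) (frame L δ k p₀ q) * e1

end Connection

end

/-! ### The curvature in the directions of the base -/

section

variable {m n : ℕ}
  {U : Type*} [TopologicalSpace U] [ChartedSpace (EuclideanSpace ℝ (Fin m)) U]
  {M : Type*} [TopologicalSpace M] [ChartedSpace (EuclideanSpace ℝ (Fin (2 * n))) M]
  [IsManifold (𝓡 m) ∞ U] [IsManifold (𝓡 (2 * n)) ∞ M]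

section Connection

variable {K : KahlerFamily m n U M}
  {L : M → Type*} [TopologicalSpace (TotalSpace ℂ L)]
  [∀ x, AddCommGroup (L x)] [∀ x, Module ℂ (L x)] [∀ x, TopologicalSpace (L x)]
  [∀ x, IsTopologicalAddGroup (L x)] [∀ x, ContinuousSMul ℝ (L x)]
  [FiberBundle ℂ L] [VectorBundle ℝ ℂ L] [VectorBundle ℂ ℂ L]
  [ContMDiffVectorBundle ∞ ℂ L (𝓡 (2 * n))]
  {δ : U × M → Type*} [TopologicalSpace (TotalSpace ℂ δ)]
  [∀ p, AddCommGroup (δ p)] [∀ p, Module ℂ (δ p)] [∀ p, TopologicalSpace (δ p)]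
  [FiberBundle ℂ δ] [VectorBundle ℝ ℂ δ] [VectorBundle ℂ ℂ δ]
  [ContMDiffVectorBundle ∞ ℂ δ ((𝓡 m).prod (𝓡 (2 * n)))]
  [T2Space U] [T2Space M] (Q : Prequantum K L) (D : HalfForm K δ) (T : TFrame (2 * n) M)

theorem isSmoothVF_zero : IsSmoothVF fun u : U => (0 : TangentSpace (𝓡 m) u) :=
  contMDiff_zeroSection ℝ (TangentSpace (𝓡 m) (M := U))

include Q T in
theorem isDerivation_nablaU (k : ℕ) {X : ∀ u : U, TangentSpace (𝓡 m) u} (hX : IsSmoothVF X) :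
    IsDerivation ((𝓡 m).prod (𝓡 (2 * n))) (frame L δ k) (baseF L δ)
      (fun q => tPair (X q.1) 0) (fun p₀ q => aδ D p₀ q (X q.1) 0) (nablaU D X) where
  apply s hs p₀ q hq := by
    have h := nablaU_eq Q D T hs X hq
    exact h
  smooth p₀ q hq := by
    have hs := aδ_smooth D T hq.2 hX (contMDiff_zeroSection ℝ (TangentSpace (𝓡 (2 * n)) (M := M)))
    exact hs

/-- The derivative of a section over `U × M` along a vector field of `M`. -/
def nablaJ {k : ℕ} (A : ∀ x : M, TangentSpace (𝓡 (2 * n)) x) (s : ∀ p, Fib L δ k p) (p : U × M) :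
    Fib L δ k p :=
  nablaM Q D (fun x => s (p.1, x)) p.2 (A p.2)

include Q T in
theorem aF_smooth (k : ℕ) {p₀ q : U × M} (hq : q ∈ baseF L δ p₀)
    {A : ∀ x : M, TangentSpace (𝓡 (2 * n)) x} (hA : IsSmoothVF A) :
    SmoothNear ((𝓡 m).prod (𝓡 (2 * n))) (fun y : U × M => aF Q D k p₀ y 0 (A y.2)) q := by
  have h1 : SmoothNear ((𝓡 m).prod (𝓡 (2 * n))) (fun y : U × M => aL Q p₀.2 y.2 (A y.2)) q :=
    SmoothNear.comp (g := fun y : U × M => y.2) (aL_smooth Q hq.1 hA) contMDiff_snd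
  exact (h1.const_mul (k : ℂ)).add (aδ_smooth D T hq.2 isSmoothVF_zero hA)

include Q T in
theorem isDerivation_nablaJ (k : ℕ) {A : ∀ x : M, TangentSpace (𝓡 (2 * n)) x} (hA : IsSmoothVF A) :
    IsDerivation ((𝓡 m).prod (𝓡 (2 * n))) (frame L δ k) (baseF L δ)
      (fun q => tPair 0 (A q.2)) (fun p₀ q => aF Q D k p₀ q 0 (A q.2)) (nablaJ Q D A) where
  apply s hs p₀ q hq := by
    have S := frameSystemF (m := m) (n := n) L δ k
    have h1 := (S.smoothNear hs hq)
    have h2 := nablaM_eq Q D T hq h1.slice_right.mdiff (A q.2)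
    rw [← mvfderiv_tPair_right h1.mdiff] at h2
    exact h2
  smooth _ _ hq := aF_smooth Q D T k hq hA

include Q T in
theorem isDerivation_nablaM (k : ℕ) (u : U) {A : ∀ x : M, TangentSpace (𝓡 (2 * n)) x}
    (hA : IsSmoothVF A) :
    IsDerivation (𝓡 (2 * n)) (sliceFrame L δ k u) (sliceBase L δ u) A
      (fun x₀ x => aF Q D k (u, x₀) (u, x) 0 (A x)) (fun t x => nablaM Q D t x (A x)) where
  apply t ht x₀ x hx :=
    nablaM_eq Q D T hx ((frameSystemSlice m L δ k u).mdiff ht hx) (A x)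
  smooth x₀ x hx := (aF_smooth Q D T k hx hA).slice_right

/-- The curvature of `δ` in the directions of `M`. -/
def curvδ (A B : ∀ x : M, TangentSpace (𝓡 (2 * n)) x) (q : U × M) : ℂ :=
  commCoef ((𝓡 m).prod (𝓡 (2 * n))) (fun q => tPair 0 (A q.2)) (fun q => tPair 0 (B q.2))
    (fun p₀ q => aδ D p₀ q 0 (A q.2)) (fun p₀ q => aδ D p₀ q 0 (B q.2))
    (fun p₀ q => aδ D p₀ q 0 (VectorField.mlieBracket (𝓡 (2 * n)) A B q.2)) q q

/-- The mixed curvature of `δ`. -/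
def mixedδ (X : ∀ u : U, TangentSpace (𝓡 m) u) (A : ∀ x : M, TangentSpace (𝓡 (2 * n)) x)
    (q : U × M) : ℂ :=
  commCoef ((𝓡 m).prod (𝓡 (2 * n))) (fun q => tPair (X q.1) 0) (fun q => tPair 0 (A q.2))
    (fun p₀ q => aδ D p₀ q (X q.1) 0) (fun p₀ q => aδ D p₀ q 0 (A q.2)) (fun _ _ => 0) q q

include Q T in
theorem mvfderiv_aF (k : ℕ) {p₀ q : U × M} (hq : q ∈ baseF L δ p₀)
    {B : ∀ x : M, TangentSpace (𝓡 (2 * n)) x} (hB : IsSmoothVF B) (X : TangentSpace (𝓡 m) q.1)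
    (v : TangentSpace (𝓡 (2 * n)) q.2) :
    mvfderiv ((𝓡 m).prod (𝓡 (2 * n))) (fun y : U × M => aF Q D k p₀ y 0 (B y.2)) q (tPair X v)
      = k * mvfderiv (𝓡 (2 * n)) (fun y => aL Q p₀.2 y (B y)) q.2 v
        + mvfderiv ((𝓡 m).prod (𝓡 (2 * n))) (fun y : U × M => aδ D p₀ y 0 (B y.2)) q
          (tPair X v) := by
  have h0 := aL_smooth Q hq.1 hB
  have h1 : SmoothNear ((𝓡 m).prod (𝓡 (2 * n))) (fun y : U × M => aL Q p₀.2 y.2 (B y.2)) q :=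
    SmoothNear.comp (g := fun y : U × M => y.2) h0 contMDiff_snd
  have h2 : SmoothNear ((𝓡 m).prod (𝓡 (2 * n))) (fun y : U × M => aδ D p₀ y 0 (B y.2)) q :=
    aδ_smooth D T hq.2 isSmoothVF_zero hB
  unfold aF
  rw [mvfderiv_add_apply (h1.const_mul (k : ℂ)).mdiff h2.mdiff,
    mvfderiv_const_mul_apply h1.mdiff,
    mvfderiv_comp_snd (g := fun y => aL Q p₀.2 y (B y)) h0.mdiff]

-- The connection form of L^k ⊗ δ is that of δ plus k times that of L, and the latter contributes k
-- times the prequantum curvature. This is the only place where curvature brings in k.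
include Q T in
theorem commCoef_aF (k : ℕ) (q : U × M) {A B : ∀ x : M, TangentSpace (𝓡 (2 * n)) x}
    (hA : IsSmoothVF A) (hB : IsSmoothVF B) :
    commCoef ((𝓡 m).prod (𝓡 (2 * n))) (fun q : U × M => tPair 0 (A q.2)) (fun q => tPair 0 (B q.2))
      (fun p₀ q => aF Q D k p₀ q 0 (A q.2)) (fun p₀ q => aF Q D k p₀ q 0 (B q.2))
      (fun p₀ q => aF Q D k p₀ q 0 (VectorField.mlieBracket (𝓡 (2 * n)) A B q.2)) q q
      = k * ((1 / Complex.I) * (K.symp q.2 (A q.2) (B q.2) : ℂ)) + curvδ D A B q := by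
  have hq := mem_baseF L δ q
  rw [curvδ, commCoef, commCoef, mvfderiv_aF Q D T k hq hA, mvfderiv_aF Q D T k hq hB,
    ← aL_curvature Q hq.1 hA hB, aF]
  ring

include Q T in
theorem curvδ_smooth {A B : ∀ x : M, TangentSpace (𝓡 (2 * n)) x}
    (hA : IsSmoothVF A) (hB : IsSmoothVF B) :
    ContMDiff ((𝓡 m).prod (𝓡 (2 * n))) 𝓘(ℝ, ℂ) ∞ (curvδ D A B) := by
  -- For k = 0 the bundle has the curvature of δ alone, so the general smoothness result applies to
  -- it.
  have h := (isDerivation_nablaJ Q D T 0 hA).commCoef_smooth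
    (frameSystemF (m := m) (n := n) L δ 0) (isDerivation_nablaJ Q D T 0 hB)
    (isDerivation_nablaJ Q D T 0 (hA.mlieBracket hB)) (contMDiff_tPair_right hA)
    (contMDiff_tPair_right hB) fun hf => mvfderiv_right_commutator hf hA hB
  have h2 := funext fun q => commCoef_aF Q D T 0 q hA hB
  rw [h2] at h
  simpa using h

include Q T in
theorem nablaM_commutator {k : ℕ} {u : U} {t : ∀ x, Fib L δ k (u, x)}
    (ht : SmoothSlice (n := n) t) {A B : ∀ x : M, TangentSpace (𝓡 (2 * n)) x}
    (hA : IsSmoothVF A) (hB : IsSmoothVF B) (x : M) :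
    nablaM Q D (fun y => nablaM Q D t y (B y)) x (A x)
      - nablaM Q D (fun y => nablaM Q D t y (A y)) x (B x)
      - nablaM Q D t x (VectorField.mlieBracket (𝓡 (2 * n)) A B x)
      = (k * ((1 / Complex.I) * (K.symp x (A x) (B x) : ℂ)) + curvδ D A B (u, x)) • t x := by
  have S := frameSystemSlice (n := n) m L δ k u
  have h := (isDerivation_nablaM Q D T k u hA).commutator S (isDerivation_nablaM Q D T k u hB)
    (isDerivation_nablaM Q D T k u (hA.mlieBracket hB)) hA hB
    (fun hf => mvfderiv_commutator hf hA hB) ht (S.mem x)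
  refine h.trans (congrArg (· • t x) ?_)
  refine Eq.trans ?_ (commCoef_aF Q D T k (u, x) hA hB)
  have hq := mem_baseF L δ (u, x)
  rw [commCoef, commCoef, mvfderiv_tPair_right (aF_smooth Q D T k hq hA).mdiff,
    mvfderiv_tPair_right (aF_smooth Q D T k hq hB).mdiff]

-- The connection form of L vanishes along U and, on a field of M, is independent of u; so k
-- disappears from the mixed curvature.
include Q T in
theorem commCoef_aF_mixed (k : ℕ) (q : U × M) {X : ∀ u : U, TangentSpace (𝓡 m) u}
    {A : ∀ x : M, TangentSpace (𝓡 (2 * n)) x} (hA : IsSmoothVF A) :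
    commCoef ((𝓡 m).prod (𝓡 (2 * n))) (fun q : U × M => tPair (X q.1) 0)
      (fun q => tPair 0 (A q.2)) (fun p₀ q => aδ D p₀ q (X q.1) 0)
      (fun p₀ q => aF Q D k p₀ q 0 (A q.2)) (fun _ _ => 0) q q = mixedδ D X A q := by
  have hq := mem_baseF L δ q
  have h : mvfderiv (𝓡 (2 * n)) (fun y => aL Q q.2 y (A y)) q.2 0 = 0 := map_zero _
  rw [mixedδ, commCoef, commCoef, mvfderiv_aF Q D T k hq hA, h]
  ring

theorem isDerivation_zero (k : ℕ) :
    IsDerivation ((𝓡 m).prod (𝓡 (2 * n))) (frame L δ k) (baseF L δ)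
      (fun _ => 0) (fun _ _ => 0) (fun _ _ => 0) where
  apply s _ p₀ q hq := by
    have h := ratio_zero (isLineFrame_frame k hq)
    simpa using h
  smooth _ q _ := smoothNear_const 0 q

include Q T in
theorem mixedδ_smooth {X : ∀ u : U, TangentSpace (𝓡 m) u} (hX : IsSmoothVF X)
    {A : ∀ x : M, TangentSpace (𝓡 (2 * n)) x} (hA : IsSmoothVF A) :
    ContMDiff ((𝓡 m).prod (𝓡 (2 * n))) 𝓘(ℝ, ℂ) ∞ (mixedδ D X A) := by
  -- Again k = 0. The third derivation is zero, because a field of U and a field of M commute on the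
  -- product.
  have h := (isDerivation_nablaU Q D T 0 hX).commCoef_smooth
    (frameSystemF (m := m) (n := n) L δ 0) (isDerivation_nablaJ Q D T 0 hA)
    (isDerivation_zero 0) (contMDiff_tPair_left hX)
    (contMDiff_tPair_right hA) fun hf => by
      rw [mvfderiv_tPair_comm hf hX hA]
      simp
  have h2 := funext fun q => commCoef_aF_mixed Q D T 0 q (X := X) hA
  rwa [h2] at h

include Q T in
theorem nablaU_nablaJ_commutator {k : ℕ} {s : ∀ p, Fib L δ k p}
    (hs : SmoothSection (m := m) (n := n) s) {X : ∀ u : U, TangentSpace (𝓡 m) u}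
    (hX : IsSmoothVF X) {A : ∀ x : M, TangentSpace (𝓡 (2 * n)) x} (hA : IsSmoothVF A) (q : U × M) :
    nablaU D X (nablaJ Q D A s) q - nablaJ Q D A (nablaU D X s) q = mixedδ D X A q • s q := by
  have S := frameSystemF (m := m) (n := n) L δ k
  have h := (isDerivation_nablaU Q D T k hX).commutator S (isDerivation_nablaJ Q D T k hA)
    (isDerivation_zero k) (contMDiff_tPair_left hX) (contMDiff_tPair_right hA)
    (fun hf => by
      rw [mvfderiv_tPair_comm hf hX hA]
      simp) hs (S.mem q)
  rw [commCoef_aF_mixed Q D T k q hA, sub_zero] at h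
  exact h

-- The part L^k is flat along U, so the curvature is that of δ and does not depend on k. This is the
-- term of order k⁰ that has to be cancelled.
include Q T in
theorem nablaU_commutator {k : ℕ} {s : ∀ p, Fib L δ k p}
    (hs : SmoothSection (m := m) (n := n) s) {X Y : ∀ u : U, TangentSpace (𝓡 m) u}
    (hX : IsSmoothVF X) (hY : IsSmoothVF Y) (q : U × M) :
    nablaU D X (nablaU D Y s) q - nablaU D Y (nablaU D X s) q
      - nablaU D (VectorField.mlieBracket (𝓡 m) X Y) s q
      = (-(Complex.I / 8) * (K.tau T q (X q.1) (Y q.1) : ℂ)) • s q := by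
  have S := frameSystemF (m := m) (n := n) L δ k
  have h := (isDerivation_nablaU Q D T k hX).commutator S (isDerivation_nablaU Q D T k hY)
    (isDerivation_nablaU Q D T k (hX.mlieBracket hY)) (contMDiff_tPair_left hX)
    (contMDiff_tPair_left hY) (fun hf => mvfderiv_left_commutator hf hX hY) hs (S.mem q)
  refine h.trans (congrArg (· • s q) ?_)
  exact aδ_curvature D T (mem_baseF L δ q).2 hX hY

end Connection

end

variable {m n : ℕ}
  {U : Type*} [TopologicalSpace U] [ChartedSpace (EuclideanSpace ℝ (Fin m)) U]
  {M : Type*} [TopologicalSpace M] [ChartedSpace (EuclideanSpace ℝ (Fin (2 * n))) M]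
  [IsManifold (𝓡 m) ∞ U] [IsManifold (𝓡 (2 * n)) ∞ M]

section Connection

open KahlerFamily

variable {K : KahlerFamily m n U M}
  {L : M → Type*} [TopologicalSpace (TotalSpace ℂ L)]
  [∀ x, AddCommGroup (L x)] [∀ x, Module ℂ (L x)] [∀ x, TopologicalSpace (L x)]
  [∀ x, IsTopologicalAddGroup (L x)] [∀ x, ContinuousSMul ℝ (L x)]
  [FiberBundle ℂ L] [VectorBundle ℝ ℂ L] [VectorBundle ℂ ℂ L]
  [ContMDiffVectorBundle ∞ ℂ L (𝓡 (2 * n))]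
  {δ : U × M → Type*} [TopologicalSpace (TotalSpace ℂ δ)]
  [∀ p, AddCommGroup (δ p)] [∀ p, Module ℂ (δ p)] [∀ p, TopologicalSpace (δ p)]
  [FiberBundle ℂ δ] [VectorBundle ℝ ℂ δ] [VectorBundle ℂ ℂ δ]
  [ContMDiffVectorBundle ∞ ℂ δ ((𝓡 m).prod (𝓡 (2 * n)))]
  [T2Space U] [T2Space M] (Q : Prequantum K L) (D : HalfForm K δ) (T : TFrame (2 * n) M)

/-! ### Covariant derivatives along complex vector fields -/

section

section Linear

variable {D}

include T in
theorem nablaM_add {k : ℕ} {u : U} (t : ∀ x, Fib L δ k (u, x)) (x : M)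
    (v w : TangentSpace (𝓡 (2 * n)) x) :
    nablaM Q D t x (v + w) = nablaM Q D t x v + nablaM Q D t x w := by
  have hm := mem_baseF L δ (u, x)
  have h1 : formL Q x (v + w) = formL Q x v + formL Q x w := aL_add Q hm.1 v w
  have h2 : formδ D (u, x) 0 (v + w) = formδ D (u, x) 0 v + formδ D (u, x) 0 w := by
    have h := aδ_add D T hm.2 0 0 v w
    rw [add_zero] at h
    exact h
  rw [nablaM, nablaM, nablaM, ← add_smul, h1, h2, map_add]
  congr 1
  ring

include T in
theorem nablaM_smul {k : ℕ} {u : U} (t : ∀ x, Fib L δ k (u, x)) (x : M) (c : ℝ)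
    (v : TangentSpace (𝓡 (2 * n)) x) :
    nablaM Q D t x (c • v) = (c : ℂ) • nablaM Q D t x v := by
  have hm := mem_baseF L δ (u, x)
  have h1 : formL Q x (c • v) = c * formL Q x v := by
    have h := ratio_smul (isLineFrame_trivialization hm.1) (c : ℂ) (Q.nabla (frameL L x) x v)
    rw [formL, map_smul]
    exact h
  have h2 : formδ D (u, x) 0 (c • v) = c * formδ D (u, x) 0 v := by
    have h := aδ_smul D T hm.2 c 0 v
    rw [smul_zero] at h
    exact h
  rw [nablaM, nablaM, smul_smul, h1, h2, map_smul, Complex.real_smul]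
  congr 1
  ring

end Linear

/-- The complex linear extension of the connection to complex tangent vectors. -/
def covC {k : ℕ} {u : U} (t : ∀ x, Fib L δ k (u, x)) (x : M) :
    (ℂ ⊗[ℝ] TangentSpace (𝓡 (2 * n)) x) →ₗ[ℂ] Fib L δ k (u, x) :=
  letI : Module ℝ (Fib L δ k (u, x)) := Module.complexToReal _
  LinearMap.liftBaseChange ℂ
    { toFun := nablaM Q D t x
      map_add' := nablaM_add Q T t x
      map_smul' := nablaM_smul Q T t x }

variable {k : ℕ} {u : U} {t t' : ∀ x, Fib L δ k (u, x)} {x : M}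

theorem cExt_nablaM (t : ∀ x, Fib L δ k (u, x)) (x : M)
    (w : ℂ ⊗[ℝ] TangentSpace (𝓡 (2 * n)) x) :
    cExt (nablaM Q D t x) w = covC Q D T t x w := by
  letI : Module ℝ (Fib L δ k (u, x)) := Module.complexToReal _
  exact cExt_eq
    { toFun := nablaM Q D t x
      map_add' := nablaM_add Q T t x
      map_smul' := nablaM_smul Q T t x } w

theorem covC_one_tmul (t : ∀ x, Fib L δ k (u, x)) (x : M) (v : TangentSpace (𝓡 (2 * n)) x) :
    covC Q D T t x ((1 : ℂ) ⊗ₜ[ℝ] v) = nablaM Q D t x v := by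
  simp [covC]

theorem covC_expand (t : ∀ x, Fib L δ k (u, x)) (x : M)
    (w : ℂ ⊗[ℝ] TangentSpace (𝓡 (2 * n)) x) :
    covC Q D T t x w = ∑ a, lamC T a x w • nablaM Q D t x (T.V a x) := by
  conv_lhs => rw [← lamC_expand T x w]
  simp only [map_sum, map_smul, covC_one_tmul]

theorem nablaM_congr (h : ∀ᶠ y in 𝓝 x, t y = t' y) : nablaM Q D t x = nablaM Q D t' x := by
  funext v
  have h1 : (fun y => ratio (t y) (frame L δ k (u, x) (u, y)))
      =ᶠ[𝓝 x] fun y => ratio (t' y) (frame L δ k (u, x) (u, y)) := by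
    filter_upwards [h] with y hy
    rw [hy]
  rw [nablaM, nablaM, mvfderiv_congr h1, h.self_of_nhds]

theorem covC_congr (h : ∀ᶠ y in 𝓝 x, t y = t' y) : covC Q D T t x = covC Q D T t' x := by
  refine LinearMap.ext fun w => ?_
  rw [covC_expand, covC_expand, nablaM_congr Q D h]

/-- Sections which are smooth near a point. -/
def LocSmooth (t : ∀ x, Fib L δ k (u, x)) (x : M) : Prop :=
  ∃ t' : ∀ x, Fib L δ k (u, x), SmoothSlice (n := n) t' ∧ ∀ᶠ y in 𝓝 x, t y = t' y

/-- The derivative of a complex function along a complex vector. -/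
def dC (f : M → ℂ) (x : M) : (ℂ ⊗[ℝ] TangentSpace (𝓡 (2 * n)) x) →ₗ[ℂ] ℂ :=
  LinearMap.liftBaseChange ℂ (mvfderiv (𝓡 (2 * n)) f x).toLinearMap

theorem cExt_mvfderiv (f : M → ℂ) (x : M) (w : ℂ ⊗[ℝ] TangentSpace (𝓡 (2 * n)) x) :
    cExt (mvfderiv (𝓡 (2 * n)) f x) w = dC f x w :=
  cExt_eq (mvfderiv (𝓡 (2 * n)) f x).toLinearMap w

theorem dC_expand (T : TFrame (2 * n) M) (f : M → ℂ) (x : M)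
    (w : ℂ ⊗[ℝ] TangentSpace (𝓡 (2 * n)) x) :
    dC f x w = ∑ a, lamC T a x w * mvfderiv (𝓡 (2 * n)) f x (T.V a x) := by
  conv_lhs => rw [← lamC_expand T x w]
  simp only [map_sum, map_smul, smul_eq_mul]
  exact Finset.sum_congr rfl fun a _ => by simp [dC]

include m in
theorem LocSmooth.of_smoothSlice (h : SmoothSlice (n := n) t) (x : M) : LocSmooth (n := n) t x :=
  ⟨t, h, Filter.Eventually.of_forall fun _ => rfl⟩

theorem LocSmooth.congr (h : LocSmooth (n := n) t x) (h' : ∀ᶠ y in 𝓝 x, t' y = t y) :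
    LocSmooth (n := n) t' x := by
  obtain ⟨s, hs, h1⟩ := h
  exact ⟨s, hs, by filter_upwards [h1, h'] with y hy hy' using hy'.trans hy⟩

include m in
theorem smoothSlice_of_locSmooth (h : ∀ x, LocSmooth (n := n) t x) : SmoothSlice (n := n) t := by
  intro x
  obtain ⟨s, hs, h1⟩ := h x
  refine (hs x).congr_of_eventuallyEq ?_
  filter_upwards [h1] with y hy
  rw [hy]

include m in
theorem LocSmooth.sum {ι : Type*} {A : Finset ι} {t : ι → ∀ x, Fib L δ k (u, x)}
    (h : ∀ i ∈ A, LocSmooth (n := n) (t i) x) :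
    LocSmooth (n := n) (fun y => ∑ i ∈ A, t i y) x := by
  choose! s hs h1 using h
  refine ⟨fun y => ∑ i ∈ A, s i y, (frameSystemSlice m L δ k u).smoothSec_sum hs, ?_⟩
  have h2 := (Filter.eventually_all_finset A).2 h1
  filter_upwards [h2] with y hy
  exact Finset.sum_congr rfl hy

include m in
theorem LocSmooth.smul {f : M → ℂ} (hf : SmoothNear (𝓡 (2 * n)) f x)
    (h : LocSmooth (n := n) t x) : LocSmooth (n := n) (fun y => f y • t y) x := by
  obtain ⟨s, hs, h1⟩ := h
  obtain ⟨g, hg, hgf⟩ := hf.exists_extension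
  refine ⟨fun y => g y • s y, (frameSystemSlice m L δ k u).smoothSec_smul hg hs, ?_⟩
  filter_upwards [h1, hgf] with y hy hy'
  rw [hy, hy']

include T in
theorem LocSmooth.nablaM (h : LocSmooth (n := n) t x) {A : ∀ x : M, TangentSpace (𝓡 (2 * n)) x}
    (hA : IsSmoothVF A) : LocSmooth (n := n) (fun y => nablaM Q D t y (A y)) x := by
  obtain ⟨s, hs, h1⟩ := h
  refine ⟨_, (isDerivation_nablaM Q D T k u hA).smoothSec (frameSystemSlice m L δ k u) hA hs, ?_⟩
  filter_upwards [h1.eventually_nhds] with y hy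
  rw [nablaM_congr Q D hy]

/-- Complex vector fields which are smooth near a point. -/
def SmoothC (w : ∀ x : M, ℂ ⊗[ℝ] TangentSpace (𝓡 (2 * n)) x) (x : M) : Prop :=
  ∀ a, SmoothNear (𝓡 (2 * n)) (fun y => lamC T a y (w y)) x

variable {w w' : ∀ x : M, ℂ ⊗[ℝ] TangentSpace (𝓡 (2 * n)) x}

theorem LocSmooth.covC (h : LocSmooth (n := n) t x) (hw : SmoothC T w x) :
    LocSmooth (n := n) (fun y => covC Q D T t y (w y)) x := by
  have h1 : LocSmooth (n := n)
      (fun y => ∑ a, lamC T a y (w y) • HalfFormQuant.nablaM Q D t y (T.V a y)) x :=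
    LocSmooth.sum (m := m) fun a _ => (h.nablaM Q D T (T.V_smooth a)).smul (m := m) (hw a)
  exact h1.congr (Filter.Eventually.of_forall fun y => covC_expand Q D T t y (w y))

include T in
theorem nablaM_leibniz {f : M → ℂ} (hf : SmoothNear (𝓡 (2 * n)) f x) (h : LocSmooth (n := n) t x)
    {A : ∀ x : M, TangentSpace (𝓡 (2 * n)) x} (hA : IsSmoothVF A) :
    nablaM Q D (fun y => f y • t y) x (A x)
      = f x • nablaM Q D t x (A x) + mvfderiv (𝓡 (2 * n)) f x (A x) • t x := by
  obtain ⟨s, hs, h1⟩ := h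
  obtain ⟨g, hg, hgf⟩ := hf.exists_extension
  have h2 : ∀ᶠ y in 𝓝 x, f y • t y = g y • s y := by
    filter_upwards [h1, hgf] with y hy hy'
    rw [hy, hy']
  rw [nablaM_congr Q D h2, nablaM_congr Q D h1, ← mvfderiv_congr hgf, ← hgf.self_of_nhds,
    h1.self_of_nhds]
  exact (isDerivation_nablaM Q D T k u hA).apply_smul (frameSystemSlice m L δ k u) hg hs x

include T in
theorem nablaM_section_add (h : LocSmooth (n := n) t x) (h' : LocSmooth (n := n) t' x)
    {A : ∀ x : M, TangentSpace (𝓡 (2 * n)) x} (hA : IsSmoothVF A) :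
    nablaM Q D (fun y => t y + t' y) x (A x) = nablaM Q D t x (A x) + nablaM Q D t' x (A x) := by
  obtain ⟨s, hs, h1⟩ := h
  obtain ⟨s', hs', h1'⟩ := h'
  have h2 : ∀ᶠ y in 𝓝 x, t y + t' y = s y + s' y := by
    filter_upwards [h1, h1'] with y hy hy'
    rw [hy, hy']
  rw [nablaM_congr Q D h2, nablaM_congr Q D h1, nablaM_congr Q D h1']
  exact (isDerivation_nablaM Q D T k u hA).apply_add (frameSystemSlice m L δ k u) hs hs' x

theorem covC_leibniz {f : M → ℂ} (hf : SmoothNear (𝓡 (2 * n)) f x) (h : LocSmooth (n := n) t x)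
    (v : ℂ ⊗[ℝ] TangentSpace (𝓡 (2 * n)) x) :
    covC Q D T (fun y => f y • t y) x v = f x • covC Q D T t x v + dC f x v • t x := by
  rw [covC_expand, covC_expand, dC_expand T, Finset.smul_sum, Finset.sum_smul,
    ← Finset.sum_add_distrib]
  refine Finset.sum_congr rfl fun a _ => ?_
  rw [nablaM_leibniz Q D T hf h (T.V_smooth a)]
  module

theorem covC_section_add (h : LocSmooth (n := n) t x) (h' : LocSmooth (n := n) t' x)
    (v : ℂ ⊗[ℝ] TangentSpace (𝓡 (2 * n)) x) :
    covC Q D T (fun y => t y + t' y) x v = covC Q D T t x v + covC Q D T t' x v := by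
  rw [covC_expand, covC_expand, covC_expand, ← Finset.sum_add_distrib]
  refine Finset.sum_congr rfl fun a _ => ?_
  rw [nablaM_section_add Q D T h h' (T.V_smooth a), smul_add]

theorem covC_section_zero (v : ℂ ⊗[ℝ] TangentSpace (𝓡 (2 * n)) x) :
    covC Q D T (fun y => (0 : Fib L δ k (u, y))) x v = 0 := by
  have hz : LocSmooth (n := n) (fun y => (0 : Fib L δ k (u, y))) x := by
    have := LocSmooth.sum (m := m) (n := n) (x := x) (A := (∅ : Finset ℕ))
      (t := fun _ y => (0 : Fib L δ k (u, y))) (by simp)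
    simpa using this
  have := covC_section_add Q D T hz hz v
  simpa using this

theorem covC_section_sum {ι : Type*} {A : Finset ι} {t : ι → ∀ x, Fib L δ k (u, x)}
    (h : ∀ i ∈ A, LocSmooth (n := n) (t i) x) (v : ℂ ⊗[ℝ] TangentSpace (𝓡 (2 * n)) x) :
    covC Q D T (fun y => ∑ i ∈ A, t i y) x v = ∑ i ∈ A, covC Q D T (t i) x v := by
  classical
  induction A using Finset.induction_on with
  | empty => simpa using covC_section_zero Q D T v
  | insert i A hi ih =>
    have h1 := fun j hj => h j (Finset.mem_insert_of_mem hj)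
    simp only [Finset.sum_insert hi]
    rw [covC_section_add Q D T (h i (Finset.mem_insert_self i A)) (LocSmooth.sum (m := m) h1), ih h1]

end

/-! ### Commutators of covariant derivatives -/

section

variable {k : ℕ} {u : U} {t t' : ∀ x, Fib L δ k (u, x)} {x : M}
  {w w' : ∀ x : M, ℂ ⊗[ℝ] TangentSpace (𝓡 (2 * n)) x}

/-- The Lie bracket of complex vector fields. -/
def cBracket (w w' : ∀ x : M, ℂ ⊗[ℝ] TangentSpace (𝓡 (2 * n)) x) (x : M) :
    ℂ ⊗[ℝ] TangentSpace (𝓡 (2 * n)) x :=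
  ∑ b, (dC (fun y => lamC T b y (w' y)) x (w x) - dC (fun y => lamC T b y (w y)) x (w' x))
      • ((1 : ℂ) ⊗ₜ[ℝ] T.V b x)
    + ∑ a, ∑ b, (lamC T a x (w x) * lamC T b x (w' x))
      • ((1 : ℂ) ⊗ₜ[ℝ] VectorField.mlieBracket (𝓡 (2 * n)) (T.V a) (T.V b) x)

/-- The curvature of `δ`, extended to complex vectors. -/
def curvC (p : U × M) (v v' : ℂ ⊗[ℝ] TangentSpace (𝓡 (2 * n)) p.2) : ℂ :=
  ∑ a, ∑ b, (lamC T a p.2 v * lamC T b p.2 v') * curvδ D (T.V a) (T.V b) p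

/-- The algebra common to commutators of complexified derivations of sections and of functions. Here
c, c' are the coefficients of the two fields, e, e' their derivatives, SS a b the derivative along
V_a of the derivative along V_b, and r the curvature term, which is zero for functions. -/
theorem sum_commutator {A ι : Type*} [AddCommGroup A] [Module ℂ A] [Fintype ι] (c c' e e' : ι → ℂ)
    (S : ι → A) (SS B : ι → ι → A) (r : ι → ι → ℂ) (s : A)
    (h : ∀ a b, SS a b - SS b a = B a b + r a b • s) :
    (∑ b, (c' b • ∑ a, c a • SS a b + e' b • S b))
      - (∑ a, (c a • ∑ b, c' b • SS b a + e a • S a))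
      = (∑ b, (e' b - e b) • S b + ∑ a, ∑ b, (c a * c' b) • B a b)
        + (∑ a, ∑ b, (c a * c' b) * r a b) • s := by
  have h1 : ∀ a b, (c a * c' b) • SS a b - (c a * c' b) • SS b a
      = (c a * c' b) • B a b + ((c a * c' b) * r a b) • s := fun a b => by
    rw [← smul_sub, h, smul_add, smul_smul]
  have h2 : (∑ a, ∑ b, (c a * c' b) • SS a b) - (∑ a, ∑ b, (c a * c' b) • SS b a)
      = (∑ a, ∑ b, (c a * c' b) • B a b) + (∑ a, ∑ b, (c a * c' b) * r a b) • s := by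
    simp only [← Finset.sum_sub_distrib, h1, Finset.sum_add_distrib, Finset.sum_smul]
  simp only [Finset.sum_add_distrib, Finset.smul_sum, smul_smul, sub_smul, Finset.sum_sub_distrib]
  rw [add_assoc, ← h2, Finset.sum_comm (f := fun b a => (c' b * c a) • SS a b)]
  simp only [mul_comm (c' _)]
  abel

theorem sympC_expand (x : M) (v v' : ℂ ⊗[ℝ] TangentSpace (𝓡 (2 * n)) x) :
    K.sympC x v v' = ∑ a, ∑ b, (lamC T a x v * lamC T b x v') * K.symp x (T.V a x) (T.V b x) := by
  conv_lhs => rw [← lamC_expand T x v, ← lamC_expand T x v']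
  simp only [map_sum, map_smul, LinearMap.sum_apply, LinearMap.smul_apply, sympC_tmul, smul_eq_mul,
    one_mul, Finset.mul_sum, mul_assoc]
  refine Finset.sum_comm.trans (Finset.sum_congr rfl fun a _ => Finset.sum_congr rfl fun b _ => ?_)
  ring

/-- Expansion of both fields in the real frame reduces the commutator to those of the V_a; the
derivatives of the coefficients are absorbed in the complex bracket. -/
theorem covC_commutator (h : LocSmooth (n := n) t x) (hw : SmoothC T w x) (hw' : SmoothC T w' x) :
    covC Q D T (fun y => covC Q D T t y (w' y)) x (w x)
      - covC Q D T (fun y => covC Q D T t y (w y)) x (w' x)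
      = covC Q D T t x (cBracket T w w' x)
        + (k * ((1 / Complex.I) * K.sympC x (w x) (w' x)) + curvC D T (u, x) (w x) (w' x))
          • t x := by
  have key : ∀ (w w' : ∀ x : M, ℂ ⊗[ℝ] TangentSpace (𝓡 (2 * n)) x), SmoothC T w' x →
      covC Q D T (fun y => covC Q D T t y (w' y)) x (w x)
        = ∑ b, (lamC T b x (w' x) • ∑ a, lamC T a x (w x) •
            nablaM Q D (fun y => nablaM Q D t y (T.V b y)) x (T.V a x)
          + dC (fun y => lamC T b y (w' y)) x (w x) • nablaM Q D t x (T.V b x)) := by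
    intro w w' hw'
    have h1 : (fun y => covC Q D T t y (w' y))
        = fun y => ∑ b, lamC T b y (w' y) • nablaM Q D t y (T.V b y) :=
      funext fun y => covC_expand Q D T t y (w' y)
    have h2 : ∀ b, LocSmooth (n := n) (fun y => nablaM Q D t y (T.V b y)) x := fun b =>
      h.nablaM Q D T (T.V_smooth b)
    rw [h1, covC_section_sum Q D T fun b _ => (h2 b).smul (m := m) (hw' b)]
    refine Finset.sum_congr rfl fun b _ => ?_
    rw [covC_leibniz Q D T (hw' b) (h2 b), covC_expand]
  have hc : ∀ a b, nablaM Q D (fun y => nablaM Q D t y (T.V b y)) x (T.V a x)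
      - nablaM Q D (fun y => nablaM Q D t y (T.V a y)) x (T.V b x)
      = nablaM Q D t x (VectorField.mlieBracket (𝓡 (2 * n)) (T.V a) (T.V b) x)
        + (k * ((1 / Complex.I) * (K.symp x (T.V a x) (T.V b x) : ℂ))
          + curvδ D (T.V a) (T.V b) (u, x)) • t x := by
    obtain ⟨s, hs, h1⟩ := h
    have h2 : ∀ b, ∀ᶠ y in 𝓝 x, nablaM Q D t y (T.V b y) = nablaM Q D s y (T.V b y) := fun b => by
      filter_upwards [h1.eventually_nhds] with y hy
      rw [nablaM_congr Q D hy]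
    intro a b
    rw [nablaM_congr Q D (h2 a), nablaM_congr Q D (h2 b), nablaM_congr Q D h1, h1.self_of_nhds]
    exact sub_eq_iff_eq_add'.1 (nablaM_commutator Q D T hs (T.V_smooth a) (T.V_smooth b) x)
  rw [key w w' hw', key w' w hw]
  have h3 := sum_commutator (fun a => lamC T a x (w x)) (fun a => lamC T a x (w' x))
    (fun b => dC (fun y => lamC T b y (w y)) x (w' x))
    (fun b => dC (fun y => lamC T b y (w' y)) x (w x))
    (fun b => nablaM Q D t x (T.V b x))
    (fun a b => nablaM Q D (fun y => nablaM Q D t y (T.V b y)) x (T.V a x)) _ _ (t x) hc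
  refine h3.trans ?_
  rw [cBracket, map_add, map_sum, map_sum]
  simp only [map_sum, map_smul, covC_one_tmul]
  congr 2
  rw [sympC_expand T, curvC]
  simp only [Finset.mul_sum, ← Finset.sum_add_distrib]
  refine Finset.sum_congr rfl fun a _ => Finset.sum_congr rfl fun b _ => ?_
  ring

theorem dC_cBracket {f : M → ℂ} (hf : SmoothNear (𝓡 (2 * n)) f x) (hw : SmoothC T w x)
    (hw' : SmoothC T w' x) :
    dC f x (cBracket T w w' x)
      = dC (fun y => dC f y (w' y)) x (w x) - dC (fun y => dC f y (w y)) x (w' x) := by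
  have key : ∀ (w w' : ∀ x : M, ℂ ⊗[ℝ] TangentSpace (𝓡 (2 * n)) x), SmoothC T w' x →
      dC (fun y => dC f y (w' y)) x (w x)
        = ∑ b, (lamC T b x (w' x) • ∑ a, lamC T a x (w x) •
            mvfderiv (𝓡 (2 * n)) (fun y => mvfderiv (𝓡 (2 * n)) f y (T.V b y)) x (T.V a x)
          + dC (fun y => lamC T b y (w' y)) x (w x) • mvfderiv (𝓡 (2 * n)) f x (T.V b x)) := by
    intro w w' hw'
    have h1 : (fun y => dC f y (w' y))
        = fun y => ∑ b, lamC T b y (w' y) * mvfderiv (𝓡 (2 * n)) f y (T.V b y) :=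
      funext fun y => dC_expand T f y (w' y)
    have h2 : ∀ b, SmoothNear (𝓡 (2 * n)) (fun y => mvfderiv (𝓡 (2 * n)) f y (T.V b y)) x :=
      fun b => hf.mvfderiv (T.V_smooth b)
    rw [h1, dC_expand T]
    simp only [mvfderiv_sum_apply fun b _ => ((hw' b).mul (h2 b)).mdiff,
      mvfderiv_mul_apply (hw' _).mdiff (h2 _).mdiff, Finset.mul_sum, smul_eq_mul]
    rw [Finset.sum_comm]
    refine Finset.sum_congr rfl fun b _ => ?_
    rw [dC_expand T, Finset.sum_mul, ← Finset.sum_add_distrib]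
    refine Finset.sum_congr rfl fun a _ => ?_
    ring
  have hc : ∀ a b,
      mvfderiv (𝓡 (2 * n)) (fun y => mvfderiv (𝓡 (2 * n)) f y (T.V b y)) x (T.V a x)
      - mvfderiv (𝓡 (2 * n)) (fun y => mvfderiv (𝓡 (2 * n)) f y (T.V a y)) x (T.V b x)
      = mvfderiv (𝓡 (2 * n)) f x (VectorField.mlieBracket (𝓡 (2 * n)) (T.V a) (T.V b) x)
        + (0 : ℂ) • (0 : ℂ) := fun a b => by
    rw [smul_zero, add_zero]
    exact mvfderiv_commutator hf (T.V_smooth a) (T.V_smooth b)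
  rw [key w w' hw', key w' w hw]
  have h3 := sum_commutator (fun a => lamC T a x (w x)) (fun a => lamC T a x (w' x))
    (fun b => dC (fun y => lamC T b y (w y)) x (w' x))
    (fun b => dC (fun y => lamC T b y (w' y)) x (w x))
    (fun b => mvfderiv (𝓡 (2 * n)) f x (T.V b x))
    (fun a b => mvfderiv (𝓡 (2 * n)) (fun y => mvfderiv (𝓡 (2 * n)) f y (T.V b y)) x (T.V a x))
    _ (fun _ _ => 0) 0 hc
  refine Eq.trans ?_ h3.symm
  have h4 : ∀ v, dC f x ((1 : ℂ) ⊗ₜ[ℝ] v) = mvfderiv (𝓡 (2 * n)) f x v := fun v => by simp [dC]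
  rw [cBracket, map_add, map_sum, map_sum]
  simp only [map_sum, map_smul, h4, smul_zero, add_zero]

end

/-! ### Holomorphic charts -/

section

variable {u : U} (c : HolChart (K.j u)) {x : M}

theorem chart_smoothNear (hx : x ∈ c.z.source) : SmoothNear (𝓡 (2 * n)) c.z x :=
  smoothNear_of_contMDiffOn c.smooth c.z.open_source hx

theorem coord_smoothNear (hx : x ∈ c.z.source) (l : Fin n) :
    SmoothNear (𝓡 (2 * n)) (fun y => c.z y l) x :=
  (chart_smoothNear c hx).clm (ContinuousLinearMap.proj l : (Fin n → ℂ) →L[ℝ] ℂ)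

theorem mvfderiv_coord (hx : x ∈ c.z.source) (l : Fin n) (v : TangentSpace (𝓡 (2 * n)) x) :
    mvfderiv (𝓡 (2 * n)) (fun y => c.z y l) x v = mvfderiv (𝓡 (2 * n)) c.z x v l :=
  mvfderiv_clm_apply (chart_smoothNear c hx).mdiff
    (ContinuousLinearMap.proj l : (Fin n → ℂ) →L[ℝ] ℂ) v

/-- The real coordinate vector field in the direction of `ξ`. -/
def coordVF (ξ : Fin n → ℂ) (x : M) : TangentSpace (𝓡 (2 * n)) x :=
  mfderiv 𝓘(ℝ, Fin n → ℂ) (𝓡 (2 * n)) c.z.symm (c.z x) ξ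

theorem mvfderiv_coordVF (hx : x ∈ c.z.source) (ξ : Fin n → ℂ) :
    mvfderiv (𝓡 (2 * n)) c.z x (coordVF c ξ x) = ξ := by
  have h1 : MDifferentiableAt (𝓡 (2 * n)) 𝓘(ℝ, Fin n → ℂ) c.z x := (chart_smoothNear c hx).mdiff
  have h2 : MDifferentiableAt 𝓘(ℝ, Fin n → ℂ) (𝓡 (2 * n)) c.z.symm (c.z x) :=
    ((c.smooth_symm _ (c.z.map_source hx)).contMDiffAt
      (c.z.open_target.mem_nhds (c.z.map_source hx))).mdifferentiableAt (by simp)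
  have h1' : MDifferentiableAt (𝓡 (2 * n)) 𝓘(ℝ, Fin n → ℂ) c.z (c.z.symm (c.z x)) := by
    rw [c.z.left_inv hx]
    exact h1
  have h3 := mfderiv_comp_apply (c.z x) h1' h2 ξ
  have h4 : (c.z ∘ c.z.symm) =ᶠ[𝓝 (c.z x)] id := by
    filter_upwards [c.z.open_target.mem_nhds (c.z.map_source hx)] with y hy
    exact c.z.right_inv hy
  rw [h4.mfderiv_eq, mfderiv_id] at h3
  have h5 := congrArg (fun y => (show EuclideanSpace ℝ (Fin (2 * n)) →L[ℝ] (Fin n → ℂ) from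
    mfderiv (𝓡 (2 * n)) 𝓘(ℝ, Fin n → ℂ) c.z y) (coordVF c ξ x)) (c.z.left_inv hx)
  exact h5.symm.trans h3.symm

theorem mvfderiv_chart_injective (hx : x ∈ c.z.source) {v : TangentSpace (𝓡 (2 * n)) x}
    (h : mvfderiv (𝓡 (2 * n)) c.z x v = 0) : v = 0 := by
  have h1 : MDifferentiableAt (𝓡 (2 * n)) 𝓘(ℝ, Fin n → ℂ) c.z x := (chart_smoothNear c hx).mdiff
  have h2 : MDifferentiableAt 𝓘(ℝ, Fin n → ℂ) (𝓡 (2 * n)) c.z.symm (c.z x) :=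
    ((c.smooth_symm _ (c.z.map_source hx)).contMDiffAt
      (c.z.open_target.mem_nhds (c.z.map_source hx))).mdifferentiableAt (by simp)
  have h3 := mfderiv_comp_apply x h2 h1 v
  have h4 : (c.z.symm ∘ c.z) =ᶠ[𝓝 x] id := by
    filter_upwards [c.z.open_source.mem_nhds hx] with y hy
    exact c.z.left_inv hy
  rw [h4.mfderiv_eq, mfderiv_id] at h3
  have h5 : mfderiv (𝓡 (2 * n)) 𝓘(ℝ, Fin n → ℂ) c.z x v = 0 := h
  rw [h5] at h3
  exact h3.trans (map_zero _)

/-- The abstract inverse in the definition of `dz` is the differential of the inverse chart, and in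
this form its smooth dependence on the point is visible. -/
theorem inverse_eq_coordVF (hx : x ∈ c.z.source) (ξ : Fin n → ℂ) :
    (show TangentSpace (𝓡 (2 * n)) x →L[ℝ] (Fin n → ℂ) from
      mvfderiv (𝓡 (2 * n)) c.z x).inverse ξ = coordVF c ξ x := by
  set f : TangentSpace (𝓡 (2 * n)) x →L[ℝ] (Fin n → ℂ) := mvfderiv (𝓡 (2 * n)) c.z x
  let g : (Fin n → ℂ) →L[ℝ] TangentSpace (𝓡 (2 * n)) x :=
    mfderiv 𝓘(ℝ, Fin n → ℂ) (𝓡 (2 * n)) c.z.symm (c.z x)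
  have h1 : ∀ ξ, f (g ξ) = ξ := mvfderiv_coordVF c hx
  have h2 : ∀ v, g (f v) = v := fun v => by
    refine sub_eq_zero.1 (mvfderiv_chart_injective c hx ?_)
    have h3 : f (g (f v) - v) = 0 := by rw [map_sub, h1, sub_self]
    exact h3
  have h4 : f.inverse = g := ContinuousLinearMap.inverse_eq (ContinuousLinearMap.ext h1)
    (ContinuousLinearMap.ext h2)
  exact congrArg (fun T => T ξ) h4

theorem coordVF_smooth (hx : x ∈ c.z.source) (ξ : Fin n → ℂ) (a : Fin T.card) :
    SmoothNear (𝓡 (2 * n)) (fun y => T.lam a y (coordVF c ξ y)) x := by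
  have h1 := c.smooth_symm.contMDiffOn_tangentMapWithin (m := ∞) (by simp)
    c.z.open_target.uniqueMDiffOn
  have h2 : ContMDiffOn (𝓡 (2 * n)) 𝓘(ℝ, Fin n → ℂ).tangent ∞
      (fun y => (⟨c.z y, ξ⟩ : TangentBundle 𝓘(ℝ, Fin n → ℂ) (Fin n → ℂ))) c.z.source := by
    intro y hy
    rw [contMDiffWithinAt_totalSpace]
    refine ⟨c.smooth y hy, ?_⟩
    refine (contMDiffWithinAt_const (I := 𝓡 (2 * n)) (I' := 𝓘(ℝ, Fin n → ℂ)) (c := ξ)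
      (M := M) (n := ∞)).congr_of_eventuallyEq ?_ ?_
    · exact Filter.Eventually.of_forall fun z => by simp
    · simp
  have h3 : ContMDiffOn (𝓡 (2 * n)) 𝓘(ℝ, ℝ) ∞ (fun y => T.lam a (c.z.symm (c.z y))
      (mfderivWithin 𝓘(ℝ, Fin n → ℂ) (𝓡 (2 * n)) c.z.symm c.z.target (c.z y) ξ)) c.z.source :=
    (T.lam_smooth a).comp_contMDiffOn (h1.comp h2 fun y hy => c.z.map_source hy)
  refine (smoothNear_of_contMDiffOn h3 c.z.open_source hx).congr ?_
  filter_upwards [c.z.open_source.mem_nhds hx] with y hy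
  have h4 := congrArg (fun z => T.lam a z (show EuclideanSpace ℝ (Fin (2 * n)) from
    coordVF c ξ y)) (c.z.left_inv hy)
  have h5 : mfderivWithin 𝓘(ℝ, Fin n → ℂ) (𝓡 (2 * n)) c.z.symm c.z.target (c.z y)
      = mfderiv 𝓘(ℝ, Fin n → ℂ) (𝓡 (2 * n)) c.z.symm (c.z y) :=
    mfderivWithin_of_mem_nhds (c.z.open_target.mem_nhds (c.z.map_source hy))
  have h6 := congrArg (fun A => T.lam a (c.z.symm (c.z y)) (A ξ)) h5
  exact h4.symm.trans h6.symm

theorem dz_val (hx : x ∈ c.z.source) (i : Fin n) :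
    (dz c i x).1 = (1 / 2 : ℂ) • ((1 : ℂ) ⊗ₜ[ℝ] coordVF c (Pi.single i 1) x)
      + (-(Complex.I / 2)) • ((1 : ℂ) ⊗ₜ[ℝ] K.j u x (coordVF c (Pi.single i 1) x)) := by
  have h := K.projE_one_tmul (u, x) (coordVF c (Pi.single i 1) x)
  refine Eq.trans ?_ h
  rw [dz, inverse_eq_coordVF c hx, cMk, TensorProduct.tmul_zero, add_zero]

theorem dz_smooth (hx : x ∈ c.z.source) (i : Fin n) : SmoothC T (fun y => (dz c i y).1) x := by
  intro a
  have h1 : ∀ b, SmoothNear (𝓡 (2 * n)) (fun y => K.Jc T b a (u, y)) x := fun b =>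
    SmoothNear.slice_right (p := (u, x)) (smoothNear_of_contMDiff (K.Jc_smooth T b a) (u, x))
  have h2 := fun a => coordVF_smooth T c hx (Pi.single i 1) a
  have h3 : SmoothNear (𝓡 (2 * n)) (fun y =>
      (1 / 2 : ℂ) * ((T.lam a y (coordVF c (Pi.single i 1) y) : ℝ) : ℂ)
      + (-(Complex.I / 2)) * ((∑ b, T.lam b y (coordVF c (Pi.single i 1) y) * K.Jc T b a (u, y) : ℝ)
        : ℂ)) x :=
    ((h2 a).ofReal.const_mul _).add
      ((SmoothNear.sum fun b _ => (h2 b).mul (h1 b)).ofReal.const_mul _)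
  refine h3.congr ?_
  filter_upwards [c.z.open_source.mem_nhds hx] with y hy
  rw [dz_val c hy, map_add, map_smul, map_smul, lamC, formC_tmul, formC_tmul, one_mul, one_mul,
    smul_eq_mul, smul_eq_mul]
  have h4 := K.lam_j T a (u, y) (coordVF c (Pi.single i 1) y)
  exact congrArg (fun r : ℝ => (1 / 2 : ℂ) * _ + (-(Complex.I / 2)) * (r : ℂ)) h4

theorem dC_tmul (f : M → ℂ) (x : M) (z : ℂ) (v : TangentSpace (𝓡 (2 * n)) x) :
    dC f x (z ⊗ₜ[ℝ] v) = z * mvfderiv (𝓡 (2 * n)) f x v := by simp [dC]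

theorem dC_cRe_cIm (f : M → ℂ) (x : M) (w : ℂ ⊗[ℝ] TangentSpace (𝓡 (2 * n)) x) :
    dC f x w = mvfderiv (𝓡 (2 * n)) f x (cRe w) + Complex.I * mvfderiv (𝓡 (2 * n)) f x (cIm w) := by
  rw [← cExt_mvfderiv]
  rfl

theorem dC_conj {f : M → ℂ} {x : M} (hf : MDifferentiableAt (𝓡 (2 * n)) 𝓘(ℝ, ℂ) f x)
    (w : ℂ ⊗[ℝ] TangentSpace (𝓡 (2 * n)) x) :
    dC (fun y => conj (f y)) x w = conj (dC f x (cConj w)) := by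
  have h : ∀ v, mvfderiv (𝓡 (2 * n)) (fun y => conj (f y)) x v
      = conj (mvfderiv (𝓡 (2 * n)) f x v) := fun v =>
    mvfderiv_clm_apply hf Complex.conjCLE.toContinuousLinearMap v
  rw [dC_cRe_cIm, dC_cRe_cIm, h, h]
  simp [cConj]

/-- The coordinates of a holomorphic chart are holomorphic. -/
theorem dC_coord_Ebar (hx : x ∈ c.z.source) (l : Fin n)
    {w : ℂ ⊗[ℝ] TangentSpace (𝓡 (2 * n)) x} (hw : w ∈ K.Ebar (u, x)) :
    dC (fun y => c.z y l) x w = 0 := by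
  have hj : ∀ w : ℂ ⊗[ℝ] TangentSpace (𝓡 (2 * n)) x, dC (fun y => c.z y l) x (K.jC (u, x) w)
      = Complex.I * dC (fun y => c.z y l) x w := by
    intro w
    induction w using TensorProduct.induction_on with
    | zero => simp
    | tmul z v =>
      have h := congrFun (c.hol x hx v) l
      rw [Pi.smul_apply, ← mvfderiv_coord c hx, ← mvfderiv_coord c hx, smul_eq_mul] at h
      rw [jC_tmul, dC_tmul, dC_tmul, h]
      ring
    | add a b ha hb => rw [map_add, map_add, ha, hb, map_add, mul_add]
  have h1 := hj w
  rw [K.jC_Ebar hw, map_neg, map_smul, smul_eq_mul] at h1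
  have h2 : (2 * Complex.I) * dC (fun y => c.z y l) x w = 0 := by linear_combination -h1
  exact (mul_eq_zero.1 h2).resolve_left (mul_ne_zero two_ne_zero Complex.I_ne_zero)

theorem dC_conj_coord_E (hx : x ∈ c.z.source) (l : Fin n) (e : K.E (u, x)) :
    dC (fun y => conj (c.z y l)) x e.1 = 0 := by
  rw [dC_conj (coord_smoothNear c hx l).mdiff, dC_coord_Ebar c hx l (K.cConj_E e), map_zero]

theorem dC_coord_dz (hx : x ∈ c.z.source) (l i : Fin n) :
    dC (fun y => c.z y l) x (dz c i x).1 = if l = i then 1 else 0 := by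
  have h := congrFun (c.hol x hx (coordVF c (Pi.single i 1) x)) l
  rw [Pi.smul_apply, ← mvfderiv_coord c hx, smul_eq_mul] at h
  rw [dz_val c hx, map_add, map_smul, map_smul, dC_tmul, dC_tmul, h, mvfderiv_coordVF c hx,
    mvfderiv_coord c hx, mvfderiv_coordVF c hx, Pi.single_apply, smul_eq_mul, smul_eq_mul]
  split_ifs
  · linear_combination (-1 / 2 : ℂ) * Complex.I_mul_I
  · ring

/-- The differentials of the coordinates and of their conjugates separate complex vectors. -/
theorem eq_zero_of_dC (hx : x ∈ c.z.source) {w : ℂ ⊗[ℝ] TangentSpace (𝓡 (2 * n)) x}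
    (h : ∀ l, dC (fun y => c.z y l) x w = 0) (h' : ∀ l, dC (fun y => conj (c.z y l)) x w = 0) :
    w = 0 := by
  have h1 : ∀ l, mvfderiv (𝓡 (2 * n)) c.z x (cRe w) l = 0
      ∧ mvfderiv (𝓡 (2 * n)) c.z x (cIm w) l = 0 := fun l => by
    have e1 := h l
    have e2 := h' l
    rw [dC_conj (coord_smoothNear c hx l).mdiff, map_eq_zero] at e2
    rw [dC_cRe_cIm, mvfderiv_coord c hx, mvfderiv_coord c hx] at e1 e2
    simp only [cConj, cRe_cMk, cIm_cMk, map_neg, Pi.neg_apply] at e2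
    generalize mvfderiv (𝓡 (2 * n)) c.z x (cRe w) l = r at *
    have e3 : (2 * Complex.I) * mvfderiv (𝓡 (2 * n)) c.z x (cIm w) l = 0 := by
      linear_combination e1 - e2
    have e4 := (mul_eq_zero.1 e3).resolve_left (mul_ne_zero two_ne_zero Complex.I_ne_zero)
    refine ⟨?_, e4⟩
    rw [e4] at e1
    simpa using e1
  have h2 := mvfderiv_chart_injective c hx (v := cRe w) (funext fun l => (h1 l).1)
  have h3 := mvfderiv_chart_injective c hx (v := cIm w) (funext fun l => (h1 l).2)
  rw [← cMk_re_im w, h2, h3]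
  simp [cMk]

theorem dz_expand (hx : x ∈ c.z.source) (e : K.E (u, x)) :
    ∑ i, dC (fun y => c.z y i) x e.1 • dz c i x = e := by
  apply Subtype.ext
  refine sub_eq_zero.1 (eq_zero_of_dC c hx (fun l => ?_) fun l => ?_)
  · rw [map_sub, Submodule.coe_sum, map_sum]
    simp only [Submodule.coe_smul, map_smul, dC_coord_dz c hx, smul_eq_mul, mul_ite, mul_one,
      mul_zero, Finset.sum_ite_eq, Finset.mem_univ, if_true, sub_self]
  · rw [map_sub, Submodule.coe_sum, map_sum]
    simp only [Submodule.coe_smul, map_smul, dC_conj_coord_E c hx, smul_zero,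
      Finset.sum_const_zero, sub_zero]

theorem dzDual_eq (hx : x ∈ c.z.source) (i : Fin n) (e : K.E (u, x)) :
    dzDual c i x e = dC (fun y => c.z y i) x e.1 := by
  have h : ∀ w : ℂ ⊗[ℝ] TangentSpace (𝓡 (2 * n)) x, LinearMap.liftBaseChange ℂ
      ((LinearMap.proj i : (Fin n → ℂ) →ₗ[ℝ] ℂ) ∘ₗ
        (mvfderiv (𝓡 (2 * n)) c.z x).toLinearMap) w = dC (fun y => c.z y i) x w := by
    intro w
    induction w using TensorProduct.induction_on with
    | zero => simp
    | tmul z v =>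
      rw [dC_tmul, mvfderiv_coord c hx]
      simp
    | add a b ha hb => rw [map_add, map_add, ha, hb]
  exact h e.1

/-- The coordinates and their conjugates have constant derivatives along the coordinate fields, so
every second derivative in the bracket vanishes; these functions separate complex vectors. -/
theorem cBracket_dz (hx : x ∈ c.z.source) (i j : Fin n) :
    cBracket T (fun y => (dz c i y).1) (fun y => (dz c j y).1) x = 0 := by
  have h1 : ∀ (l i : Fin n) (v : ℂ ⊗[ℝ] TangentSpace (𝓡 (2 * n)) x),
    dC (fun y => dC (fun y => c.z y l) y (dz c i y).1) x v = 0 := by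
    intro l i v
    have h : (fun y => dC (fun y => c.z y l) y (dz c i y).1)
        =ᶠ[𝓝 x] fun _ => if l = i then 1 else 0 := by
      filter_upwards [c.z.open_source.mem_nhds hx] with y hy using dC_coord_dz c hy l i
    rw [dC_expand T]
    simp only [mvfderiv_congr h, mvfderiv_const_apply, mul_zero, Finset.sum_const_zero]
  have h2 : ∀ (l i : Fin n) (v : ℂ ⊗[ℝ] TangentSpace (𝓡 (2 * n)) x),
    dC (fun y => dC (fun y => conj (c.z y l)) y (dz c i y).1) x v = 0 := by
    intro l i v
    have h : (fun y => dC (fun y => conj (c.z y l)) y (dz c i y).1) =ᶠ[𝓝 x] fun _ => 0 := by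
      filter_upwards [c.z.open_source.mem_nhds hx] with y hy using dC_conj_coord_E c hy l _
    rw [dC_expand T]
    simp only [mvfderiv_congr h, mvfderiv_const_apply, mul_zero, Finset.sum_const_zero]
  have hc : ∀ l, SmoothNear (𝓡 (2 * n)) (fun y => conj (c.z y l)) x := fun l =>
    (coord_smoothNear c hx l).clm Complex.conjCLE.toContinuousLinearMap
  refine eq_zero_of_dC c hx (fun l => ?_) fun l => ?_
  · rw [dC_cBracket T (coord_smoothNear c hx l) (dz_smooth T c hx i) (dz_smooth T c hx j), h1, h1,
      sub_zero]
  · rw [dC_cBracket T (hc l) (dz_smooth T c hx i) (dz_smooth T c hx j), h2, h2, sub_zero]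

variable {k : ℕ} {t : ∀ x, Fib L δ k (u, x)}

theorem nablaHol_eq (i : Fin n) (t : ∀ x, Fib L δ k (u, x)) (x : M) :
    nablaHol Q D c i t x = covC Q D T t x (dz c i x).1 := cExt_nablaM Q D T t x _

theorem nablaAnti_eq (i : Fin n) (t : ∀ x, Fib L δ k (u, x)) (x : M) :
    nablaAnti Q D c i t x = covC Q D T t x (cConj (dz c i x).1) := cExt_nablaM Q D T t x _

/-- The holomorphic coordinate derivatives commute up to a function. -/
theorem nablaHol_commutator (hx : x ∈ c.z.source) (h : LocSmooth (n := n) t x) (i j : Fin n) :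
    nablaHol Q D c i (nablaHol Q D c j t) x - nablaHol Q D c j (nablaHol Q D c i t) x
      = curvC D T (u, x) (dz c i x).1 (dz c j x).1 • t x := by
  have h1 := covC_commutator Q D T h (dz_smooth T c hx i) (dz_smooth T c hx j)
  -- The term proportional to k disappears because ω vanishes on two vectors of type (1,0); only the
  -- curvature of δ is left.
  rw [cBracket_dz T c hx, map_zero, zero_add, K.sympC_E (p := (u, x)), mul_zero, mul_zero,
    zero_add] at h1
  have h2 : ∀ i, nablaHol Q D c i t = fun y => covC Q D T t y (dz c i y).1 := fun i =>
    funext fun y => nablaHol_eq Q D T c i t y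
  rw [nablaHol_eq Q D T, nablaHol_eq Q D T, h2, h2]
  exact h1

include Q in
theorem curvC_smooth {w w' : ∀ x : M, ℂ ⊗[ℝ] TangentSpace (𝓡 (2 * n)) x} (hw : SmoothC T w x)
    (hw' : SmoothC T w' x) :
    SmoothNear (𝓡 (2 * n)) (fun y => curvC D T (u, y) (w y) (w' y)) x :=
  SmoothNear.sum fun a _ => SmoothNear.sum fun b _ => ((hw a).mul (hw' b)).mul
    (SmoothNear.slice_right (p := (u, x)) (smoothNear_of_contMDiff
      (curvδ_smooth Q D T (T.V_smooth a) (T.V_smooth b)) (u, x)))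

end

/-! ### Multi-indices and operators in a chart -/

section

section MultiIndex

theorem mem_multiIdx {n ℓ : ℕ} {α : Fin n → ℕ} : α ∈ multiIdx n ℓ ↔ ∑ i, α i ≤ ℓ := by
  rw [multiIdx, Finset.mem_filter, Fintype.mem_piFinset, and_iff_right_iff_imp]
  intro h i
  rw [Finset.mem_range]
  exact Nat.lt_succ_of_le ((Finset.single_le_sum (fun j _ => Nat.zero_le (α j))
    (Finset.mem_univ i)).trans h)

/-- The factors with index below m are absent, so one more D_m can be put at the left end without
moving it past another operator. No commutation is assumed. -/
theorem foldr_iterate_add_single {S ι : Type*} [LinearOrder ι] (F : ι → S → S) (α : ι → ℕ) {m : ι}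
    (hα : ∀ j < m, α j = 0) :
    ∀ l : List ι, l.Pairwise (· < ·) → m ∈ l →
      (l.map fun i => (F i)^[(α + Pi.single m 1 : ι → ℕ) i]).foldr (· ∘ ·) id
        = F m ∘ (l.map fun i => (F i)^[α i]).foldr (· ∘ ·) id := by
  intro l
  induction l with
  | nil => intro _ h; exact absurd h List.not_mem_nil
  | cons a l ih =>
    intro hl hm
    rw [List.pairwise_cons] at hl
    rw [List.map_cons, List.map_cons, List.foldr_cons, List.foldr_cons]
    by_cases h : a = m
    · subst h
      have h1 : (l.map fun i => (F i)^[(α + Pi.single a 1 : ι → ℕ) i]) = l.map fun i => (F i)^[α i] := by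
        refine List.map_congr_left fun i hi => ?_
        rw [Pi.add_apply, Pi.single_eq_of_ne (hl.1 i hi).ne', add_zero]
      rw [h1, Pi.add_apply, Pi.single_eq_same, Function.iterate_succ', Function.comp_assoc]
    · have h1 : m ∈ l := (List.mem_cons.1 hm).resolve_left (Ne.symm h)
      rw [ih hl.2 h1, Pi.add_apply, Pi.single_eq_of_ne h, hα a (hl.1 m h1)]
      rfl

theorem multiOp_add_single {S : Type*} {n : ℕ} (F : Fin n → S → S) (α : Fin n → ℕ) {m : Fin n}
    (hα : ∀ j < m, α j = 0) : multiOp F (α + Pi.single m 1) = F m ∘ multiOp F α :=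
  foldr_iterate_add_single F α hα _ (List.pairwise_lt_finRange n) (List.mem_finRange m)

theorem multiOp_zero {S : Type*} {n : ℕ} (F : Fin n → S → S) : multiOp F 0 = id := by
  rw [multiOp]
  generalize List.finRange n = l
  induction l with
  | nil => rfl
  | cons a l ih => rw [List.map_cons, List.foldr_cons, ih]; rfl

theorem multiOp_single {S : Type*} {n : ℕ} (F : Fin n → S → S) (m : Fin n) :
    multiOp F (Pi.single m 1) = F m := by
  have h := multiOp_add_single F 0 (m := m) fun _ _ => rfl
  rwa [zero_add, multiOp_zero] at h

/-- A nonzero multi-index is the sum of a multi-index and of its first unit vector. -/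
theorem exists_eq_add_single {n : ℕ} {α : Fin n → ℕ} {i : Fin n} (hi : α i ≠ 0) :
    ∃ (m : Fin n) (β : Fin n → ℕ), m ≤ i ∧ (∀ j < m, β j = 0) ∧ α = β + Pi.single m 1 := by
  obtain ⟨m, hm, hmin⟩ := (Finset.univ.filter fun j => α j ≠ 0).exists_minimal
    ⟨i, by simp [hi]⟩
  have hm' : α m ≠ 0 := by simpa using hm
  have hlt : ∀ j < m, α j = 0 := fun j hj => by
    by_contra h
    exact absurd (hmin (by simp [h]) hj.le) (not_le.2 hj)
  refine ⟨m, α - Pi.single m 1, ?_, ?_, ?_⟩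
  · by_contra h
    exact hi (hlt i (not_le.1 h))
  · intro j hj
    rw [Pi.sub_apply, hlt j hj, Nat.zero_sub]
  · funext j
    rw [Pi.add_apply, Pi.sub_apply]
    by_cases h : j = m
    · subst h; rw [Pi.single_eq_same]; omega
    · rw [Pi.single_eq_of_ne h]; omega

theorem sum_add_single {n : ℕ} (α : Fin n → ℕ) (m : Fin n) :
    ∑ i, (α + Pi.single m 1 : Fin n → ℕ) i = ∑ i, α i + 1 := by
  simp [Finset.sum_add_distrib]

/-- Every multi-index is obtained from `0` by adding unit vectors in decreasing order. -/
theorem multiIdx_induction {n : ℕ} {p : (Fin n → ℕ) → Prop} (h0 : p 0)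
    (h : ∀ (m : Fin n) (β : Fin n → ℕ), (∀ j < m, β j = 0) → p β → p (β + Pi.single m 1))
    (α : Fin n → ℕ) : p α := by
  induction hs : ∑ i, α i generalizing α with
  | zero =>
    have : α = 0 := funext fun i => Finset.sum_eq_zero_iff.1 hs i (Finset.mem_univ i)
    exact this ▸ h0
  | succ s ih =>
    obtain ⟨i, -, hi⟩ := Finset.exists_ne_zero_of_sum_ne_zero (hs.trans_ne (Nat.succ_ne_zero s))
    obtain ⟨m, β, -, hβ, rfl⟩ := exists_eq_add_single hi
    rw [sum_add_single] at hs
    exact h m β hβ (ih β (by omega))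

end MultiIndex

variable {u : U} (c : HolChart (K.j u)) {x : M} {k : ℕ} {t t' : ∀ x, Fib L δ k (u, x)}

/-- Smoothness over the domain of a chart. -/
def ChartSmooth (t : ∀ x, Fib L δ k (u, x)) : Prop := ∀ y ∈ c.z.source, LocSmooth (n := n) t y

include T in
theorem ChartSmooth.nablaHol (h : ChartSmooth c t) (i : Fin n) :
    ChartSmooth c (nablaHol Q D c i t) := by
  intro y hy
  have h1 := LocSmooth.covC Q D T (h y hy) (dz_smooth T c hy i)
  have h2 : HalfFormQuant.nablaHol Q D c i t = fun y => HalfFormQuant.covC Q D T t y (dz c i y).1 :=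
    funext fun y => nablaHol_eq Q D T c i t y
  rw [h2]
  exact h1

include T in
theorem ChartSmooth.multiOp (h : ChartSmooth c t) (α : Fin n → ℕ) :
    ChartSmooth c (multiOp (HalfFormQuant.nablaHol Q D c) α t) := by
  induction α using multiIdx_induction with
  | h0 => rwa [multiOp_zero]
  | h m β hβ ih => rw [multiOp_add_single _ _ hβ]; exact ih.nablaHol Q D T c m

include T in
theorem nablaHol_congr (h : ∀ y ∈ c.z.source, t y = t' y) (hx : x ∈ c.z.source) (i : Fin n) :
    nablaHol Q D c i t x = nablaHol Q D c i t' x := by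
  rw [nablaHol_eq Q D T, nablaHol_eq Q D T, covC_congr Q D T]
  filter_upwards [c.z.open_source.mem_nhds hx] with y hy using h y hy

/-- The families of operators on the sections of the bundles `L_u^k ⊗ δ_u`, `k ∈ ℕ`, which are
holomorphic differential operators of order `≤ ℓ` with coefficients independent of `k` in the
chart `c`. -/
def ChartOp (ℓ : ℕ) (P : ∀ k, (∀ x, Fib L δ k (u, x)) → ∀ x, Fib L δ k (u, x)) : Prop :=
  ∃ a : (Fin n → ℕ) → M → ℂ,
    (∀ α, ContMDiffOn (𝓡 (2 * n)) 𝓘(ℝ, ℂ) ∞ (a α) c.z.source) ∧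
    ∀ k (t : ∀ x, Fib L δ k (u, x)), ChartSmooth c t → ∀ x ∈ c.z.source,
      P k t x = ∑ α ∈ multiIdx n ℓ, a α x • multiOp (nablaHol Q D c) α t x

namespace ChartOp

variable {c} {Q} {D} {ℓ ℓ' : ℕ} {P P' : ∀ k, (∀ x, Fib L δ k (u, x)) → ∀ x, Fib L δ k (u, x)}

theorem congr (h : ChartOp Q D c ℓ P) (h' : ∀ k (t : ∀ x, Fib L δ k (u, x)), ChartSmooth c t →
    ∀ x ∈ c.z.source, P' k t x = P k t x) : ChartOp Q D c ℓ P' := by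
  obtain ⟨a, ha, hP⟩ := h
  exact ⟨a, ha, fun k t ht x hx => (h' k t ht x hx).trans (hP k t ht x hx)⟩

theorem mono (h : ChartOp Q D c ℓ P) (hℓ : ℓ ≤ ℓ') : ChartOp Q D c ℓ' P := by
  classical
  obtain ⟨a, ha, hP⟩ := h
  refine ⟨fun α => if α ∈ multiIdx n ℓ then a α else fun _ => 0, fun α => ?_, fun k t ht x hx => ?_⟩
  · by_cases hα : α ∈ multiIdx n ℓ
    · simp only [if_pos hα]; exact ha α
    · simp only [if_neg hα]; exact contMDiffOn_const
  · rw [hP k t ht x hx]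
    refine Eq.trans ?_ (Finset.sum_subset (s₁ := multiIdx n ℓ) (fun α hα => ?_) fun α _ hα => ?_)
    · refine Finset.sum_congr rfl fun α hα => ?_
      beta_reduce
      rw [if_pos hα]
    · exact mem_multiIdx.2 ((mem_multiIdx.1 hα).trans hℓ)
    · beta_reduce
      rw [if_neg hα, zero_smul]

theorem add (h : ChartOp Q D c ℓ P) (h' : ChartOp Q D c ℓ P') :
    ChartOp Q D c ℓ fun k t x => P k t x + P' k t x := by
  obtain ⟨a, ha, hP⟩ := h
  obtain ⟨a', ha', hP'⟩ := h'
  refine ⟨fun α x => a α x + a' α x, fun α => (ha α).add (ha' α), fun k t ht x hx => ?_⟩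
  beta_reduce
  rw [hP k t ht x hx, hP' k t ht x hx, ← Finset.sum_add_distrib]
  exact Finset.sum_congr rfl fun α _ => (add_smul _ _ _).symm

theorem smul {f : M → ℂ} (hf : ContMDiffOn (𝓡 (2 * n)) 𝓘(ℝ, ℂ) ∞ f c.z.source)
    (h : ChartOp Q D c ℓ P) : ChartOp Q D c ℓ fun k t x => f x • P k t x := by
  obtain ⟨a, ha, hP⟩ := h
  refine ⟨fun α x => f x * a α x, fun α => contMDiffOn_of_smoothNear fun y hy =>
    (smoothNear_of_contMDiffOn hf c.z.open_source hy).mul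
      (smoothNear_of_contMDiffOn (ha α) c.z.open_source hy), fun k t ht x hx => ?_⟩
  beta_reduce
  rw [hP k t ht x hx, Finset.smul_sum]
  exact Finset.sum_congr rfl fun α _ => smul_smul _ _ _

variable (Q D c) in
theorem zero : ChartOp Q D c ℓ fun _ _ _ => 0 :=
  ⟨fun _ _ => 0, fun _ => contMDiffOn_const, fun k t ht x hx => by simp⟩

theorem sum {ι : Type*} {A : Finset ι}
    {P : ι → ∀ k, (∀ x, Fib L δ k (u, x)) → ∀ x, Fib L δ k (u, x)}
    (h : ∀ i ∈ A, ChartOp Q D c ℓ (P i)) : ChartOp Q D c ℓ fun k t x => ∑ i ∈ A, P i k t x := by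
  classical
  induction A using Finset.induction_on with
  | empty => simpa only [Finset.sum_empty] using zero Q D c
  | insert i A hi ih =>
    simp only [Finset.sum_insert hi]
    exact (h i (Finset.mem_insert_self i A)).add
      (ih fun j hj => h j (Finset.mem_insert_of_mem hj))

variable (Q D c) in
theorem multiOp {α : Fin n → ℕ} (hα : ∑ i, α i ≤ ℓ) :
    ChartOp Q D c ℓ fun _ t x => HalfFormQuant.multiOp (nablaHol Q D c) α t x := by
  classical
  refine ⟨fun β _ => if β = α then 1 else 0, fun _ => contMDiffOn_const, fun k t ht x hx => ?_⟩
  beta_reduce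
  rw [Finset.sum_eq_single_of_mem α (mem_multiIdx.2 hα) fun β _ hβ => by rw [if_neg hβ, zero_smul],
    if_pos rfl, one_smul]

end ChartOp

end

/-! ### Composition of operators in a chart -/

section

theorem dC_smooth {f : M → ℂ} {w : ∀ x : M, ℂ ⊗[ℝ] TangentSpace (𝓡 (2 * n)) x} {x : M}
    (hf : SmoothNear (𝓡 (2 * n)) f x) (hw : SmoothC T w x) :
    SmoothNear (𝓡 (2 * n)) (fun y => dC f y (w y)) x := by
  have h : (fun y => dC f y (w y))
      = fun y => ∑ a, lamC T a y (w y) * mvfderiv (𝓡 (2 * n)) f y (T.V a y) :=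
    funext fun y => dC_expand T f y (w y)
  rw [h]
  exact SmoothNear.sum fun a _ => (hw a).mul (hf.mvfderiv (T.V_smooth a))

variable {u : U} {c : HolChart (K.j u)} {x : M} {k : ℕ} {t t' : ∀ x, Fib L δ k (u, x)}
  {ℓ ℓ' : ℕ} {P P' : ∀ k, (∀ x, Fib L δ k (u, x)) → ∀ x, Fib L δ k (u, x)}

variable {Q D}

-- Coordinate derivatives are controlled over the domain of the chart only; preservation of
-- smoothness there is what composing such operators needs.
include T in
theorem chartSmooth_of_chartOp (h : ChartOp Q D c ℓ P) (ht : ChartSmooth c t) :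
    ChartSmooth c (P k t) := by
  obtain ⟨a, ha, hP⟩ := h
  intro y hy
  have h1 : LocSmooth (n := n)
      (fun y => ∑ α ∈ multiIdx n ℓ, a α y • multiOp (nablaHol Q D c) α t y) y :=
    LocSmooth.sum (m := m) fun α _ => LocSmooth.smul (m := m)
      (smoothNear_of_contMDiffOn (ha α) c.z.open_source hy) (ht.multiOp Q D T c α y hy)
  refine h1.congr ?_
  filter_upwards [c.z.open_source.mem_nhds hy] with z hz using hP k t ht z hz

-- By the Leibniz rule, ∇_i(a ∇^α) is a ∇_i∇^α plus a derivative of a times ∇^α. That ∇_i∇^α differs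
-- from the ordered monomial by an operator of order at most ℓ is left as a hypothesis, so that the
-- statement can serve inside the induction that proves this very fact.
include T in
theorem chartOp_nablaHol_of (h : ChartOp Q D c ℓ P) (i : Fin n)
    (hN : ∀ α, ∑ i, α i ≤ ℓ → ChartOp Q D c ℓ fun _ t x =>
      nablaHol Q D c i (multiOp (nablaHol Q D c) α t) x
        - multiOp (nablaHol Q D c) (α + Pi.single i 1) t x) :
    ChartOp Q D c (ℓ + 1) fun k t => nablaHol Q D c i (P k t) := by
  obtain ⟨a, ha, hP⟩ := h
  have h1 : ChartOp Q D c (ℓ + 1) fun k t x => ∑ α ∈ multiIdx n ℓ,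
      (a α x • (multiOp (nablaHol Q D c) (α + Pi.single i 1) t x
        + (nablaHol Q D c i (multiOp (nablaHol Q D c) α t) x
          - multiOp (nablaHol Q D c) (α + Pi.single i 1) t x))
        + dC (a α) x (dz c i x).1 • multiOp (nablaHol Q D c) α t x) := by
    refine ChartOp.sum fun α hα => ?_
    have h2 := mem_multiIdx.1 hα
    refine ((ChartOp.add (ChartOp.multiOp Q D c ?_) ((hN α h2).mono (Nat.le_succ ℓ))).smul
      (ha α)).add ((ChartOp.multiOp Q D c (h2.trans (Nat.le_succ ℓ))).smul ?_)
    · rw [sum_add_single]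
      exact Nat.succ_le_succ h2
    · exact contMDiffOn_of_smoothNear fun y hy =>
        dC_smooth T (smoothNear_of_contMDiffOn (ha α) c.z.open_source hy) (dz_smooth T c hy i)
  refine h1.congr fun k t ht x hx => ?_
  rw [nablaHol_congr Q D T c (hP k t ht) hx, nablaHol_eq Q D T]
  have h3 : ∀ α, SmoothNear (𝓡 (2 * n)) (a α) x := fun α =>
    smoothNear_of_contMDiffOn (ha α) c.z.open_source hx
  have h4 : ∀ α, LocSmooth (n := n) (multiOp (nablaHol Q D c) α t) x := fun α =>
    ht.multiOp Q D T c α x hx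
  rw [covC_section_sum Q D T fun α _ => LocSmooth.smul (m := m) (h3 α) (h4 α)]
  refine Finset.sum_congr rfl fun α _ => ?_
  rw [covC_leibniz Q D T (h3 α) (h4 α), ← nablaHol_eq Q D T, add_sub_cancel]

-- If a factor ∇_{m'} with m' < i stands first, then ∇_i is moved past it: the commutator is a
-- function independent of k, and the induction hypothesis handles ∇_i acting on the shorter
-- monomial.
include T in
theorem chartOp_nablaHol_multiOp (c : HolChart (K.j u)) (ℓ : ℕ) : ∀ α, ∑ i, α i ≤ ℓ →
    ∀ i, ChartOp Q D c ℓ fun _ t x =>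
      nablaHol Q D c i (multiOp (nablaHol Q D c) α t) x
        - multiOp (nablaHol Q D c) (α + Pi.single i 1) t x := by
  induction ℓ with
  | zero =>
    intro α hα i
    have h : α = 0 := funext fun i =>
      Finset.sum_eq_zero_iff.1 (Nat.le_zero.1 hα) i (Finset.mem_univ i)
    refine (ChartOp.zero Q D c).congr fun k t ht x hx => ?_
    rw [h, zero_add, multiOp_single, multiOp_zero, id, sub_self]
  | succ ℓ ih =>
    intro α hα i
    by_cases h0 : ∀ j < i, α j = 0
    · refine (ChartOp.zero Q D c).congr fun k t ht x hx => ?_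
      rw [multiOp_add_single _ _ h0, Function.comp_apply, sub_self]
    · push Not at h0
      obtain ⟨j, hj, hαj⟩ := h0
      obtain ⟨m', β, hm, hβ, rfl⟩ := exists_eq_add_single hαj
      rw [sum_add_single] at hα
      have hβℓ : ∑ i, β i ≤ ℓ := by omega
      have hmi : m' < i := hm.trans_lt hj
      -- As m' < i, adding the unit vector of i creates no entry before m', so ∇_{m'} can still be
      -- put in front in the right order.
      have hβ' : ∀ j < m', (β + Pi.single i 1 : Fin n → ℕ) j = 0 := fun j hj => by
        rw [Pi.add_apply, hβ j hj, Pi.single_eq_of_ne (hj.trans hmi).ne, add_zero]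
      have h1 := chartOp_nablaHol_of T (ih β hβℓ i) m' fun α hα => ih α hα m'
      have h2 : ChartOp Q D c (ℓ + 1) fun k t x => curvC D T (u, x) (dz c i x).1 (dz c m' x).1
          • multiOp (nablaHol Q D c) β t x :=
        (ChartOp.multiOp Q D c (by omega)).smul (contMDiffOn_of_smoothNear fun y hy =>
          curvC_smooth Q D T (dz_smooth T c hy i) (dz_smooth T c hy m'))
      refine (h1.add h2).congr fun k t ht x hx => ?_
      have hB := ht.multiOp Q D T c β
      have h3 := nablaHol_commutator Q D T c hx (hB x hx) i m'
      have h4 : β + Pi.single m' 1 + Pi.single i 1 = β + Pi.single i 1 + Pi.single m' 1 :=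
        add_right_comm _ _ _
      rw [h4, multiOp_add_single _ _ hβ, multiOp_add_single _ _ hβ', Function.comp_apply,
        Function.comp_apply, ← h3]
      have h5 : nablaHol Q D c m' (fun y => nablaHol Q D c i (multiOp (nablaHol Q D c) β t) y
          - multiOp (nablaHol Q D c) (β + Pi.single i 1) t y) x
          = nablaHol Q D c m' (nablaHol Q D c i (multiOp (nablaHol Q D c) β t)) x
            - nablaHol Q D c m' (multiOp (nablaHol Q D c) (β + Pi.single i 1) t) x := by
        have hE := chartSmooth_of_chartOp T (ih β hβℓ i) ht (k := k) x hx
        have hF := ht.multiOp Q D T c (β + Pi.single i 1) x hx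
        have h6 := covC_section_add Q D T hE hF (dz c m' x).1
        simp only [sub_add_cancel] at h6
        rw [nablaHol_eq Q D T, nablaHol_eq Q D T, nablaHol_eq Q D T, eq_sub_iff_add_eq]
        exact h6.symm
      rw [h5]
      abel

include T in
theorem chartOp_nablaHol (h : ChartOp Q D c ℓ P) (i : Fin n) :
    ChartOp Q D c (ℓ + 1) fun k t => nablaHol Q D c i (P k t) :=
  chartOp_nablaHol_of T h i fun α hα => chartOp_nablaHol_multiOp T c ℓ α hα i

end

/-! ### Holomorphic operators and the anti-holomorphic ideal -/

section

/-- Families of operators on the sections of the bundles `L_u^k ⊗ δ_u`. -/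
abbrev SliceFamily (L : M → Type*) [∀ x, AddCommGroup (L x)] [∀ x, Module ℂ (L x)]
    (δ : U × M → Type*) [∀ p, AddCommGroup (δ p)] [∀ p, Module ℂ (δ p)] :=
  ∀ (k : ℕ) (u : U), (∀ x, Fib L δ k (u, x)) → ∀ x, Fib L δ k (u, x)

/-- The families generated by functions and the derivatives along the fields `W_a`. -/
inductive HolOp : SliceFamily L δ → Prop
  | id : HolOp fun _ _ t x => t x
  | smul {P : SliceFamily L δ} {f : U × M → ℂ}
      (hf : ContMDiff ((𝓡 m).prod (𝓡 (2 * n))) 𝓘(ℝ, ℂ) ∞ f) (h : HolOp P) :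
      HolOp fun k u t x => f (u, x) • P k u t x
  | add {P P' : SliceFamily L δ} (h : HolOp P) (h' : HolOp P') :
      HolOp fun k u t x => P k u t x + P' k u t x
  | cov {P : SliceFamily L δ} (a : Fin T.card) (h : HolOp P) :
      HolOp fun k u t x => covC Q D T (P k u t) x (K.W T a (u, x)).1

/-- The left ideal generated by the derivatives along the fields conjugate to the `W_a`. -/
inductive AntiOp : SliceFamily L δ → Prop
  | zero : AntiOp fun _ _ _ _ => 0
  | bar (a : Fin T.card) :
      AntiOp fun _ u t x => covC Q D T t x (cConj (K.W T a (u, x)).1)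
  | smul {P : SliceFamily L δ} {f : U × M → ℂ}
      (hf : ContMDiff ((𝓡 m).prod (𝓡 (2 * n))) 𝓘(ℝ, ℂ) ∞ f) (h : AntiOp P) :
      AntiOp fun k u t x => f (u, x) • P k u t x
  | add {P P' : SliceFamily L δ} (h : AntiOp P) (h' : AntiOp P') :
      AntiOp fun k u t x => P k u t x + P' k u t x
  | cov {P : SliceFamily L δ} (a : Fin T.card) (h : AntiOp P) :
      AntiOp fun k u t x => covC Q D T (P k u t) x (K.W T a (u, x)).1

variable {Q D T} {P P' : SliceFamily L δ}

/-- Each generator acts on the left of an operator already built, so the induction on the outer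
operator replaces the identity at its root by the inner one. It makes the commutator of the two
corrections holomorphic. -/
theorem HolOp.comp (h : HolOp Q D T P) (h' : HolOp Q D T P') :
    HolOp Q D T fun k u t => P k u (P' k u t) := by
  induction h with
  | id => exact h'
  | smul hf h ih => exact ih.smul hf
  | add h₁ h₂ ih₁ ih₂ => exact ih₁.add ih₂
  | cov a h ih => exact ih.cov a

theorem HolOp.neg (h : HolOp Q D T P) : HolOp Q D T fun k u t x => -P k u t x := by
  have h1 : (fun k u t x => -P k u t x : SliceFamily L δ) = fun k u t x => (-1 : ℂ) • P k u t x := by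
    funext k u t x
    exact (neg_one_smul ℂ _).symm
  rw [h1]
  exact h.smul (f := fun _ => -1) contMDiff_const

theorem HolOp.sub (h : HolOp Q D T P) (h' : HolOp Q D T P') :
    HolOp Q D T fun k u t x => P k u t x - P' k u t x := by
  simpa only [sub_eq_add_neg] using h.add h'.neg

theorem AntiOp.neg (h : AntiOp Q D T P) : AntiOp Q D T fun k u t x => -P k u t x := by
  have h1 : (fun k u t x => -P k u t x : SliceFamily L δ) = fun k u t x => (-1 : ℂ) • P k u t x := by
    funext k u t x
    exact (neg_one_smul ℂ _).symm
  rw [h1]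
  exact h.smul (f := fun _ => -1) contMDiff_const

theorem HolOp.zero : HolOp Q D T fun _ _ _ _ => 0 := by
  have h1 := (HolOp.id (Q := Q) (D := D) (T := T)).smul (f := fun _ => 0) contMDiff_const
  simpa only [zero_smul] using h1

theorem HolOp.sum {ι : Type*} {A : Finset ι} {P : ι → SliceFamily L δ}
    (h : ∀ i ∈ A, HolOp Q D T (P i)) : HolOp Q D T fun k u t x => ∑ i ∈ A, P i k u t x := by
  classical
  induction A using Finset.induction_on with
  | empty => simpa only [Finset.sum_empty] using HolOp.zero
  | insert i A hi ih =>
    simp only [Finset.sum_insert hi]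
    exact (h i (Finset.mem_insert_self i A)).add
      (ih fun j hj => h j (Finset.mem_insert_of_mem hj))

theorem smoothC_W (a : Fin T.card) (u : U) (x : M) :
    SmoothC T (fun y => (K.W T a (u, y)).1) x := fun b =>
  SmoothNear.slice_right (p := (u, x)) (smoothNear_of_contMDiff (K.lamC_W_smooth T a b) (u, x))

theorem lamC_cConj (a : Fin T.card) (x : M) (w : ℂ ⊗[ℝ] TangentSpace (𝓡 (2 * n)) x) :
    lamC T a x (cConj w) = conj (lamC T a x w) :=
  formC_cConj _ w

theorem SmoothC.cConj {w : ∀ x : M, ℂ ⊗[ℝ] TangentSpace (𝓡 (2 * n)) x} {x : M}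
    (hw : SmoothC T w x) : SmoothC T (fun y => cConj (w y)) x := fun a => by
  simp only [lamC_cConj]
  exact (hw a).clm Complex.conjCLE.toContinuousLinearMap

theorem HolOp.smoothSlice (h : HolOp Q D T P) {k : ℕ} {u : U} {t : ∀ x, Fib L δ k (u, x)}
    (ht : SmoothSlice (n := n) t) : SmoothSlice (n := n) (P k u t) := by
  induction h with
  | id => exact ht
  | smul hf h ih =>
    exact (frameSystemSlice m L δ k u).smoothSec_smul (hf.comp (contMDiff_const.prodMk contMDiff_id)) ih
  | add h₁ h₂ ih₁ ih₂ => exact (frameSystemSlice m L δ k u).smoothSec_add ih₁ ih₂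
  | cov a h ih =>
    exact smoothSlice_of_locSmooth (m := m) fun x =>
      (LocSmooth.of_smoothSlice (m := m) ih x).covC Q D T (smoothC_W a u x)

/-- The covariant derivative of a smooth section over `U × M` along a smooth family of complex
vector fields of the slices is smooth. -/
theorem smoothSection_covC {k : ℕ} {s : ∀ p, Fib L δ k p} (hs : SmoothSection (m := m) (n := n) s)
    {w : ∀ p : U × M, ℂ ⊗[ℝ] TangentSpace (𝓡 (2 * n)) p.2}
    (hw : ∀ a, ContMDiff ((𝓡 m).prod (𝓡 (2 * n))) 𝓘(ℝ, ℂ) ∞ fun p => lamC T a p.2 (w p)) :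
    SmoothSection (m := m) (n := n)
      fun p : U × M => (covC Q D T (fun x => s (p.1, x)) p.2 (w p) : Fib L δ k p) := by
  have S := frameSystemF (m := m) (n := n) L δ k
  have h1 : (fun p : U × M => (covC Q D T (fun x => s (p.1, x)) p.2 (w p) : Fib L δ k p))
      = fun p => ∑ b, lamC T b p.2 (w p) • nablaJ Q D (T.V b) s p :=
    funext fun p => covC_expand Q D T _ _ _
  rw [h1]
  exact S.smoothSec_sum fun b _ => S.smoothSec_smul (hw b)
    ((isDerivation_nablaJ Q D T k (T.V_smooth b)).smoothSec S
      (contMDiff_tPair_right (T.V_smooth b)) hs)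

theorem HolOp.smoothSection (h : HolOp Q D T P) {k : ℕ} {s : ∀ p, Fib L δ k p}
    (hs : SmoothSection (m := m) (n := n) s) :
    SmoothSection (m := m) (n := n)
      fun p : U × M => (P k p.1 (fun x => s (p.1, x)) p.2 : Fib L δ k p) := by
  have S := frameSystemF (m := m) (n := n) L δ k
  induction h with
  | id => exact hs
  | smul hf h ih => exact S.smoothSec_smul hf ih
  | add h₁ h₂ ih₁ ih₂ => exact S.smoothSec_add ih₁ ih₂
  | cov a h ih => exact smoothSection_covC ih fun b => K.lamC_W_smooth T a b

variable {u : U} {x : M} {k : ℕ}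

theorem covC_W_eq (c : HolChart (K.j u)) (hx : x ∈ c.z.source) (t : ∀ x, Fib L δ k (u, x))
    (a : Fin T.card) : covC Q D T t x (K.W T a (u, x)).1
      = ∑ i, dC (fun y => c.z y i) x (K.W T a (u, x)).1 • nablaHol Q D c i t x := by
  conv_lhs => rw [← dz_expand c hx (K.W T a (u, x))]
  rw [Submodule.coe_sum, map_sum]
  simp only [Submodule.coe_smul, map_smul, nablaHol_eq Q D T]

theorem covC_conj_W_eq (c : HolChart (K.j u)) (hx : x ∈ c.z.source) (t : ∀ x, Fib L δ k (u, x))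
    (a : Fin T.card) : covC Q D T t x (cConj (K.W T a (u, x)).1)
      = ∑ i, conj (dC (fun y => c.z y i) x (K.W T a (u, x)).1) • nablaAnti Q D c i t x := by
  conv_lhs => rw [← dz_expand c hx (K.W T a (u, x))]
  rw [Submodule.coe_sum, cConj_sum, map_sum]
  simp only [Submodule.coe_smul, cConj_smul, map_smul, nablaAnti_eq Q D T]

theorem dC_coord_W_smooth (c : HolChart (K.j u)) (a : Fin T.card) (i : Fin n) :
    ContMDiffOn (𝓡 (2 * n)) 𝓘(ℝ, ℂ) ∞
      (fun y => dC (fun y => c.z y i) y (K.W T a (u, y)).1) c.z.source :=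
  contMDiffOn_of_smoothNear fun y hy => dC_smooth T (coord_smoothNear c hy i) (smoothC_W a u y)

/-- The order is read off the way the operator is built, before any chart is chosen. In a chart each
∇_{W_a} is a combination of the ∇_{z^i} with smooth coefficients, and `chartOp_nablaHol` puts the
result back in order. -/
theorem HolOp.exists_chartOp_comp (h : HolOp Q D T P) (u : U) :
    ∃ ℓ, ∀ (c : HolChart (K.j u)) (ℓ' : ℕ) (R : ∀ k, (∀ x, Fib L δ k (u, x)) → ∀ x, Fib L δ k (u, x)),
      ChartOp Q D c ℓ' R → ChartOp Q D c (ℓ + ℓ') fun k t => P k u (R k t) := by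
  induction h with
  | id => exact ⟨0, fun c ℓ' R hR => hR.mono (Nat.zero_add ℓ').ge⟩
  | smul hf h ih =>
    obtain ⟨ℓ, ih⟩ := ih
    exact ⟨ℓ, fun c ℓ' R hR =>
      (ih c ℓ' R hR).smul (hf.comp (contMDiff_const.prodMk contMDiff_id)).contMDiffOn⟩
  | add h₁ h₂ ih₁ ih₂ =>
    obtain ⟨ℓ₁, ih₁⟩ := ih₁
    obtain ⟨ℓ₂, ih₂⟩ := ih₂
    exact ⟨ℓ₁ + ℓ₂, fun c ℓ' R hR => ((ih₁ c ℓ' R hR).mono (by omega)).add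
      ((ih₂ c ℓ' R hR).mono (by omega))⟩
  | cov a h ih =>
    obtain ⟨ℓ, ih⟩ := ih
    refine ⟨ℓ + 1, fun c ℓ' R hR => ?_⟩
    have h1 := ChartOp.sum (A := Finset.univ) fun i _ =>
      (chartOp_nablaHol T (ih c ℓ' R hR) i).smul (dC_coord_W_smooth (T := T) c a i)
    refine (h1.mono (by omega)).congr fun k t ht x hx => ?_
    exact covC_W_eq c hx _ a

theorem HolOp.exists_chartOp (h : HolOp Q D T P) (u : U) :
    ∃ ℓ, ∀ c : HolChart (K.j u), ChartOp Q D c ℓ fun k => P k u := by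
  obtain ⟨ℓ, hℓ⟩ := h.exists_chartOp_comp u
  refine ⟨ℓ + 0, fun c => ?_⟩
  refine hℓ c 0 (fun k t => t) ((ChartOp.multiOp Q D c (α := 0) (by simp)).congr fun k t ht x hx => ?_)
  rw [multiOp_zero, _root_.id]

theorem chartSmooth_of_smoothSlice (c : HolChart (K.j u)) {t : ∀ x, Fib L δ k (u, x)}
    (ht : SmoothSlice (n := n) t) : ChartSmooth c t := fun y _ => LocSmooth.of_smoothSlice (m := m) ht y

theorem HolOp.opSc (h : HolOp Q D T P) (k₀ : ℕ) : OpSc Q D k₀ P := by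
  refine ⟨fun k _ s hs => h.smoothSection hs, fun u => ?_⟩
  obtain ⟨ℓ, hℓ⟩ := h.exists_chartOp u
  refine ⟨ℓ, fun c => ?_⟩
  obtain ⟨a, ha, hP⟩ := hℓ c
  exact ⟨a, ha, fun k _ t ht => hP k t (chartSmooth_of_smoothSlice c ht)⟩

theorem HolOp.isHolDiffOp (h : HolOp Q D T P) (k : ℕ) (u : U) : IsHolDiffOp Q D (P k u) := by
  obtain ⟨ℓ, hℓ⟩ := h.exists_chartOp u
  refine ⟨ℓ, fun c => ?_⟩
  obtain ⟨a, ha, hP⟩ := hℓ c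
  exact ⟨a, ha, fun t ht => hP k t (chartSmooth_of_smoothSlice c ht)⟩

include T in
theorem chartSmooth_nablaAnti {c : HolChart (K.j u)} {t : ∀ x, Fib L δ k (u, x)}
    (h : ChartSmooth c t) (i : Fin n) : ChartSmooth c (nablaAnti Q D c i t) := by
  intro y hy
  have h1 := LocSmooth.covC Q D T (h y hy) (dz_smooth T c hy i).cConj
  have h2 : nablaAnti Q D c i t = fun y => covC Q D T t y (cConj (dz c i y).1) :=
    funext fun y => nablaAnti_eq Q D T c i t y
  rw [h2]
  exact h1

/-- In a chart an element of the ideal is a sum of holomorphic operators R_r applied after the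
derivatives along ∂/∂z̄^r. Composition on the left alters the R_r only, so no commutation of the two
kinds of derivatives is needed. -/
theorem AntiOp.exists_chartOp (h : AntiOp Q D T P) (u : U) :
    ∃ ℓ, ∀ c : HolChart (K.j u),
      ∃ R : Fin n → ∀ k, (∀ x, Fib L δ k (u, x)) → ∀ x, Fib L δ k (u, x),
        (∀ r, ChartOp Q D c ℓ (R r)) ∧ ∀ k (t : ∀ x, Fib L δ k (u, x)), ChartSmooth c t →
          ∀ x ∈ c.z.source, P k u t x = ∑ r, R r k (nablaAnti Q D c r t) x := by
  induction h with
  | zero =>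
    exact ⟨0, fun c => ⟨fun _ _ _ _ => 0, fun r => ChartOp.zero Q D c, fun k t ht x hx => by simp⟩⟩
  | bar a =>
    refine ⟨0, fun c => ⟨fun r k t x =>
      conj (dC (fun y => c.z y r) x (K.W T a (u, x)).1) • t x, fun r => ?_, fun k t ht x hx => ?_⟩⟩
    · have h1 : ChartOp Q D c 0 fun k (t : ∀ x, Fib L δ k (u, x)) => t :=
        (ChartOp.multiOp Q D c (α := 0) (by simp)).congr fun k t ht x hx => by
          rw [multiOp_zero, _root_.id]
      exact h1.smul (contMDiffOn_of_smoothNear fun y hy => (dC_smooth T (coord_smoothNear c hy r)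
        (smoothC_W a u y)).clm Complex.conjCLE.toContinuousLinearMap)
    · exact covC_conj_W_eq c hx t a
  | @smul P f hf h ih =>
    obtain ⟨ℓ, ih⟩ := ih
    refine ⟨ℓ, fun c => ?_⟩
    obtain ⟨R, hR, hP⟩ := ih c
    refine ⟨fun r k t x => f (u, x) • R r k t x, fun r =>
      (hR r).smul (hf.comp (contMDiff_const.prodMk contMDiff_id)).contMDiffOn,
      fun k t ht x hx => ?_⟩
    beta_reduce
    rw [hP k t ht x hx, Finset.smul_sum]
  | add h₁ h₂ ih₁ ih₂ =>
    obtain ⟨ℓ₁, ih₁⟩ := ih₁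
    obtain ⟨ℓ₂, ih₂⟩ := ih₂
    refine ⟨ℓ₁ + ℓ₂, fun c => ?_⟩
    obtain ⟨R₁, hR₁, hP₁⟩ := ih₁ c
    obtain ⟨R₂, hR₂, hP₂⟩ := ih₂ c
    refine ⟨fun r k t x => R₁ r k t x + R₂ r k t x, fun r => ((hR₁ r).mono (by omega)).add
      ((hR₂ r).mono (by omega)), fun k t ht x hx => ?_⟩
    beta_reduce
    rw [hP₁ k t ht x hx, hP₂ k t ht x hx, Finset.sum_add_distrib]
  | @cov P a h ih =>
    obtain ⟨ℓ, ih⟩ := ih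
    refine ⟨ℓ + 1, fun c => ?_⟩
    obtain ⟨R, hR, hP⟩ := ih c
    refine ⟨fun r k t x => covC Q D T (R r k t) x (K.W T a (u, x)).1, fun r => ?_,
      fun k t ht x hx => ?_⟩
    · have h1 := ChartOp.sum (A := Finset.univ) fun i _ =>
        (chartOp_nablaHol T (hR r) i).smul (dC_coord_W_smooth (T := T) c a i)
      exact h1.congr fun k t ht x hx => covC_W_eq c hx _ a
    · have h1 : ∀ᶠ y in 𝓝 x, P k u t y = ∑ r, R r k (nablaAnti Q D c r t) y := by
        filter_upwards [c.z.open_source.mem_nhds hx] with y hy using hP k t ht y hy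
      beta_reduce
      rw [covC_congr Q D T h1, covC_section_sum Q D T fun r _ =>
        chartSmooth_of_chartOp T (hR r) (chartSmooth_nablaAnti (T := T) ht r) x hx]

theorem AntiOp.inAntiIdeal (h : AntiOp Q D T P) (k : ℕ) (u : U) : InAntiIdeal Q D (P k u) := by
  classical
  obtain ⟨ℓ, hℓ⟩ := h.exists_chartOp u
  -- The bound ℓ + 1 admits the unit multi-indices β even when ℓ = 0; no other β has a nonzero
  -- coefficient.
  refine ⟨ℓ + 1, fun c => ?_⟩
  obtain ⟨R, hR, hP⟩ := hℓ c
  choose b hb hRb using fun r => (hR r).mono (Nat.le_succ ℓ)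
  refine ⟨fun α β x => ∑ r, if β = Pi.single r 1 then b r α x else 0, fun α β => ?_,
    fun t ht x hx => ?_⟩
  · refine contMDiffOn_of_smoothNear fun y hy => SmoothNear.sum fun r _ => ?_
    split_ifs
    · exact smoothNear_of_contMDiffOn (hb r α) c.z.open_source hy
    · exact smoothNear_const 0 y
  · have ht' := chartSmooth_of_smoothSlice c ht
    have h1 : ∀ r : Fin n, (Pi.single r 1 : Fin n → ℕ) ∈ (multiIdx n (ℓ + 1)).filter (· ≠ 0) := by
      intro r
      rw [Finset.mem_filter, mem_multiIdx]
      refine ⟨by simp, fun h => ?_⟩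
      simpa using congrFun h r
    have h2 : ∀ α, ∑ β ∈ (multiIdx n (ℓ + 1)).filter (· ≠ 0),
        (∑ r, if β = Pi.single r 1 then b r α x else 0)
          • multiOp (nablaHol Q D c) α (multiOp (nablaAnti Q D c) β t) x
        = ∑ r, b r α x • multiOp (nablaHol Q D c) α (nablaAnti Q D c r t) x := by
      intro α
      simp only [Finset.sum_smul]
      rw [Finset.sum_comm]
      refine Finset.sum_congr rfl fun r _ => ?_
      rw [Finset.sum_eq_single_of_mem _ (h1 r) fun β _ hβ => by rw [if_neg hβ, zero_smul],
        if_pos rfl, multiOp_single]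
    rw [hP k t ht' x hx, Finset.sum_congr rfl fun α _ => h2 α, Finset.sum_comm]
    exact Finset.sum_congr rfl fun r _ =>
      hRb r k _ (chartSmooth_nablaAnti (T := T) ht' r) x hx

end

/-! ### The Laplacian in an overcomplete frame -/

section

section Divergence

variable (K) in
/-- The Chern connection of `T^{1,0} M_u`, extended to complex tangent vectors. -/
def covEC {u : U} (W : ∀ x : M, K.E (u, x)) (x : M) :
    (ℂ ⊗[ℝ] TangentSpace (𝓡 (2 * n)) x) →ₗ[ℂ] K.E (u, x) :=
  ∑ a, (lamC T a x).smulRight (K.covESlice u W x (T.V a x))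

variable {u : U} {x : M}

theorem covEC_apply (W : ∀ x : M, K.E (u, x)) (w : ℂ ⊗[ℝ] TangentSpace (𝓡 (2 * n)) x) :
    covEC K T W x w = ∑ a, lamC T a x w • K.covESlice u W x (T.V a x) := by
  rw [covEC, LinearMap.sum_apply]
  rfl

/-- The Levi-Civita derivative is specified by choice, so its linearity in the direction is taken
from its explicit formula; hence the smoothness condition on W. -/
theorem cExt_covESlice {W : ∀ x : M, K.E (u, x)} (hW : SmoothC T (fun y => (W y).1) x)
    (w : ℂ ⊗[ℝ] TangentSpace (𝓡 (2 * n)) x) :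
    cExt (K.covESlice u W x) w = covEC K T W x w := by
  have h := fun v => K.covESlice_eq T (fun d => (hW d).mdiff) v
  letI : Module ℝ (K.E (u, x)) := Module.complexToReal _
  let Φ : TangentSpace (𝓡 (2 * n)) x →ₗ[ℝ] K.E (u, x) :=
    { toFun := K.covESlice u W x
      map_add' := fun v v' => by
        rw [h, h, h, ← Finset.sum_add_distrib]
        refine Finset.sum_congr rfl fun d _ => ?_
        simp only [map_add, Complex.ofReal_add, add_smul, Finset.sum_add_distrib, smul_add]
        abel
      map_smul' := fun c v => by
        rw [h, h, Finset.smul_sum]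
        refine Finset.sum_congr rfl fun d _ => ?_
        simp only [map_smul, smul_eq_mul, Complex.ofReal_mul, mul_smul, RingHom.id_apply, smul_add,
          ← Finset.smul_sum, Complex.real_smul]
        congr 1
        rw [smul_comm]
        rfl }
  have h1 : cExt (K.covESlice u W x) w = LinearMap.liftBaseChange ℂ Φ w := cExt_eq Φ w
  rw [h1, covEC_apply]
  conv_lhs => rw [← lamC_expand T x w]
  simp only [map_sum, map_smul]
  refine Finset.sum_congr rfl fun a _ => ?_
  rw [LinearMap.liftBaseChange_tmul, one_smul]
  rfl

theorem covEC_sum {κ : Type*} [Fintype κ] {f : κ → M → ℂ} {e : κ → ∀ x, K.E (u, x)}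
    (hf : ∀ i, SmoothNear (𝓡 (2 * n)) (f i) x) (he : ∀ i, SmoothC T (fun y => (e i y).1) x)
    {W : ∀ x, K.E (u, x)} (hW : ∀ᶠ y in 𝓝 x, W y = ∑ i, f i y • e i y)
    (w : ℂ ⊗[ℝ] TangentSpace (𝓡 (2 * n)) x) :
    covEC K T W x w = ∑ i, (dC (f i) x w • e i x + f i x • covEC K T (e i) x w) := by
  rw [covEC_apply]
  simp only [K.covESlice_sum T (fun i => (hf i).mdiff) (fun i d => (he i d).mdiff) hW, Finset.smul_sum]
  rw [Finset.sum_comm]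
  refine Finset.sum_congr rfl fun i _ => ?_
  rw [covEC_apply, dC_expand T, Finset.sum_smul, Finset.smul_sum, ← Finset.sum_add_distrib]
  refine Finset.sum_congr rfl fun a _ => ?_
  module

variable (K) in
/-- The divergence of the field `W_a`. -/
def divW (a : Fin T.card) (p : U × M) : ℂ :=
  ∑ c, lamC T c p.2 (covEC K T (fun y => K.W T a (p.1, y)) p.2 (K.W T c p).1).1

theorem covE_zero_left (W : ∀ p : U × M, K.E p) (p : U × M) (v : TangentSpace (𝓡 (2 * n)) p.2) :
    K.covE W p 0 v = K.covESlice p.1 (fun y => W (p.1, y)) p.2 v := by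
  have h : ∀ w : ∀ p : U × M, TangentSpace (𝓡 (2 * n)) p.2,
      K.covTM w p 0 v = K.leviCivita p.1 (fun x => w (p.1, x)) p.2 v := fun w => by
    have h1 : mvfderiv (𝓡 m) (fun u : U => toModel (w (u, p.2))) p.1 0 = 0 := map_zero _
    rw [covTM, h1]
    exact zero_add _
  rw [covE, h, h]
  rfl

theorem divW_smooth (a : Fin T.card) :
    ContMDiff ((𝓡 m).prod (𝓡 (2 * n))) 𝓘(ℝ, ℂ) ∞ (divW K T a) := by
  have h : divW K T a = fun p => ∑ c, ∑ d, lamC T d p.2 (K.W T c p).1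
      * ∑ b, K.connMat T a b p 0 (T.V d p.2) * lamC T c p.2 (K.W T b p).1 := by
    funext p
    refine Finset.sum_congr rfl fun c _ => ?_
    have h1 : ∀ d, K.covESlice p.1 (fun y => K.W T a (p.1, y)) p.2 (T.V d p.2)
        = ∑ b, K.connMat T a b p 0 (T.V d p.2) • K.W T b p := fun d => by
      rw [← covE_W, covE_zero_left]
    have h2 := congrArg ((lamC T c p.2) ∘ₗ (K.E p).subtype)
      (covEC_apply T (fun y => K.W T a (p.1, y)) (K.W T c p).1)
    refine h2.trans ?_
    rw [map_sum]
    refine Finset.sum_congr rfl fun d _ => ?_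
    rw [map_smul, h1, map_sum]
    simp only [map_smul]
    rfl
  rw [h]
  refine contMDiff_of_smoothNear fun p => SmoothNear.sum fun c _ => SmoothNear.sum fun d _ =>
    (smoothNear_of_contMDiff (K.lamC_W_smooth T c d) p).mul (SmoothNear.sum fun b _ => ?_)
  exact (K.connMat_smooth T a b isSmoothVF_zero (T.V_smooth d) p).mul
    (smoothNear_of_contMDiff (K.lamC_W_smooth T b c) p)

/-- The divergence in a holomorphic chart. -/
theorem divW_eq (c : HolChart (K.j u)) (hx : x ∈ c.z.source) (a : Fin T.card) :
    divW K T a (u, x) = ∑ i, (dC (fun y => dC (fun z => c.z z i) y (K.W T a (u, y)).1) x (dz c i x).1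
      + dC (fun y => c.z y i) x (K.W T a (u, x)).1
        * ∑ l, dzDual c l x (covEC K T (dz c i) x (dz c l x).1)) := by
  -- The divergence is a trace, so the overcomplete frame may be exchanged for the coordinate frame.
  have h1 : divW K T a (u, x)
      = ∑ l, dzDual c l x (covEC K T (fun y => K.W T a (u, y)) x (dz c l x).1) := by
    refine sum_coord_eq_sum_coord (E := K.E (u, x)) (l := fun b => (lamC T b x) ∘ₗ (K.E (u, x)).subtype)
      (w := fun b => K.W T b (u, x)) (l' := fun l => dzDual c l x) (w' := fun l => dz c l x)
      (fun e => K.E_expand T e) (fun e => ?_)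
      ((covEC K T (fun y => K.W T a (u, y)) x) ∘ₗ (K.E (u, x)).subtype)
    simp only [dzDual_eq c hx]
    exact dz_expand c hx e
  have h2 : ∀ᶠ y in 𝓝 x, K.W T a (u, y)
      = ∑ i, dC (fun z => c.z z i) y (K.W T a (u, y)).1 • dz c i y := by
    filter_upwards [c.z.open_source.mem_nhds hx] with y hy using (dz_expand c hy _).symm
  rw [h1]
  simp only [covEC_sum T (fun i => dC_smooth T (coord_smoothNear c hx i) (smoothC_W (T := T) a u x))
    (fun i => dz_smooth T c hx i) h2, map_sum, map_add, map_smul, smul_eq_mul]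
  rw [Finset.sum_comm]
  refine Finset.sum_congr rfl fun i _ => ?_
  rw [Finset.sum_add_distrib, ← Finset.mul_sum]
  congr 1
  simp only [dzDual_eq c hx, dC_coord_dz c hx, mul_ite, mul_one, mul_zero]
  rw [Finset.sum_ite_eq' Finset.univ i, if_pos (Finset.mem_univ i)]

end Divergence

/-- The operators `t ↦ ∑_b G_{ab} ∇_{W_b} t`. -/
def gradOp (X : ∀ u : U, TangentSpace (𝓡 m) u) (a : Fin T.card) : SliceFamily L δ :=
  fun _ u t x => ∑ b, (K.Gc T a b (u, x) (X u) : ℂ) • covC Q D T t x (K.W T b (u, x)).1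

/-- `Δ^{G(X)}`, computed in the frame of the `W_a`. -/
def deltaOp (X : ∀ u : U, TangentSpace (𝓡 m) u) : SliceFamily L δ :=
  fun k u t x => ∑ a, (covC Q D T (gradOp Q D T X a k u t) x (K.W T a (u, x)).1
    + divW K T a (u, x) • gradOp Q D T X a k u t x)

theorem ofReal_contMDiff {f : U × M → ℝ} (hf : ContMDiff ((𝓡 m).prod (𝓡 (2 * n))) 𝓘(ℝ, ℝ) ∞ f) :
    ContMDiff ((𝓡 m).prod (𝓡 (2 * n))) 𝓘(ℝ, ℂ) ∞ fun p => (f p : ℂ) :=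
  contMDiff_of_smoothNear fun p => (smoothNear_of_contMDiff hf p).ofReal

variable {X : ∀ u : U, TangentSpace (𝓡 m) u}

theorem gradOp_holOp (hX : IsSmoothVF X) (a : Fin T.card) : HolOp Q D T (gradOp Q D T X a) :=
  HolOp.sum fun b _ => (HolOp.id.cov b).smul (f := fun p : U × M => (K.Gc T a b p (X p.1) : ℂ))
    (ofReal_contMDiff (K.Gc_smooth T a b hX))

theorem deltaOp_holOp (hX : IsSmoothVF X) : HolOp Q D T (deltaOp Q D T X) :=
  HolOp.sum fun a _ => ((gradOp_holOp Q D T hX a).cov a).add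
    ((gradOp_holOp Q D T hX a).smul (divW_smooth T a))

variable {u : U} {x : M} {k : ℕ} {t : ∀ x, Fib L δ k (u, x)}

include T in
theorem Gcomp_eq (c : HolChart (K.j u)) (hx : x ∈ c.z.source) (v : TangentSpace (𝓡 m) u) (i j : Fin n) :
    Gcomp c v i j x = ∑ a, ∑ b, (K.Gc T a b (u, x) v : ℂ)
      * (dC (fun y => c.z y i) x (K.W T a (u, x)).1 * dC (fun y => c.z y j) x (K.W T b (u, x)).1) := by
  rw [Gcomp, K.G_eq_sum T]
  simp only [map_sum, map_smul, TensorProduct.map_tmul, TensorProduct.lid_tmul, smul_eq_mul,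
    dzDual_eq c hx]

/-- The components in the chart are τ_i = ∑_a dz^i(W_a) times the a-th gradient component. The
Leibniz terms in the derivatives of dz^i(W_a), together with the divergences of the coordinate
fields, add up to the divergence of W_a. -/
theorem delta_eq_deltaOp (hX : IsSmoothVF X) (ht : SmoothSlice (n := n) t) :
    delta Q D (X u) t x = deltaOp Q D T X k u t x := by
  have hx : x ∈ (K.holChartAt u x).z.source := (K.j_integrable u x).choose_spec
  rw [delta]
  -- The chart used in `delta` changes with the point; all that matters is that it contains x.
  generalize K.holChartAt u x = c at hx
  have hσ : ∀ y a, LocSmooth (n := n) (gradOp Q D T X a k u t) y := fun y a =>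
    LocSmooth.of_smoothSlice (m := m) ((gradOp_holOp Q D T hX a).smoothSlice ht) y
  have hw : ∀ a i, SmoothNear (𝓡 (2 * n))
      (fun y => dC (fun z => c.z z i) y (K.W T a (u, y)).1) x := fun a i =>
    dC_smooth T (coord_smoothNear c hx i) (smoothC_W (T := T) a u x)
  have hτ : ∀ i, ∀ y ∈ c.z.source, ∑ j, Gcomp c (X u) i j y • nablaHol Q D c j t y
      = ∑ a, dC (fun z => c.z z i) y (K.W T a (u, y)).1 • gradOp Q D T X a k u t y := by
    intro i y hy
    simp only [Gcomp_eq T c hy, gradOp, covC_W_eq c hy, Finset.sum_smul, Finset.smul_sum, smul_smul]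
    rw [Finset.sum_comm]
    refine Finset.sum_congr rfl fun a _ => ?_
    rw [Finset.sum_comm]
    refine Finset.sum_congr rfl fun b _ => Finset.sum_congr rfl fun j _ => ?_
    refine congrArg (fun z : ℂ => z • _) ?_
    ring
  have hτ' : ∀ i, nablaHol Q D c i (fun y => ∑ j, Gcomp c (X u) i j y • nablaHol Q D c j t y) x
      = ∑ a, (dC (fun z => c.z z i) x (K.W T a (u, x)).1 • nablaHol Q D c i (gradOp Q D T X a k u t) x
        + dC (fun y => dC (fun z => c.z z i) y (K.W T a (u, y)).1) x (dz c i x).1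
          • gradOp Q D T X a k u t x) := by
    intro i
    rw [nablaHol_congr Q D T c (hτ i) hx, nablaHol_eq Q D T,
      covC_section_sum Q D T fun a _ => LocSmooth.smul (m := m) (hw a i) (hσ x a)]
    refine Finset.sum_congr rfl fun a _ => ?_
    rw [covC_leibniz Q D T (hw a i) (hσ x a), nablaHol_eq Q D T]
  have h1 : deltaChart Q D c (X u) t x = ∑ i,
      (nablaHol Q D c i (fun y => ∑ j, Gcomp c (X u) i j y • nablaHol Q D c j t y) x
        + (∑ l, dzDual c l x (covEC K T (dz c i) x (dz c l x).1))
          • ∑ j, Gcomp c (X u) i j x • nablaHol Q D c j t x) := by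
    rw [deltaChart, Finset.sum_comm]
    refine Finset.sum_congr rfl fun i _ => ?_
    rw [Finset.sum_add_distrib, ← Finset.sum_smul]
    refine congrArg₂ (fun v w => v + w) ?_ (congrArg (fun z : ℂ => z • _) ?_)
    · simp only [dzDual_eq c hx, dC_coord_dz c hx, ite_smul, one_smul, zero_smul]
      rw [Finset.sum_ite_eq' Finset.univ i, if_pos (Finset.mem_univ i)]
    · simp only [cExt_covESlice T (dz_smooth T c hx i)]
  obtain ⟨r, hr⟩ : ∃ r : Fin n → ℂ, ∀ i,
      ∑ l, dzDual c l x (covEC K T (dz c i) x (dz c l x).1) = r i := ⟨_, fun _ => rfl⟩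
  rw [h1, deltaOp]
  simp only [hr, hτ', hτ _ x hx, divW_eq T c hx, covC_W_eq c hx, Finset.smul_sum, Finset.sum_smul,
    ← Finset.sum_add_distrib]
  rw [Finset.sum_comm]
  refine Finset.sum_congr rfl fun a _ => Finset.sum_congr rfl fun i _ => ?_
  module

end

/-! ### Normal forms -/

section

variable {Q D T}

theorem AntiOp.smoothSlice {P : SliceFamily L δ} (h : AntiOp Q D T P) {k : ℕ} {u : U}
    {t : ∀ x, Fib L δ k (u, x)} (ht : SmoothSlice (n := n) t) :
    SmoothSlice (n := n) (P k u t) := by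
  induction h with
  | zero =>
    have h1 := (frameSystemSlice (n := n) m L δ k u).smoothSec_sum (A := (∅ : Finset ℕ))
      (s := fun _ _ => (0 : Fib L δ k (u, _))) (by simp)
    simp only [Finset.sum_empty] at h1
    exact h1
  | bar a =>
    exact smoothSlice_of_locSmooth (m := m) fun x =>
      (LocSmooth.of_smoothSlice (m := m) ht x).covC Q D T (smoothC_W a u x).cConj
  | smul hf h ih =>
    exact (frameSystemSlice m L δ k u).smoothSec_smul
      (hf.comp (contMDiff_const.prodMk contMDiff_id)) ih
  | add h₁ h₂ ih₁ ih₂ => exact (frameSystemSlice m L δ k u).smoothSec_add ih₁ ih₂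
  | cov a h ih =>
    exact smoothSlice_of_locSmooth (m := m) fun x =>
      (LocSmooth.of_smoothSlice (m := m) ih x).covC Q D T (smoothC_W a u x)

/-- The operator on the sections over `U × M` defined by operators on the slices. -/
def onSlices (P : SliceFamily L δ) (k : ℕ) (s : ∀ p, Fib L δ k p) (p : U × M) : Fib L δ k p :=
  P k p.1 (fun x => s (p.1, x)) p.2

variable (Q D T) in
/-- The operators which are the sum of a holomorphic operator, an element of the left ideal
generated by the anti-holomorphic derivations and `k` times a function. -/
def HasNormalForm (f : U × M → ℂ) (F : ∀ k, (∀ p, Fib L δ k p) → ∀ p, Fib L δ k p) : Prop :=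
  ∃ A N : SliceFamily L δ, HolOp Q D T A ∧ AntiOp Q D T N ∧
    ∀ k (s : ∀ p, Fib L δ k p), SmoothSection (m := m) (n := n) s → ∀ p,
      F k s p = onSlices A k s p + onSlices N k s p + (k * f p) • s p

namespace HasNormalForm

variable {f g : U × M → ℂ} {F F' : ∀ k, (∀ p, Fib L δ k p) → ∀ p, Fib L δ k p}

theorem congr (h : HasNormalForm Q D T f F)
    (h' : ∀ k (s : ∀ p, Fib L δ k p), SmoothSection (m := m) (n := n) s → ∀ p, F' k s p = F k s p) :
    HasNormalForm Q D T f F' := by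
  obtain ⟨A, N, hA, hN, h⟩ := h
  exact ⟨A, N, hA, hN, fun k s hs p => (h' k s hs p).trans (h k s hs p)⟩

theorem add (h : HasNormalForm Q D T f F) (h' : HasNormalForm Q D T g F') :
    HasNormalForm Q D T (fun p => f p + g p) fun k s p => F k s p + F' k s p := by
  obtain ⟨A, N, hA, hN, h⟩ := h
  obtain ⟨A', N', hA', hN', h'⟩ := h'
  refine ⟨_, _, hA.add hA', hN.add hN', fun k s hs p => ?_⟩
  simp only [onSlices, h k s hs p, h' k s hs p]
  module

theorem smul (hg : ContMDiff ((𝓡 m).prod (𝓡 (2 * n))) 𝓘(ℝ, ℂ) ∞ g)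
    (h : HasNormalForm Q D T f F) :
    HasNormalForm Q D T (fun p => g p * f p) fun k s p => g p • F k s p := by
  obtain ⟨A, N, hA, hN, h⟩ := h
  refine ⟨_, _, hA.smul hg, hN.smul hg, fun k s hs p => ?_⟩
  simp only [onSlices, h k s hs p]
  module

theorem of_holOp {A : SliceFamily L δ} (hA : HolOp Q D T A) :
    HasNormalForm Q D T (fun _ => 0) (onSlices A) :=
  ⟨A, _, hA, AntiOp.zero, fun k s _ p => by
    simp only [onSlices, mul_zero, zero_smul, add_zero]⟩

theorem of_antiOp {N : SliceFamily L δ} (hN : AntiOp Q D T N) :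
    HasNormalForm Q D T (fun _ => 0) (onSlices N) :=
  ⟨_, N, HolOp.zero, hN, fun k s _ p => by
    simp only [onSlices, mul_zero, zero_smul, add_zero, zero_add]⟩

theorem neg (h : HasNormalForm Q D T f F) :
    HasNormalForm Q D T (fun p => -f p) fun k s p => -F k s p := by
  obtain ⟨A, N, hA, hN, h⟩ := h
  refine ⟨_, _, hA.neg, hN.neg, fun k s hs p => ?_⟩
  beta_reduce
  rw [h k s hs p]
  simp only [onSlices]
  module

theorem sub (h : HasNormalForm Q D T f F) (h' : HasNormalForm Q D T g F') :
    HasNormalForm Q D T (fun p => f p - g p) fun k s p => F k s p - F' k s p := by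
  simpa only [sub_eq_add_neg] using h.add h'.neg

theorem sum {ι : Type*} {A : Finset ι} {f : ι → U × M → ℂ}
    {F : ι → ∀ k, (∀ p, Fib L δ k p) → ∀ p, Fib L δ k p}
    (h : ∀ i ∈ A, HasNormalForm Q D T (f i) (F i)) :
    HasNormalForm Q D T (fun p => ∑ i ∈ A, f i p) fun k s p => ∑ i ∈ A, F i k s p := by
  classical
  induction A using Finset.induction_on with
  | empty =>
    simp only [Finset.sum_empty]
    exact of_holOp HolOp.zero
  | insert i A hi ih =>
    simp only [Finset.sum_insert hi]
    exact (h i (Finset.mem_insert_self i A)).add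
      (ih fun j hj => h j (Finset.mem_insert_of_mem hj))

/-- Composition with ∇_{W_a} on the left preserves the holomorphic operators and the ideal, but it
would turn a term k f into an operator with coefficient k. It is therefore used when f = 0 only. -/
theorem cov (hf : ∀ p, f p = 0) (h : HasNormalForm Q D T f F) (a : Fin T.card) :
    HasNormalForm Q D T (fun _ => 0)
      fun k s p => covC Q D T (fun x => F k s (p.1, x)) p.2 (K.W T a p).1 := by
  obtain ⟨A, N, hA, hN, h⟩ := h
  refine ⟨_, _, hA.cov a, hN.cov a, fun k s hs p => ?_⟩
  have h1 : (fun x => F k s (p.1, x))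
      = fun x => A k p.1 (fun x => s (p.1, x)) x + N k p.1 (fun x => s (p.1, x)) x := by
    funext x
    rw [h k s hs, hf, mul_zero, zero_smul, add_zero]
    rfl
  have hs' : SmoothSlice (n := n) fun x => s (p.1, x) := SmoothSection.slice hs p.1
  beta_reduce
  rw [h1, covC_section_add Q D T (LocSmooth.of_smoothSlice (m := m) (hA.smoothSlice hs') p.2)
    (LocSmooth.of_smoothSlice (m := m) (hN.smoothSlice hs') p.2), mul_zero, zero_smul, add_zero]
  rfl

end HasNormalForm

/-- Derivatives along smooth families of complex vector fields. -/
theorem hasNormalForm_covC {w : ∀ p : U × M, ℂ ⊗[ℝ] TangentSpace (𝓡 (2 * n)) p.2}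
    (hw : ∀ a, ContMDiff ((𝓡 m).prod (𝓡 (2 * n))) 𝓘(ℝ, ℂ) ∞ fun p => lamC T a p.2 (w p)) :
    HasNormalForm Q D T (fun _ => 0) fun (k : ℕ) (s : ∀ p, Fib L δ k p) (p : U × M) =>
      (covC Q D T (fun x => s (p.1, x)) p.2 (w p) : Fib L δ k p) := by
  have h1 := HasNormalForm.sum (A := Finset.univ) fun d _ =>
    ((HasNormalForm.of_holOp (HolOp.id.cov (Q := Q) (D := D) (T := T) d)).add
      (HasNormalForm.of_antiOp (AntiOp.bar d))).smul (hw d)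
  simp only [add_zero, mul_zero, Finset.sum_const_zero] at h1
  refine h1.congr fun k s hs p => ?_
  conv_lhs => rw [← lamC_expand T p.2 (w p)]
  rw [map_sum]
  refine Finset.sum_congr rfl fun d _ => ?_
  rw [map_smul, ← K.W_add_conj T d p, map_add]
  rfl

section Smoothness

variable {w w' : ∀ p : U × M, ℂ ⊗[ℝ] TangentSpace (𝓡 (2 * n)) p.2} {p : U × M}

theorem dC_slice_smooth {f : U × M → ℂ} (hf : ContMDiff ((𝓡 m).prod (𝓡 (2 * n))) 𝓘(ℝ, ℂ) ∞ f)
    (hw : ∀ a, ContMDiff ((𝓡 m).prod (𝓡 (2 * n))) 𝓘(ℝ, ℂ) ∞ fun p => lamC T a p.2 (w p)) :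
    ContMDiff ((𝓡 m).prod (𝓡 (2 * n))) 𝓘(ℝ, ℂ) ∞
      fun p : U × M => dC (fun x => f (p.1, x)) p.2 (w p) := by
  have h1 : (fun p : U × M => dC (fun x => f (p.1, x)) p.2 (w p)) = fun p => ∑ a, lamC T a p.2 (w p)
      * mvfderiv ((𝓡 m).prod (𝓡 (2 * n))) f p (tPair 0 (T.V a p.2)) := by
    funext p
    rw [dC_expand T]
    refine Finset.sum_congr rfl fun a _ => ?_
    rw [mvfderiv_tPair_right ((hf p).mdifferentiableAt (by simp))]
  rw [h1]
  exact contMDiff_of_smoothNear fun p => SmoothNear.sum fun a _ =>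
    (smoothNear_of_contMDiff (hw a) p).mul
      (smoothNear_mvfderiv_right (smoothNear_of_contMDiff hf p) (T.V_smooth a))

theorem cBracket_slice_smooth
    (hw : ∀ a, ContMDiff ((𝓡 m).prod (𝓡 (2 * n))) 𝓘(ℝ, ℂ) ∞ fun p => lamC T a p.2 (w p))
    (hw' : ∀ a, ContMDiff ((𝓡 m).prod (𝓡 (2 * n))) 𝓘(ℝ, ℂ) ∞ fun p => lamC T a p.2 (w' p))
    (d : Fin T.card) :
    ContMDiff ((𝓡 m).prod (𝓡 (2 * n))) 𝓘(ℝ, ℂ) ∞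
      fun p : U × M => lamC T d p.2 (cBracket T (fun x => w (p.1, x)) (fun x => w' (p.1, x)) p.2) := by
  have hs : ∀ {V : ∀ x : M, TangentSpace (𝓡 (2 * n)) x}, IsSmoothVF V → ∀ p : U × M,
      SmoothNear ((𝓡 m).prod (𝓡 (2 * n))) (fun p : U × M => lamC T d p.2 ((1 : ℂ) ⊗ₜ[ℝ] V p.2)) p := by
    intro V hV p
    have h : (fun p : U × M => lamC T d p.2 ((1 : ℂ) ⊗ₜ[ℝ] V p.2))
        = fun p => ((T.lam d p.2 (V p.2) : ℝ) : ℂ) := by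
      funext p
      rw [lamC, formC_tmul, one_mul]
    rw [h]
    exact (smoothNear_of_contMDiff ((T.isSmoothVF_iff.1 hV d).comp contMDiff_snd) p).ofReal
  refine contMDiff_of_smoothNear fun p => ?_
  have h1 : (fun p : U × M => lamC T d p.2 (cBracket T (fun x => w (p.1, x)) (fun x => w' (p.1, x)) p.2))
      = fun p => ∑ b, (dC (fun y => lamC T b y (w' (p.1, y))) p.2 (w p)
          - dC (fun y => lamC T b y (w (p.1, y))) p.2 (w' p)) * lamC T d p.2 ((1 : ℂ) ⊗ₜ[ℝ] T.V b p.2)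
        + ∑ a, ∑ b, (lamC T a p.2 (w p) * lamC T b p.2 (w' p)) * lamC T d p.2
          ((1 : ℂ) ⊗ₜ[ℝ] VectorField.mlieBracket (𝓡 (2 * n)) (T.V a) (T.V b) p.2) := by
    funext p
    rw [cBracket, map_add, map_sum, map_sum]
    simp only [map_sum, map_smul, smul_eq_mul]
  rw [h1]
  refine SmoothNear.add (SmoothNear.sum fun b _ => SmoothNear.mul (SmoothNear.sub ?_ ?_)
    (hs (T.V_smooth b) p)) (SmoothNear.sum fun a _ => SmoothNear.sum fun b _ => SmoothNear.mul
      (SmoothNear.mul ?_ ?_) (hs ((T.V_smooth a).mlieBracket (T.V_smooth b)) p))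
  · exact smoothNear_of_contMDiff (dC_slice_smooth (hw' b) hw) p
  · exact smoothNear_of_contMDiff (dC_slice_smooth (hw b) hw') p
  · exact smoothNear_of_contMDiff (hw a) p
  · exact smoothNear_of_contMDiff (hw' b) p

include Q in
theorem curvC_slice_smooth
    (hw : ∀ a, ContMDiff ((𝓡 m).prod (𝓡 (2 * n))) 𝓘(ℝ, ℂ) ∞ fun p => lamC T a p.2 (w p))
    (hw' : ∀ a, ContMDiff ((𝓡 m).prod (𝓡 (2 * n))) 𝓘(ℝ, ℂ) ∞ fun p => lamC T a p.2 (w' p)) :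
    ContMDiff ((𝓡 m).prod (𝓡 (2 * n))) 𝓘(ℝ, ℂ) ∞ fun p : U × M => curvC D T p (w p) (w' p) :=
  contMDiff_of_smoothNear fun p => SmoothNear.sum fun a _ => SmoothNear.sum fun b _ =>
    ((smoothNear_of_contMDiff (hw a) p).mul (smoothNear_of_contMDiff (hw' b) p)).mul
      (smoothNear_of_contMDiff (curvδ_smooth Q D T (T.V_smooth a) (T.V_smooth b)) p)

end Smoothness

variable (K T) in
/-- The fields conjugate to the `W_a`. -/
def Wbar (a : Fin T.card) (p : U × M) : ℂ ⊗[ℝ] TangentSpace (𝓡 (2 * n)) p.2 := cConj (K.W T a p).1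

theorem lamC_Wbar_smooth (a b : Fin T.card) :
    ContMDiff ((𝓡 m).prod (𝓡 (2 * n))) 𝓘(ℝ, ℂ) ∞ fun p => lamC T b p.2 (Wbar K T a p) := by
  refine contMDiff_of_smoothNear fun p => ?_
  simp only [Wbar, lamC_cConj]
  exact (smoothNear_of_contMDiff (K.lamC_W_smooth T a b) p).clm Complex.conjCLE.toContinuousLinearMap

/-- Moving an anti-holomorphic derivative past a holomorphic one. -/
theorem hasNormalForm_bar_cov (c b : Fin T.card) :
    HasNormalForm Q D T (fun p => (1 / Complex.I) * K.sympC p.2 (Wbar K T c p) (K.W T b p).1)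
      fun (k : ℕ) (s : ∀ p, Fib L δ k p) (p : U × M) =>
        (covC Q D T (fun x => covC Q D T (fun x => s (p.1, x)) x (K.W T b (p.1, x)).1) p.2
          (Wbar K T c p) : Fib L δ k p) := by
  have hW := fun a => K.lamC_W_smooth T b a
  have hWb := fun a => lamC_Wbar_smooth (K := K) (T := T) c a
  obtain ⟨A, N, hA, hN, h⟩ := hasNormalForm_covC (Q := Q) (D := D)
    (cBracket_slice_smooth (T := T) hWb hW)
  have h1 : HasNormalForm Q D T (fun p => (1 / Complex.I) * K.sympC p.2 (Wbar K T c p) (K.W T b p).1)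
      (fun k s p => (k * ((1 / Complex.I) * K.sympC p.2 (Wbar K T c p) (K.W T b p).1)) • s p) :=
    ⟨_, _, HolOp.zero, AntiOp.zero, fun k s _ p => by simp only [onSlices, zero_add]⟩
  have h2 := ((h1.add ⟨A, N, hA, hN, h⟩).add (HasNormalForm.of_antiOp ((AntiOp.bar c).cov b))).add
    (HasNormalForm.of_holOp (HolOp.id.smul (curvC_slice_smooth (Q := Q) (D := D) hWb hW)))
  simp only [add_zero] at h2
  refine h2.congr fun k s hs p => ?_
  have hs' : SmoothSlice (n := n) fun x => s (p.1, x) := SmoothSection.slice (m := m) hs p.1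
  have hl := LocSmooth.of_smoothSlice (m := m) hs' p.2
  -- Exchanging the two derivatives costs a derivative along a bracket, the curvature of δ, and
  -- (k/i) ω(W̄_c, W_b); only the last depends on k.
  have h3 := covC_commutator Q D T hl
    (smoothC_W (K := K) c p.1 p.2).cConj (smoothC_W (K := K) b p.1 p.2)
  rw [sub_eq_iff_eq_add] at h3
  refine h3.trans ?_
  simp only [onSlices, Wbar]
  rw [add_smul]
  abel

end

/-! ### The commutator of a horizontal derivative and the Laplacian -/

section

variable {Q D T} {X Y : ∀ u : U, TangentSpace (𝓡 m) u} {k : ℕ} {s s' : ∀ p, Fib L δ k p}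

section Derivation

include Q T in
theorem nablaU_smoothSection (hX : IsSmoothVF X) (hs : SmoothSection (m := m) (n := n) s) :
    SmoothSection (m := m) (n := n) (nablaU D X s) :=
  (isDerivation_nablaU Q D T k hX).smoothSec (frameSystemF (m := m) (n := n) L δ k)
    (contMDiff_tPair_left hX) hs

include Q T in
theorem nablaU_add (hX : IsSmoothVF X) (hs : SmoothSection (m := m) (n := n) s)
    (hs' : SmoothSection (m := m) (n := n) s') (p : U × M) :
    nablaU D X (fun p => s p + s' p) p = nablaU D X s p + nablaU D X s' p :=
  (isDerivation_nablaU Q D T k hX).apply_add (frameSystemF (m := m) (n := n) L δ k) hs hs' p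

include Q T in
theorem nablaU_smul (hX : IsSmoothVF X) {f : U × M → ℂ}
    (hf : ContMDiff ((𝓡 m).prod (𝓡 (2 * n))) 𝓘(ℝ, ℂ) ∞ f)
    (hs : SmoothSection (m := m) (n := n) s) (p : U × M) :
    nablaU D X (fun p => f p • s p) p = f p • nablaU D X s p
      + mvfderiv ((𝓡 m).prod (𝓡 (2 * n))) f p (tPair (X p.1) 0) • s p :=
  (isDerivation_nablaU Q D T k hX).apply_smul (frameSystemF (m := m) (n := n) L δ k) hf hs p

include Q T in
theorem nablaU_sum (hX : IsSmoothVF X) {ι : Type*} {A : Finset ι} {s : ι → ∀ p, Fib L δ k p}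
    (hs : ∀ i ∈ A, SmoothSection (m := m) (n := n) (s i)) (p : U × M) :
    nablaU D X (fun p => ∑ i ∈ A, s i p) p = ∑ i ∈ A, nablaU D X (s i) p := by
  classical
  have S := frameSystemF (m := m) (n := n) L δ k
  induction A using Finset.induction_on with
  | empty =>
    have h0 : SmoothSection (m := m) (n := n) fun p => (0 : Fib L δ k p) := by
      have h1 := S.smoothSec_sum (A := (∅ : Finset ℕ)) (s := fun _ p => (0 : Fib L δ k p)) (by simp)
      simp only [Finset.sum_empty] at h1
      exact h1
    have h := nablaU_add (Q := Q) (D := D) (T := T) hX h0 h0 p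
    simpa using h
  | insert i A hi ih =>
    simp only [Finset.sum_insert hi]
    have h1 := fun j hj => hs j (Finset.mem_insert_of_mem hj)
    rw [nablaU_add (Q := Q) (T := T) hX (hs i (Finset.mem_insert_self i A)) (S.smoothSec_sum h1),
      ih h1]

end Derivation

theorem mvfderiv_lamC_W_left (a b : Fin T.card) (p : U × M) (v : TangentSpace (𝓡 m) p.1) :
    mvfderiv ((𝓡 m).prod (𝓡 (2 * n))) (fun q => lamC T b q.2 (K.W T a q).1) p (tPair v 0)
      = -(Complex.I / 2) * (K.dJ T a b p v : ℂ) := by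
  rw [← K.connMat_left T a b p v, connMat]
  simp

variable (D T X) in
/-- The zeroth order part of the commutator of `∇_X` and `∇_{W_a}`. -/
def mixedW (a : Fin T.card) (p : U × M) : ℂ :=
  ∑ b, lamC T b p.2 (K.W T a p).1 * mixedδ D X (T.V b) p

include Q in
theorem mixedW_smooth (hX : IsSmoothVF X) (a : Fin T.card) :
    ContMDiff ((𝓡 m).prod (𝓡 (2 * n))) 𝓘(ℝ, ℂ) ∞ (mixedW D T X a) :=
  contMDiff_of_smoothNear fun p => SmoothNear.sum fun b _ =>
    (smoothNear_of_contMDiff (K.lamC_W_smooth T a b) p).mul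
      (smoothNear_of_contMDiff (mixedδ_smooth Q D T hX (T.V_smooth b)) p)

/-- The field W_a depends on u through j alone, and its derivative is -(i/2)(X.j)V_a = ∑ -(i/2)
dJ_{ab} V_b. Writing V_b = W_b + W̄_b exhibits the anti-holomorphic derivatives; the mixed curvature
accounts for the zeroth order term. -/
theorem nablaU_covC_W (hX : IsSmoothVF X) (hs : SmoothSection (m := m) (n := n) s)
    (a : Fin T.card) (p : U × M) :
    nablaU D X (fun p => (covC Q D T (fun x => s (p.1, x)) p.2 (K.W T a p).1 : Fib L δ k p)) p
      = covC Q D T (fun x => nablaU D X s (p.1, x)) p.2 (K.W T a p).1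
        + (mixedW D T X a p • s p + ∑ b, (-(Complex.I / 2) * (K.dJ T a b p (X p.1) : ℂ))
          • (covC Q D T (fun x => s (p.1, x)) p.2 (K.W T b p).1
            + covC Q D T (fun x => s (p.1, x)) p.2 (Wbar K T b p))) := by
  have S := frameSystemF (m := m) (n := n) L δ k
  have h1 : (fun p => (covC Q D T (fun x => s (p.1, x)) p.2 (K.W T a p).1 : Fib L δ k p))
      = fun p => ∑ b, lamC T b p.2 (K.W T a p).1 • nablaJ Q D (T.V b) s p :=
    funext fun p => covC_expand Q D T _ _ _
  have hV : ∀ b, SmoothSection (m := m) (n := n) (nablaJ Q D (T.V b) s) := fun b =>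
    (isDerivation_nablaJ Q D T k (T.V_smooth b)).smoothSec S (contMDiff_tPair_right (T.V_smooth b)) hs
  have h2 : ∀ b, nablaU D X (fun p => lamC T b p.2 (K.W T a p).1 • nablaJ Q D (T.V b) s p) p
      = lamC T b p.2 (K.W T a p).1 • nablaJ Q D (T.V b) (nablaU D X s) p
        + ((lamC T b p.2 (K.W T a p).1 * mixedδ D X (T.V b) p) • s p
        + (-(Complex.I / 2) * (K.dJ T a b p (X p.1) : ℂ)) • nablaJ Q D (T.V b) s p) := fun b => by
    have h3 := nablaU_nablaJ_commutator Q D T hs hX (T.V_smooth b) p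
    rw [sub_eq_iff_eq_add] at h3
    rw [nablaU_smul (Q := Q) (T := T) hX (K.lamC_W_smooth T a b) (hV b), mvfderiv_lamC_W_left, h3]
    module
  have h4 : ∀ b, nablaJ Q D (T.V b) s p = covC Q D T (fun x => s (p.1, x)) p.2 (K.W T b p).1
      + covC Q D T (fun x => s (p.1, x)) p.2 (Wbar K T b p) := fun b => by
    rw [← map_add, Wbar, K.W_add_conj T b p, covC_one_tmul]
    rfl
  rw [h1, nablaU_sum (Q := Q) (T := T) hX fun b _ => S.smoothSec_smul (K.lamC_W_smooth T a b) (hV b)]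
  simp only [h2, Finset.sum_add_distrib]
  rw [← Finset.sum_smul]
  simp only [h4]
  congr 1
  exact (covC_expand Q D T _ _ _).symm

variable (X Y) in
/-- The coefficient of `k` in the commutator of `∇_X` and `Δ^{G(Y)}`. -/
def commSymbol (T : TFrame (2 * n) M) (K : KahlerFamily m n U M) (p : U × M) : ℂ :=
  ∑ a, ∑ c, (-(Complex.I / 2) * (K.dJ T a c p (X p.1) : ℂ)) * ∑ b, (K.Gc T a b p (Y p.1) : ℂ)
    * ((1 / Complex.I) * K.sympC p.2 (Wbar K T c p) (K.W T b p).1)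

theorem dJ_contMDiff (hX : IsSmoothVF X) (a c : Fin T.card) :
    ContMDiff ((𝓡 m).prod (𝓡 (2 * n))) 𝓘(ℝ, ℂ) ∞
      fun p : U × M => -(Complex.I / 2) * (K.dJ T a c p (X p.1) : ℂ) :=
  contMDiff_of_smoothNear fun p => (smoothNear_const _ p).mul
    (smoothNear_of_contMDiff (ofReal_contMDiff (K.dJ_smooth T a c hX)) p)

theorem Gc_contMDiff (hY : IsSmoothVF Y) (a b : Fin T.card) :
    ContMDiff ((𝓡 m).prod (𝓡 (2 * n))) 𝓘(ℝ, ℂ) ∞ fun p : U × M => (K.Gc T a b p (Y p.1) : ℂ) :=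
  ofReal_contMDiff (K.Gc_smooth T a b hY)

/-- The derivatives along the W̄_b act first here, so they lie in the left ideal as they stand and
no factor k arises. -/
theorem hasNormalForm_commutator_cov (hX : IsSmoothVF X) (a : Fin T.card) :
    HasNormalForm Q D T (fun _ => 0) fun (k : ℕ) (s : ∀ p, Fib L δ k p) (p : U × M) =>
      nablaU D X (onSlices (fun _ u t x => covC Q D T t x (K.W T a (u, x)).1) k s) p
        - onSlices (fun _ u t x => covC Q D T t x (K.W T a (u, x)).1) k (nablaU D X s) p := by
  have h1 := (HasNormalForm.of_holOp ((HolOp.id (Q := Q) (D := D) (T := T)).smul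
    (mixedW_smooth (Q := Q) (D := D) (T := T) hX a))).add (HasNormalForm.sum (A := Finset.univ) fun b _ =>
    ((HasNormalForm.of_holOp (HolOp.id.cov (Q := Q) (D := D) (T := T) b)).add
      (HasNormalForm.of_antiOp (AntiOp.bar b))).smul (dJ_contMDiff (K := K) hX a b))
  simp only [add_zero, mul_zero, Finset.sum_const_zero] at h1
  refine h1.congr fun k s hs p => ?_
  rw [sub_eq_iff_eq_add']
  exact nablaU_covC_W hX hs a p

theorem hasNormalForm_commutator_gradOp (hX : IsSmoothVF X) (hY : IsSmoothVF Y) (a : Fin T.card) :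
    HasNormalForm Q D T (fun _ => 0) fun (k : ℕ) (s : ∀ p, Fib L δ k p) (p : U × M) =>
      nablaU D X (onSlices (gradOp Q D T Y a) k s) p
        - onSlices (gradOp Q D T Y a) k (nablaU D X s) p := by
  have h1 := HasNormalForm.sum (A := Finset.univ) fun b _ =>
    ((hasNormalForm_commutator_cov (Q := Q) (D := D) hX b).smul (Gc_contMDiff (K := K) (T := T) hY a b)).add
      (HasNormalForm.of_holOp ((HolOp.id.cov (Q := Q) (D := D) (T := T) b).smul
        (contMDiff_mvfderiv_apply (Gc_contMDiff (K := K) (T := T) hY a b) (contMDiff_tPair_left hX))))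
  simp only [add_zero, mul_zero, Finset.sum_const_zero] at h1
  refine h1.congr fun k s hs p => ?_
  have S := frameSystemF (m := m) (n := n) L δ k
  have h2 : ∀ b, SmoothSection (m := m) (n := n)
      (onSlices (fun _ u t x => covC Q D T t x (K.W T b (u, x)).1) k s) := fun b =>
    (HolOp.id.cov b).smoothSection hs
  have h3 : onSlices (gradOp Q D T Y a) k s = fun p => ∑ b, (K.Gc T a b p (Y p.1) : ℂ)
      • onSlices (fun _ u t x => covC Q D T t x (K.W T b (u, x)).1) k s p := rfl
  have h4 : onSlices (gradOp Q D T Y a) k (nablaU D X s) p = ∑ b, (K.Gc T a b p (Y p.1) : ℂ)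
      • onSlices (fun _ u t x => covC Q D T t x (K.W T b (u, x)).1) k (nablaU D X s) p := rfl
  rw [h3, h4, nablaU_sum (Q := Q) (T := T) hX fun b _ => S.smoothSec_smul (Gc_contMDiff (K := K) (T := T) hY a b) (h2 b),
    ← Finset.sum_sub_distrib]
  refine Finset.sum_congr rfl fun b _ => ?_
  rw [nablaU_smul (Q := Q) (T := T) hX (Gc_contMDiff (K := K) (T := T) hY a b) (h2 b), smul_sub]
  simp only [onSlices]
  abel

theorem hasNormalForm_bar_gradOp (hY : IsSmoothVF Y) (c a : Fin T.card) :
    HasNormalForm Q D T (fun p => ∑ b, (K.Gc T a b p (Y p.1) : ℂ)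
        * ((1 / Complex.I) * K.sympC p.2 (Wbar K T c p) (K.W T b p).1))
      fun (k : ℕ) (s : ∀ p, Fib L δ k p) (p : U × M) =>
        (covC Q D T (gradOp Q D T Y a k p.1 fun x => s (p.1, x)) p.2 (Wbar K T c p) : Fib L δ k p) := by
  have h1 := HasNormalForm.sum (A := Finset.univ) fun b _ =>
    ((hasNormalForm_bar_cov (Q := Q) (D := D) c b).smul (Gc_contMDiff (K := K) (T := T) hY a b)).add
      (HasNormalForm.of_holOp ((HolOp.id.cov (Q := Q) (D := D) (T := T) b).smul
        (dC_slice_smooth (Gc_contMDiff (K := K) (T := T) hY a b)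
          (lamC_Wbar_smooth (K := K) (T := T) c))))
  simp only [add_zero] at h1
  refine h1.congr fun k s hs p => ?_
  have hs' : SmoothSlice (n := n) fun x => s (p.1, x) := SmoothSection.slice (m := m) hs p.1
  have h2 : ∀ b, LocSmooth (n := n)
      (fun x => covC Q D T (fun x => s (p.1, x)) x (K.W T b (p.1, x)).1) p.2 := fun b =>
    (LocSmooth.of_smoothSlice (m := m) hs' p.2).covC Q D T (smoothC_W (K := K) b p.1 p.2)
  have h3 : ∀ b, SmoothNear (𝓡 (2 * n)) (fun x => (K.Gc T a b (p.1, x) (Y p.1) : ℂ)) p.2 := fun b =>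
    SmoothNear.slice_right (p := p) (smoothNear_of_contMDiff (Gc_contMDiff (K := K) (T := T) hY a b) p)
  have h4 := covC_section_sum Q D T (A := Finset.univ)
    (fun b _ => LocSmooth.smul (m := m) (h3 b) (h2 b)) (Wbar K T c p)
  refine h4.trans (Finset.sum_congr rfl fun b _ => ?_)
  exact covC_leibniz Q D T (h3 b) (h2 b) _

/-- The commutator with the outer derivative puts ∇_{W̄_c} to the left of the gradient, and moving
it to the right produces the multiple of k. -/
theorem hasNormalForm_commutator_cov_gradOp (hX : IsSmoothVF X) (hY : IsSmoothVF Y) (a : Fin T.card) :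
    HasNormalForm Q D T (fun p => ∑ c, (-(Complex.I / 2) * (K.dJ T a c p (X p.1) : ℂ))
        * ∑ b, (K.Gc T a b p (Y p.1) : ℂ)
          * ((1 / Complex.I) * K.sympC p.2 (Wbar K T c p) (K.W T b p).1))
      fun (k : ℕ) (s : ∀ p, Fib L δ k p) (p : U × M) =>
        nablaU D X (onSlices (fun _ u t x => covC Q D T t x (K.W T a (u, x)).1) k
            (onSlices (gradOp Q D T Y a) k s)) p
          - onSlices (fun _ u t x => covC Q D T t x (K.W T a (u, x)).1) k
              (nablaU D X (onSlices (gradOp Q D T Y a) k s)) p := by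
  have hg := gradOp_holOp Q D T hY a
  have h1 := (HasNormalForm.of_holOp (hg.smul (mixedW_smooth (Q := Q) (D := D) (T := T) hX a))).add
    (HasNormalForm.sum (A := Finset.univ) fun c _ =>
      ((HasNormalForm.of_holOp (hg.cov c)).add
        (hasNormalForm_bar_gradOp (Q := Q) (D := D) hY c a)).smul (dJ_contMDiff (K := K) hX a c))
  simp only [zero_add] at h1
  refine h1.congr fun k s hs p => ?_
  rw [sub_eq_iff_eq_add']
  exact nablaU_covC_W hX (hg.smoothSection hs) a p

/-- For each a, ∇_X is commuted successively with the outer ∇_{W_a}, with the gradient and with the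
divergence factor. Only the first of these contributes to the coefficient of k. -/
theorem hasNormalForm_commutator_deltaOp (hX : IsSmoothVF X) (hY : IsSmoothVF Y) :
    HasNormalForm Q D T (commSymbol X Y T K) fun (k : ℕ) (s : ∀ p, Fib L δ k p) (p : U × M) =>
      nablaU D X (onSlices (deltaOp Q D T Y) k s) p
        - onSlices (deltaOp Q D T Y) k (nablaU D X s) p := by
  have hE := fun a => hasNormalForm_commutator_gradOp (Q := Q) (D := D) (T := T) hX hY a
  have h1 := HasNormalForm.sum (A := Finset.univ) fun a _ =>
    ((hasNormalForm_commutator_cov_gradOp (Q := Q) (D := D) (T := T) hX hY a).add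
      ((hE a).cov (fun _ => rfl) a)).add (((hE a).smul (divW_smooth (K := K) T a)).add
        (HasNormalForm.of_holOp ((gradOp_holOp Q D T hY a).smul
          (contMDiff_mvfderiv_apply (divW_smooth (K := K) T a) (contMDiff_tPair_left hX)))))
  simp only [add_zero, mul_zero] at h1
  refine h1.congr fun k s hs p => ?_
  have S := frameSystemF (m := m) (n := n) L δ k
  have hX' := nablaU_smoothSection (Q := Q) (D := D) (T := T) hX hs
  have hg : ∀ a, SmoothSection (m := m) (n := n) (onSlices (gradOp Q D T Y a) k s) := fun a =>
    (gradOp_holOp Q D T hY a).smoothSection hs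
  have hcg : ∀ a, SmoothSection (m := m) (n := n)
      (onSlices (fun _ u t x => covC Q D T t x (K.W T a (u, x)).1) k
        (onSlices (gradOp Q D T Y a) k s)) := fun a => (HolOp.id.cov a).smoothSection (hg a)
  have hgX : ∀ a, SmoothSection (m := m) (n := n) (onSlices (gradOp Q D T Y a) k (nablaU D X s)) :=
    fun a => (gradOp_holOp Q D T hY a).smoothSection hX'
  have hE' : ∀ a, SmoothSection (m := m) (n := n) fun p =>
      nablaU D X (onSlices (gradOp Q D T Y a) k s) p
        - onSlices (gradOp Q D T Y a) k (nablaU D X s) p := fun a =>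
    S.smoothSec_sub (nablaU_smoothSection (Q := Q) (T := T) hX (hg a)) (hgX a)
  have h3 : onSlices (deltaOp Q D T Y) k s = fun p => ∑ a,
      (onSlices (fun _ u t x => covC Q D T t x (K.W T a (u, x)).1) k
        (onSlices (gradOp Q D T Y a) k s) p
        + divW K T a p • onSlices (gradOp Q D T Y a) k s p) := rfl
  have h4 : onSlices (deltaOp Q D T Y) k (nablaU D X s) p = ∑ a,
      (onSlices (fun _ u t x => covC Q D T t x (K.W T a (u, x)).1) k
        (onSlices (gradOp Q D T Y a) k (nablaU D X s)) p
        + divW K T a p • onSlices (gradOp Q D T Y a) k (nablaU D X s) p) := rfl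
  have hdg := fun a => S.smoothSec_smul (divW_smooth (K := K) T a) (hg a)
  rw [h3, h4, nablaU_sum (Q := Q) (T := T) hX fun a _ => S.smoothSec_add (hcg a) (hdg a),
    ← Finset.sum_sub_distrib]
  refine Finset.sum_congr rfl fun a _ => ?_
  rw [nablaU_add (Q := Q) (T := T) hX (hcg a) (hdg a),
    nablaU_smul (Q := Q) (T := T) hX (divW_smooth (K := K) T a) (hg a)]
  -- The section ∇_X(grad s) is split as the commutator applied to s plus grad(∇_X s), so that the
  -- normal form of the inner commutator can be composed with ∇_{W_a}.
  have h5 : onSlices (fun _ u t x => covC Q D T t x (K.W T a (u, x)).1) k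
      (nablaU D X (onSlices (gradOp Q D T Y a) k s)) p
      = covC Q D T (fun x => nablaU D X (onSlices (gradOp Q D T Y a) k s) (p.1, x)
          - onSlices (gradOp Q D T Y a) k (nablaU D X s) (p.1, x)) p.2 (K.W T a p).1
        + onSlices (fun _ u t x => covC Q D T t x (K.W T a (u, x)).1) k
          (onSlices (gradOp Q D T Y a) k (nablaU D X s)) p := by
    have e1 : SmoothSlice (n := n) fun x => nablaU D X (onSlices (gradOp Q D T Y a) k s) (p.1, x)
          - onSlices (gradOp Q D T Y a) k (nablaU D X s) (p.1, x) :=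
      SmoothSection.slice (m := m) (hE' a) p.1
    have e2 : SmoothSlice (n := n) fun x => onSlices (gradOp Q D T Y a) k (nablaU D X s) (p.1, x) :=
      SmoothSection.slice (m := m) (hgX a) p.1
    have e3 := covC_section_add Q D T (LocSmooth.of_smoothSlice (m := m) e1 p.2)
      (LocSmooth.of_smoothSlice (m := m) e2 p.2) (K.W T a p).1
    simp only [sub_add_cancel] at e3
    exact e3
  rw [h5]
  simp only [onSlices, smul_sub]
  abel

end

/-! ### The symbol of the commutator -/

section

variable {Q D T} {X Y : ∀ u : U, TangentSpace (𝓡 m) u}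

theorem sympC_Wbar_W (p : U × M) (c b : Fin T.card) :
    K.sympC p.2 (Wbar K T c p) (K.W T b p).1
      = 1 / 2 * (K.symp p.2 (T.V c p.2) (T.V b p.2) : ℂ)
        - Complex.I / 2 * (K.symp p.2 (T.V c p.2) (K.j p.1 p.2 (T.V b p.2)) : ℂ) := by
  have h1 : K.sympC p.2 (Wbar K T c p) (K.W T b p).1
      = K.sympC p.2 ((1 : ℂ) ⊗ₜ[ℝ] T.V c p.2) (K.W T b p).1 := by
    rw [← K.W_add_conj T c p, map_add, LinearMap.add_apply, K.sympC_E, zero_add, Wbar]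
  rw [h1, K.W_val T b p, map_add, map_smul, map_smul, K.sympC_tmul, K.sympC_tmul, smul_eq_mul,
    smul_eq_mul]
  ring

/-- The diagonal entry λ_e((X.j) S (Y.j) V_e) is ω of λ_e^♯ with (X.j) S (Y.j) V_e, for X = v and Y
= w. Antisymmetry of X.j for ω moves it to λ_e^♯ with a minus sign, and the sum over e rebuilds the
components of G(Y). -/
theorem sum_dJ_Gc_symp (p : U × M) (v w : TangentSpace (𝓡 m) p.1)
    (S : TangentSpace (𝓡 (2 * n)) p.2 →ₗ[ℝ] TangentSpace (𝓡 (2 * n)) p.2) :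
    ∑ a, ∑ c, ∑ b, K.dJ T a c p v * K.Gc T a b p w * K.symp p.2 (T.V c p.2) (S (T.V b p.2))
      = -frameTrace T p.2 (K.dj T p v ∘ₗ S ∘ₗ K.dj T p w) := by
  have h1 : ∀ ξ : TangentSpace (𝓡 (2 * n)) p.2,
      K.dj T p v ξ = ∑ a, T.lam a p.2 ξ • ∑ c, K.dJ T a c p v • T.V c p.2 := fun ξ => by
    conv_lhs => rw [← T.sum_eq p.2 ξ]
    simp only [map_sum, map_smul, K.dj_V T _ p v]
  have h2 : ∀ e, T.lam e p.2 (K.dj T p v (S (K.dj T p w (T.V e p.2))))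
      = -∑ b, ∑ a, ∑ c, T.lam a p.2 (K.sharp p.2 (T.lam e p.2)) * K.dJ T a c p v * K.dJ T e b p w
        * K.symp p.2 (T.V c p.2) (S (T.V b p.2)) := fun e => by
    rw [← K.symp_sharp p.2 (T.lam e p.2), ← neg_neg (K.symp p.2 _ _), ← K.symp_dj T, h1, K.dj_V T e p w]
    simp only [map_sum, map_smul, LinearMap.sum_apply, LinearMap.smul_apply, smul_eq_mul,
      Finset.mul_sum]
    refine congrArg Neg.neg (Finset.sum_congr rfl fun b _ => ?_)
    refine Finset.sum_congr rfl fun a _ => Finset.sum_congr rfl fun c _ => ?_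
    ring
  have h3 : frameTrace T p.2 (K.dj T p v ∘ₗ S ∘ₗ K.dj T p w)
      = ∑ e, T.lam e p.2 (K.dj T p v (S (K.dj T p w (T.V e p.2)))) := rfl
  rw [h3]
  simp only [h2, Finset.sum_neg_distrib, neg_neg, Gc, Finset.mul_sum, Finset.sum_mul]
  have h4 : ∀ F : Fin T.card → Fin T.card → Fin T.card → Fin T.card → ℝ,
      ∑ a, ∑ c, ∑ b, ∑ e, F a c b e = ∑ e, ∑ b, ∑ a, ∑ c, F a c b e := fun F =>
    calc ∑ a, ∑ c, ∑ b, ∑ e, F a c b e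
        = ∑ a, ∑ b, ∑ c, ∑ e, F a c b e := Finset.sum_congr rfl fun a _ => Finset.sum_comm
      _ = ∑ b, ∑ a, ∑ c, ∑ e, F a c b e := Finset.sum_comm
      _ = ∑ b, ∑ a, ∑ e, ∑ c, F a c b e := Finset.sum_congr rfl fun b _ =>
          Finset.sum_congr rfl fun a _ => Finset.sum_comm
      _ = ∑ b, ∑ e, ∑ a, ∑ c, F a c b e := Finset.sum_congr rfl fun b _ => Finset.sum_comm
      _ = ∑ e, ∑ b, ∑ a, ∑ c, F a c b e := Finset.sum_comm
  rw [h4]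
  refine Finset.sum_congr rfl fun e _ => Finset.sum_congr rfl fun b _ => ?_
  refine Finset.sum_congr rfl fun a _ => Finset.sum_congr rfl fun c _ => ?_
  ring

/-- Since ω(W̄_c, W_b) = ½ ω(V_c, V_b) - (i/2) ω(V_c, jV_b), the symbol is a combination of the
traces of (X.j)S(Y.j) for S = id and S = j; in the second, j is moved to the right end past Y.j. -/
theorem commSymbol_eq (p : U × M) :
    commSymbol X Y T K p = 1 / 4 * (frameTrace T p.2 (K.dj T p (X p.1) ∘ₗ K.dj T p (Y p.1)) : ℂ)
      + Complex.I / 4 * (K.tau T p (X p.1) (Y p.1) : ℂ) := by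
  have h1 := sum_dJ_Gc_symp (K := K) (T := T) p (X p.1) (Y p.1) LinearMap.id
  have h2 := sum_dJ_Gc_symp (K := K) (T := T) p (X p.1) (Y p.1) (K.j p.1 p.2).toLinearMap
  have h3 : K.dj T p (X p.1) ∘ₗ (K.j p.1 p.2).toLinearMap ∘ₗ K.dj T p (Y p.1)
      = -(K.dj T p (X p.1) ∘ₗ K.dj T p (Y p.1) ∘ₗ (K.j p.1 p.2).toLinearMap) := by
    ext v
    simp [K.dj_j]
  rw [h3, frameTrace_neg, neg_neg] at h2
  rw [LinearMap.id_comp] at h1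
  have h1' := congrArg (fun r : ℝ => (r : ℂ)) h1
  have h2' := congrArg (fun r : ℝ => (r : ℂ)) h2
  simp only [Complex.ofReal_sum, Complex.ofReal_mul, Complex.ofReal_neg, LinearMap.id_apply] at h1' h2'
  have h4 : ∀ a c b : Fin T.card, -(Complex.I / 2) * (K.dJ T a c p (X p.1) : ℂ)
      * ((K.Gc T a b p (Y p.1) : ℂ) * ((1 / Complex.I) * K.sympC p.2 (Wbar K T c p) (K.W T b p).1))
      = -(1 / 4) * ((K.dJ T a c p (X p.1) : ℂ) * (K.Gc T a b p (Y p.1) : ℂ)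
          * (K.symp p.2 (T.V c p.2) (T.V b p.2) : ℂ))
        + Complex.I / 4 * ((K.dJ T a c p (X p.1) : ℂ) * (K.Gc T a b p (Y p.1) : ℂ)
          * (K.symp p.2 (T.V c p.2) (K.j p.1 p.2 (T.V b p.2)) : ℂ)) := fun a c b => by
    rw [sympC_Wbar_W]
    field_simp
    ring
  simp only [commSymbol, Finset.mul_sum]
  simp only [h4, Finset.sum_add_distrib, ← Finset.mul_sum]
  rw [h1']
  have h5 : K.tau T p (X p.1) (Y p.1)
    = frameTrace T p.2 (K.dj T p (X p.1) ∘ₗ K.dj T p (Y p.1) ∘ₗ (K.j p.1 p.2).toLinearMap) := rfl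
  rw [h5, ← h2']
  simp only [ContinuousLinearMap.coe_coe]
  ring

/-- The trace of (X.j)(Y.j) is symmetric and cancels; τ is antisymmetric and doubles. -/
theorem commSymbol_sub (p : U × M) :
    commSymbol X Y T K p - commSymbol Y X T K p
      = Complex.I / 2 * (K.tau T p (X p.1) (Y p.1) : ℂ) := by
  rw [commSymbol_eq, commSymbol_eq, frameTrace_comp_comm T p.2 (K.dj T p (Y p.1)),
    K.tau_swap T p (X p.1) (Y p.1)]
  push_cast
  ring

end

/-! ### The curvature of the connection -/

section

variable {Q D T} {X Y : ∀ u : U, TangentSpace (𝓡 m) u}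
  {H : ∀ p : U × M, TangentSpace (𝓡 m) p.1 →L[ℝ] ℂ}

/-- Linearity on smooth sections, as needed to apply one correction to the sum of a horizontal
derivative and another correction. The induction is over all points at once, because a derivative at
x uses the identity near x. -/
theorem HolOp.map_add_smul {P : SliceFamily L δ} (h : HolOp Q D T P) {k : ℕ} {u : U}
    {t t' : ∀ x, Fib L δ k (u, x)} (ht : SmoothSlice (n := n) t) (ht' : SmoothSlice (n := n) t')
    (c : ℂ) (x : M) : P k u (fun x => t x + c • t' x) x = P k u t x + c • P k u t' x := by
  induction h generalizing x with
  | id => rfl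
  | smul hf h ih =>
    beta_reduce
    rw [ih, smul_add, smul_comm]
  | add h₁ h₂ ih₁ ih₂ =>
    beta_reduce
    rw [ih₁, ih₂]
    module
  | @cov P a h ih =>
    beta_reduce
    have hl := LocSmooth.of_smoothSlice (m := m) (h.smoothSlice ht') x
    rw [funext fun y => ih y,
      covC_section_add Q D T (LocSmooth.of_smoothSlice (m := m) (h.smoothSlice ht) x)
        (LocSmooth.smul (m := m) (smoothNear_const c x) hl),
      covC_leibniz Q D T (smoothNear_const c x) hl, dC_expand T]
    simp only [mvfderiv_const_apply, mul_zero, Finset.sum_const_zero, zero_smul, add_zero]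

variable (Q D T H X) in
/-- The family of operators `Δ^{G(X)} - H(X)`. -/
def potentialOp : SliceFamily L δ := fun k u t x =>
  deltaOp Q D T X k u t x - H (u, x) (X u) • t x

/-- The commutator of ∇_X with multiplication by H(Y) is multiplication by a function independent of
k, so the coefficient of k is that of the Laplacian. -/
theorem hasNormalForm_commutator_potentialOp (hX : IsSmoothVF X) (hY : IsSmoothVF Y)
    (hHY : ContMDiff ((𝓡 m).prod (𝓡 (2 * n))) 𝓘(ℝ, ℂ) ∞ fun p : U × M => H p (Y p.1)) :
    HasNormalForm Q D T (commSymbol X Y T K) fun (k : ℕ) (s : ∀ p, Fib L δ k p) (p : U × M) =>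
      nablaU D X (onSlices (potentialOp Q D T Y H) k s) p
        - onSlices (potentialOp Q D T Y H) k (nablaU D X s) p := by
  have h1 := (hasNormalForm_commutator_deltaOp (Q := Q) (D := D) (T := T) hX hY).sub
    (HasNormalForm.of_holOp (HolOp.id.smul
      (contMDiff_mvfderiv_apply hHY (contMDiff_tPair_left hX))))
  simp only [sub_zero] at h1
  refine h1.congr fun k s hs p => ?_
  have S := frameSystemF (m := m) (n := n) L δ k
  have hΔ : SmoothSection (m := m) (n := n) (onSlices (deltaOp Q D T Y) k s) :=
    (deltaOp_holOp Q D T hY).smoothSection hs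
  have hHs := S.smoothSec_smul (contMDiff_const (c := (-1 : ℂ))) (S.smoothSec_smul hHY hs)
  have h2 : onSlices (potentialOp Q D T Y H) k s
      = fun p => onSlices (deltaOp Q D T Y) k s p + (-1 : ℂ) • (H p (Y p.1) • s p) := by
    funext p
    simp only [onSlices, potentialOp]
    module
  rw [h2, nablaU_add (Q := Q) (T := T) hX hΔ hHs,
    nablaU_smul (Q := Q) (T := T) hX contMDiff_const (S.smoothSec_smul hHY hs),
    nablaU_smul (Q := Q) (T := T) hX hHY hs, mvfderiv_const_apply]
  simp only [onSlices, potentialOp]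
  module

variable [CompactSpace M]

theorem potentialOp_holOp (hX : IsSmoothVF X) (hH : IsPotential Q D H) :
    HolOp Q D T (potentialOp Q D T X H) := by
  have h1 := (HolOp.id (Q := Q) (D := D) (T := T)).smul (hH.smooth X hX)
  exact (deltaOp_holOp Q D T hX).sub h1

variable {k : ℕ} {s : ∀ p, Fib L δ k p}

theorem hitchin_eq (hX : IsSmoothVF X) (hs : SmoothSection (m := m) (n := n) s) (p : U × M) :
    hitchin Q D H X s p
      = nablaU D X s p + (1 / (4 * k : ℂ)) • onSlices (potentialOp Q D T X H) k s p := by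
  have h1 : SmoothSlice (n := n) fun x => s (p.1, x) := SmoothSection.slice (m := m) hs p.1
  rw [hitchin, delta_eq_deltaOp Q D T hX h1]
  rfl

theorem hitchin_smoothSection (hX : IsSmoothVF X) (hH : IsPotential Q D H)
    (hs : SmoothSection (m := m) (n := n) s) :
    SmoothSection (m := m) (n := n) fun p => nablaU D X s p
      + (1 / (4 * k : ℂ)) • onSlices (potentialOp Q D T X H) k s p := by
  have S := frameSystemF (m := m) (n := n) L δ k
  exact S.smoothSec_add (nablaU_smoothSection (Q := Q) (T := T) hX hs)
    (S.smoothSec_smul contMDiff_const ((potentialOp_holOp hX hH).smoothSection hs))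

theorem hitchin_hitchin (hX : IsSmoothVF X) (hY : IsSmoothVF Y) (hH : IsPotential Q D H)
    (hs : SmoothSection (m := m) (n := n) s) (p : U × M) :
    hitchin Q D H X (hitchin Q D H Y s) p
      = nablaU D X (nablaU D Y s) p
        + (1 / (4 * k : ℂ)) • (nablaU D X (onSlices (potentialOp Q D T Y H) k s) p
          + onSlices (potentialOp Q D T X H) k (nablaU D Y s) p)
        + (1 / (4 * k : ℂ)) ^ 2 • onSlices (potentialOp Q D T X H) k
            (onSlices (potentialOp Q D T Y H) k s) p := by
  have S := frameSystemF (m := m) (n := n) L δ k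
  have hY' := nablaU_smoothSection (Q := Q) (D := D) (T := T) hY hs
  have hP : SmoothSection (m := m) (n := n) (onSlices (potentialOp Q D T Y H) k s) :=
    (potentialOp_holOp hY hH).smoothSection hs
  have h1 := (potentialOp_holOp (T := T) hX hH).map_add_smul (SmoothSection.slice (m := m) hY' p.1)
    (SmoothSection.slice (m := m) hP p.1) (1 / (4 * k : ℂ)) p.2
  have h2 : onSlices (potentialOp Q D T X H) k (fun p => nablaU D Y s p
        + (1 / (4 * k : ℂ)) • onSlices (potentialOp Q D T Y H) k s p) p
      = onSlices (potentialOp Q D T X H) k (nablaU D Y s) p + (1 / (4 * k : ℂ)) •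
        onSlices (potentialOp Q D T X H) k (onSlices (potentialOp Q D T Y H) k s) p := h1
  have h3 : hitchin Q D H Y s = fun p => nablaU D Y s p
      + (1 / (4 * k : ℂ)) • onSlices (potentialOp Q D T Y H) k s p :=
    funext fun p => hitchin_eq hY hs p
  rw [h3, hitchin_eq (T := T) hX (hitchin_smoothSection hY hH hs), h2,
    nablaU_add (Q := Q) (T := T) hX hY' (S.smoothSec_smul contMDiff_const hP),
    nablaU_smul (Q := Q) (T := T) hX contMDiff_const hP, mvfderiv_const_apply]
  module

/-- The squares of the connection are expanded by linearity, and the bracket relation for ∇ isolates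
the curvature of δ. The other terms are grouped by powers of 1/(4k). -/
theorem hitchinCurv_eq (hX : IsSmoothVF X) (hY : IsSmoothVF Y) (hH : IsPotential Q D H)
    (hs : SmoothSection (m := m) (n := n) s) (p : U × M) :
    hitchinCurv Q D H X Y s p
      = (-(Complex.I / 8) * (K.tau T p (X p.1) (Y p.1) : ℂ)) • s p
        + (1 / (4 * k : ℂ)) • (nablaU D X (onSlices (potentialOp Q D T Y H) k s) p
          - onSlices (potentialOp Q D T Y H) k (nablaU D X s) p
          - (nablaU D Y (onSlices (potentialOp Q D T X H) k s) p
            - onSlices (potentialOp Q D T X H) k (nablaU D Y s) p)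
          - onSlices (potentialOp Q D T (VectorField.mlieBracket (𝓡 m) X Y) H) k s p)
        + (1 / (4 * k : ℂ)) ^ 2 • (onSlices (potentialOp Q D T X H) k
            (onSlices (potentialOp Q D T Y H) k s) p - onSlices (potentialOp Q D T Y H) k
            (onSlices (potentialOp Q D T X H) k s) p) := by
  rw [hitchinCurv, hitchin_hitchin (T := T) hX hY hH hs, hitchin_hitchin (T := T) hY hX hH hs,
    hitchin_eq (T := T) (hX.mlieBracket hY) hs, ← nablaU_commutator Q D T hs hX hY p]
  module

/-- The holomorphic part of the curvature. -/
theorem exists_isHolPart_hitchinCurv (hX : IsSmoothVF X) (hY : IsSmoothVF Y)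
    (hH : IsPotential Q D H) (T : TFrame (2 * n) M) :
    ∃ P₁ P₂ : SliceFamily L δ, HolOp Q D T P₁ ∧ HolOp Q D T P₂ ∧ ∀ k, 1 ≤ k →
      IsHolPart Q D (hitchinCurv Q D H (k := k) X Y)
        (fun u t x => (k : ℂ)⁻¹ • P₁ k u t x + ((k : ℂ) ^ 2)⁻¹ • P₂ k u t x) := by
  obtain ⟨A, N, hA, hN, h⟩ := ((hasNormalForm_commutator_potentialOp (Q := Q) (D := D) (T := T)
    hX hY (hH.smooth Y hY)).sub (hasNormalForm_commutator_potentialOp (Q := Q) (D := D) (T := T)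
    hY hX (hH.smooth X hX))).sub (HasNormalForm.of_holOp
      (potentialOp_holOp (T := T) (hX.mlieBracket hY) hH))
  have hPX := potentialOp_holOp (T := T) hX hH
  have hPY := potentialOp_holOp (T := T) hY hH
  -- P₁ is a quarter of the holomorphic operator in the normal form of the middle term, and P₂ is
  -- 1/16 of the commutator of the corrections for X and Y.
  have h1 := hA.smul (contMDiff_const (c := (1 / 4 : ℂ)))
  have h2 := ((hPX.comp hPY).sub (hPY.comp hPX)).smul (contMDiff_const (c := (1 / 16 : ℂ)))
  refine ⟨_, _, h1, h2, fun k hk u => ⟨?_, _, (hN.smul (contMDiff_const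
    (c := (1 / (4 * k) : ℂ)))).inAntiIdeal k u, fun s hs x => ?_⟩⟩
  · exact ((h1.smul contMDiff_const).add (h2.smul contMDiff_const)).isHolDiffOp k u
  · have hk0 : (k : ℂ) ≠ 0 := Nat.cast_ne_zero.mpr (by omega)
    have h3 := h k s hs (u, x)
    beta_reduce at h3
    rw [hitchinCurv_eq (T := T) hX hY hH hs, h3, commSymbol_sub]
    -- Here the terms of order k⁰ cancel: k/(4k) times the antisymmetrized symbol (i/2)τ is (i/8)τ,
    -- the opposite of the curvature of δ. The zero is the coefficient of k in the correction for
    -- the bracket.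
    have h4 : (1 / (4 * k : ℂ)) * (k * (Complex.I / 2 * (K.tau T (u, x) (X u) (Y u) : ℂ) - 0))
        = Complex.I / 8 * (K.tau T (u, x) (X u) (Y u) : ℂ) := by
      field_simp
      ring
    rw [smul_add, smul_smul, h4]
    have h5 : (1 / (4 * k : ℂ)) ^ 2 = ((k : ℂ) ^ 2)⁻¹ * (1 / 16) := by
      field_simp
      norm_num
    have h6 : (1 / (4 * k : ℂ)) = (k : ℂ)⁻¹ * (1 / 4) := by
      field_simp
    have h7 : ∀ (r : ℂ) (v a b w : Fib L δ k (u, x)),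
        (-r) • v + ((1 / (4 * k : ℂ)) • (a + b) + r • v) + (((k : ℂ) ^ 2)⁻¹ * (1 / 16)) • w
          = (k : ℂ)⁻¹ • (1 / 4 : ℂ) • a + ((k : ℂ) ^ 2)⁻¹ • (1 / 16 : ℂ) • w
            + (1 / (4 * k : ℂ)) • b := fun r v a b w => by
      rw [h6]
      module
    rw [h5, neg_mul]
    exact h7 _ _ _ _ _

end

end Connection

end HalfFormQuant

end

theorem mainTheorem9 {m n : ℕ}
    {U : Type*} [TopologicalSpace U] [ChartedSpace (EuclideanSpace ℝ (Fin m)) U]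
    [IsManifold (𝓡 m) ∞ U] [T2Space U] [SecondCountableTopology U]
    {M : Type*} [TopologicalSpace M] [ChartedSpace (EuclideanSpace ℝ (Fin (2 * n))) M]
    [IsManifold (𝓡 (2 * n)) ∞ M] [T2Space M] [CompactSpace M] [SimplyConnectedSpace M]
    (K : HalfFormQuant.KahlerFamily m n U M)
    {L : M → Type*} [TopologicalSpace (Bundle.TotalSpace ℂ L)]
    [∀ x, AddCommGroup (L x)] [∀ x, Module ℂ (L x)] [∀ x, TopologicalSpace (L x)]
    [∀ x, IsTopologicalAddGroup (L x)] [∀ x, ContinuousSMul ℝ (L x)]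
    [FiberBundle ℂ L] [VectorBundle ℝ ℂ L] [VectorBundle ℂ ℂ L]
    [ContMDiffVectorBundle ∞ ℂ L (𝓡 (2 * n))]
    {δ : U × M → Type*} [TopologicalSpace (Bundle.TotalSpace ℂ δ)]
    [∀ p, AddCommGroup (δ p)] [∀ p, Module ℂ (δ p)] [∀ p, TopologicalSpace (δ p)]
    [FiberBundle ℂ δ] [VectorBundle ℝ ℂ δ] [VectorBundle ℂ ℂ δ]
    [ContMDiffVectorBundle ∞ ℂ δ ((𝓡 m).prod (𝓡 (2 * n)))]
    (Q : HalfFormQuant.Prequantum K L) (D : HalfFormQuant.HalfForm K δ)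
    (hG : K.GHolomorphic)
    (H : ∀ p : U × M, TangentSpace (𝓡 m) p.1 →L[ℝ] ℂ) (hH : HalfFormQuant.IsPotential Q D H)
    (X Y : ∀ u : U, TangentSpace (𝓡 m) u)
    (hX : HalfFormQuant.IsSmoothVF X) (hY : HalfFormQuant.IsSmoothVF Y)
    (k₀ : ℕ) (hk₀ : 1 ≤ k₀) :
    ∃ P₁ P₂ : ∀ (k : ℕ) (u : U),
        (∀ x, HalfFormQuant.Fib L δ k (u, x)) → ∀ x, HalfFormQuant.Fib L δ k (u, x),
      HalfFormQuant.OpSc Q D k₀ P₁ ∧ HalfFormQuant.OpSc Q D k₀ P₂ ∧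
      ∀ k, k₀ ≤ k →
        HalfFormQuant.IsHolPart Q D (HalfFormQuant.hitchinCurv Q D H (k := k) X Y)
          (fun u t x => (k : ℂ)⁻¹ • P₁ k u t x + ((k : ℂ) ^ 2)⁻¹ • P₂ k u t x) := by
  -- Compactness of M provides the finite frame.
  obtain ⟨T⟩ := HalfFormQuant.TFrame.exists (d := 2 * n) (N := M)
  obtain ⟨P₁, P₂, h₁, h₂, h⟩ := HalfFormQuant.exists_isHolPart_hitchinCurv hX hY hH T
  exact ⟨P₁, P₂, h₁.opSc k₀, h₂.opSc k₀, fun k hk => h k (hk₀.trans hk)⟩
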